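/- **Conventions.** A Young function is a convex $\Phi:[0,\infty]\to[0,\infty]$ with $\Phi(0)=0$, $\lim_{t\to\infty}\Phi(t)=\Phi(\infty)=\infty$ and $\Phi(t)<\infty$ for some $t>0$. Its conjugate is $\Phi^*(t)=\sup_{s\ge 0}(st-\Phi(s))$ for $t<\infty$, $\Phi^*(\infty)=\infty$. With $t_1=\sup\{t:\Phi(t)=0\}$, $t_2=\sup\{t:\Phi(t)<\infty\}$, $s_0=\sup\{\Phi(t):t<t_2\}$, its essential inverse is $\Phi^{-\&}(0)=0$, $\Phi^{-\&}(s)=t$ if $s=\Phi(t)$ with $t_1<t<t_2$, and $\Phi^{-\&}(s)=t_2$ for $s>0$, $s\ge s_0$. $\Phi$ satisfies a local $\Delta_2$-condition if $\Phi(2t)\le C\Phi(t)$ on some $[0,r]$, $r>0$. For $P\in(0,\infty)$, $\Phi$ is $P$-steered if either $\liminf_{t\to0+}\Phi(t)/t^P>0$, or $t\mapsto\Phi(t^{1/P})$ equals a Young function near the origin. $f\lesssim g$ means $f\le Cg$ for some constant $C$; $t^\infty$ means $0$ for $t\le1$ and $\infty$ for $t>1$; $p'$ is the conjugate exponent of $p$.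 $\mathcal S_{1/2}(\mathbf R^n)$ is the space of $f\in C^\infty(\mathbf R^n)$ with $\sup_{x,\alpha,\beta}|x^\beta\partial^\alpha f(x)|/(h^{|\alpha+\beta|}(\alpha!\beta!)^{1/2})<\infty$ for some $h>0$, with the inductive limit topology, and $\mathcal S_{1/2}'(\mathbf R^n)$ is its dual. A weight on $\mathbf R^n$ is a function $\omega>0$ with $\omega,1/\omega\in L^\infty_{loc}$; $\mathscr P_E(\mathbf R^n)$ is the set of weights $\omega$ with $\omega(x+y)\lesssim\omega(x)v(y)$ for some weight $v$. With $\phi(x)=\pi^{-n/4}e^{-|x|^2/2}$, let $V_\phi f(x,\xi)=(2\pi)^{-n/2}\langle f,\overline{\phi(\cdot-x)}e^{-i\langle\cdot,\xi\rangle}\rangle$ for $f\in\mathcal S_{1/2}'(\mathbf R^n)$. $M^{p,q}_{(\omega)}(\mathbf R^n)$ [resp. $M^{\Phi,\Psi}_{(\omega)}(\mathbf R^n)$] is the set of $f\in\mathcal S_{1/2}'(\mathbf R^n)$ with finite norm, the norm being the $L^p$-norm [Luxemburg norm of $L^\Phi$] of $V_\phi f(x,\xi)\,\omega(x,\xi)$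 in $x$ followed by the $L^q$-norm [Luxemburg norm of $L^\Psi$] in $\xi$. For $A\in\mathbf M(d,\mathbf R)$ and $a\in\mathcal S_{1/2}'(\mathbf R^{2d})$, $\operatorname{Op}_A(a):\mathcal S_{1/2}(\mathbf R^d)\to\mathcal S_{1/2}'(\mathbf R^d)$ is the operator with distribution kernel $K_{a,A}(x,y)=(2\pi)^{-d/2}(\mathscr F_2^{-1}a)(x-A(x-y),x-y)$, where $\mathscr F_2$ is the partial Fourier transform in the second variable. A sequence $f_n\in M^{\Phi,\Psi}_{(\omega)}$ is said to converge dominatedly to $f\in M^{\Phi,\Psi}_{(\omega)}$ if $f_n\to f$ weakly in $\mathcal S_{1/2}'$ and there is a measurable $G\ge0$ with $G\in L^{\Phi,\Psi}_{(\omega)}$ such that $|V_\phi f_n|\le G$ a.e. for all $n$. A bounded operator $T$ between such spaces is called dominatedly continuous if $Tf_n\to Tf$ weakly in $\mathcal S_{1/2}'$ whenever $f_n\to f$ dominatedly. **Theorem.** Let $A\in\mathbf M(d,\mathbf R)$, $1\le q\le p\le\infty$, and let $\Phi_1,\Phi_2,\Psi_1,\Psi_2$ be Young functions. If $p>1$,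 assume in addition that they are all $p'$-steered and satisfy a local $\Delta_2$-condition, and that for some $r>0$ $$\Phi_j(t)\gtrsim t^{q'},\quad \Psi_j(t)\gtrsim t^{q'}\quad (t\in[0,r],\ j=1,2),$$ $$\Phi_1^{-\&}(s)\Phi_2^{-\&}(s)\lesssim s^{\frac1{p'}+\frac1{q'}},\quad \Psi_1^{-\&}(s)\Psi_2^{-\&}(s)\lesssim s^{\frac1{p'}+\frac1{q'}}\quad (s\in[0,r]).$$ Let $\omega_0\in\mathscr P_E(\mathbf R^{2d}\oplus\mathbf R^{2d})$ and $\omega_1,\omega_2\in\mathscr P_E(\mathbf R^{2d})$ satisfy $$\frac{\omega_2(x,\xi)}{\omega_1(y,\eta)}\lesssim\omega_0\big(x-A(x-y),\,A^*\xi+(I-A^*)\eta,\,\xi-\eta,\,y-x\big),\qquad x,y,\xi,\eta\in\mathbf R^d.$$ Then there is a constant $C$ such that for every $a\in M^{p,q}_{(\omega_0)}(\mathbf R^{2d})$ the operator $\operatorname{Op}_A(a)$ extends from $\mathcal S_{1/2}(\mathbf R^d)$ to a bounded linear map $$T:M^{\Phi_1,\Psi_1}_{(\omega_1)}(\mathbf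 R^d)\to M^{\Phi_2^*,\Psi_2^*}_{(\omega_2)}(\mathbf R^d),\qquad \|T\|\le C\|a\|_{M^{p,q}_{(\omega_0)}},$$ which is dominatedly continuous. It is the unique bounded linear extension that is dominatedly continuous, and, if $\Phi_1$ and $\Psi_1$ satisfy a local $\Delta_2$-condition and vanish only at $0$ (which is automatic when $q>1$), it is the unique bounded linear extension. If in addition $a$ belongs to the closure of $\mathcal S_{1/2}(\mathbf R^{2d})$ under the $M^{p,q}_{(\omega_0)}$-norm, then $T$ is compact. -/

import Mathlib

open MeasureTheory Filter Topology
open scoped ENNReal NNReal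

noncomputable section

/-! ## Young functions -/

/-- A Young function `Φ : [0,∞] → [0,∞]`: convex, `Φ 0 = 0`, `lim_{t → ∞} Φ t = Φ ∞ = ∞`.
As usual, the degenerate function that is `∞` on all of `(0,∞]` is not admitted. -/
structure YoungFunction where
  toFun : ℝ≥0∞ → ℝ≥0∞
  convex' : ∀ s₁ s₂ t₁ t₂ : ℝ≥0, s₁ + s₂ = 1 →
    toFun ((s₁ * t₁ + s₂ * t₂ : ℝ≥0) : ℝ≥0∞) ≤ s₁ * toFun t₁ + s₂ * toFun t₂
  map_zero' : toFun 0 = 0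
  map_top' : toFun ∞ = ∞
  tendsto' : Tendsto (fun t : ℝ≥0 => toFun (t : ℝ≥0∞)) atTop (𝓝 ∞)
  exists_finite' : ∃ t : ℝ≥0∞, t ≠ 0 ∧ toFun t ≠ ∞

namespace YoungFunction

instance : CoeFun YoungFunction (fun _ => ℝ≥0∞ → ℝ≥0∞) := ⟨YoungFunction.toFun⟩

theorem convex (Φ : YoungFunction) (s₁ s₂ : ℝ≥0) (t₁ t₂ : ℝ≥0∞) (h : s₁ + s₂ = 1) :
    Φ (s₁ * t₁ + s₂ * t₂) ≤ s₁ * Φ t₁ + s₂ * Φ t₂ := by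
  rcases eq_or_ne s₁ 0 with rfl | h1
  · have h2 : s₂ = 1 := by simpa using h
    subst h2
    simp
  rcases eq_or_ne s₂ 0 with rfl | h2
  · have h1 : s₁ = 1 := by simpa using h
    subst h1
    simp
  rcases eq_or_ne t₁ ∞ with rfl | ht1
  · rw [Φ.map_top', ENNReal.mul_top (by exact_mod_cast h1)]
    simp
  rcases eq_or_ne t₂ ∞ with rfl | ht2
  · rw [Φ.map_top', ENNReal.mul_top (by exact_mod_cast h2)]
    simp
  lift t₁ to ℝ≥0 using ht1
  lift t₂ to ℝ≥0 using ht2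
  exact_mod_cast Φ.convex' s₁ s₂ t₁ t₂ h

theorem mono (Φ : YoungFunction) : Monotone Φ.toFun := by
  intro t₁ t₂ h
  rcases eq_or_ne t₂ ∞ with rfl | h2
  · rw [Φ.map_top']
    exact le_top
  lift t₂ to ℝ≥0 using h2
  lift t₁ to ℝ≥0 using (h.trans_lt ENNReal.coe_lt_top).ne
  have h' : t₁ ≤ t₂ := by exact_mod_cast h
  rcases eq_or_ne t₂ 0 with rfl | h0
  · have : t₁ = 0 := by simpa using h'
    subst this
    exact le_rfl
  have hs : t₁ / t₂ ≤ 1 := by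
    rw [div_le_one₀ (pos_iff_ne_zero.mpr h0)]
    exact h'
  have hc := Φ.convex' (t₁ / t₂) (1 - t₁ / t₂) t₂ 0 (add_tsub_cancel_of_le hs)
  rw [mul_zero, add_zero, div_mul_cancel₀ _ h0, ENNReal.coe_zero, Φ.map_zero', mul_zero,
    add_zero] at hc
  refine hc.trans ?_
  calc ((t₁ / t₂ : ℝ≥0) : ℝ≥0∞) * Φ t₂ ≤ 1 * Φ t₂ := by
        gcongr
        exact_mod_cast hs
    _ = Φ t₂ := one_mul _

/-- The conjugate `Φ*(t) = sup_{s ≥ 0} (s t - Φ(s))` for `t < ∞`, and `Φ*(∞) = ∞`.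
Subtraction in `[0,∞]` truncates at `0`, which does not change the supremum, as `s = 0`
contributes `0`. -/
def conjFun (Φ : YoungFunction) (t : ℝ≥0∞) : ℝ≥0∞ :=
  if t = ∞ then ∞ else ⨆ s : ℝ≥0, ((s : ℝ≥0∞) * t - Φ s)

/-- The conjugate Young function `Φ*`. -/
def conj (Φ : YoungFunction) : YoungFunction where
  toFun := Φ.conjFun
  convex' := by
    intro a b t₁ t₂ hab
    simp only [conjFun, ENNReal.coe_ne_top, if_false]
    refine iSup_le fun s => ?_
    have e1 := le_iSup (fun s : ℝ≥0 => ((s : ℝ≥0∞) * (t₁ : ℝ≥0∞) - Φ s)) s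
    have e2 := le_iSup (fun s : ℝ≥0 => ((s : ℝ≥0∞) * (t₂ : ℝ≥0∞) - Φ s)) s
    refine le_trans ?_ (add_le_add (mul_le_mul_right e1 (a : ℝ≥0∞))
      (mul_le_mul_right e2 (b : ℝ≥0∞)))
    rw [tsub_le_iff_right]
    have hab' : (a : ℝ≥0∞) + b = 1 := by exact_mod_cast hab
    calc (s : ℝ≥0∞) * ((a * t₁ + b * t₂ : ℝ≥0) : ℝ≥0∞)
        = a * (s * t₁) + b * (s * t₂) := by push_cast; ring
      _ ≤ a * ((s * t₁ - Φ s) + Φ s) + b * ((s * t₂ - Φ s) + Φ s) := by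
          gcongr <;> exact le_tsub_add
      _ = a * (s * t₁ - Φ s) + b * (s * t₂ - Φ s) + (a + b) * Φ s := by ring
      _ = _ := by rw [hab', one_mul]
  map_zero' := by simp [conjFun]
  map_top' := by simp [conjFun]
  tendsto' := by
    obtain ⟨t₀, h0, hf⟩ := Φ.exists_finite'
    have htop : t₀ ≠ ∞ := by
      rintro rfl
      exact hf Φ.map_top'
    lift t₀ to ℝ≥0 using htop
    have hlim : Tendsto (fun t : ℝ≥0 => (t₀ : ℝ≥0∞) * (t : ℝ≥0∞) - Φ t₀) atTop (𝓝 ∞) := by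
      have h1 : Tendsto (fun t : ℝ≥0 => (t₀ : ℝ≥0∞) * (t : ℝ≥0∞)) atTop (𝓝 ∞) := by
        have := ENNReal.Tendsto.const_mul (a := (t₀ : ℝ≥0∞)) (ENNReal.tendsto_coe_nhds_top.mpr tendsto_id)
          (Or.inl ENNReal.top_ne_zero)
        rwa [ENNReal.mul_top h0] at this
      have := ENNReal.Tendsto.sub h1 (tendsto_const_nhds (x := Φ t₀)) (Or.inr hf)
      rwa [ENNReal.top_sub hf] at this
    refine tendsto_nhds_top_mono hlim (Eventually.of_forall fun t => ?_)
    simp only [conjFun, ENNReal.coe_ne_top, if_false]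
    exact le_iSup (fun s : ℝ≥0 => ((s : ℝ≥0∞) * (t : ℝ≥0∞) - Φ s)) t₀
  exists_finite' := by
    have hev := (Φ.tendsto'.eventually (lt_mem_nhds (ENNReal.one_lt_top))).and
      (eventually_gt_atTop (0 : ℝ≥0))
    obtain ⟨T, hT, hT0⟩ := hev.exists
    refine ⟨((T⁻¹ : ℝ≥0) : ℝ≥0∞), by simpa using hT0.ne', ?_⟩
    simp only [conjFun, ENNReal.coe_ne_top, if_false]
    refine ne_top_of_le_ne_top ENNReal.one_ne_top (iSup_le fun s => ?_)
    rw [tsub_le_iff_right]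
    rcases le_total s T with h | h
    · refine le_trans ?_ le_self_add
      rw [← ENNReal.coe_mul, ENNReal.coe_le_one_iff, ← div_eq_mul_inv, div_le_one₀ hT0]
      exact h
    · refine le_trans ?_ le_add_self
      have hs0 : 0 < s := hT0.trans_le h
      have hs : T / s ≤ 1 := by
        rw [div_le_one₀ hs0]
        exact h
      have hc := Φ.convex' (T / s) (1 - T / s) s 0 (add_tsub_cancel_of_le hs)
      rw [mul_zero, add_zero, div_mul_cancel₀ _ hs0.ne', ENNReal.coe_zero, Φ.map_zero', mul_zero,
        add_zero] at hc
      have h2 : (1 : ℝ≥0∞) ≤ ((T / s : ℝ≥0) : ℝ≥0∞) * Φ s := hT.le.trans hc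
      calc (s : ℝ≥0∞) * ((T⁻¹ : ℝ≥0) : ℝ≥0∞)
          ≤ (s : ℝ≥0∞) * ((T⁻¹ : ℝ≥0) : ℝ≥0∞) * (((T / s : ℝ≥0) : ℝ≥0∞) * Φ s) :=
            le_mul_of_one_le_right' h2
        _ = ((s * T⁻¹ * (T / s) : ℝ≥0) : ℝ≥0∞) * Φ s := by push_cast; ring
        _ = Φ s := by
            have : s * T⁻¹ * (T / s) = 1 := by
              field_simp
            rw [this, ENNReal.coe_one, one_mul]

/-- The zero point `t₁ = sup {t ≥ 0 | Φ t = 0}`. -/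
def zeroPoint (Φ : YoungFunction) : ℝ≥0∞ := sSup {t | Φ t = 0}

/-- The infinity point `t₂ = sup {t ≥ 0 | Φ t < ∞}`. -/
def infinityPoint (Φ : YoungFunction) : ℝ≥0∞ := sSup {t | Φ t < ∞}

/-- `s₀ = sup {Φ t | t < t₂}`. -/
def supValue (Φ : YoungFunction) : ℝ≥0∞ := ⨆ t, ⨆ _ : t < Φ.infinityPoint, Φ t

/-- The essential inverse of `Φ`: `0` at `s = 0`, the infinity point `t₂` for `s ≥ s₀`, and for
`0 < s < s₀` the unique `t ∈ (t₁, t₂)` with `Φ t = s`. -/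
def essInv (Φ : YoungFunction) (s : ℝ≥0∞) : ℝ≥0∞ :=
  if s = 0 then 0
  else if Φ.supValue ≤ s then Φ.infinityPoint
  else sSup {t | Φ.zeroPoint < t ∧ t < Φ.infinityPoint ∧ Φ t = s}

/-- The local `Δ₂`-condition (`Δ₂`-condition near the origin). -/
def LocalDelta2 (Φ : YoungFunction) : Prop :=
  ∃ r : ℝ≥0∞, r ≠ 0 ∧ ∃ C : ℝ≥0, ∀ t ≤ r, Φ (2 * t) ≤ C * Φ t

end YoungFunction

/-- `f ≲ g` near the origin: `f t ≤ C g t` on some interval `[0, r]` with `r > 0`. -/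
def LeNearZero (f g : ℝ≥0∞ → ℝ≥0∞) : Prop :=
  ∃ r : ℝ≥0∞, r ≠ 0 ∧ ∃ C : ℝ≥0, ∀ t ≤ r, f t ≤ C * g t

/-- `t ↦ t ^ Q` for `Q ∈ (0,∞]`, where `t ^ ∞` is `0` for `t ≤ 1` and `∞` for `t > 1`. -/
def powFun (Q : ℝ≥0∞) (t : ℝ≥0∞) : ℝ≥0∞ :=
  if Q = ∞ then (if t ≤ 1 then 0 else ∞) else t ^ Q.toReal

/-- `Φ` is `P`-steered: either `liminf_{t → 0+} Φ(t) / t ^ P > 0` (that is, `t ^ P ≲ Φ(t)` near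
the origin), or `t ↦ Φ(t ^ (1 / P))` is equal to a Young function near the origin. -/
def IsSteered (P : ℝ) (Φ : YoungFunction) : Prop :=
  0 < liminf (fun t : ℝ≥0∞ => Φ t / t ^ P) (𝓝[>] 0) ∨
  ∃ Φ₀ : YoungFunction, ∃ r : ℝ≥0∞, r ≠ 0 ∧ ∀ t ≤ r, Φ (t ^ (1 / P)) = Φ₀ t

/-! ## Orlicz norms -/

/-- The Luxemburg norm `inf {λ > 0 | ∫ Φ(u / λ) dμ ≤ 1}` of a `[0,∞]`-valued function, as an
element of `[0,∞]`. -/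
def luxNorm {α : Type*} [MeasurableSpace α] (Φ : YoungFunction) (μ : Measure α)
    (u : α → ℝ≥0∞) : ℝ≥0∞ :=
  sInf {l : ℝ≥0∞ | l ≠ 0 ∧ l ≠ ∞ ∧ ∫⁻ x, Φ (u x / l) ∂μ ≤ 1}

/-- The mixed Orlicz norm: the `Φ`-norm in the first variable, then the `Ψ`-norm in the second. -/
def mixedLuxNorm {α β : Type*} [MeasureSpace α] [MeasureSpace β] (Φ Ψ : YoungFunction)
    (F : α × β → ℝ≥0∞) : ℝ≥0∞ :=
  luxNorm Ψ volume fun y => luxNorm Φ volume fun x => F (x, y)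

/-- The mixed Lebesgue norm: the `L^p`-norm in the first variable, then the `L^q`-norm in the
second. -/
def mixedLpNorm {α β : Type*} [MeasureSpace α] [MeasureSpace β] (p q : ℝ≥0∞)
    (F : α × β → ℝ≥0∞) : ℝ≥0∞ :=
  eLpNorm (fun y => eLpNorm (fun x => F (x, y)) p volume) q volume

section OrliczFacts

variable {α β : Type*} [MeasurableSpace α] [MeasurableSpace β]

theorem luxNorm_mono_ae (Φ : YoungFunction) {μ : Measure α} {u v : α → ℝ≥0∞}
    (h : ∀ᵐ x ∂μ, u x ≤ v x) : luxNorm Φ μ u ≤ luxNorm Φ μ v := by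
  refine sInf_le_sInf fun l hl => ⟨hl.1, hl.2.1, le_trans (lintegral_mono_ae ?_) hl.2.2⟩
  filter_upwards [h] with x hx
  exact Φ.mono (ENNReal.div_le_div_right hx l)

theorem luxNorm_congr_ae (Φ : YoungFunction) {μ : Measure α} {u v : α → ℝ≥0∞}
    (h : ∀ᵐ x ∂μ, u x = v x) : luxNorm Φ μ u = luxNorm Φ μ v :=
  le_antisymm (luxNorm_mono_ae Φ (h.mono fun _ hx => hx.le))
    (luxNorm_mono_ae Φ (h.mono fun _ hx => hx.ge))

theorem luxNorm_zero (Φ : YoungFunction) (μ : Measure α) :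
    luxNorm Φ μ (fun _ => (0 : ℝ≥0∞)) = 0 := by
  refine le_antisymm (le_of_forall_gt_imp_ge_of_dense fun l hl => ?_) zero_le
  rcases eq_or_ne l ∞ with rfl | hl'
  · exact le_top
  refine sInf_le ⟨hl.ne', hl', ?_⟩
  simp [Φ.map_zero']

theorem luxNorm_mul_le (Φ : YoungFunction) (μ : Measure α) (u : α → ℝ≥0∞) (c : ℝ≥0) :
    luxNorm Φ μ (fun x => c * u x) ≤ c * luxNorm Φ μ u := by
  rcases eq_or_ne c 0 with rfl | hc
  · simp [luxNorm_zero]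
  have hc0 : (c : ℝ≥0∞) ≠ 0 := by exact_mod_cast hc
  rw [mul_comm, ← ENNReal.div_le_iff_le_mul (Or.inl hc0) (Or.inl ENNReal.coe_ne_top)]
  refine le_sInf fun l hl => ?_
  rw [ENNReal.div_le_iff_le_mul (Or.inl hc0) (Or.inl ENNReal.coe_ne_top)]
  refine sInf_le ⟨mul_ne_zero hl.1 hc0, ENNReal.mul_ne_top hl.2.1 ENNReal.coe_ne_top, ?_⟩
  refine le_of_eq_of_le (lintegral_congr fun x => ?_) hl.2.2
  rw [mul_comm l, ENNReal.mul_div_mul_left _ _ hc0 ENNReal.coe_ne_top]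

theorem luxNorm_add_le (Φ : YoungFunction) {μ : Measure α} {u v : α → ℝ≥0∞}
    (hu : AEMeasurable u μ) :
    luxNorm Φ μ (fun x => u x + v x) ≤ luxNorm Φ μ u + luxNorm Φ μ v := by
  have key : ∀ k ∈ {l : ℝ≥0∞ | l ≠ 0 ∧ l ≠ ∞ ∧ ∫⁻ x, Φ (u x / l) ∂μ ≤ 1},
      ∀ l ∈ {l : ℝ≥0∞ | l ≠ 0 ∧ l ≠ ∞ ∧ ∫⁻ x, Φ (v x / l) ∂μ ≤ 1},
      luxNorm Φ μ (fun x => u x + v x) ≤ k + l := by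
    rintro k ⟨hk0, hk, hku⟩ l ⟨hl0, hl, hlv⟩
    lift k to ℝ≥0 using hk
    lift l to ℝ≥0 using hl
    have hk0' : k ≠ 0 := by exact_mod_cast hk0
    have hl0' : l ≠ 0 := by exact_mod_cast hl0
    have hs : k + l ≠ 0 := by
      intro h
      exact hk0' (by simpa using (add_eq_zero.mp h).1)
    have hs1 : k / (k + l) + l / (k + l) = 1 := by
      rw [← add_div, div_self hs]
    refine sInf_le ⟨by exact_mod_cast hs, by finiteness, ?_⟩
    have hpt : ∀ x, Φ ((u x + v x) / (k + l : ℝ≥0∞)) ≤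
        ((k / (k + l) : ℝ≥0) : ℝ≥0∞) * Φ (u x / k) +
        ((l / (k + l) : ℝ≥0) : ℝ≥0∞) * Φ (v x / l) := by
      intro x
      refine le_of_eq_of_le ?_ (Φ.convex _ _ (u x / k) (v x / l) hs1)
      congr 1
      have hsum : ((k + l : ℝ≥0) : ℝ≥0∞) = (k : ℝ≥0∞) + l := by push_cast; rfl
      have aux : ∀ (m : ℝ≥0) (w : ℝ≥0∞), m ≠ 0 →
          ((m / (k + l) : ℝ≥0) : ℝ≥0∞) * (w / m) = w / (k + l : ℝ≥0∞) := by
        intro m w hm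
        have hm0 : (m : ℝ≥0∞) ≠ 0 := by exact_mod_cast hm
        rw [ENNReal.coe_div hs, hsum, div_eq_mul_inv, div_eq_mul_inv, div_eq_mul_inv,
          mul_comm (m : ℝ≥0∞), mul_assoc, mul_comm w, ← mul_assoc (m : ℝ≥0∞),
          ENNReal.mul_inv_cancel hm0 ENNReal.coe_ne_top, one_mul, mul_comm]
      rw [aux k _ hk0', aux l _ hl0', ENNReal.add_div]
    calc ∫⁻ x, Φ ((u x + v x) / (k + l : ℝ≥0∞)) ∂μ
        ≤ ∫⁻ x, (((k / (k + l) : ℝ≥0) : ℝ≥0∞) * Φ (u x / k) +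
          ((l / (k + l) : ℝ≥0) : ℝ≥0∞) * Φ (v x / l)) ∂μ := lintegral_mono hpt
      _ = ((k / (k + l) : ℝ≥0) : ℝ≥0∞) * ∫⁻ x, Φ (u x / k) ∂μ +
          ((l / (k + l) : ℝ≥0) : ℝ≥0∞) * ∫⁻ x, Φ (v x / l) ∂μ := by
          rw [lintegral_add_left', lintegral_const_mul' _ _ ENNReal.coe_ne_top,
            lintegral_const_mul' _ _ ENNReal.coe_ne_top]
          exact (Φ.mono.measurable.comp_aemeasurable (hu.div_const _)).const_mul _
      _ ≤ ((k / (k + l) : ℝ≥0) : ℝ≥0∞) * 1 + ((l / (k + l) : ℝ≥0) : ℝ≥0∞) * 1 := by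
          gcongr
      _ = 1 := by
          rw [mul_one, mul_one]
          exact_mod_cast hs1
  have h1 : ∀ k ∈ {l : ℝ≥0∞ | l ≠ 0 ∧ l ≠ ∞ ∧ ∫⁻ x, Φ (u x / l) ∂μ ≤ 1},
      luxNorm Φ μ (fun x => u x + v x) - luxNorm Φ μ v ≤ k := by
    intro k hk
    rw [tsub_le_iff_left, add_comm, ← tsub_le_iff_left]
    refine le_sInf fun l hl => ?_
    rw [tsub_le_iff_left]
    exact key k hk l hl
  rw [← tsub_le_iff_right]
  exact le_sInf h1

theorem measurable_luxNorm_left (Φ : YoungFunction) {μ : Measure α} [SFinite μ]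
    {F : α × β → ℝ≥0∞} (hF : Measurable F) :
    Measurable fun y => luxNorm Φ μ fun x => F (x, y) := by
  refine measurable_of_Iio fun c => ?_
  have : (fun y => luxNorm Φ μ fun x => F (x, y)) ⁻¹' Set.Iio c =
      ⋃ q : ℚ, {y | (Real.toNNReal q : ℝ≥0∞) ≠ 0 ∧ (Real.toNNReal q : ℝ≥0∞) < c ∧
        ∫⁻ x, Φ (F (x, y) / (Real.toNNReal q : ℝ≥0∞)) ∂μ ≤ 1} := by
    ext y
    simp only [Set.mem_preimage, Set.mem_Iio, Set.mem_iUnion, Set.mem_ofPred_eq]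
    constructor
    · intro h
      obtain ⟨l, ⟨hl0, hl, hI⟩, hlc⟩ := sInf_lt_iff.mp h
      obtain ⟨q, -, hq1, hq2⟩ := ENNReal.lt_iff_exists_rat_btwn.mp hlc
      refine ⟨q, (zero_le.trans_lt hq1).ne', hq2, le_trans (lintegral_mono fun x => ?_) hI⟩
      exact Φ.mono (ENNReal.div_le_div_left hq1.le _)
    · rintro ⟨q, h0, hq, hI⟩
      refine lt_of_le_of_lt (sInf_le ?_) hq
      exact ⟨h0, ENNReal.coe_ne_top, hI⟩
  rw [this]
  refine MeasurableSet.iUnion fun q => ?_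
  refine (MeasurableSet.const _).inter ((MeasurableSet.const _).inter ?_)
  exact measurableSet_le
    (Measurable.lintegral_prod_left' (Φ.mono.measurable.comp (hF.div_const _))) measurable_const

end OrliczFacts

theorem mixedLuxNorm_zero {α β : Type*} [MeasureSpace α] [MeasureSpace β] (Φ Ψ : YoungFunction) :
    mixedLuxNorm Φ Ψ (fun _ : α × β => (0 : ℝ≥0∞)) = 0 := by
  simp [mixedLuxNorm, luxNorm_zero]

theorem mixedLuxNorm_mul_le {α β : Type*} [MeasureSpace α] [MeasureSpace β] (Φ Ψ : YoungFunction) (F : α × β → ℝ≥0∞) (c : ℝ≥0) :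
    mixedLuxNorm Φ Ψ (fun z => c * F z) ≤ c * mixedLuxNorm Φ Ψ F := by
  refine le_trans (luxNorm_mono_ae Ψ (Eventually.of_forall fun y => ?_))
    (luxNorm_mul_le Ψ volume _ c)
  exact luxNorm_mul_le Φ volume _ c

section MixedFacts

variable {α β : Type*} [MeasureSpace α] [MeasureSpace β]
  [SFinite (volume : Measure α)] [SFinite (volume : Measure β)]

theorem ae_ae_snd_of_ae_prod {P : α × β → Prop} (h : ∀ᵐ z, P z) :
    ∀ᵐ y : β, ∀ᵐ x : α, P (x, y) := by
  have h' : ∀ᵐ z ∂((volume : Measure β).prod (volume : Measure α)), P z.swap :=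
    (Measure.measurePreserving_swap (μ := (volume : Measure β))
      (ν := (volume : Measure α))).quasiMeasurePreserving.ae h
  exact Measure.ae_ae_of_ae_prod h'

theorem mixedLuxNorm_mono_ae (Φ Ψ : YoungFunction) {F G : α × β → ℝ≥0∞}
    (h : ∀ᵐ z, F z ≤ G z) : mixedLuxNorm Φ Ψ F ≤ mixedLuxNorm Φ Ψ G :=
  luxNorm_mono_ae Ψ ((ae_ae_snd_of_ae_prod h).mono fun _ hy => luxNorm_mono_ae Φ hy)

theorem mixedLuxNorm_add_le (Φ Ψ : YoungFunction) {F G : α × β → ℝ≥0∞}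
    (hF : AEMeasurable F) :
    mixedLuxNorm Φ Ψ (fun z => F z + G z) ≤ mixedLuxNorm Φ Ψ F + mixedLuxNorm Φ Ψ G := by
  have hs := ae_ae_snd_of_ae_prod (P := fun z => F z = hF.mk F z) hF.ae_eq_mk
  have hsl : ∀ y, Measurable fun x => hF.mk F (x, y) := fun y =>
    hF.measurable_mk.comp measurable_prodMk_right
  refine le_trans (luxNorm_mono_ae Ψ (v := fun y => (luxNorm Φ volume fun x => F (x, y)) +
    luxNorm Φ volume fun x => G (x, y)) ?_) (luxNorm_add_le Ψ ?_)
  · filter_upwards [hs] with y hy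
    have hm : AEMeasurable (fun x => F (x, y)) := ⟨_, hsl y, hy⟩
    exact luxNorm_add_le Φ hm
  · refine ⟨_, measurable_luxNorm_left Φ (μ := (volume : Measure α)) hF.measurable_mk, ?_⟩
    filter_upwards [hs] with y hy
    exact luxNorm_congr_ae Φ hy

end MixedFacts

/-! ## Weights -/

/-- A weight: a positive function `ω` with `ω, 1 / ω ∈ L^∞_loc`. -/
structure IsWeight {G : Type*} [TopologicalSpace G] [MeasureSpace G] (ω : G → ℝ) : Prop where
  pos : ∀ x, 0 < ω x
  aemeasurable : AEMeasurable ω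
  locBdd : ∀ K : Set G, IsCompact K → ∃ C : ℝ, ∀ᵐ x ∂(volume.restrict K), ω x ≤ C
  locBdd_inv : ∀ K : Set G, IsCompact K → ∃ C : ℝ, ∀ᵐ x ∂(volume.restrict K), (ω x)⁻¹ ≤ C

/-- The moderate weights: weights `ω` with `ω (x + y) ≤ C ω(x) v(y)` for some weight `v`. -/
structure ModerateWeight (G : Type*) [AddGroup G] [TopologicalSpace G] [MeasureSpace G] where
  toFun : G → ℝ
  isWeight : IsWeight toFun
  moderate : ∃ v : G → ℝ, IsWeight v ∧ ∃ C : ℝ, ∀ x y, toFun (x + y) ≤ C * (toFun x * v y)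

instance (G : Type*) [AddGroup G] [TopologicalSpace G] [MeasureSpace G] :
    CoeFun (ModerateWeight G) (fun _ => G → ℝ) := ⟨ModerateWeight.toFun⟩

/-! ## Gelfand-Shilov space `S_{1/2}` and its dual -/

/-- `ℝ^ι` with its Euclidean structure; `ℝ^{2d}` is `Euc (Fin d ⊕ Fin d)`. -/
abbrev Euc (ι : Type) [Fintype ι] : Type := EuclideanSpace ℝ ι

section GelfandShilov

variable (ι : Type) [Fintype ι]

/-- `M` bounds the `S_{1/2,h}`-seminorm of `f`, in norm form. As
`|x ^ β ∂ ^ α f| ≤ ‖x‖ ^ |β| ‖D ^ |α| f‖` and `α! ≤ |α|! ≤ n ^ |α| α!` for multi-indices `α` in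
dimension `n`, this is the multi-index seminorm up to replacing `h` by a fixed multiple, and so
gives the same spaces. -/
def GSBound {ι : Type} [Fintype ι] (h M : ℝ) (f : Euc ι → ℂ) : Prop :=
  ∀ (k n : ℕ) (x : Euc ι), ‖x‖ ^ k * ‖iteratedFDeriv ℝ n f x‖ ≤
    M * (h ^ (k + n) * Real.sqrt (k.factorial * n.factorial))

theorem GSBound.weaken {ι : Type} [Fintype ι] {h h' M : ℝ} {f : Euc ι → ℂ} (hf : GSBound h M f)
    (h0 : 0 < h) (hh : h ≤ h') : GSBound h' M f := by
  have hM : 0 ≤ M := by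
    have := hf 0 0 0
    simp only [pow_zero, one_mul, add_zero, Nat.factorial_zero, Nat.cast_one, mul_one,
      Real.sqrt_one] at this
    exact (norm_nonneg _).trans this
  intro k n x
  refine (hf k n x).trans ?_
  gcongr

/-- The Gelfand-Shilov space `S_{1/2}(ℝ^ι)` of Roumieu type, as a space of functions. -/
def gsSubmodule : Submodule ℂ (Euc ι → ℂ) where
  carrier := {f | ContDiff ℝ ((⊤ : ℕ∞) : WithTop ℕ∞) f ∧ ∃ h > 0, ∃ M, GSBound h M f}
  zero_mem' := by
    refine ⟨contDiff_const, 1, one_pos, 0, fun k n x => ?_⟩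
    simp
  add_mem' := by
    rintro f g ⟨hf, h₁, h₁0, M₁, hM₁⟩ ⟨hg, h₂, h₂0, M₂, hM₂⟩
    refine ⟨hf.add hg, max h₁ h₂, lt_max_of_lt_left h₁0, M₁ + M₂, fun k n x => ?_⟩
    have e1 := hM₁.weaken h₁0 (le_max_left h₁ h₂) k n x
    have e2 := hM₂.weaken h₂0 (le_max_right h₁ h₂) k n x
    have hn : ((n : ℕ∞) : WithTop ℕ∞) ≤ ((⊤ : ℕ∞) : WithTop ℕ∞) := by exact_mod_cast le_top
    rw [iteratedFDeriv_add_apply ((hf.of_le hn).contDiffAt) ((hg.of_le hn).contDiffAt), add_mul]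
    refine le_trans ?_ (add_le_add e1 e2)
    rw [← mul_add]
    gcongr
    exact norm_add_le _ _
  smul_mem' := by
    rintro c f ⟨hf, h, h0, M, hM⟩
    refine ⟨hf.const_smul c, h, h0, ‖c‖ * M, fun k n x => ?_⟩
    have hn : ((n : ℕ∞) : WithTop ℕ∞) ≤ ((⊤ : ℕ∞) : WithTop ℕ∞) := by exact_mod_cast le_top
    rw [iteratedFDeriv_const_smul_apply ((hf.of_le hn).contDiffAt), norm_smul, mul_left_comm,
      mul_assoc]
    exact mul_le_mul_of_nonneg_left (hM k n x) (norm_nonneg c)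

/-- The Gelfand-Shilov space `S_{1/2}(ℝ^ι)` of Roumieu type. -/
abbrev GS : Type := gsSubmodule ι

/-- The dual `S'_{1/2}(ℝ^ι)`: the linear forms on `S_{1/2}` that are bounded on each `S_{1/2,h}`,
that is, continuous for the inductive limit topology. -/
def gsDualSubmodule : Submodule ℂ (GS ι →ₗ[ℂ] ℂ) where
  carrier := {u | ∀ h > 0, ∃ C : ℝ, ∀ (f : GS ι) (M : ℝ), GSBound h M (f : Euc ι → ℂ) →
    ‖u f‖ ≤ C * M}
  zero_mem' := fun h _ => ⟨0, fun f M _ => by simp⟩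
  add_mem' := by
    intro u v hu hv h h0
    obtain ⟨C, hC⟩ := hu h h0
    obtain ⟨D, hD⟩ := hv h h0
    refine ⟨C + D, fun f M hf => ?_⟩
    rw [LinearMap.add_apply, add_mul]
    exact (norm_add_le _ _).trans (add_le_add (hC f M hf) (hD f M hf))
  smul_mem' := by
    intro c u hu h h0
    obtain ⟨C, hC⟩ := hu h h0
    refine ⟨‖c‖ * C, fun f M hf => ?_⟩
    rw [LinearMap.smul_apply, norm_smul, mul_assoc]
    exact mul_le_mul_of_nonneg_left (hC f M hf) (norm_nonneg c)

/-- The Gelfand-Shilov distribution space `S'_{1/2}(ℝ^ι)`. -/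
abbrev GSDual : Type := gsDualSubmodule ι

variable {ι}

/-- Every element of `S_{1/2}` is a Schwartz function. -/
def GS.toSchwartz (f : GS ι) : SchwartzMap (Euc ι) ℂ where
  toFun := f
  smooth' := f.2.1
  decay' := by
    obtain ⟨-, h, -, M, hM⟩ := f.2
    exact fun k n => ⟨_, hM k n⟩

theorem GS.integrable (f : GS ι) : Integrable (f : Euc ι → ℂ) := f.toSchwartz.integrable

theorem GSBound.norm_le {h M : ℝ} {f : Euc ι → ℂ} (hf : GSBound h M f) (x : Euc ι) :
    ‖f x‖ ≤ M := by
  have := hf 0 0 x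
  simpa using this

theorem GS.integrable_mul (f g : GS ι) :
    Integrable (fun x => (f : Euc ι → ℂ) x * (g : Euc ι → ℂ) x) := by
  obtain ⟨hg, h, -, M, hM⟩ := g.2
  exact f.integrable.mul_bdd hg.continuous.aestronglyMeasurable
    (Eventually.of_forall hM.norm_le)

/-- The embedding of `S_{1/2}` into `S'_{1/2}`, `f ↦ (g ↦ ∫ f g)`. -/
def GS.toDual (f : GS ι) : GSDual ι where
  val :=
    { toFun := fun g => ∫ x, (f : Euc ι → ℂ) x * (g : Euc ι → ℂ) x
      map_add' := fun g₁ g₂ => by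
        rw [← integral_add (f.integrable_mul g₁) (f.integrable_mul g₂)]
        refine integral_congr_ae (Eventually.of_forall fun x => ?_)
        simp [mul_add]
      map_smul' := fun c g => by
        rw [RingHom.id_apply, smul_eq_mul, ← integral_const_mul]
        refine integral_congr_ae (Eventually.of_forall fun x => ?_)
        simp [mul_left_comm] }
  property := by
    intro h _
    refine ⟨∫ x, ‖(f : Euc ι → ℂ) x‖, fun g M hM => ?_⟩
    rw [← integral_mul_const]
    refine norm_integral_le_of_norm_le (f.integrable.norm.mul_const M)
      (Eventually.of_forall fun x => ?_)
    rw [norm_mul]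
    gcongr
    exact hM.norm_le x

open scoped Classical in
/-- The value `⟨u, g⟩` of `u ∈ S'_{1/2}` at a function `g`; it is only used for `g ∈ S_{1/2}`. -/
def GSDual.eval (u : GSDual ι) (g : Euc ι → ℂ) : ℂ :=
  if h : g ∈ gsSubmodule ι then (u : GS ι →ₗ[ℂ] ℂ) ⟨g, h⟩ else 0

/-! ## Short-time Fourier transform and modulation spaces -/

/-- The Gaussian `φ(x) = π ^ (-n/4) exp (-|x|² / 2)` on `ℝ^ι`, `n = #ι`. -/
def gaussWindow (x : Euc ι) : ℂ :=
  ((Real.pi ^ (-(Fintype.card ι : ℝ) / 4) * Real.exp (-‖x‖ ^ 2 / 2) : ℝ) : ℂ)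

/-- The normalizing constant `(2π) ^ (-n/2)`, `n = #ι`, of the Fourier transform on `ℝ^ι`. -/
def fourierConst (ι : Type) [Fintype ι] : ℂ :=
  (((2 * Real.pi) ^ (-(Fintype.card ι : ℝ) / 2) : ℝ) : ℂ)

/-- The short-time Fourier transform with Gaussian window,
`V_φ f (x,ξ) = (2π) ^ (-n/2) ⟨f, conj (φ(· - x)) e ^ (-i⟨·,ξ⟩)⟩`. -/
def stft (f : GSDual ι) (z : Euc ι × Euc ι) : ℂ :=
  fourierConst ι * f.eval fun y =>
    starRingEnd ℂ (gaussWindow (y - z.1)) * Complex.exp (-Complex.I * (inner ℝ y z.2 : ℝ))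

/-- The function `|V_φ f| ω`. -/
def wstft (ω : Euc ι × Euc ι → ℝ) (f : GSDual ι) (z : Euc ι × Euc ι) : ℝ≥0∞ :=
  ‖stft f z‖ₑ * ENNReal.ofReal (ω z)

/-- The norm of the modulation space `M^{p,q}_{(ω)}`, as an element of `[0,∞]`. -/
def modNorm (p q : ℝ≥0∞) (ω : ModerateWeight (Euc ι × Euc ι)) (f : GSDual ι) : ℝ≥0∞ :=
  mixedLpNorm p q (wstft ω f)

/-- Membership in the modulation space `M^{p,q}_{(ω)}`. -/
def MemMod (p q : ℝ≥0∞) (ω : ModerateWeight (Euc ι × Euc ι)) (f : GSDual ι) : Prop :=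
  AEMeasurable (stft f) ∧ modNorm p q ω f < ∞

/-- The norm of the Orlicz modulation space `M^{Φ,Ψ}_{(ω)}`, as an element of `[0,∞]`. -/
def orliczModNorm (Φ Ψ : YoungFunction) (ω : ModerateWeight (Euc ι × Euc ι)) (f : GSDual ι) :
    ℝ≥0∞ :=
  mixedLuxNorm Φ Ψ (wstft ω f)

theorem stft_add (f g : GSDual ι) (z : Euc ι × Euc ι) :
    stft (f + g) z = stft f z + stft g z := by
  unfold stft GSDual.eval
  split_ifs <;> simp [mul_add]

theorem stft_smul (c : ℂ) (f : GSDual ι) (z : Euc ι × Euc ι) :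
    stft (c • f) z = c * stft f z := by
  unfold stft GSDual.eval
  split_ifs <;> simp [mul_left_comm]

theorem stft_zero (z : Euc ι × Euc ι) : stft (0 : GSDual ι) z = 0 := by
  unfold stft GSDual.eval
  split_ifs <;> simp

theorem aemeasurable_wstft (ω : ModerateWeight (Euc ι × Euc ι)) {f : GSDual ι}
    (hf : AEMeasurable (stft f)) : AEMeasurable (wstft ω f) :=
  hf.enorm.mul ω.isWeight.aemeasurable.ennreal_ofReal

theorem orliczModNorm_zero (Φ Ψ : YoungFunction) (ω : ModerateWeight (Euc ι × Euc ι)) :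
    orliczModNorm Φ Ψ ω (0 : GSDual ι) = 0 := by
  have : wstft ω (0 : GSDual ι) = fun _ => 0 := by
    ext z
    simp [wstft, stft_zero]
  rw [orliczModNorm, this, mixedLuxNorm_zero]

theorem orliczModNorm_add_le (Φ Ψ : YoungFunction) (ω : ModerateWeight (Euc ι × Euc ι))
    {f g : GSDual ι} (hf : AEMeasurable (stft f)) :
    orliczModNorm Φ Ψ ω (f + g) ≤ orliczModNorm Φ Ψ ω f + orliczModNorm Φ Ψ ω g := by
  refine le_trans (mixedLuxNorm_mono_ae Φ Ψ (Eventually.of_forall fun z => ?_))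
    (mixedLuxNorm_add_le Φ Ψ (aemeasurable_wstft ω hf))
  simp only [wstft, stft_add, ← add_mul]
  gcongr
  exact enorm_add_le _ _

theorem orliczModNorm_smul_le (Φ Ψ : YoungFunction) (ω : ModerateWeight (Euc ι × Euc ι))
    (c : ℂ) (f : GSDual ι) :
    orliczModNorm Φ Ψ ω (c • f) ≤ ‖c‖ₑ * orliczModNorm Φ Ψ ω f := by
  have : wstft ω (c • f) = fun z => (‖c‖₊ : ℝ≥0∞) * wstft ω f z := by
    ext z
    simp [wstft, stft_smul, mul_assoc, enorm_eq_nnnorm]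
  rw [orliczModNorm, this]
  exact mixedLuxNorm_mul_le Φ Ψ _ _

/-- The Orlicz modulation space `M^{Φ,Ψ}_{(ω)}` as a subspace of `S'_{1/2}`: those `f` for which
`V_φ f` belongs to the mixed weighted Orlicz space `L^{Φ,Ψ}_{(ω)}`, that is, is measurable with
finite norm. -/
def orliczModSubmodule (Φ Ψ : YoungFunction) (ω : ModerateWeight (Euc ι × Euc ι)) :
    Submodule ℂ (GSDual ι) where
  carrier := {f | AEMeasurable (stft f) ∧ orliczModNorm Φ Ψ ω f < ∞}
  zero_mem' := by
    refine ⟨?_, by simp [orliczModNorm_zero]⟩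
    have : stft (0 : GSDual ι) = fun _ => 0 := funext stft_zero
    rw [this]
    exact aemeasurable_const
  add_mem' := by
    rintro f g ⟨hf, hf'⟩ ⟨hg, hg'⟩
    refine ⟨?_, (orliczModNorm_add_le Φ Ψ ω hf).trans_lt (ENNReal.add_lt_top.mpr ⟨hf', hg'⟩)⟩
    have : stft (f + g) = fun z => stft f z + stft g z := funext (stft_add f g)
    rw [this]
    exact hf.add hg
  smul_mem' := by
    rintro c f ⟨hf, hf'⟩
    refine ⟨?_, (orliczModNorm_smul_le Φ Ψ ω c f).trans_lt
      (ENNReal.mul_lt_top (by simp) hf')⟩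
    have : stft (c • f) = fun z => c * stft f z := funext (stft_smul c f)
    rw [this]
    exact hf.const_mul c

/-- The Orlicz modulation space `M^{Φ,Ψ}_{(ω)}(ℝ^ι)` as a type. -/
def OrliczMod (Φ Ψ : YoungFunction) (ω : ModerateWeight (Euc ι × Euc ι)) : Type :=
  orliczModSubmodule Φ Ψ ω

namespace OrliczMod

variable {Φ Ψ : YoungFunction} {ω : ModerateWeight (Euc ι × Euc ι)}

instance : AddCommGroup (OrliczMod Φ Ψ ω) :=
  inferInstanceAs (AddCommGroup (orliczModSubmodule Φ Ψ ω))

instance : Module ℂ (OrliczMod Φ Ψ ω) :=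
  inferInstanceAs (Module ℂ (orliczModSubmodule Φ Ψ ω))

/-- The inclusion of `M^{Φ,Ψ}_{(ω)}` into `S'_{1/2}`. -/
def toDual : OrliczMod Φ Ψ ω →ₗ[ℂ] GSDual ι := (orliczModSubmodule Φ Ψ ω).subtype

instance : Norm (OrliczMod Φ Ψ ω) := ⟨fun f => (orliczModNorm Φ Ψ ω f.toDual).toReal⟩

theorem norm_def (f : OrliczMod Φ Ψ ω) : ‖f‖ = (orliczModNorm Φ Ψ ω f.toDual).toReal := rfl

theorem norm_smul_le' (c : ℂ) (f : OrliczMod Φ Ψ ω) : ‖c • f‖ ≤ ‖c‖ * ‖f‖ := by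
  rw [norm_def, norm_def, map_smul, ← toReal_enorm c, ← ENNReal.toReal_mul]
  exact ENNReal.toReal_mono (ENNReal.mul_ne_top (by simp) f.2.2.ne)
    (orliczModNorm_smul_le Φ Ψ ω c _)

instance : SeminormedAddCommGroup (OrliczMod Φ Ψ ω) :=
  SeminormedAddCommGroup.ofCore (𝕜 := ℂ)
    { norm_nonneg := fun f => ENNReal.toReal_nonneg
      norm_smul := fun c f => by
        refine le_antisymm (norm_smul_le' c f) ?_
        rcases eq_or_ne c 0 with rfl | hc
        · rw [norm_zero, zero_mul]
          exact ENNReal.toReal_nonneg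
        have h := norm_smul_le' c⁻¹ (c • f)
        rw [smul_smul, inv_mul_cancel₀ hc, one_smul, norm_inv] at h
        rwa [← le_inv_mul_iff₀ (norm_pos_iff.mpr hc)]
      norm_triangle := fun f g => by
        have hf : orliczModNorm Φ Ψ ω f.toDual ≠ ∞ := f.2.2.ne
        have hg : orliczModNorm Φ Ψ ω g.toDual ≠ ∞ := g.2.2.ne
        rw [norm_def, norm_def, norm_def, map_add, ← ENNReal.toReal_add hf hg]
        exact ENNReal.toReal_mono (ENNReal.add_ne_top.mpr ⟨f.2.2.ne, g.2.2.ne⟩)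
          (orliczModNorm_add_le Φ Ψ ω f.2.1) }

instance : NormedSpace ℂ (OrliczMod Φ Ψ ω) where
  norm_smul_le := norm_smul_le'

end OrliczMod

end GelfandShilov

/-! ## Pseudo-differential operators -/

section Pseudo

variable {ι : Type} [Fintype ι]

/-- The point `(x, y)` of `ℝ^{2d}`. -/
def pair (x y : Euc ι) : Euc (ι ⊕ ι) := WithLp.toLp 2 (Sum.elim x y)

/-- The first component of a point of `ℝ^{2d}`. -/
def pairFst (z : Euc (ι ⊕ ι)) : Euc ι := WithLp.toLp 2 fun i => z (Sum.inl i)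

/-- The second component of a point of `ℝ^{2d}`. -/
def pairSnd (z : Euc (ι ⊕ ι)) : Euc ι := WithLp.toLp 2 fun i => z (Sum.inr i)

/-- Matrix times vector on Euclidean space. -/
def matVec (A : Matrix ι ι ℝ) (x : Euc ι) : Euc ι := WithLp.toLp 2 (A.mulVec x)

/-- The transpose of the map `a ↦ (𝓕₂⁻¹ a)(x - A(x - y), x - y)`: with `x = u + A v` and
`y = u + (A - I) v` (a substitution of determinant `± 1`), it takes `Θ` to
`(u, ξ) ↦ (2π) ^ (-d/2) ∫ Θ(u + A v, u + (A - I) v) e ^ (i⟨v,ξ⟩) dv`. -/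
def kernelTranspose [DecidableEq ι] (A : Matrix ι ι ℝ) (Θ : Euc (ι ⊕ ι) → ℂ)
    (z : Euc (ι ⊕ ι)) : ℂ :=
  fourierConst ι * ∫ v : Euc ι,
    Θ (pair (pairFst z + matVec A v) (pairFst z + matVec (A - 1) v)) *
      Complex.exp (Complex.I * (inner ℝ v (pairSnd z) : ℝ))

/-- The pairing `⟨K_{a,A}, Θ⟩` of the distribution kernel
`K_{a,A}(x,y) = (2π) ^ (-d/2) (𝓕₂⁻¹ a)(x - A(x - y), x - y)` with a test function `Θ`. -/
def kernelPairing [DecidableEq ι] (A : Matrix ι ι ℝ) (a : GSDual (ι ⊕ ι))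
    (Θ : Euc (ι ⊕ ι) → ℂ) : ℂ :=
  fourierConst ι * a.eval (kernelTranspose A Θ)

/-- `u = Op_A(a) f`, that is, `⟨u, g⟩ = ⟨K_{a,A}, g ⊗ f⟩` for all `g ∈ S_{1/2}`. -/
def IsOp [DecidableEq ι] (A : Matrix ι ι ℝ) (a : GSDual (ι ⊕ ι)) (f : GS ι) (u : GSDual ι) :
    Prop :=
  ∀ g : GS ι, (u : GS ι →ₗ[ℂ] ℂ) g =
    kernelPairing A a fun z => (g : Euc ι → ℂ) (pairFst z) * (f : Euc ι → ℂ) (pairSnd z)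

variable {Φ₁ Ψ₁ Φ₂ Ψ₂ : YoungFunction} {ω₁ ω₂ : ModerateWeight (Euc ι × Euc ι)}

/-- `T` is an extension of `Op_A(a) : S_{1/2} → S'_{1/2}`: each `φ ∈ S_{1/2}` belongs to the
domain of `T`, and `T φ = Op_A(a) φ`. -/
def ExtendsOp [DecidableEq ι] (A : Matrix ι ι ℝ) (a : GSDual (ι ⊕ ι))
    (T : OrliczMod Φ₁ Ψ₁ ω₁ →L[ℂ] OrliczMod Φ₂ Ψ₂ ω₂) : Prop :=
  ∀ φ : GS ι, ∃ f : OrliczMod Φ₁ Ψ₁ ω₁, f.toDual = φ.toDual ∧ IsOp A a φ (T f).toDual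

/-- `f n → f₀` boundedly: `f n → f₀` weakly in `S'_{1/2}`, and all `|V_φ (f n)|` are dominated by
one element of `L^{Φ,Ψ}_{(ω)}`. -/
def DominatedTendsto (f : ℕ → OrliczMod Φ₁ Ψ₁ ω₁) (f₀ : OrliczMod Φ₁ Ψ₁ ω₁) : Prop :=
  (∀ g : GS ι, Tendsto (fun n => ((f n).toDual : GS ι →ₗ[ℂ] ℂ) g) atTop
    (𝓝 ((f₀.toDual : GS ι →ₗ[ℂ] ℂ) g))) ∧
  ∃ G : Euc ι × Euc ι → ℝ≥0∞, AEMeasurable G ∧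
    mixedLuxNorm Φ₁ Ψ₁ (fun z => G z * ENNReal.ofReal (ω₁ z)) < ∞ ∧
    ∀ n, ∀ᵐ z, ‖stft (f n).toDual z‖ₑ ≤ G z

/-- `T` takes dominated convergent sequences to weakly convergent sequences in `S'_{1/2}`. -/
def DominatedContinuous (T : OrliczMod Φ₁ Ψ₁ ω₁ →L[ℂ] OrliczMod Φ₂ Ψ₂ ω₂) : Prop :=
  ∀ (f : ℕ → OrliczMod Φ₁ Ψ₁ ω₁) (f₀ : OrliczMod Φ₁ Ψ₁ ω₁), DominatedTendsto f f₀ →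
    ∀ g : GS ι, Tendsto (fun n => ((T (f n)).toDual : GS ι →ₗ[ℂ] ℂ) g) atTop
      (𝓝 (((T f₀).toDual : GS ι →ₗ[ℂ] ℂ) g))

end Pseudo

end

open MeasureTheory Filter Topology
open scoped ENNReal NNReal

noncomputable section

/-! ### Young functions: growth, supporting lines, Jensen's inequality -/

namespace YoungFunction

/-! The operator is studied through its matrix in the Gabor system, the time-frequency shifts π(z)
of the Gaussian φ. Up to a phase, the entry between w and z is the value of the symbol a on a
time-frequency shift of one fixed test function Θ_A, and the shift is by exactly the point at which
ω₀ is evaluated in the weight condition (`kernelTranspose_gsPi`, `kernelPairing_eq`). The matrix is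
thus a short-time Fourier transform of a, the weight condition distributes ω₂(z) over symbol and
argument, and boundedness becomes a statement about ∫ h(`kernelPoint A z w`) F(w) dw with h in
L^{p,q} and F in L^{Φ₁,Ψ₁}.

The reproducing formula `apply_eq_integral_gsHat` bounds every weighted short-time Fourier transform
by its convolution with an exponential, because moderate weights grow at most exponentially while
Gabor coefficients of test functions decay like Gaussians. Hence h and F may be taken to vary at
most exponentially and can be sampled on the integer lattice. In suitable lattice coordinates X, Y
the kernel point is (X + shear of Y, Y) (`kernelPoint_lat`); the shear disappears by translation
invariance, and duality of Orlicz sequence spaces (`mixLux_conj_le`) leaves the trilinear form Σ_Y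
Σ_X H(X,Y) G(X₁, X₂+Y₁) F(X₁+Y₂, X₂), estimated in `exists_trilinear_le`.

For p = 1 that form is bounded because F and G are bounded sequences. For p > 1, Hölder's inequality
in X and in Y reduces it to a convolution inequality for F^{p'} and G^{p'} with values in ℓ^{q'/p'}.
This follows from the pointwise bound xy ≲ Φ₁(x)^{1/p'} Φ₂(y)^{1/q'} + Φ₁(x)^{1/q'} Φ₂(y)^{1/p'} for
small x, y (`ProductBound`): since Φ₁(u) and Φ₂(v) are summable, the p'-th power of the right-hand
side consists of products of an ℓ¹ sequence with an ℓ^{q'/p'} sequence, and the triangle inequality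
suffices; no interpolation is involved. The steering conditions and the essential inverses enter
only in the pointwise bound (`productBound`, `mul_le_of_essInv`).

The extension is defined by the weak form `opForm`, an absolutely convergent integral over phase
space, so dominated convergence there yields dominated continuity (`TrilinearBound.tendsto_opForm`).
Truncated Gabor expansions of f are test functions; they converge to f dominatedly, and in norm
under Δ₂ and positivity off the origin, which gives both uniqueness statements. For a symbol in
S_{1/2} the matrix has Gaussian decay and the operator is a Bochner integral of rank one operators,
hence compact; the norm estimate carries compactness to the closure. -/

theorem map_mul_le (Φ : YoungFunction) {θ : ℝ≥0} (hθ : θ ≤ 1) (t : ℝ≥0∞) :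
    Φ (θ * t) ≤ θ * Φ t := by
  have := Φ.convex θ (1 - θ) t 0 (add_tsub_cancel_of_le hθ)
  simpa [Φ.map_zero'] using this

theorem exists_pos_finite (Φ : YoungFunction) : ∃ t : ℝ≥0, 0 < t ∧ Φ t ≠ ∞ := by
  obtain ⟨t, h0, hf⟩ := Φ.exists_finite'
  have htop : t ≠ ∞ := by
    rintro rfl
    exact hf Φ.map_top'
  lift t to ℝ≥0 using htop
  exact ⟨t, pos_iff_ne_zero.mpr (by exact_mod_cast h0), hf⟩

theorem exists_lt_map (Φ : YoungFunction) {K : ℝ≥0∞} (hK : K ≠ ∞) :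
    ∃ T : ℝ≥0, 0 < T ∧ K < Φ T :=
  ((eventually_gt_atTop (0 : ℝ≥0)).and
    (Φ.tendsto'.eventually (lt_mem_nhds hK.lt_top))).exists

theorem exists_le_of_map_le (Φ : YoungFunction) {K : ℝ≥0∞} (hK : K ≠ ∞) :
    ∃ T : ℝ≥0, 0 < T ∧ ∀ t, Φ t ≤ K → t ≤ T := by
  obtain ⟨T, h0, hT⟩ := Φ.exists_lt_map hK
  refine ⟨T, h0, fun t ht => ?_⟩
  by_contra! h
  exact absurd (hT.trans_le (Φ.mono h.le)) ht.not_gt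

/-- Convexity and Φ(0) = 0 force at least linear growth beyond a point where Φ exceeds 1. On a
probability space this makes ∫ X finite whenever ∫ Φ(X) is. -/
theorem exists_le_linear (Φ : YoungFunction) :
    ∃ T : ℝ≥0, 0 < T ∧ ∀ t, t ≤ T + T * Φ t := by
  obtain ⟨T, h0, hT⟩ := Φ.exists_lt_map ENNReal.one_ne_top
  refine ⟨T, h0, fun t => ?_⟩
  rcases eq_or_ne t ∞ with rfl | ht
  · rw [Φ.map_top', ENNReal.mul_top (by exact_mod_cast h0.ne')]
    simp
  lift t to ℝ≥0 using ht
  rcases le_total t T with h | h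
  · exact le_trans (by exact_mod_cast h) le_self_add
  have ht0 : 0 < t := h0.trans_le h
  have h1 := Φ.map_mul_le (θ := T / t) ((div_le_one₀ ht0).mpr h) t
  rw [← ENNReal.coe_mul, div_mul_cancel₀ _ ht0.ne'] at h1
  have h2 := hT.le.trans h1
  calc (t : ℝ≥0∞) = t * 1 := (mul_one _).symm
    _ ≤ t * (((T / t : ℝ≥0) : ℝ≥0∞) * Φ t) := by gcongr
    _ = ((t * (T / t) : ℝ≥0) : ℝ≥0∞) * Φ t := by push_cast; ring
    _ = T * Φ t := by rw [mul_div_cancel₀ _ ht0.ne']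
    _ ≤ _ := le_add_self

/-- Convexity for the three points a ≤ b ≤ c with the denominators cleared, so that infinite values
of Φ need no separate treatment. -/
theorem map_mul_add_le (Φ : YoungFunction) {a b c : ℝ≥0} (hab : a ≤ b) (hbc : b ≤ c)
    (hac : a < c) :
    ((c - a : ℝ≥0) : ℝ≥0∞) * Φ b ≤ ((c - b : ℝ≥0) : ℝ≥0∞) * Φ a + ((b - a : ℝ≥0) : ℝ≥0∞) * Φ c := by
  have hd : c - a ≠ 0 := (tsub_pos_of_lt hac).ne'
  have hs : (c - b) / (c - a) + (b - a) / (c - a) = 1 := by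
    rw [← add_div, tsub_add_tsub_cancel hbc hab, div_self hd]
  have h := Φ.convex' ((c - b) / (c - a)) ((b - a) / (c - a)) a c hs
  have hb : (c - b) / (c - a) * a + (b - a) / (c - a) * c = b := by
    have : ((c - a : ℝ≥0) : ℝ) ≠ 0 := by exact_mod_cast hd
    rw [← NNReal.coe_inj]
    push_cast [NNReal.coe_sub hbc, NNReal.coe_sub hab, NNReal.coe_sub hac.le] at this ⊢
    field_simp
    ring
  rw [hb] at h
  refine (mul_le_mul_right h ((c - a : ℝ≥0) : ℝ≥0∞)).trans_eq ?_
  rw [mul_add, ← mul_assoc, ← mul_assoc, ← ENNReal.coe_mul, ← ENNReal.coe_mul,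
    mul_div_cancel₀ _ hd, mul_div_cancel₀ _ hd]

/-- A supporting line at a point below the infinity point. -/
theorem exists_supporting_line (Φ : YoungFunction) {t₀ t₁ : ℝ≥0} (h01 : t₀ < t₁)
    (hf : Φ t₁ ≠ ∞) : ∃ m : ℝ≥0, ∀ t : ℝ≥0∞, Φ t₀ + m * t ≤ Φ t + m * t₀ := by
  have hf0 : Φ t₀ ≠ ∞ := ne_top_of_le_ne_top hf (Φ.mono (by exact_mod_cast h01.le))
  set slope : ℝ≥0 → ℝ≥0∞ := fun s => (Φ s - Φ t₀) / ((s - t₀ : ℝ≥0) : ℝ≥0∞)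
  -- The slope is the right derivative at t₀, as the infimum of the difference quotients to the
  -- right; the finite value at t₁ makes it finite.
  set m : ℝ≥0∞ := ⨅ s : ℝ≥0, ⨅ _ : t₀ < s, slope s with hm
  have hmfin : m ≠ ∞ := by
    refine ne_top_of_le_ne_top ?_ (iInf₂_le t₁ h01)
    exact ENNReal.div_ne_top (ENNReal.sub_ne_top hf) (ENNReal.coe_ne_zero.mpr (tsub_pos_of_lt h01).ne')
  refine ⟨m.toNNReal, fun t => ?_⟩
  rw [ENNReal.coe_toNNReal hmfin]
  rcases eq_or_ne t ∞ with rfl | ht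
  · rw [Φ.map_top', top_add]
    exact le_top
  lift t to ℝ≥0 using ht
  rcases lt_trichotomy t t₀ with h | rfl | h
  · have hft : Φ t ≠ ∞ := ne_top_of_le_ne_top hf0 (Φ.mono (by exact_mod_cast h.le))
    have key : (Φ t₀ - Φ t) / ((t₀ - t : ℝ≥0) : ℝ≥0∞) ≤ m := by
      refine le_iInf₂ fun s hs => ?_
      have h1 : ((t₀ - t : ℝ≥0) : ℝ≥0∞) ≠ 0 := ENNReal.coe_ne_zero.mpr (tsub_pos_of_lt h).ne'
      have h2 : ((s - t₀ : ℝ≥0) : ℝ≥0∞) ≠ 0 := ENNReal.coe_ne_zero.mpr (tsub_pos_of_lt hs).ne'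
      rw [ENNReal.div_le_iff_le_mul (Or.inl h1) (Or.inl ENNReal.coe_ne_top), mul_comm,
        mul_div_assoc', ENNReal.le_div_iff_mul_le (Or.inl h2) (Or.inl ENNReal.coe_ne_top)]
      rcases eq_or_ne (Φ s) ∞ with hfs | hfs
      · rw [hfs, ENNReal.top_sub hf0, ENNReal.mul_top h1]
        exact le_top
      have h3 := Φ.map_mul_add_le h.le hs.le (h.trans hs)
      have m1 : (Φ t).toReal ≤ (Φ t₀).toReal := ENNReal.toReal_mono hf0 (Φ.mono (by exact_mod_cast h.le))
      have m2 : (Φ t₀).toReal ≤ (Φ s).toReal := ENNReal.toReal_mono hfs (Φ.mono (by exact_mod_cast hs.le))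
      have h4 := ENNReal.toReal_mono (by finiteness) h3
      rw [ENNReal.toReal_add (by finiteness) (by finiteness), ENNReal.toReal_mul,
        ENNReal.toReal_mul, ENNReal.toReal_mul] at h4
      simp only [ENNReal.coe_toReal, NNReal.coe_sub h.le, NNReal.coe_sub hs.le,
        NNReal.coe_sub (h.trans hs).le] at h4
      rw [← ENNReal.toReal_le_toReal (by finiteness) (by finiteness), ENNReal.toReal_mul,
        ENNReal.toReal_mul, ENNReal.toReal_sub_of_le (Φ.mono (by exact_mod_cast h.le)) hf0,
        ENNReal.toReal_sub_of_le (Φ.mono (by exact_mod_cast hs.le)) hfs]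
      simp only [ENNReal.coe_toReal, NNReal.coe_sub h.le, NNReal.coe_sub hs.le]
      nlinarith
    rw [ENNReal.div_le_iff_le_mul (Or.inl (ENNReal.coe_ne_zero.mpr (tsub_pos_of_lt h).ne')) (Or.inl ENNReal.coe_ne_top)] at key
    calc Φ t₀ + m * t ≤ (Φ t + (Φ t₀ - Φ t)) + m * t := by
          gcongr
          exact le_add_tsub
      _ ≤ (Φ t + m * ((t₀ - t : ℝ≥0) : ℝ≥0∞)) + m * t := by gcongr
      _ = Φ t + m * ((t₀ - t + t : ℝ≥0) : ℝ≥0∞) := by push_cast; ring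
      _ = _ := by rw [tsub_add_cancel_of_le h.le]
  · exact le_rfl
  · have key : m ≤ (Φ t - Φ t₀) / ((t - t₀ : ℝ≥0) : ℝ≥0∞) := iInf₂_le t h
    rw [ENNReal.le_div_iff_mul_le (Or.inl (ENNReal.coe_ne_zero.mpr (tsub_pos_of_lt h).ne')) (Or.inl ENNReal.coe_ne_top)] at key
    calc Φ t₀ + m * t = Φ t₀ + m * ((t - t₀ + t₀ : ℝ≥0) : ℝ≥0∞) := by
          rw [tsub_add_cancel_of_le h.le]
      _ = (Φ t₀ + m * ((t - t₀ : ℝ≥0) : ℝ≥0∞)) + m * t₀ := by push_cast; ring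
      _ ≤ (Φ t₀ + (Φ t - Φ t₀)) + m * t₀ := by gcongr
      _ = _ := by rw [add_tsub_cancel_of_le (Φ.mono (by exact_mod_cast h.le))]

/-- Jensen's inequality; the factor `θ < 1` takes care of a jump of `Φ` to `∞`. -/
theorem map_lintegral_le {Ω : Type*} [MeasurableSpace Ω] {ν : Measure Ω} [IsProbabilityMeasure ν]
    (Φ : YoungFunction) {X : Ω → ℝ≥0∞} (hX : AEMeasurable X ν) {θ : ℝ≥0} (hθ : θ < 1) :
    Φ (θ * ∫⁻ w, X w ∂ν) ≤ ∫⁻ w, Φ (X w) ∂ν := by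
  rcases eq_or_ne (∫⁻ w, Φ (X w) ∂ν) ∞ with htop | hfin
  · rw [htop]
    exact le_top
  have hΦX : AEMeasurable (fun w => Φ (X w)) ν := Φ.mono.measurable.comp_aemeasurable hX
  have hI : ∫⁻ w, X w ∂ν ≠ ∞ := by
    obtain ⟨T, -, hT⟩ := Φ.exists_le_linear
    refine ne_top_of_le_ne_top ?_ (lintegral_mono fun w => hT (X w))
    rw [lintegral_add_left measurable_const, lintegral_const, lintegral_const_mul' _ _ (by simp)]
    finiteness
  lift ∫⁻ w, X w ∂ν to ℝ≥0 using hI with I hIdef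
  rcases eq_or_ne I 0 with rfl | hI0
  · simp [Φ.map_zero']
  have hlt : θ * I < I := by
    calc θ * I < 1 * I := by
          have : 0 < I := pos_iff_ne_zero.mpr hI0
          gcongr
      _ = I := one_mul I
  -- If Φ is finite somewhere beyond θI, the supporting line at θI is integrated. Otherwise Φ = ∞
  -- beyond θI, so finiteness of ∫ Φ(X) forces X ≤ θI almost everywhere, which contradicts ∫ X = I >
  -- θI.
  by_cases hex : ∃ s : ℝ≥0, θ * I < s ∧ Φ s ≠ ∞
  · obtain ⟨s, hs, hfs⟩ := hex
    obtain ⟨m, hm⟩ := Φ.exists_supporting_line hs hfs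
    have h1 := lintegral_mono (μ := ν) fun w => hm (X w)
    rw [lintegral_add_left measurable_const, lintegral_const, lintegral_const_mul' _ _ (by simp),
      lintegral_add_right _ measurable_const, lintegral_const, measure_univ, mul_one, mul_one,
      ← hIdef] at h1
    have h2 : (m : ℝ≥0∞) * ((θ * I : ℝ≥0) : ℝ≥0∞) ≤ m * I := by gcongr
    rw [← ENNReal.coe_mul]
    refine (ENNReal.add_le_add_iff_right (a := (m : ℝ≥0∞) * ((θ * I : ℝ≥0) : ℝ≥0∞))
      (by finiteness)).mp (le_trans ?_ h1)
    gcongr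
  · push Not at hex
    exfalso
    have hae : ∀ᵐ w ∂ν, X w ≤ ((θ * I : ℝ≥0) : ℝ≥0∞) := by
      filter_upwards [ae_lt_top' hΦX hfin] with w hw
      by_contra! h
      have hXt : X w ≠ ∞ := by
        intro h'
        rw [h', Φ.map_top'] at hw
        exact lt_irrefl _ hw
      lift X w to ℝ≥0 using hXt with x
      exact hw.ne (hex x (by exact_mod_cast h))
    have h3 := lintegral_mono_ae hae
    rw [← hIdef, lintegral_const, measure_univ, mul_one] at h3
    exact absurd (by exact_mod_cast h3 : I ≤ θ * I) hlt.not_ge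

/-- The Young function `t ^ r`, `1 ≤ r ≤ ∞`. -/
def pow (r : ℝ≥0∞) (hr : 1 ≤ r) : YoungFunction where
  toFun := powFun r
  convex' := by
    intro s₁ s₂ t₁ t₂ h
    have h' : (s₁ : ℝ≥0∞) + s₂ = 1 := by exact_mod_cast h
    unfold powFun
    by_cases hr' : r = ∞
    · simp only [hr', if_true]
      have aux : ∀ s t : ℝ≥0, s ≠ 0 → 1 < t →
          (s : ℝ≥0∞) * (if (t : ℝ≥0∞) ≤ 1 then 0 else ∞) = ∞ := by
        intro s t hs ht
        rw [if_neg (by exact_mod_cast ht.not_ge), ENNReal.mul_top (by exact_mod_cast hs)]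
      by_cases c1 : s₁ ≠ 0 ∧ 1 < t₁
      · rw [aux s₁ t₁ c1.1 c1.2, top_add]
        exact le_top
      by_cases c2 : s₂ ≠ 0 ∧ 1 < t₂
      · rw [aux s₂ t₂ c2.1 c2.2, add_top]
        exact le_top
      have aux2 : ∀ s t : ℝ≥0, ¬(s ≠ 0 ∧ 1 < t) → s * t ≤ s := by
        intro s t hst
        rcases eq_or_ne s 0 with rfl | hs
        · simp
        · exact mul_le_of_le_one_right' (not_lt.mp fun ht => hst ⟨hs, ht⟩)
      have : s₁ * t₁ + s₂ * t₂ ≤ 1 := (add_le_add (aux2 _ _ c1) (aux2 _ _ c2)).trans h.le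
      rw [if_pos (by exact_mod_cast this)]
      exact zero_le
    · simp only [hr', if_false]
      have := ENNReal.rpow_arith_mean_le_arith_mean2_rpow (s₁ : ℝ≥0∞) s₂ t₁ t₂ h'
        (p := r.toReal) (by rwa [← ENNReal.ofReal_le_iff_le_toReal hr', ENNReal.ofReal_one])
      exact_mod_cast this
  map_zero' := by
    unfold powFun
    split_ifs with h1 h2
    · rfl
    · exact absurd zero_le h2
    · exact ENNReal.zero_rpow_of_pos (ENNReal.toReal_pos (zero_lt_one.trans_le hr).ne' h1)
  map_top' := by
    unfold powFun
    split_ifs with h1 h2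
    · simp at h2
    · rfl
    · exact ENNReal.top_rpow_of_pos (ENNReal.toReal_pos (zero_lt_one.trans_le hr).ne' h1)
  tendsto' := by
    unfold powFun
    split_ifs with h1
    · refine tendsto_const_nhds.congr' ?_
      filter_upwards [eventually_gt_atTop (1 : ℝ≥0)] with t ht
      rw [if_neg (by exact_mod_cast ht.not_ge)]
    · have h0 : 0 < r.toReal := ENNReal.toReal_pos (zero_lt_one.trans_le hr).ne' h1
      have h := (ENNReal.continuous_rpow_const (y := r.toReal)).tendsto ∞
      rw [ENNReal.top_rpow_of_pos h0] at h
      exact h.comp (ENNReal.tendsto_coe_nhds_top.mpr tendsto_id)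
  exists_finite' := by
    refine ⟨1, one_ne_zero, ?_⟩
    unfold powFun
    split_ifs with _ h2
    · simp
    · exact absurd le_rfl h2
    · simp

end YoungFunction

/-! ### Luxemburg norms: Lebesgue norms as a special case, Minkowski's inequality, Fatou's lemma -/

section LuxNorm

variable {α β : Type*} [MeasurableSpace α] [MeasurableSpace β] {μ : Measure α}

theorem luxNorm_le (Φ : YoungFunction) {u : α → ℝ≥0∞} {l : ℝ≥0∞} (h0 : l ≠ 0) (ht : l ≠ ∞)
    (h : ∫⁻ x, Φ (u x / l) ∂μ ≤ 1) : luxNorm Φ μ u ≤ l := sInf_le ⟨h0, ht, h⟩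

theorem lintegral_le_one_of_luxNorm_lt (Φ : YoungFunction) {u : α → ℝ≥0∞} {l : ℝ≥0∞}
    (h : luxNorm Φ μ u < l) : ∫⁻ x, Φ (u x / l) ∂μ ≤ 1 := by
  obtain ⟨k, ⟨-, -, hk⟩, hkl⟩ := sInf_lt_iff.mp h
  exact (lintegral_mono fun x => Φ.mono (ENNReal.div_le_div_left hkl.le _)).trans hk

theorem luxNorm_comp {Φ : YoungFunction} {ν : Measure β} {g : α → β} (hg : MeasurePreserving g μ ν)
    {u : β → ℝ≥0∞} (hu : Measurable u) : luxNorm Φ μ (fun x => u (g x)) = luxNorm Φ ν u := by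
  unfold luxNorm
  congr! 5 with l
  rw [← hg.lintegral_comp (f := fun y => Φ (u y / l))
    (Φ.mono.measurable.comp (hu.div_const _))]

/-- The two norms have the same admissible levels: the modular of u / l is at most 1 exactly when
the L^r-norm is at most l. The case r = ∞ is separate since t^∞ only takes the values 0 and ∞. -/
theorem luxNorm_pow {r : ℝ≥0∞} (hr : 1 ≤ r) {u : α → ℝ≥0∞} (hu : AEMeasurable u μ) :
    luxNorm (YoungFunction.pow r hr) μ u = eLpNorm u r μ := by
  have key : ∀ l : ℝ≥0∞, l ≠ 0 → l ≠ ∞ →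
      (∫⁻ x, YoungFunction.pow r hr (u x / l) ∂μ ≤ 1 ↔ eLpNorm u r μ ≤ l) := by
    intro l h0 ht
    by_cases hr' : r = ∞
    · subst hr'
      have e : ∀ x, YoungFunction.pow ∞ hr (u x / l) = if u x ≤ l then 0 else ∞ := by
        intro x
        simp only [YoungFunction.pow, powFun, if_true,
          ENNReal.div_le_iff_le_mul (Or.inl h0) (Or.inl ht), one_mul]
      simp only [e]
      rw [eLpNorm_exponent_top, eLpNormEssSup]
      simp only [enorm_eq_self]
      constructor
      · intro h
        have h2 : ∀ᵐ x ∂μ, (if u x ≤ l then (0 : ℝ≥0∞) else ∞) < ∞ := by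
          refine ae_lt_top' ?_ (ne_top_of_le_ne_top ENNReal.one_ne_top h)
          have hm : Measurable fun t : ℝ≥0∞ => if t ≤ l then (0 : ℝ≥0∞) else ∞ :=
            Measurable.ite measurableSet_Iic measurable_const measurable_const
          exact hm.comp_aemeasurable hu
        refine essSup_le_of_ae_le _ (h2.mono fun x hx => ?_)
        by_contra hc
        simp [hc] at hx
      · intro h
        have h2 : ∀ᵐ x ∂μ, u x ≤ l := (ae_le_essSup (f := u)).mono fun x hx => hx.trans h
        rw [lintegral_congr_ae (g := fun _ => 0) (h2.mono fun x hx => by simp [hx])]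
        simp
    · have hp : 0 < r.toReal := ENNReal.toReal_pos (zero_lt_one.trans_le hr).ne' hr'
      have e : ∀ x, YoungFunction.pow r hr (u x / l) = u x ^ r.toReal * (l ^ r.toReal)⁻¹ := by
        intro x
        simp only [YoungFunction.pow, powFun, hr', if_false]
        rw [ENNReal.div_rpow_of_nonneg _ _ hp.le, div_eq_mul_inv]
      have hl0 : l ^ r.toReal ≠ 0 := by simp [h0, ht]
      have hlt : l ^ r.toReal ≠ ∞ := by simp [h0, ht]
      simp only [e]
      rw [lintegral_mul_const' _ _ (ENNReal.inv_ne_top.mpr hl0), ← div_eq_mul_inv,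
        ENNReal.div_le_iff_le_mul (Or.inl hl0) (Or.inl hlt), one_mul,
        eLpNorm_eq_lintegral_rpow_enorm_toReal (zero_lt_one.trans_le hr).ne' hr',
        one_div, ENNReal.rpow_inv_le_iff hp]
      simp only [enorm_eq_self]
  refine le_antisymm (le_of_forall_gt_imp_ge_of_dense fun l hl => ?_) (le_sInf fun l hl => ?_)
  · rcases eq_or_ne l ∞ with rfl | ht
    · exact le_top
    exact luxNorm_le _ (zero_le.trans_lt hl).ne' ht ((key l (zero_le.trans_lt hl).ne' ht).mpr hl.le)
  · exact (key l hl.1 hl.2.1).mp hl.2.2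

/-- Minkowski's inequality for Luxemburg norms. -/
theorem luxNorm_lintegral_le (Φ : YoungFunction) [SFinite μ] (ν : Measure β) [SigmaFinite ν]
    {F : α × β → ℝ≥0∞} (hF : Measurable F) :
    luxNorm Φ μ (fun x => ∫⁻ w, F (x, w) ∂ν) ≤ ∫⁻ w, luxNorm Φ μ (fun x => F (x, w)) ∂ν := by
  set N : β → ℝ≥0∞ := fun w => luxNorm Φ μ fun x => F (x, w) with hN
  have hNm : Measurable N := measurable_luxNorm_left Φ hF
  rcases eq_or_ne (∫⁻ w, N w ∂ν) ∞ with htop | hfin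
  · rw [htop]
    exact le_top
  refine le_of_forall_gt_imp_ge_of_dense fun K hK => ?_
  rcases eq_or_ne K ∞ with rfl | hKt
  · exact le_top
  -- A positive perturbation of small integral makes `lam` strictly larger than the norm of each
  -- section. The modular of a section at level `lam w` is then at most 1, and division by `lam` is
  -- harmless.
  obtain ⟨g, hg0, hgm, hgI⟩ := exists_pos_lintegral_lt_of_sigmaFinite ν (tsub_pos_of_lt hK).ne'
  set lam : β → ℝ≥0∞ := fun w => N w + g w with hlam
  have hlm : Measurable lam := hNm.add hgm.coe_nnreal_ennreal
  have hlI : ∫⁻ w, lam w ∂ν < K := by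
    rw [hlam, lintegral_add_left hNm]
    calc _ < ∫⁻ w, N w ∂ν + (K - ∫⁻ w, N w ∂ν) := by
          rw [ENNReal.add_lt_add_iff_left hfin]
          exact hgI
      _ = K := add_tsub_cancel_of_le hK.le
  set Λ := ∫⁻ w, lam w ∂ν with hΛ
  have hΛt : Λ ≠ ∞ := (hlI.trans_le le_top).ne
  have hl0 : ∀ w, lam w ≠ 0 := fun w => by
    simp [hlam, (hg0 w).ne']
  have hlt : ∀ᵐ w ∂ν, lam w < ∞ := ae_lt_top hlm hΛt
  rcases eq_or_ne Λ 0 with h0 | hΛ0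
  · have hν : ν = 0 := by
      rw [hΛ, lintegral_eq_zero_iff hlm] at h0
      have : ∀ᵐ w ∂ν, False := h0.mono fun w hw => hl0 w hw
      rwa [eventually_false_iff_eq_bot, ae_eq_bot] at this
    subst hν
    simp [luxNorm_zero]
  -- Under the probability measure ρ, the integral of F against ν is Λ times the mean of F / `lam`,
  -- a mean of functions of modular at most 1, to which Jensen's inequality applies.
  set ρ : Measure β := ν.withDensity (fun w => lam w / Λ) with hρ
  have hρm : Measurable fun w => lam w / Λ := hlm.div_const _
  have : IsProbabilityMeasure ρ := by
    refine ⟨?_⟩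
    rw [hρ, withDensity_apply _ MeasurableSet.univ, Measure.restrict_univ]
    simp only [div_eq_mul_inv]
    rw [lintegral_mul_const _ hlm, ENNReal.mul_inv_cancel hΛ0 hΛt]
  -- choose `θ < 1` with `Λ / θ ≤ K`
  obtain ⟨k, hk1, hk2⟩ := exists_between hlI
  have hkt : k ≠ ∞ := (hk2.trans_le le_top).ne
  have hk0 : k ≠ 0 := (zero_le.trans_lt hk1).ne'
  have hθ : Λ / k < 1 := by
    rw [ENNReal.div_lt_iff (Or.inl hk0) (Or.inl hkt), one_mul]
    exact hk1
  refine (luxNorm_le Φ hk0 hkt ?_).trans hk2.le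
  lift Λ / k to ℝ≥0 using (hθ.trans_le le_top).ne with θ hθe
  have hinner : ∀ x, (∫⁻ w, F (x, w) ∂ν) / k = θ * ∫⁻ w, F (x, w) / lam w ∂ρ := by
    intro x
    have e1 : ∫⁻ w, F (x, w) / lam w ∂ρ = (∫⁻ w, F (x, w) ∂ν) / Λ := by
      have hFx : Measurable fun w => F (x, w) := hF.comp measurable_prodMk_left
      rw [hρ, lintegral_withDensity_eq_lintegral_mul (g := fun w => F (x, w) / lam w) _ hρm
        (hFx.div hlm)]
      simp only [div_eq_mul_inv]
      rw [← lintegral_mul_const _ hFx]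
      refine lintegral_congr_ae (hlt.mono fun w hw => ?_)
      simp only [Pi.mul_apply]
      rw [mul_comm (F (x, w)), mul_assoc, ← mul_assoc _ _ (F (x, w)), mul_comm (Λ⁻¹), mul_assoc,
        ← mul_assoc (lam w), ENNReal.mul_inv_cancel (hl0 w) hw.ne, one_mul, mul_comm]
    rw [e1, hθe, div_eq_mul_inv, div_eq_mul_inv, div_eq_mul_inv, mul_comm Λ, mul_assoc,
      mul_comm (∫⁻ w, F (x, w) ∂ν) Λ⁻¹, ← mul_assoc Λ, ENNReal.mul_inv_cancel hΛ0 hΛt, one_mul,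
      mul_comm]
  have hθ1 : θ < 1 := by exact_mod_cast hθ
  have hsec : ∀ᵐ w ∂ρ, ∫⁻ x, Φ (F (x, w) / lam w) ∂μ ≤ 1 := by
    refine (withDensity_absolutelyContinuous ν _).ae_le (hlt.mono fun w hw => ?_)
    refine lintegral_le_one_of_luxNorm_lt Φ ?_
    have : N w ≠ ∞ := ne_top_of_le_ne_top hw.ne le_self_add
    exact ENNReal.lt_add_right this (by exact_mod_cast (hg0 w).ne')
  have hjm : Measurable fun z : α × β => Φ (F z / lam z.2) :=
    Φ.mono.measurable.comp (hF.div (hlm.comp measurable_snd))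
  calc ∫⁻ x, Φ ((∫⁻ w, F (x, w) ∂ν) / k) ∂μ
      ≤ ∫⁻ x, ∫⁻ w, Φ (F (x, w) / lam w) ∂ρ ∂μ := by
        refine lintegral_mono fun x => ?_
        simp only [hinner]
        exact Φ.map_lintegral_le
          ((hF.comp measurable_prodMk_left).div hlm).aemeasurable hθ1
    _ = ∫⁻ w, ∫⁻ x, Φ (F (x, w) / lam w) ∂μ ∂ρ :=
        lintegral_lintegral_swap hjm.aemeasurable
    _ ≤ ∫⁻ w, 1 ∂ρ := lintegral_mono_ae hsec
    _ = 1 := by simp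

/-- Fatou's lemma for Luxemburg norms. -/
theorem luxNorm_le_liminf (Φ : YoungFunction) {u : α → ℝ≥0∞} {v : ℕ → α → ℝ≥0∞}
    (hv : ∀ n, AEMeasurable (v n) μ) (h : ∀ᵐ x ∂μ, u x ≤ liminf (fun n => v n x) atTop) :
    luxNorm Φ μ u ≤ liminf (fun n => luxNorm Φ μ (v n)) atTop := by
  refine le_of_forall_gt_imp_ge_of_dense fun K hK => ?_
  rcases eq_or_ne K ∞ with rfl | hKt
  · exact le_top
  obtain ⟨l, hl1, hl2⟩ := exists_between hK
  have hlt : l ≠ ∞ := (hl2.trans_le le_top).ne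
  have hl0 : l ≠ 0 := (zero_le.trans_lt hl1).ne'
  have hK0 : K ≠ 0 := (zero_le.trans_lt hl2).ne'
  have hfr : ∃ᶠ n in atTop, luxNorm Φ μ (v n) < l := frequently_lt_of_liminf_lt (by isBoundedDefault) hl1
  refine luxNorm_le Φ hK0 hKt ?_
  have hpt : ∀ᵐ x ∂μ, Φ (u x / K) ≤ liminf (fun n => Φ (v n x / l)) atTop := by
    filter_upwards [h] with x hx
    -- Φ may fail to be left continuous at its infinity point, so values strictly below `u x` are
    -- used; the gap between the levels l < K provides one of them, namely `u x / K * l`.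
    have step : ∀ c < u x, Φ (c / l) ≤ liminf (fun n => Φ (v n x / l)) atTop := by
      intro c hc
      refine le_liminf_of_le (by isBoundedDefault) ?_
      filter_upwards [eventually_lt_of_lt_liminf (hc.trans_le hx) (by isBoundedDefault)] with n hn
      exact Φ.mono (ENNReal.div_le_div_right hn.le l)
    rcases eq_or_ne (u x) 0 with h0 | h0
    · simp [h0, Φ.map_zero']
    rcases eq_or_ne (u x) ∞ with ht | ht
    · have : liminf (fun n => Φ (v n x / l)) atTop = ∞ := by
        refine ENNReal.eq_top_of_forall_nnreal_le fun r => ?_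
        obtain ⟨T, -, hT⟩ := Φ.exists_lt_map (K := r) ENNReal.coe_ne_top
        have := step (T * l) (by rw [ht]; exact ENNReal.mul_lt_top ENNReal.coe_lt_top hlt.lt_top)
        rw [ENNReal.mul_div_cancel_right hl0 hlt] at this
        exact hT.le.trans this
      rw [this]
      exact le_top
    · have h2 : u x / K * l < u x := by
        rw [ENNReal.div_eq_inv_mul, mul_comm, ← mul_assoc, ← ENNReal.div_eq_inv_mul.trans (mul_comm _ _)]
        calc l / K * u x < 1 * u x := by
              rw [ENNReal.mul_lt_mul_iff_left h0 ht, ENNReal.div_lt_iff (Or.inl hK0) (Or.inl hKt), one_mul]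
              exact hl2
          _ = u x := one_mul _
      have := step _ h2
      rwa [ENNReal.mul_div_cancel_right hl0 hlt] at this
  calc ∫⁻ x, Φ (u x / K) ∂μ ≤ ∫⁻ x, liminf (fun n => Φ (v n x / l)) atTop ∂μ := lintegral_mono_ae hpt
    _ ≤ liminf (fun n => ∫⁻ x, Φ (v n x / l) ∂μ) atTop :=
        lintegral_liminf_le' fun n => Φ.mono.measurable.comp_aemeasurable ((hv n).div_const _)
    _ ≤ 1 := liminf_le_of_frequently_le' (hfr.mono fun n hn => lintegral_le_one_of_luxNorm_lt Φ hn)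

end LuxNorm

/-! ### The essential inverse -/

namespace YoungFunction

theorem exists_pos_map_le (Φ : YoungFunction) {r : ℝ≥0∞} (hr : r ≠ 0) :
    ∃ ρ : ℝ≥0, 0 < ρ ∧ Φ ρ ≤ r := by
  obtain ⟨t, ht0, htf⟩ := Φ.exists_pos_finite
  obtain ⟨θ, hθ0, hθ⟩ := ENNReal.exists_nnreal_pos_mul_lt htf hr
  refine ⟨min θ 1 * t, mul_pos (lt_min hθ0 one_pos) ht0, ?_⟩
  rw [ENNReal.coe_mul]
  refine (Φ.map_mul_le (min_le_right θ 1) t).trans (le_trans ?_ hθ.le)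
  gcongr
  exact min_le_left _ _

/-- A convex function is continuous in the interior of its domain of finiteness, so the intermediate
value theorem applies between b, where Φ exceeds s, and a small multiple e of b, where Φ(e) ≤ s by
scaling. The point found exceeds the zero point, since otherwise Φ would vanish to its left and, by
continuity, at the point itself. -/
theorem exists_map_eq (Φ : YoungFunction) {s : ℝ≥0∞} (hs : s ≠ 0) (h : s < Φ.supValue) :
    ∃ t, Φ.zeroPoint < t ∧ t < Φ.infinityPoint ∧ Φ t = s := by
  obtain ⟨b, hb, hsb⟩ : ∃ b, b < Φ.infinityPoint ∧ s < Φ b := by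
    simpa [supValue, lt_iSup_iff] using h
  obtain ⟨c, hbc, hc⟩ := exists_between hb
  obtain ⟨y, hy, hcy⟩ := lt_sSup_iff.mp hc
  have hcf : Φ c ≠ ∞ := ne_top_of_le_ne_top (ne_of_lt hy) (Φ.mono hcy.le)
  have hst : s ≠ ∞ := (hsb.trans_le le_top).ne
  lift c to ℝ≥0 using (hc.trans_le le_top).ne
  lift b to ℝ≥0 using (hb.trans_le le_top).ne
  have hbc' : b < c := by exact_mod_cast hbc
  have hb0 : 0 < b := by
    rw [pos_iff_ne_zero]
    rintro rfl
    simp [Φ.map_zero'] at hsb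
  have hfin : ∀ x : ℝ, x < c → Φ (ENNReal.ofReal x) ≠ ∞ := fun x hx =>
    ne_top_of_le_ne_top hcf (Φ.mono (ENNReal.ofReal_le_of_le_toReal (by simpa using hx.le)))
  set f : ℝ → ℝ := fun x => (Φ (ENNReal.ofReal x)).toReal with hf
  have hconv : ConvexOn ℝ (Set.Ioo 0 (c : ℝ)) f := by
    refine ⟨convex_Ioo _ _, fun x hx y hy α β hα hβ hαβ => ?_⟩
    lift α to ℝ≥0 using hα
    lift β to ℝ≥0 using hβ
    have h1 := Φ.convex α β (ENNReal.ofReal x) (ENNReal.ofReal y) (by exact_mod_cast hαβ)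
    have e : (α : ℝ≥0∞) * ENNReal.ofReal x + β * ENNReal.ofReal y =
        ENNReal.ofReal (α * x + β * y) := by
      rw [ENNReal.ofReal_add (mul_nonneg α.coe_nonneg hx.1.le) (mul_nonneg β.coe_nonneg hy.1.le),
        ENNReal.ofReal_mul α.coe_nonneg, ENNReal.ofReal_mul β.coe_nonneg]
      simp
    rw [e] at h1
    have hfx := hfin x hx.2
    have hfy := hfin y hy.2
    have h2 := ENNReal.toReal_mono (by finiteness) h1
    rw [ENNReal.toReal_add (by finiteness) (by finiteness)] at h2
    simpa [hf] using h2
  have hcont : ContinuousOn f (Set.Ioo 0 (c : ℝ)) := hconv.continuousOn isOpen_Ioo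
  obtain ⟨θ, hθ0, hθ⟩ := ENNReal.exists_nnreal_pos_mul_lt (a := Φ b)
    (ne_top_of_le_ne_top hcf (Φ.mono hbc.le)) hs
  set e : ℝ≥0 := min θ 1 * b
  have he0 : 0 < e := mul_pos (lt_min hθ0 one_pos) hb0
  have heb : e ≤ b := mul_le_of_le_one_left' (min_le_right _ _)
  have hes : Φ e ≤ s := by
    rw [ENNReal.coe_mul]
    refine (Φ.map_mul_le (min_le_right θ 1) b).trans (le_trans ?_ hθ.le)
    gcongr
    exact min_le_left _ _
  have hiv := intermediate_value_Icc (f := f) (a := (e : ℝ)) (b := b) (by exact_mod_cast heb)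
    (hcont.mono fun x hx => ⟨lt_of_lt_of_le (by exact_mod_cast he0) hx.1,
      lt_of_le_of_lt hx.2 (by exact_mod_cast hbc')⟩)
  have hfe : f e ≤ s.toReal := by
    simp only [hf, ENNReal.ofReal_coe_nnreal]
    exact ENNReal.toReal_mono hst hes
  have hfb : s.toReal ≤ f b := by
    simp only [hf, ENNReal.ofReal_coe_nnreal]
    exact ENNReal.toReal_mono (ne_top_of_le_ne_top hcf (Φ.mono hbc.le)) hsb.le
  obtain ⟨x, hx, hfx⟩ := hiv ⟨hfe, hfb⟩
  have hx0 : 0 < x := lt_of_lt_of_le (by exact_mod_cast he0) hx.1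
  have hxc : x < c := lt_of_le_of_lt hx.2 (by exact_mod_cast hbc')
  have hΦx : Φ (ENNReal.ofReal x) = s := by
    rw [← ENNReal.toReal_eq_toReal_iff' (hfin x hxc) hst]
    exact hfx
  refine ⟨ENNReal.ofReal x, ?_, ?_, hΦx⟩
  · by_contra! hle
    have hzero : ∀ y ∈ Set.Ioo 0 x, f y = 0 := by
      intro y hy
      have : ENNReal.ofReal y < Φ.zeroPoint :=
        lt_of_lt_of_le ((ENNReal.ofReal_lt_ofReal_iff hx0).mpr hy.2) hle
      obtain ⟨w, hw, hyw⟩ := lt_sSup_iff.mp this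
      have h0 : Φ (ENNReal.ofReal y) = 0 := le_antisymm ((Φ.mono hyw.le).trans_eq hw) zero_le
      simp [hf, h0]
    have h1 : Tendsto f (𝓝[<] x) (𝓝 (f x)) :=
      ((hcont x ⟨hx0, hxc⟩).continuousAt (Ioo_mem_nhds hx0 hxc)).mono_left nhdsWithin_le_nhds
    have h2 : Tendsto f (𝓝[<] x) (𝓝 0) := by
      refine tendsto_const_nhds.congr' ?_
      filter_upwards [Ioo_mem_nhdsLT hx0] with y hy
      exact (hzero y hy).symm
    have h3 := tendsto_nhds_unique h1 h2
    rw [hfx, ENNReal.toReal_eq_zero_iff] at h3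
    exact h3.elim hs hst
  · refine lt_of_le_of_lt ?_ hb
    exact ENNReal.ofReal_le_of_le_toReal (by simpa using hx.2)

/-- This is how the essential inverse enters the estimates: it majorizes the sublevel sets of Φ at
every level 0 < s < ∞. -/
theorem le_essInv (Φ : YoungFunction) {s t : ℝ≥0∞} (hs : s ≠ 0) (hst : s ≠ ∞) (h : Φ t ≤ s) :
    t ≤ Φ.essInv s := by
  unfold essInv
  rw [if_neg hs]
  split_ifs with h1
  · exact le_sSup (lt_of_le_of_lt h hst.lt_top)
  · push Not at h1
    obtain ⟨x, hx1, hx2, hx3⟩ := Φ.exists_map_eq hs h1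
    rcases le_total t x with htx | htx
    · exact htx.trans (le_sSup ⟨hx1, hx2, hx3⟩)
    · refine le_sSup ⟨hx1.trans_le htx, ?_, le_antisymm h (hx3 ▸ Φ.mono htx)⟩
      obtain ⟨b, hb, hsb⟩ : ∃ b, b < Φ.infinityPoint ∧ s < Φ b := by
        simpa [supValue, lt_iSup_iff] using h1
      refine lt_of_le_of_lt ?_ hb
      by_contra! hc
      exact absurd (Φ.mono hc.le) (not_le.mpr (h.trans_lt hsb))

end YoungFunction

/-! ### The pointwise product bound -/

/-- The pointwise estimate from which the convolution inequality for Orlicz sequence spaces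
follows. -/
def ProductBound (P κ : ℝ) (Φ₁ Φ₂ : YoungFunction) : Prop :=
  ∃ ρ : ℝ≥0, 0 < ρ ∧ ∃ C : ℝ≥0, ∀ x y : ℝ≥0∞, x ≤ ρ → y ≤ ρ →
    x * y ≤ C * (Φ₁ x ^ (1 / P) * Φ₂ y ^ κ + Φ₁ x ^ κ * Φ₂ y ^ (1 / P))

theorem ProductBound.symm {P κ : ℝ} {Φ₁ Φ₂ : YoungFunction} (h : ProductBound P κ Φ₁ Φ₂) :
    ProductBound P κ Φ₂ Φ₁ := by
  obtain ⟨ρ, h0, C, h⟩ := h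
  refine ⟨ρ, h0, C, fun x y hx hy => ?_⟩
  rw [mul_comm]
  refine (h y x hy hx).trans_eq ?_
  ring

theorem LeNearZero.exists_le_rpow {P : ℝ} (hP : 0 < P) {Φ : YoungFunction}
    (h : LeNearZero (fun t => t ^ P) Φ) :
    ∃ ρ : ℝ≥0, 0 < ρ ∧ ∃ C : ℝ≥0, ∀ x : ℝ≥0∞, x ≤ ρ → x ≤ C * Φ x ^ (1 / P) := by
  obtain ⟨r, hr, C, h⟩ := h
  obtain ⟨ρ, h0, hρ⟩ := ENNReal.lt_iff_exists_nnreal_btwn.mp (pos_iff_ne_zero.mpr hr)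
  refine ⟨ρ, by exact_mod_cast h0, C ^ (1 / P), fun x hx => ?_⟩
  have := ENNReal.rpow_le_rpow (h x (hx.trans hρ.le)) (one_div_pos.mpr hP).le
  rw [← ENNReal.rpow_mul, mul_one_div_cancel hP.ne', ENNReal.rpow_one,
    ENNReal.mul_rpow_of_nonneg _ _ (one_div_pos.mpr hP).le] at this
  rwa [← ENNReal.coe_rpow_of_nonneg _ (one_div_pos.mpr hP).le] at this

/-- One of the two summands is enough: x is absorbed by Φ₁(x)^{1/P} and y by Φ₂(y)^κ. For κ = 0 the
latter only says that y ≤ 1 near the origin. -/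
theorem productBound_of_le {P κ : ℝ} (hP : 0 < P) (hκ : 0 ≤ κ) {Φ₁ Φ₂ : YoungFunction}
    (h₁ : LeNearZero (fun t => t ^ P) Φ₁)
    (h₂ : κ ≠ 0 → LeNearZero (fun t => t ^ (1 / κ)) Φ₂) : ProductBound P κ Φ₁ Φ₂ := by
  obtain ⟨ρ₁, h01, C₁, h₁⟩ := h₁.exists_le_rpow hP
  obtain ⟨ρ₂, h02, C₂, h₂⟩ : ∃ ρ : ℝ≥0, 0 < ρ ∧ ∃ C : ℝ≥0, ∀ x : ℝ≥0∞, x ≤ ρ →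
      x ≤ C * Φ₂ x ^ κ := by
    rcases eq_or_ne κ 0 with rfl | h0
    · exact ⟨1, one_pos, 1, fun x hx => by simpa using hx⟩
    · simpa using (h₂ h0).exists_le_rpow (one_div_pos.mpr (lt_of_le_of_ne hκ h0.symm))
  refine ⟨min ρ₁ ρ₂, lt_min h01 h02, C₁ * C₂, fun x y hx hy => ?_⟩
  have e1 := h₁ x (hx.trans (by exact_mod_cast min_le_left _ _))
  have e2 := h₂ y (hy.trans (by exact_mod_cast min_le_right _ _))
  calc x * y ≤ (C₁ * Φ₁ x ^ (1 / P)) * (C₂ * Φ₂ y ^ κ) := by gcongr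
    _ = ((C₁ * C₂ : ℝ≥0) : ℝ≥0∞) * (Φ₁ x ^ (1 / P) * Φ₂ y ^ κ) := by push_cast; ring
    _ ≤ _ := by
        gcongr
        exact le_self_add

theorem IsSteered.cases {P : ℝ} {Φ : YoungFunction} (hP : 0 < P) (h : IsSteered P Φ) :
    LeNearZero (fun t => t ^ P) Φ ∨
      ∃ Φ₀ : YoungFunction, ∃ r : ℝ≥0∞, r ≠ 0 ∧ ∀ t ≤ r, Φ (t ^ (1 / P)) = Φ₀ t := by
  refine h.imp_left fun h => ?_
  obtain ⟨c, hc0, hc⟩ := exists_between h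
  have hev := eventually_lt_of_lt_liminf hc (by isBoundedDefault)
  rw [eventually_nhdsWithin_iff, ENNReal.nhds_zero_basis_Iic.eventually_iff] at hev
  obtain ⟨r, hr, hev⟩ := hev
  obtain ⟨k, hk0, hk⟩ := ENNReal.lt_iff_exists_nnreal_btwn.mp hc0
  have hk0' : k ≠ 0 := by
    rintro rfl
    simp at hk0
  refine ⟨min r 1, by simp [hr.ne'], k⁻¹, fun t ht => ?_⟩
  rcases eq_or_ne t 0 with rfl | ht0
  · simp [ENNReal.zero_rpow_of_pos hP]
  have htt : t ≠ ∞ := ne_top_of_le_ne_top ENNReal.one_ne_top (ht.trans (min_le_right _ _))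
  have h1 := (hk.trans (hev (ht.trans (min_le_left _ _)) (pos_iff_ne_zero.mpr ht0))).le
  rw [ENNReal.le_div_iff_mul_le (Or.inl (by simp [ht0, htt])) (Or.inl (by simp [ht0, htt]))] at h1
  rw [ENNReal.coe_inv hk0', mul_comm, ← div_eq_mul_inv,
    ENNReal.le_div_iff_mul_le (Or.inl (by exact_mod_cast hk0')) (Or.inl ENNReal.coe_ne_top), mul_comm]
  exact h1

/-- Put a = Φ₁(x). Convexity of t ↦ Φ₁(t^{1/P}) gives Φ₁((s/a)^{1/P} x) ≤ (s/a) a = s, so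
(s/a)^{1/P} x and y are both bounded by essential inverses at the same level s. The hypothesis on
their product then reads (s/a)^{1/P} xy ≤ C s^{1/P} s^κ, and s^{1/P} cancels. -/
theorem mul_le_of_essInv {P κ : ℝ} (hP : 0 < P) {Φ₁ Φ₂ Φ₀ : YoungFunction} {r r' : ℝ≥0∞} {C : ℝ≥0}
    (h₀ : ∀ t ≤ r, Φ₁ (t ^ (1 / P)) = Φ₀ t)
    (hC : ∀ s ≤ r', Φ₁.essInv s * Φ₂.essInv s ≤ C * s ^ (1 / P + κ))
    {x y s : ℝ≥0∞} (hx : x ^ P ≤ r) (hxf : Φ₁ x ≠ ∞) (hs : s ≠ 0) (hsr : s ≤ r')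
    (hys : Φ₂ y ≤ s) (hsx : s ≤ Φ₁ x) : x * y ≤ C * (Φ₁ x ^ (1 / P) * s ^ κ) := by
  have hP' : 0 < 1 / P := one_div_pos.mpr hP
  have hst : s ≠ ∞ := ne_top_of_le_ne_top hxf hsx
  have ha0 : Φ₁ x ≠ 0 := fun h => hs (le_antisymm (h ▸ hsx) zero_le)
  set a := Φ₁ x with ha
  have hsa : s / a ≤ 1 := ENNReal.div_le_of_le_mul (by simpa using hsx)
  have hxx : (x ^ P) ^ (1 / P) = x := by
    rw [← ENNReal.rpow_mul, mul_one_div_cancel hP.ne', ENNReal.rpow_one]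
  have hx' : Φ₁ ((s / a) ^ (1 / P) * x) ≤ s := by
    have e1 : (s / a) ^ (1 / P) * x = (s / a * x ^ P) ^ (1 / P) := by
      rw [ENNReal.mul_rpow_of_nonneg _ _ hP'.le, hxx]
    have hle : s / a * x ^ P ≤ x ^ P := mul_le_of_le_one_left' hsa
    rw [e1, h₀ _ (hle.trans hx)]
    have hf : s / a ≠ ∞ := (hsa.trans_lt ENNReal.one_lt_top).ne
    have e2 := Φ₀.map_mul_le (θ := (s / a).toNNReal)
      (by rw [← ENNReal.coe_le_coe, ENNReal.coe_toNNReal hf]; simpa using hsa) (x ^ P)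
    rw [ENNReal.coe_toNNReal hf, ← h₀ _ hx, hxx, ← ha] at e2
    exact e2.trans (ENNReal.div_mul_cancel ha0 hxf).le
  have k1 := Φ₁.le_essInv hs hst hx'
  have k2 := Φ₂.le_essInv hs hst hys
  have hpos : (s / a) ^ (1 / P) ≠ 0 := by
    simp only [ne_eq, ENNReal.rpow_eq_zero_iff_of_pos hP']
    exact ENNReal.div_ne_zero.mpr ⟨hs, hxf⟩
  have hfin : (s / a) ^ (1 / P) ≠ ∞ :=
    ENNReal.rpow_ne_top_of_nonneg hP'.le (hsa.trans_lt ENNReal.one_lt_top).ne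
  have key : (s / a) ^ (1 / P) * (x * y) ≤ (s / a) ^ (1 / P) * (C * (a ^ (1 / P) * s ^ κ)) := by
    calc (s / a) ^ (1 / P) * (x * y) = ((s / a) ^ (1 / P) * x) * y := by ring
      _ ≤ Φ₁.essInv s * Φ₂.essInv s := by gcongr
      _ ≤ C * s ^ (1 / P + κ) := hC s hsr
      _ = C * (s ^ (1 / P) * s ^ κ) := by rw [ENNReal.rpow_add _ _ hs hst]
      _ = C * ((s / a * a) ^ (1 / P) * s ^ κ) := by rw [ENNReal.div_mul_cancel ha0 hxf]
      _ = _ := by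
          rw [ENNReal.mul_rpow_of_nonneg _ _ hP'.le]
          ring
  exact (ENNReal.mul_le_mul_iff_right hpos hfin).mp key

theorem productBound_of_essInv {P κ : ℝ} (hP : 0 < P) (hκ : 0 ≤ κ)
    {Φ₁ Φ₂ Φ₀ Φ₀' : YoungFunction} {r r' : ℝ≥0∞} (hr : r ≠ 0) (hr' : r' ≠ 0)
    (h₁ : ∀ t ≤ r, Φ₁ (t ^ (1 / P)) = Φ₀ t) (h₂ : ∀ t ≤ r', Φ₂ (t ^ (1 / P)) = Φ₀' t)
    (h : LeNearZero (fun s => Φ₁.essInv s * Φ₂.essInv s) (fun s => s ^ (1 / P + κ))) :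
    ProductBound P κ Φ₁ Φ₂ := by
  obtain ⟨r₀, hr₀, C, hC⟩ := h
  have hP' : 0 < 1 / P := one_div_pos.mpr hP
  have hmin : min r₀ 1 ≠ 0 := by simp [hr₀]
  have hmin' : min r₀ 1 ≠ ∞ := ne_top_of_le_ne_top ENNReal.one_ne_top (min_le_right _ _)
  obtain ⟨ρ₁, h01, hρ₁⟩ := Φ₁.exists_pos_map_le hmin
  obtain ⟨ρ₂, h02, hρ₂⟩ := Φ₂.exists_pos_map_le hmin
  have small : ∀ r : ℝ≥0∞, r ≠ 0 → ∃ ρ : ℝ≥0, 0 < ρ ∧ (ρ : ℝ≥0∞) ^ P ≤ r := by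
    intro r hr
    obtain ⟨c, hc0, hc⟩ := ENNReal.lt_iff_exists_nnreal_btwn.mp (pos_iff_ne_zero.mpr hr)
    refine ⟨c ^ (1 / P), NNReal.rpow_pos (by exact_mod_cast hc0), ?_⟩
    rw [ENNReal.coe_rpow_of_nonneg _ hP'.le, ← ENNReal.rpow_mul, one_div_mul_cancel hP.ne',
      ENNReal.rpow_one]
    exact hc.le
  obtain ⟨ρ₃, h03, hρ₃⟩ := small r hr
  obtain ⟨ρ₄, h04, hρ₄⟩ := small r' hr'
  refine ⟨min (min ρ₁ ρ₂) (min ρ₃ ρ₄), lt_min (lt_min h01 h02) (lt_min h03 h04), C,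
    fun x y hx hy => ?_⟩
  have hx' : x ≤ ρ₁ ∧ x ≤ ρ₂ ∧ x ≤ ρ₃ ∧ x ≤ ρ₄ := by
    simpa [ENNReal.coe_min, and_assoc] using hx
  have hy' : y ≤ ρ₁ ∧ y ≤ ρ₂ ∧ y ≤ ρ₃ ∧ y ≤ ρ₄ := by
    simpa [ENNReal.coe_min, and_assoc] using hy
  have ha : Φ₁ x ≤ min r₀ 1 := (Φ₁.mono hx'.1).trans hρ₁
  have hb : Φ₂ y ≤ min r₀ 1 := (Φ₂.mono hy'.2.1).trans hρ₂
  have haf : Φ₁ x ≠ ∞ := ne_top_of_le_ne_top hmin' ha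
  have hbf : Φ₂ y ≠ ∞ := ne_top_of_le_ne_top hmin' hb
  have hxr : x ^ P ≤ r := (ENNReal.rpow_le_rpow hx'.2.2.1 hP.le).trans hρ₃
  have hyr : y ^ P ≤ r' := (ENNReal.rpow_le_rpow hy'.2.2.2 hP.le).trans hρ₄
  have hC' : ∀ s ≤ r₀, Φ₂.essInv s * Φ₁.essInv s ≤ C * s ^ (1 / P + κ) := fun s hs => by
    rw [mul_comm]
    exact hC s hs
  -- The smaller value b is the level wanted. If b = 0 it is reached as a limit s → 0, since
  -- essential inverses are useful only at positive levels; the limit is also correct for κ = 0,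
  -- where 0^κ = 1.
  have lim : ∀ a b : ℝ≥0∞, b ≤ a → a ≤ min r₀ 1 → (∀ s, s ≠ 0 → b ≤ s → s ≤ a →
      x * y ≤ C * (a ^ (1 / P) * s ^ κ)) → a ≠ 0 → x * y ≤ C * (a ^ (1 / P) * b ^ κ) := by
    intro a b hba har hs ha0
    rcases eq_or_ne b 0 with rfl | hb0
    · have hat : a ^ (1 / P) ≠ ∞ := ENNReal.rpow_ne_top_of_nonneg hP'.le
        (ne_top_of_le_ne_top hmin' har)
      have ht : Tendsto (fun s : ℝ≥0∞ => (C : ℝ≥0∞) * (a ^ (1 / P) * s ^ κ)) (𝓝[>] 0)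
          (𝓝 (C * (a ^ (1 / P) * 0 ^ κ))) := by
        refine Tendsto.mono_left ?_ nhdsWithin_le_nhds
        exact ENNReal.Tendsto.const_mul (ENNReal.Tendsto.const_mul
          (ENNReal.continuous_rpow_const.tendsto _) (Or.inr hat)) (Or.inr ENNReal.coe_ne_top)
      refine ge_of_tendsto ht ?_
      filter_upwards [Ioo_mem_nhdsGT (pos_iff_ne_zero.mpr ha0)] with s hs'
      exact hs s hs'.1.ne' zero_le hs'.2.le
    · exact hs b hb0 le_rfl hba
  -- If both values vanish, xy ≤ C s^{1/P+κ} for all small s > 0, so xy = 0.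
  by_cases h00 : Φ₁ x = 0 ∧ Φ₂ y = 0
  · have : x * y ≤ C * 0 ^ (1 / P + κ) := by
      have ht : Tendsto (fun s : ℝ≥0∞ => (C : ℝ≥0∞) * s ^ (1 / P + κ)) (𝓝[>] 0)
          (𝓝 (C * 0 ^ (1 / P + κ))) := by
        refine Tendsto.mono_left ?_ nhdsWithin_le_nhds
        exact ENNReal.Tendsto.const_mul
          (ENNReal.continuous_rpow_const.tendsto _) (Or.inr ENNReal.coe_ne_top)
      refine ge_of_tendsto ht ?_
      filter_upwards [Ioo_mem_nhdsGT (pos_iff_ne_zero.mpr hmin)] with s hs'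
      have hst : s ≠ ∞ := (hs'.2.trans_le le_top).ne
      refine le_trans ?_ (hC s (hs'.2.le.trans (min_le_left _ _)))
      exact mul_le_mul' (Φ₁.le_essInv hs'.1.ne' hst (by rw [h00.1]; exact zero_le))
        (Φ₂.le_essInv hs'.1.ne' hst (by rw [h00.2]; exact zero_le))
    rw [ENNReal.zero_rpow_of_pos (by positivity), mul_zero] at this
    exact this.trans zero_le
  rcases le_total (Φ₂ y) (Φ₁ x) with hle | hle
  · have ha0 : Φ₁ x ≠ 0 := fun h => h00 ⟨h, le_antisymm (h ▸ hle) zero_le⟩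
    refine (lim _ _ hle ha (fun s hs hbs hsa => ?_) ha0).trans
      (by gcongr; exact le_self_add)
    exact mul_le_of_essInv hP h₁ hC hxr haf hs
      (hsa.trans (ha.trans (min_le_left _ _))) hbs hsa
  · have hb0 : Φ₂ y ≠ 0 := fun h => h00 ⟨le_antisymm (h ▸ hle) zero_le, h⟩
    refine (lim _ _ hle hb (fun s hs hbs hsa => ?_) hb0).trans
      (by gcongr; rw [mul_comm (Φ₁ x ^ κ)]; exact le_add_self)
    rw [mul_comm x y]
    exact mul_le_of_essInv hP h₂ hC' hyr hbf hs
      (hsa.trans (hb.trans (min_le_left _ _))) hbs hsa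

/-- If one of the functions dominates t^P, the lower bound t^{1/κ} for the other one suffices; the
essential inverses are needed only when both Φ₁(t^{1/P}) and Φ₂(t^{1/P}) are Young functions near
the origin. -/
theorem productBound {P κ : ℝ} (hP : 0 < P) (hκ : 0 ≤ κ) {Φ₁ Φ₂ : YoungFunction}
    (hs₁ : IsSteered P Φ₁) (hs₂ : IsSteered P Φ₂)
    (h₁ : κ ≠ 0 → LeNearZero (fun t => t ^ (1 / κ)) Φ₁)
    (h₂ : κ ≠ 0 → LeNearZero (fun t => t ^ (1 / κ)) Φ₂)
    (h : LeNearZero (fun s => Φ₁.essInv s * Φ₂.essInv s) (fun s => s ^ (1 / P + κ))) :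
    ProductBound P κ Φ₁ Φ₂ := by
  rcases hs₁.cases hP with c₁ | ⟨Φ₀, r, hr, h0⟩
  · exact productBound_of_le hP hκ c₁ h₂
  rcases hs₂.cases hP with c₂ | ⟨Φ₀', r', hr', h0'⟩
  · exact (productBound_of_le hP hκ c₂ h₁).symm
  exact productBound_of_essInv hP hκ hr hr' h0 h0' h

/-! ### Convolution inequalities for Orlicz sequence spaces -/

section Discrete

set_option linter.unusedSectionVars false

variable {A B : Type*} [MeasurableSpace A] [MeasurableSingletonClass A] [Countable A]
  [MeasurableSpace B] [MeasurableSingletonClass B] [Countable B]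

theorem luxNorm_mul_le' {α : Type*} [MeasurableSpace α] {μ : Measure α} (Φ : YoungFunction)
    (u : α → ℝ≥0∞) {c : ℝ≥0∞} (hc : c ≠ ∞) :
    luxNorm Φ μ (fun x => c * u x) ≤ c * luxNorm Φ μ u := by
  lift c to ℝ≥0 using hc
  exact luxNorm_mul_le Φ μ u c

theorem luxNorm_mono {α : Type*} [MeasurableSpace α] {μ : Measure α} (Φ : YoungFunction)
    {u v : α → ℝ≥0∞} (h : ∀ x, u x ≤ v x) : luxNorm Φ μ u ≤ luxNorm Φ μ v :=
  luxNorm_mono_ae Φ (Eventually.of_forall h)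

theorem luxNorm_tsum_le {α : Type*} [MeasurableSpace α] [MeasurableSingletonClass α] [Countable α]
    (Φ : YoungFunction) (F : α → B → ℝ≥0∞) :
    luxNorm Φ .count (fun x => ∑' w, F x w) ≤ ∑' w, luxNorm Φ .count (fun x => F x w) := by
  have := luxNorm_lintegral_le (μ := Measure.count) Φ (Measure.count : Measure B)
    (F := fun z : α × B => F z.1 z.2) (Measurable.of_discrete)
  simpa only [lintegral_count] using this

/-- Each term of a sum of modulars that is at most 1 is itself at most 1, so ℓ^Φ embeds into ℓ^∞.
The constant depends on Φ alone and not on the index set. -/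
theorem YoungFunction.exists_apply_le (Φ : YoungFunction) :
    ∃ T : ℝ≥0, 0 < T ∧ ∀ {A : Type} [MeasurableSpace A] [MeasurableSingletonClass A]
      (u : A → ℝ≥0∞) (k : A), u k ≤ T * luxNorm Φ .count u := by
  obtain ⟨T, h0, hT⟩ := Φ.exists_le_of_map_le ENNReal.one_ne_top
  refine ⟨T, h0, fun {A} _ _ u k => ?_⟩
  have hT0 : (T : ℝ≥0∞) ≠ 0 := by exact_mod_cast h0.ne'
  rw [mul_comm, ← ENNReal.div_le_iff_le_mul (Or.inl hT0) (Or.inl ENNReal.coe_ne_top)]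
  refine le_of_forall_gt_imp_ge_of_dense fun l hl => ?_
  rcases eq_or_ne l ∞ with rfl | hlt
  · exact le_top
  have h1 := lintegral_le_one_of_luxNorm_lt Φ hl
  rw [lintegral_count] at h1
  have h2 := hT _ ((ENNReal.le_tsum k).trans h1)
  rw [ENNReal.div_le_iff_le_mul (Or.inl (zero_le.trans_lt hl).ne') (Or.inl hlt)] at h2
  rwa [ENNReal.div_le_iff_le_mul (Or.inl hT0) (Or.inl ENNReal.coe_ne_top), mul_comm]

/-- Here σ stands for 1/r, with the value 0 for r = ∞, where b^σ is the constant 1. -/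
theorem luxNorm_rpow_le_one {r : ℝ≥0∞} (hr : 1 ≤ r) {σ : ℝ}
    (hσ : (r = ∞ ∧ σ = 0) ∨ (r ≠ ∞ ∧ σ * r.toReal = 1)) {b : A → ℝ≥0∞} (hb : ∑' k, b k ≤ 1) :
    luxNorm (YoungFunction.pow r hr) .count (fun k => b k ^ σ) ≤ 1 := by
  refine luxNorm_le _ one_ne_zero ENNReal.one_ne_top ?_
  rw [lintegral_count]
  rcases hσ with ⟨rfl, rfl⟩ | ⟨h1, h2⟩
  · simp [YoungFunction.pow, powFun]
  · simpa [YoungFunction.pow, powFun, h1, ← ENNReal.rpow_mul, h2] using hb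

variable {Γ : Type} [MeasurableSpace Γ] [MeasurableSingletonClass Γ] [Countable Γ] [AddCommGroup Γ]

/-- Young's inequality for ℓ¹ and ℓ^r: the triangle inequality over k, and invariance of the norm
under translations and reflections. The second sum becomes the first with the roles exchanged after
the substitution j = k + ν. -/
theorem luxNorm_conv_le_one {r : ℝ≥0∞} (hr : 1 ≤ r) {σ : ℝ}
    (hσ : (r = ∞ ∧ σ = 0) ∨ (r ≠ ∞ ∧ σ * r.toReal = 1)) {a b : Γ → ℝ≥0∞}
    (ha : ∑' k, a k ≤ 1) (hb : ∑' k, b k ≤ 1) :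
    luxNorm (YoungFunction.pow r hr) .count (fun ν => ∑' k, b k * a (k + ν) ^ σ) ≤ 1 ∧
      luxNorm (YoungFunction.pow r hr) .count (fun ν => ∑' k, a (k + ν) * b k ^ σ) ≤ 1 := by
  have aux : ∀ (a b : Γ → ℝ≥0∞) (e : Γ → Γ ≃ Γ), ∑' k, a k ≤ 1 → ∑' k, b k ≤ 1 →
      luxNorm (YoungFunction.pow r hr) .count (fun ν => ∑' k, b k * a (e k ν) ^ σ) ≤ 1 := by
    intro a b e ha hb
    refine (luxNorm_tsum_le _ _).trans (le_trans (ENNReal.tsum_le_tsum fun k => ?_) hb)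
    have hbk : b k ≠ ∞ :=
      ne_top_of_le_ne_top ENNReal.one_ne_top ((ENNReal.le_tsum k).trans hb)
    refine (luxNorm_mul_le' _ _ hbk).trans (mul_le_of_le_one_right' ?_)
    exact luxNorm_rpow_le_one hr hσ (b := fun ν => a (e k ν))
      (((e k).tsum_eq a).trans_le ha)
  refine ⟨aux a b (fun k => Equiv.addLeft k) ha hb, ?_⟩
  convert aux b a (fun k => Equiv.subLeft k) hb ha using 3 with ν
  rw [← (Equiv.addRight ν).tsum_eq fun j => a j * b (Equiv.subLeft j ν) ^ σ]
  simp

/-- With a = Φ₁(τu/2) and b = Φ₂(τv/2), both of sum at most 1, the P-th power of the product bound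
is controlled by a b^{κP} + a^{κP} b. Since 1/r = κP, each part is a convolution of ℓ¹ with the unit
ball of ℓ^r. Norms strictly below 2 make the level 2 admissible in the modulars. -/
theorem ProductBound.exists_conv_le_of_lt {P κ : ℝ} (hP : 1 ≤ P) {Φ₁ Φ₂ : YoungFunction}
    (h : ProductBound P κ Φ₁ Φ₂) {r : ℝ≥0∞} (hr : 1 ≤ r)
    (hσ : (r = ∞ ∧ κ * P = 0) ∨ (r ≠ ∞ ∧ κ * P * r.toReal = 1)) :
    ∃ C : ℝ≥0, ∀ {Γ : Type} [MeasurableSpace Γ] [MeasurableSingletonClass Γ] [Countable Γ]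
      [AddCommGroup Γ] (u v : Γ → ℝ≥0∞), luxNorm Φ₁ .count u < 2 → luxNorm Φ₂ .count v < 2 →
      luxNorm (YoungFunction.pow r hr) .count (fun ν => ∑' k, (v k * u (k + ν)) ^ P) ≤ C := by
  obtain ⟨ρ, hρ, C, hC⟩ := h
  obtain ⟨T₁, h01, hT₁⟩ := Φ₁.exists_le_of_map_le ENNReal.one_ne_top
  obtain ⟨T₂, h02, hT₂⟩ := Φ₂.exists_le_of_map_le ENNReal.one_ne_top
  have hP0 : 0 < P := one_pos.trans_le hP
  -- Modulars at most 1 only give u/2 ≤ T₁ and v/2 ≤ T₂; the factor τ moves these values into the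
  -- range [0, ρ] of the product bound.
  obtain ⟨τ, hτ0, hτ1, hτT₁, hτT₂⟩ : ∃ τ : ℝ≥0, 0 < τ ∧ τ ≤ 1 ∧ τ * T₁ ≤ ρ ∧ τ * T₂ ≤ ρ := by
    refine ⟨min 1 (min (ρ / T₁) (ρ / T₂)), by positivity, min_le_left _ _, ?_, ?_⟩
    · rw [← le_div_iff₀ h01]
      exact (min_le_right _ _).trans (min_le_left _ _)
    · rw [← le_div_iff₀ h02]
      exact (min_le_right _ _).trans (min_le_right _ _)
  have hτ : (τ : ℝ≥0∞) ≠ 0 := by exact_mod_cast hτ0.ne'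
  have hk2 : (2 / τ : ℝ≥0∞) ≠ ∞ := ENNReal.div_ne_top (by simp) hτ
  have hDt : ((2 / τ * (2 / τ) * C : ℝ≥0∞) ^ P * 2 ^ (P - 1)) ≠ ∞ := by
    refine ENNReal.mul_ne_top (ENNReal.rpow_ne_top_of_nonneg hP0.le (by finiteness))
      (ENNReal.rpow_ne_top_of_nonneg (by linarith) (by simp))
  set D : ℝ≥0∞ := (2 / τ * (2 / τ) * C : ℝ≥0∞) ^ P * 2 ^ (P - 1) with hD
  refine ⟨(D * 2).toNNReal, fun {Γ} _ _ _ _ u v hu hv => ?_⟩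
  rw [ENNReal.coe_toNNReal (by finiteness)]
  have hu' := lintegral_le_one_of_luxNorm_lt Φ₁ hu
  have hv' := lintegral_le_one_of_luxNorm_lt Φ₂ hv
  rw [lintegral_count] at hu' hv'
  have norm : ∀ (Φ : YoungFunction) (T : ℝ≥0) (w : Γ → ℝ≥0∞), (∀ t, Φ t ≤ 1 → t ≤ T) →
      τ * T ≤ ρ → ∑' k, Φ (w k / 2) ≤ 1 → ∀ k, τ * (w k / 2) ≤ ρ := by
    intro Φ T w hT hτT hw k
    calc (τ : ℝ≥0∞) * (w k / 2) ≤ τ * T := by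
          gcongr
          exact hT _ ((ENNReal.le_tsum k).trans hw)
      _ ≤ ρ := by exact_mod_cast hτT
  have hle : ∀ (Φ : YoungFunction) (w : ℝ≥0∞), Φ (τ * (w / 2)) ≤ Φ (w / 2) := fun Φ w =>
    Φ.mono (mul_le_of_le_one_left' (by exact_mod_cast hτ1))
  set a : Γ → ℝ≥0∞ := fun k => Φ₁ (τ * (u k / 2)) with ha
  set b : Γ → ℝ≥0∞ := fun k => Φ₂ (τ * (v k / 2)) with hb
  have ha1 : ∑' k, a k ≤ 1 := (ENNReal.tsum_le_tsum fun k => hle Φ₁ _).trans hu'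
  have hb1 : ∑' k, b k ≤ 1 := (ENNReal.tsum_le_tsum fun k => hle Φ₂ _).trans hv'
  have hrec : ∀ w : ℝ≥0∞, w = 2 / τ * (τ * (w / 2)) := by
    intro w
    rw [← mul_assoc, ENNReal.div_mul_cancel hτ ENNReal.coe_ne_top,
      ENNReal.mul_div_cancel (by simp) (by simp)]
  have hpt : ∀ k ν, (v k * u (k + ν)) ^ P ≤
      D * (b k * a (k + ν) ^ (κ * P) + a (k + ν) * b k ^ (κ * P)) := by
    intro k ν
    have h1 := hC _ _ (norm Φ₁ T₁ u hT₁ hτT₁ hu' (k + ν)) (norm Φ₂ T₂ v hT₂ hτT₂ hv' k)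
    have h2 : v k * u (k + ν) ≤ (2 / τ * (2 / τ) * C) *
        (a (k + ν) ^ (1 / P) * b k ^ κ + a (k + ν) ^ κ * b k ^ (1 / P)) := by
      calc v k * u (k + ν) = (2 / τ * (2 / τ)) *
            ((τ * (u (k + ν) / 2)) * (τ * (v k / 2))) := by
            conv_lhs => rw [hrec (v k), hrec (u (k + ν))]
            ring
        _ ≤ (2 / τ * (2 / τ)) * (C * (a (k + ν) ^ (1 / P) * b k ^ κ +
            a (k + ν) ^ κ * b k ^ (1 / P))) := by gcongr
        _ = _ := by ring
    have e : ∀ x y : ℝ≥0∞, (x ^ (1 / P) * y ^ κ) ^ P = x * y ^ (κ * P) := by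
      intro x y
      rw [ENNReal.mul_rpow_of_nonneg _ _ hP0.le, ← ENNReal.rpow_mul, ← ENNReal.rpow_mul,
        one_div_mul_cancel hP0.ne', ENNReal.rpow_one]
    calc (v k * u (k + ν)) ^ P ≤ _ := ENNReal.rpow_le_rpow h2 hP0.le
      _ = (2 / τ * (2 / τ) * C : ℝ≥0∞) ^ P *
          (a (k + ν) ^ (1 / P) * b k ^ κ + a (k + ν) ^ κ * b k ^ (1 / P)) ^ P :=
          ENNReal.mul_rpow_of_nonneg _ _ hP0.le
      _ ≤ (2 / τ * (2 / τ) * C : ℝ≥0∞) ^ P * (2 ^ (P - 1) *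
          ((a (k + ν) ^ (1 / P) * b k ^ κ) ^ P + (a (k + ν) ^ κ * b k ^ (1 / P)) ^ P)) := by
          gcongr
          exact ENNReal.rpow_add_le_mul_rpow_add_rpow _ _ hP
      _ = _ := by
          rw [e, mul_comm (a (k + ν) ^ κ), e, hD]
          ring
  obtain ⟨k1, k2⟩ := luxNorm_conv_le_one hr hσ ha1 hb1
  calc luxNorm (YoungFunction.pow r hr) .count (fun ν => ∑' k, (v k * u (k + ν)) ^ P)
      ≤ luxNorm (YoungFunction.pow r hr) .count (fun ν => D *
        ((∑' k, b k * a (k + ν) ^ (κ * P)) + ∑' k, a (k + ν) * b k ^ (κ * P))) := by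
        refine luxNorm_mono _ fun ν => ?_
        rw [← ENNReal.tsum_add, ← ENNReal.tsum_mul_left]
        exact ENNReal.tsum_le_tsum fun k => hpt k ν
    _ ≤ D * luxNorm (YoungFunction.pow r hr) .count (fun ν =>
        ((∑' k, b k * a (k + ν) ^ (κ * P)) + ∑' k, a (k + ν) * b k ^ (κ * P))) :=
        luxNorm_mul_le' _ _ hDt
    _ ≤ D * (1 + 1) := by
        gcongr
        exact (luxNorm_add_le _ (Measurable.of_discrete).aemeasurable).trans (add_le_add k1 k2)
    _ = D * 2 := by norm_num

theorem ProductBound.exists_conv_le {P κ : ℝ} (hP : 1 ≤ P) {Φ₁ Φ₂ : YoungFunction}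
    (h : ProductBound P κ Φ₁ Φ₂) {r : ℝ≥0∞} (hr : 1 ≤ r)
    (hσ : (r = ∞ ∧ κ * P = 0) ∨ (r ≠ ∞ ∧ κ * P * r.toReal = 1)) :
    ∃ C : ℝ≥0, C ≠ 0 ∧ ∀ {Γ : Type} [MeasurableSpace Γ] [MeasurableSingletonClass Γ] [Countable Γ]
      [AddCommGroup Γ] (u v : Γ → ℝ≥0∞),
      luxNorm (YoungFunction.pow r hr) .count (fun ν => ∑' k, (v k * u (k + ν)) ^ P) ≤
        C * (luxNorm Φ₁ .count u * luxNorm Φ₂ .count v) ^ P := by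
  obtain ⟨C, hC⟩ := h.exists_conv_le_of_lt hP hr hσ
  obtain ⟨T₁, -, hT₁⟩ := Φ₁.exists_apply_le
  obtain ⟨T₂, -, hT₂⟩ := Φ₂.exists_apply_le
  have hP0 : 0 < P := one_pos.trans_le hP
  -- The constant is made nonzero so that the right-hand side is ∞ when a norm is infinite and the
  -- other one does not vanish.
  refine ⟨C + 1, by positivity, fun {Γ} _ _ _ _ u v => ?_⟩
  rcases eq_or_ne (luxNorm Φ₁ .count u) 0 with hu0 | hu0
  · have : ∀ k, u k = 0 := fun k => by simpa [hu0] using hT₁ u k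
    simp [this, ENNReal.zero_rpow_of_pos hP0, luxNorm_zero]
  rcases eq_or_ne (luxNorm Φ₂ .count v) 0 with hv0 | hv0
  · have : ∀ k, v k = 0 := fun k => by simpa [hv0] using hT₂ v k
    simp [this, ENNReal.zero_rpow_of_pos hP0, luxNorm_zero]
  rcases eq_or_ne (luxNorm Φ₁ .count u) ∞ with hut | hut
  · rw [hut, ENNReal.top_mul hv0, ENNReal.top_rpow_of_pos hP0, ENNReal.mul_top (by simp)]
    exact le_top
  rcases eq_or_ne (luxNorm Φ₂ .count v) ∞ with hvt | hvt
  · rw [hvt, ENNReal.mul_top hu0, ENNReal.top_rpow_of_pos hP0, ENNReal.mul_top (by simp)]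
    exact le_top
  set M := luxNorm Φ₁ .count u with hM
  set N := luxNorm Φ₂ .count v with hN
  have h1 : luxNorm Φ₁ .count (fun k => M⁻¹ * u k) < 2 := by
    refine (luxNorm_mul_le' _ _ (ENNReal.inv_ne_top.mpr hu0)).trans_lt ?_
    rw [← hM, ENNReal.inv_mul_cancel hu0 hut]
    exact ENNReal.one_lt_two
  have h2 : luxNorm Φ₂ .count (fun k => N⁻¹ * v k) < 2 := by
    refine (luxNorm_mul_le' _ _ (ENNReal.inv_ne_top.mpr hv0)).trans_lt ?_
    rw [← hN, ENNReal.inv_mul_cancel hv0 hvt]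
    exact ENNReal.one_lt_two
  have h3 := hC _ _ h1 h2
  have hMN : (M * N) ^ P ≠ ∞ := ENNReal.rpow_ne_top_of_nonneg hP0.le (by finiteness)
  have e : ∀ k ν, (v k * u (k + ν)) ^ P =
      (M * N) ^ P * (N⁻¹ * v k * (M⁻¹ * u (k + ν))) ^ P := by
    intro k ν
    rw [← ENNReal.mul_rpow_of_nonneg _ _ hP0.le]
    congr 1
    calc v k * u (k + ν) = (M * M⁻¹) * (N * N⁻¹) * (v k * u (k + ν)) := by
          rw [ENNReal.mul_inv_cancel hu0 hut, ENNReal.mul_inv_cancel hv0 hvt, one_mul, one_mul]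
      _ = _ := by ring
  simp only [e, ENNReal.tsum_mul_left]
  refine (luxNorm_mul_le' _ _ hMN).trans ?_
  rw [mul_comm]
  gcongr
  exact h3.trans (by push_cast; exact le_self_add)

/-- The mixed norm of a double sequence: `Φ` in the first index, then `Ψ` in the second. -/
def mixLux (Φ Ψ : YoungFunction) (F : A → B → ℝ≥0∞) : ℝ≥0∞ :=
  luxNorm Ψ .count fun b => luxNorm Φ .count fun a => F a b

/-- For fixed n and μ the inner sum is a convolution in the first index. The triangle inequality
moves the norm in ν inside the sum over n, and what remains is a convolution in the second index of
the Φ-norms. There the shifted factor is G instead of F, hence the symmetric form of the bound for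
Ψ₁, Ψ₂. -/
theorem exists_mixed_conv_le {P κ : ℝ} (hP : 1 ≤ P) {Φ₁ Φ₂ Ψ₁ Ψ₂ : YoungFunction}
    (hΦ : ProductBound P κ Φ₁ Φ₂) (hΨ : ProductBound P κ Ψ₁ Ψ₂) {r : ℝ≥0∞} (hr : 1 ≤ r)
    (hσ : (r = ∞ ∧ κ * P = 0) ∨ (r ≠ ∞ ∧ κ * P * r.toReal = 1)) :
    ∃ C : ℝ≥0, ∀ {Γ : Type} [MeasurableSpace Γ] [MeasurableSingletonClass Γ] [Countable Γ]
      [AddCommGroup Γ] (F G : Γ → Γ → ℝ≥0∞),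
      luxNorm (YoungFunction.pow r hr) .count (fun μ =>
        luxNorm (YoungFunction.pow r hr) .count (fun ν =>
          ∑' n, ∑' k, (G k (n + μ) * F (k + ν) n) ^ P)) ≤
        C * (mixLux Φ₁ Ψ₁ F * mixLux Φ₂ Ψ₂ G) ^ P := by
  obtain ⟨C₁, -, h₁⟩ := hΦ.exists_conv_le hP hr hσ
  obtain ⟨C₂, -, h₂⟩ := hΨ.symm.exists_conv_le hP hr hσ
  refine ⟨C₁ * C₂, fun {Γ} _ _ _ _ F G => ?_⟩
  calc _ ≤ luxNorm (YoungFunction.pow r hr) .count (fun μ => C₁ * ∑' n,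
        ((luxNorm Φ₁ .count fun l => F l n) * luxNorm Φ₂ .count fun k => G k (n + μ)) ^ P) := by
        refine luxNorm_mono _ fun μ => (luxNorm_tsum_le _ _).trans ?_
        rw [← ENNReal.tsum_mul_left]
        exact ENNReal.tsum_le_tsum fun n => h₁ (fun l => F l n) (fun k => G k (n + μ))
    _ ≤ C₁ * _ := luxNorm_mul_le' _ _ ENNReal.coe_ne_top
    _ ≤ C₁ * (C₂ * (mixLux Φ₂ Ψ₂ G * mixLux Φ₁ Ψ₁ F) ^ P) := by
        gcongr
        exact h₂ (fun m => luxNorm Φ₂ .count fun k => G k m) (fun n => luxNorm Φ₁ .count fun l => F l n)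
    _ = _ := by
        rw [mul_comm (mixLux Φ₂ Ψ₂ G)]
        push_cast
        ring

theorem eLpNorm_top_count (f : A → ℝ≥0∞) : eLpNorm f ∞ .count = ⨆ a, f a := by
  rw [eLpNorm_exponent_top, eLpNormEssSup]
  simp only [enorm_eq_self]
  refine le_antisymm (essSup_le_of_ae_le _ (Eventually.of_forall fun a => le_iSup f a))
    (iSup_le fun a => ?_)
  have h : ∀ᵐ a ∂(Measure.count : Measure A), f a ≤ essSup f .count := ae_le_essSup
  rw [ae_iff, Measure.count_eq_zero_iff] at h
  by_contra hc
  exact (Set.eq_empty_iff_forall_notMem.mp h) a hc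

theorem eLpNorm_rpow_count {r : ℝ≥0∞} (h0 : r ≠ 0) (ht : r ≠ ∞) (f : A → ℝ≥0∞) :
    eLpNorm f r .count ^ r.toReal = ∑' a, f a ^ r.toReal := by
  rw [eLpNorm_eq_lintegral_rpow_enorm_toReal h0 ht, ← ENNReal.rpow_mul,
    one_div_mul_cancel (ENNReal.toReal_pos h0 ht).ne', ENNReal.rpow_one, lintegral_count]
  simp

theorem eLpNorm_prod_le {r : ℝ≥0∞} (h0 : r ≠ 0) (f : A × B → ℝ≥0∞) :
    eLpNorm f r .count ≤
      eLpNorm (fun a => eLpNorm (fun b => f (a, b)) r .count) r .count := by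
  rcases eq_or_ne r ∞ with rfl | ht
  · simp only [eLpNorm_top_count]
    exact iSup_le fun z => (le_iSup (fun b => f (z.1, b)) z.2).trans
      (le_iSup (fun a => ⨆ b, f (a, b)) z.1)
  · rw [← ENNReal.rpow_le_rpow_iff (ENNReal.toReal_pos h0 ht), eLpNorm_rpow_count h0 ht,
      eLpNorm_rpow_count h0 ht, ENNReal.tsum_prod']
    simp only [eLpNorm_rpow_count h0 ht, le_refl]

theorem tsum_mul_le_eLpNorm (p q : ℝ≥0∞) [p.HolderConjugate q] (f g : A → ℝ≥0∞) :
    ∑' a, f a * g a ≤ eLpNorm f p .count * eLpNorm g q .count := by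
  have aux : ∀ f g : A → ℝ≥0∞, ∑' a, f a * g a ≤ eLpNorm f ∞ .count * eLpNorm g 1 .count := by
    intro f g
    rw [eLpNorm_top_count, eLpNorm_one_eq_lintegral_enorm, lintegral_count, ← ENNReal.tsum_mul_left]
    refine ENNReal.tsum_le_tsum fun a => ?_
    rw [enorm_eq_self]
    gcongr
    exact le_iSup f a
  have hinv := ENNReal.HolderConjugate.inv_add_inv_eq_one p q
  rcases eq_or_ne p ∞ with rfl | hp
  · have : q = 1 := by simpa using hinv
    subst this
    exact aux f g
  rcases eq_or_ne q ∞ with rfl | hq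
  · have : p = 1 := by simpa using hinv
    subst this
    simp only [mul_comm (f _), mul_comm (eLpNorm f _ _)]
    exact aux g f
  have hp0 : p ≠ 0 := fun h => by simp [h] at hinv
  have hq0 : q ≠ 0 := fun h => by simp [h] at hinv
  have hconj : p.toReal.HolderConjugate q.toReal := by
    rw [Real.holderConjugate_iff]
    have h2 := congrArg ENNReal.toReal hinv
    rw [ENNReal.toReal_add (by simp [hp0]) (by simp [hq0]), ENNReal.toReal_inv,
      ENNReal.toReal_inv, ENNReal.toReal_one] at h2
    refine ⟨?_, h2⟩
    have h3 : 0 < (q.toReal)⁻¹ := inv_pos.mpr (ENNReal.toReal_pos hq0 hq)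
    have h4 : 0 < p.toReal := ENNReal.toReal_pos hp0 hp
    have h5 : (p.toReal)⁻¹ < 1 := by linarith
    exact (inv_lt_one₀ h4).mp h5
  have := ENNReal.lintegral_mul_le_Lp_mul_Lq (Measure.count : Measure A) hconj
    (f := f) (g := g) (Measurable.of_discrete).aemeasurable (Measurable.of_discrete).aemeasurable
  rw [eLpNorm_eq_lintegral_rpow_enorm_toReal hp0 hp, eLpNorm_eq_lintegral_rpow_enorm_toReal hq0 hq]
  simpa [lintegral_count] using this

end Discrete

/-! ### The trilinear estimate and duality of Orlicz sequence spaces -/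

section Core

set_option linter.unusedSectionVars false

/-- Hölder's inequality in X with p, P and in Y with q, q' leaves the ℓ^{q'}-norm of J^{1/P}. This
is a power of the ℓ^{q'/P}-norm of J, and J is the mixed convolution of the P-th powers of F and G.
-/
theorem exists_tsum_trilinear_le {P : ℝ} (hP : 1 ≤ P) {κ : ℝ} (hκ : 0 ≤ κ) (hκP : κ ≤ 1 / P)
    {p q p' q' : ℝ≥0∞} [p.HolderConjugate p'] [q.HolderConjugate q']
    (hp' : p' = ENNReal.ofReal P) (hq' : q'⁻¹ = ENNReal.ofReal κ)
    {Φ₁ Φ₂ Ψ₁ Ψ₂ : YoungFunction}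
    (hΦ : ProductBound P κ Φ₁ Φ₂) (hΨ : ProductBound P κ Ψ₁ Ψ₂) :
    ∃ C : ℝ≥0, ∀ {Γ : Type} [MeasurableSpace Γ] [MeasurableSingletonClass Γ] [Countable Γ]
      [AddCommGroup Γ] (F G : Γ → Γ → ℝ≥0∞) (H : Γ × Γ → Γ × Γ → ℝ≥0∞),
      ∑' Y : Γ × Γ, ∑' X : Γ × Γ, H X Y * (G X.1 (X.2 + Y.1) * F (X.1 + Y.2) X.2) ≤
        C * eLpNorm (fun Y => eLpNorm (fun X => H X Y) p .count) q .count *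
          (mixLux Φ₁ Ψ₁ F * mixLux Φ₂ Ψ₂ G) := by
  have hP0 : 0 < P := one_pos.trans_le hP
  have hP'0 : 0 < 1 / P := one_div_pos.mpr hP0
  -- r = q'/P, so that 1/r = κP; the condition κ ≤ 1/P, which expresses q ≤ p, is what gives r ≥ 1.
  set r : ℝ≥0∞ := q' * ENNReal.ofReal (1 / P) with hr
  have hrinv : r⁻¹ = ENNReal.ofReal (κ * P) := by
    rw [hr, ENNReal.mul_inv (Or.inr ENNReal.ofReal_ne_top)
      (Or.inr (by simpa using hP0)), hq', ENNReal.ofReal_mul hκ, one_div,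
      ENNReal.ofReal_inv_of_pos hP0, inv_inv]
  have hκP' : κ * P ≤ 1 := by rwa [← le_div_iff₀ hP0]
  have hr1 : 1 ≤ r := by
    rw [← ENNReal.inv_le_one, hrinv, ENNReal.ofReal_le_one]
    exact hκP'
  have hσ : (r = ∞ ∧ κ * P = 0) ∨ (r ≠ ∞ ∧ κ * P * r.toReal = 1) := by
    rcases eq_or_ne r ∞ with h | h
    · refine Or.inl ⟨h, ?_⟩
      rw [h, ENNReal.inv_top, eq_comm, ENNReal.ofReal_eq_zero] at hrinv
      exact le_antisymm hrinv (by positivity)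
    · refine Or.inr ⟨h, ?_⟩
      have h2 := congrArg ENNReal.toReal hrinv
      rw [ENNReal.toReal_inv, ENNReal.toReal_ofReal (by positivity)] at h2
      rw [← h2]
      exact inv_mul_cancel₀ (ENNReal.toReal_pos (zero_lt_one.trans_le hr1).ne' h).ne'
  obtain ⟨C, hC⟩ := exists_mixed_conv_le hP hΦ hΨ hr1 hσ
  refine ⟨C ^ (1 / P), fun {Γ} _ _ _ _ F G H => ?_⟩
  set J : Γ × Γ → ℝ≥0∞ := fun Y => ∑' X : Γ × Γ, (G X.1 (X.2 + Y.1) * F (X.1 + Y.2) X.2) ^ P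
    with hJ
  have hpt : ∀ Y : Γ × Γ, ∑' X : Γ × Γ, H X Y * (G X.1 (X.2 + Y.1) * F (X.1 + Y.2) X.2) ≤
      eLpNorm (fun X => H X Y) p .count * J Y ^ (1 / P) := by
    intro Y
    refine (tsum_mul_le_eLpNorm p p' _ _).trans_eq ?_
    congr 1
    rw [eLpNorm_eq_lintegral_rpow_enorm_toReal (by rw [hp']; simpa using hP0)
      (by rw [hp']; exact ENNReal.ofReal_ne_top), lintegral_count]
    simp [hp', hP0.le, hJ]
  have hpow : eLpNorm (fun Y => J Y ^ (1 / P)) q' .count = eLpNorm J r .count ^ (1 / P) := by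
    have := eLpNorm_enorm_rpow (μ := (Measure.count : Measure (Γ × Γ))) (p := q') J hP'0
    simp only [enorm_eq_self] at this
    exact this
  have hJle : eLpNorm J r .count ≤ C * (mixLux Φ₁ Ψ₁ F * mixLux Φ₂ Ψ₂ G) ^ P := by
    refine (eLpNorm_prod_le (zero_lt_one.trans_le hr1).ne' J).trans (le_trans (le_of_eq ?_) (hC F G))
    rw [luxNorm_pow hr1 (Measurable.of_discrete).aemeasurable]
    congr 1
    ext μ
    rw [luxNorm_pow hr1 (Measurable.of_discrete).aemeasurable]
    congr 1
    ext ν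
    simp only [hJ]
    rw [ENNReal.tsum_prod', ENNReal.tsum_comm]
  calc _ ≤ ∑' Y : Γ × Γ, eLpNorm (fun X => H X Y) p .count * J Y ^ (1 / P) :=
        ENNReal.tsum_le_tsum hpt
    _ ≤ _ := tsum_mul_le_eLpNorm q q' _ _
    _ ≤ eLpNorm (fun Y => eLpNorm (fun X => H X Y) p .count) q .count *
        (C * (mixLux Φ₁ Ψ₁ F * mixLux Φ₂ Ψ₂ G) ^ P) ^ (1 / P) := by
        rw [hpow]
        gcongr
    _ = _ := by
        rw [ENNReal.mul_rpow_of_nonneg _ _ hP'0.le, ← ENNReal.rpow_mul,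
          mul_one_div_cancel hP0.ne', ENNReal.rpow_one, ENNReal.coe_rpow_of_nonneg _ hP'0.le]
        ring

variable {p q : ℝ≥0∞} {Φ₁ Φ₂ Ψ₁ Ψ₂ : YoungFunction}

theorem exists_apply_le_mixLux (Φ Ψ : YoungFunction) :
    ∃ T : ℝ≥0, 0 < T ∧ ∀ {A : Type} [MeasurableSpace A] [MeasurableSingletonClass A]
      (F : A → A → ℝ≥0∞) (a b : A), F a b ≤ T * mixLux Φ Ψ F := by
  obtain ⟨T₁, h₁, hT₁⟩ := Φ.exists_apply_le
  obtain ⟨T₂, h₂, hT₂⟩ := Ψ.exists_apply_le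
  refine ⟨T₁ * T₂, mul_pos h₁ h₂, fun {A} _ _ F a b => ?_⟩
  calc F a b ≤ T₁ * luxNorm Φ .count fun a => F a b := hT₁ (fun a => F a b) a
    _ ≤ T₁ * (T₂ * mixLux Φ Ψ F) := by
        gcongr
        exact hT₂ (fun b => luxNorm Φ .count fun a => F a b) b
    _ = _ := by
        push_cast
        ring

/-- If p = 1 then q = 1, and it suffices that F and G are bounded by their norms; no condition on
the Young functions is needed. If p > 1 then p' is finite, and the previous estimate applies with P
= p' and κ = 1/q'. -/
theorem exists_trilinear_le (hq : 1 ≤ q) (hqp : q ≤ p)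
    (hp : 1 < p →
      (IsSteered (ENNReal.conjExponent p).toReal Φ₁ ∧
        IsSteered (ENNReal.conjExponent p).toReal Φ₂ ∧
        IsSteered (ENNReal.conjExponent p).toReal Ψ₁ ∧
        IsSteered (ENNReal.conjExponent p).toReal Ψ₂) ∧
      (LeNearZero (powFun (ENNReal.conjExponent q)) Φ₁ ∧
        LeNearZero (powFun (ENNReal.conjExponent q)) Φ₂ ∧
        LeNearZero (powFun (ENNReal.conjExponent q)) Ψ₁ ∧
        LeNearZero (powFun (ENNReal.conjExponent q)) Ψ₂) ∧
      LeNearZero (fun s => Φ₁.essInv s * Φ₂.essInv s)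
        (fun s => s ^ ((ENNReal.conjExponent p)⁻¹ + (ENNReal.conjExponent q)⁻¹).toReal) ∧
      LeNearZero (fun s => Ψ₁.essInv s * Ψ₂.essInv s)
        (fun s => s ^ ((ENNReal.conjExponent p)⁻¹ + (ENNReal.conjExponent q)⁻¹).toReal)) :
    ∃ C : ℝ≥0, ∀ {Γ : Type} [MeasurableSpace Γ] [MeasurableSingletonClass Γ] [Countable Γ]
      [AddCommGroup Γ] (F G : Γ → Γ → ℝ≥0∞) (H : Γ × Γ → Γ × Γ → ℝ≥0∞),
      ∑' Y : Γ × Γ, ∑' X : Γ × Γ, H X Y * (G X.1 (X.2 + Y.1) * F (X.1 + Y.2) X.2) ≤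
        C * eLpNorm (fun Y => eLpNorm (fun X => H X Y) p .count) q .count *
          (mixLux Φ₁ Ψ₁ F * mixLux Φ₂ Ψ₂ G) := by
  rcases (hq.trans hqp).eq_or_lt with rfl | h1
  · obtain rfl : q = 1 := le_antisymm hqp hq
    obtain ⟨T₁, -, hT₁⟩ := exists_apply_le_mixLux Φ₁ Ψ₁
    obtain ⟨T₂, -, hT₂⟩ := exists_apply_le_mixLux Φ₂ Ψ₂
    refine ⟨T₁ * T₂, fun {Γ} _ _ _ _ F G H => ?_⟩
    simp only [eLpNorm_one_eq_lintegral_enorm, enorm_eq_self, lintegral_count]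
    rw [mul_assoc, mul_comm, mul_assoc, ← ENNReal.tsum_mul_right]
    refine ENNReal.tsum_le_tsum fun Y => ?_
    rw [← ENNReal.tsum_mul_right]
    refine ENNReal.tsum_le_tsum fun X => ?_
    refine mul_le_mul' le_rfl ((mul_le_mul' (hT₂ G X.1 (X.2 + Y.1)) (hT₁ F (X.1 + Y.2) X.2)).trans_eq ?_)
    push_cast
    ring
  obtain ⟨⟨s1, s2, s3, s4⟩, ⟨l1, l2, l3, l4⟩, e1, e2⟩ := hp h1
  have : p.HolderConjugate p.conjExponent := .conjExponent h1.le
  have : q.HolderConjugate q.conjExponent := .conjExponent hq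
  have hpi := ENNReal.HolderConjugate.inv_add_inv_eq_one p p.conjExponent
  have hqi := ENNReal.HolderConjugate.inv_add_inv_eq_one q q.conjExponent
  set p' := p.conjExponent with hp'
  set q' := q.conjExponent with hq'
  have hp't : p' ≠ ∞ := by
    intro h
    rw [h, ENNReal.inv_top, add_zero, ENNReal.inv_eq_one] at hpi
    exact h1.ne' hpi
  have hp'1 : 1 ≤ p' := by
    rw [← ENNReal.inv_le_one, ← hpi]
    exact le_add_self
  have hq'1 : 1 ≤ q' := by
    rw [← ENNReal.inv_le_one, ← hqi]
    exact le_add_self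
  have hpq : q'⁻¹ ≤ p'⁻¹ := by
    have hpf : p⁻¹ ≠ ∞ := ENNReal.inv_ne_top.mpr (zero_lt_one.trans h1).ne'
    have hle : p⁻¹ ≤ q⁻¹ := ENNReal.inv_le_inv.mpr hqp
    have : p⁻¹ + q'⁻¹ ≤ p⁻¹ + p'⁻¹ := by
      rw [hpi, ← hqi]
      gcongr
    exact (ENNReal.add_le_add_iff_left hpf).mp this
  have hP : 1 ≤ p'.toReal := by
    rw [← ENNReal.ofReal_le_iff_le_toReal hp't]
    simpa using hp'1
  have hq'f : q'⁻¹ ≠ ∞ := ENNReal.inv_ne_top.mpr (zero_lt_one.trans_le hq'1).ne'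
  have hp'f : p'⁻¹ ≠ ∞ := ENNReal.inv_ne_top.mpr (zero_lt_one.trans_le hp'1).ne'
  have hexp : (p'⁻¹ + q'⁻¹).toReal = 1 / p'.toReal + (q'⁻¹).toReal := by
    rw [ENNReal.toReal_add hp'f hq'f, ENNReal.toReal_inv, one_div]
  rw [hexp] at e1 e2
  have conv : ∀ {Φ : YoungFunction}, LeNearZero (powFun q') Φ → (q'⁻¹).toReal ≠ 0 →
      LeNearZero (fun t => t ^ (1 / (q'⁻¹).toReal)) Φ := by
    intro Φ hl h0
    have hq't : q' ≠ ∞ := by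
      rintro h
      simp [h] at h0
    have : powFun q' = fun t => t ^ (1 / (q'⁻¹).toReal) := by
      ext t
      simp [powFun, hq't, ENNReal.toReal_inv]
    rwa [this] at hl
  refine exists_tsum_trilinear_le (p' := p') (q' := q') hP ENNReal.toReal_nonneg ?_
    (ENNReal.ofReal_toReal hp't).symm (ENNReal.ofReal_toReal hq'f).symm
    (productBound (by linarith) ENNReal.toReal_nonneg s1 s2 (conv l1) (conv l2) e1)
    (productBound (by linarith) ENNReal.toReal_nonneg s3 s4 (conv l3) (conv l4) e2)
  rw [one_div, ← ENNReal.toReal_inv]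
  exact ENNReal.toReal_mono hp'f hpq

/-! ### Duality -/

variable {A : Type*} [MeasurableSpace A] [MeasurableSingletonClass A]

theorem conj_apply_of_ne_top (Φ : YoungFunction) {t : ℝ≥0∞} (ht : t ≠ ∞) :
    Φ.conj t = ⨆ s : ℝ≥0, ((s : ℝ≥0∞) * t - Φ s) := by
  change Φ.conjFun t = _
  rw [YoungFunction.conjFun, if_neg ht]

/-- Allows the competitors in finitely many suprema to be chosen independently, without
ε-approximation. -/
theorem finset_sum_iSup_eq {A B : Type*} (s : Finset A) (h : A → B → ℝ≥0∞) :
    ∑ a ∈ s, ⨆ b, h a b = ⨆ φ : A → B, ∑ a ∈ s, h a (φ a) := by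
  classical
  rcases isEmpty_or_nonempty B with hB | hB
  · rcases s.eq_empty_or_nonempty with rfl | ⟨a, ha⟩
    · simp
    · have : IsEmpty (A → B) := ⟨fun f => hB.elim (f a)⟩
      simp
  rw [← ENNReal.finsetSum_iSup (f := fun a (φ : A → B) => h a (φ a))]
  · refine Finset.sum_congr rfl fun a _ => le_antisymm (iSup_le fun b => ?_) (iSup_le fun φ => ?_)
    · exact le_iSup (fun φ : A → B => h a (φ a)) (fun _ => b)
    · exact le_iSup (h a) (φ a)
  · intro φ ψ
    refine ⟨fun a => if h a (φ a) ≤ h a (ψ a) then ψ a else φ a, fun a => ?_⟩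
    dsimp only
    split_ifs with hc
    · exact ⟨hc, le_rfl⟩
    · exact ⟨le_rfl, (not_le.mp hc).le⟩

/-- Choose a competitor φ(a) in each supremum defining Φ*(U(a)/L), let S be the sum of the Φ(φ(a))
and c = max(1, S). Convexity makes φ/c an admissible test function, so Σ φ U/L ≤ c ≤ 1 + S, and
subtracting S leaves the modular bound 1. No constant is lost. -/
theorem luxNorm_conj_le (Φ : YoungFunction) (U : A → ℝ≥0∞) {K : ℝ≥0∞}
    (h : ∀ g : A → ℝ≥0∞, ∑' a, Φ (g a) ≤ 1 → ∑' a, U a * g a ≤ K) :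
    luxNorm Φ.conj .count U ≤ K := by
  classical
  refine le_of_forall_gt_imp_ge_of_dense fun L hL => ?_
  rcases eq_or_ne L ∞ with rfl | hLt
  · exact le_top
  have hL0 : L ≠ 0 := (zero_le.trans_lt hL).ne'
  have hKt : K ≠ ∞ := (hL.trans_le le_top).ne
  -- Testing with a point mass of height t, where Φ(t) ≤ 1, shows that U is finite; the supremum
  -- formula for the conjugate holds only at finite arguments.
  have hUt : ∀ a, U a ≠ ∞ := by
    intro a ha
    obtain ⟨t, ht0, ht⟩ := Φ.exists_pos_map_le one_ne_zero
    have := h (Pi.single a t) (by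
      rw [tsum_eq_single a fun b hb => by simp [Pi.single_eq_of_ne hb, Φ.map_zero']]
      simpa using ht)
    have h2 := (ENNReal.le_tsum a).trans this
    rw [Pi.single_eq_same, ha, ENNReal.top_mul (by exact_mod_cast ht0.ne')] at h2
    exact hKt (top_le_iff.mp h2)
  refine luxNorm_le _ hL0 hLt ?_
  rw [lintegral_count, ENNReal.tsum_eq_iSup_sum]
  refine iSup_le fun s => ?_
  have hxt : ∀ a, U a / L ≠ ∞ := fun a => ENNReal.div_ne_top (hUt a) hL0
  simp only [conj_apply_of_ne_top Φ (hxt _)]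
  rw [finset_sum_iSup_eq]
  refine iSup_le fun φ => ?_
  -- Subtraction truncates at 0. Keeping only the terms where it is genuine makes S finite, so that
  -- S can be cancelled at the end.
  set s' := s.filter fun a => Φ (φ a) ≤ φ a * (U a / L) with hs'
  have hss : ∑ a ∈ s, ((φ a : ℝ≥0∞) * (U a / L) - Φ (φ a)) =
      ∑ a ∈ s', ((φ a : ℝ≥0∞) * (U a / L) - Φ (φ a)) := by
    rw [hs', Finset.sum_filter]
    refine Finset.sum_congr rfl fun a _ => ?_
    split_ifs with hc
    · rfl
    · exact tsub_eq_zero_of_le (not_le.mp hc).le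
  rw [hss]
  have hle : ∀ a ∈ s', Φ (φ a) ≤ φ a * (U a / L) := fun a ha => (Finset.mem_filter.mp ha).2
  have hΦf : ∀ a ∈ s', Φ (φ a) ≠ ∞ := fun a ha =>
    ne_top_of_le_ne_top (ENNReal.mul_ne_top ENNReal.coe_ne_top (hxt a)) (hle a ha)
  set S := ∑ a ∈ s', Φ (φ a) with hS
  have hSf : S ≠ ∞ := ENNReal.sum_ne_top.mpr hΦf
  set c : ℝ≥0∞ := max 1 S with hc
  have hc1 : 1 ≤ c := le_max_left _ _
  have hct : c ≠ ∞ := by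
    rw [hc]
    exact (max_lt ENNReal.one_lt_top hSf.lt_top).ne
  have hc0 : c ≠ 0 := (zero_lt_one.trans_le hc1).ne'
  have hcinv : c⁻¹ ≠ ∞ := ENNReal.inv_ne_top.mpr hc0
  set g : A → ℝ≥0∞ := fun a => if a ∈ s' then c⁻¹ * φ a else 0 with hg
  have hgΦ : ∑' a, Φ (g a) ≤ 1 := by
    rw [tsum_eq_sum (s := s') fun a ha => by simp [hg, ha, Φ.map_zero']]
    calc ∑ a ∈ s', Φ (g a) ≤ ∑ a ∈ s', c⁻¹ * Φ (φ a) := by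
          refine Finset.sum_le_sum fun a ha => ?_
          simp only [hg, ha, if_true]
          have := Φ.map_mul_le (θ := c⁻¹.toNNReal) (by
            rw [← ENNReal.coe_le_coe, ENNReal.coe_toNNReal hcinv]
            simpa using hc1) (φ a)
          rwa [ENNReal.coe_toNNReal hcinv] at this
      _ = c⁻¹ * S := by rw [← Finset.mul_sum]
      _ ≤ c⁻¹ * c := by
          gcongr
          exact le_max_right _ _
      _ = 1 := ENNReal.inv_mul_cancel hc0 hct
  have hsum := h g hgΦ
  rw [tsum_eq_sum (s := s') fun a ha => by simp [hg, ha]] at hsum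
  have hmain : ∑ a ∈ s', (φ a : ℝ≥0∞) * (U a / L) ≤ 1 + S := by
    have e : ∑ a ∈ s', (φ a : ℝ≥0∞) * (U a / L) = c * L⁻¹ * ∑ a ∈ s', U a * g a := by
      rw [Finset.mul_sum]
      refine Finset.sum_congr rfl fun a ha => ?_
      simp only [hg, ha, if_true]
      calc (φ a : ℝ≥0∞) * (U a / L) = (c * c⁻¹) * (φ a * (U a / L)) := by
            rw [ENNReal.mul_inv_cancel hc0 hct, one_mul]
        _ = _ := by
            rw [div_eq_mul_inv]
            ring
    rw [e]
    calc c * L⁻¹ * ∑ a ∈ s', U a * g a ≤ c * L⁻¹ * L := by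
          gcongr
          exact hsum.trans hL.le
      _ = c := by rw [mul_assoc, ENNReal.inv_mul_cancel hL0 hLt, mul_one]
      _ ≤ 1 + S := max_le le_self_add le_add_self
  refine (ENNReal.add_le_add_iff_right hSf).mp (le_trans (le_of_eq ?_) hmain)
  rw [hS, ← Finset.sum_add_distrib]
  exact Finset.sum_congr rfl fun a ha => tsub_add_cancel_of_le (hle a ha)

/-- The one-variable statement is used in each variable. Only finitely many b matter at a time, so
inner test functions g_b can be chosen for each of them, and γ(b) g_b(a) is admissible for the mixed
norm by homogeneity. -/
theorem mixLux_conj_le {B : Type*} [MeasurableSpace B] [MeasurableSingletonClass B]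
    (Φ Ψ : YoungFunction) (U : A → B → ℝ≥0∞) {K : ℝ≥0∞}
    (h : ∀ G : A → B → ℝ≥0∞, mixLux Φ Ψ G ≤ 1 → ∑' b, ∑' a, U a b * G a b ≤ K) :
    mixLux Φ.conj Ψ.conj U ≤ K := by
  classical
  set D := {g : A → ℝ≥0∞ // ∑' a, Φ (g a) ≤ 1}
  set O : B → ℝ≥0∞ := fun b => ⨆ g : D, ∑' a, U a b * g.1 a with hO
  have hN : ∀ b, luxNorm Φ.conj .count (fun a => U a b) ≤ O b := fun b =>
    luxNorm_conj_le Φ _ fun g hg => le_iSup (fun g : D => ∑' a, U a b * g.1 a) ⟨g, hg⟩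
  refine luxNorm_conj_le Ψ _ fun γ hγ => ?_
  refine (ENNReal.tsum_le_tsum fun b => mul_le_mul_left (hN b) (γ b)).trans ?_
  rw [ENNReal.tsum_eq_iSup_sum]
  refine iSup_le fun s => ?_
  simp only [hO, ENNReal.iSup_mul]
  rw [finset_sum_iSup_eq]
  refine iSup_le fun φ => ?_
  refine le_trans ?_ (h (fun a b => γ b * (φ b).1 a) ?_)
  · refine (ENNReal.sum_le_tsum s).trans (ENNReal.tsum_le_tsum fun b => ?_)
    rw [← ENNReal.tsum_mul_right]
    refine ENNReal.tsum_le_tsum fun a => le_of_eq ?_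
    ring
  · have hγt : ∀ b, γ b ≠ ∞ := by
      intro b hb
      have := (ENNReal.le_tsum b).trans hγ
      rw [hb, Ψ.map_top'] at this
      simp at this
    have h1 : ∀ b, luxNorm Φ .count (fun a => γ b * (φ b).1 a) ≤ γ b := fun b =>
      (luxNorm_mul_le' _ _ (hγt b)).trans (mul_le_of_le_one_right' (luxNorm_le _ one_ne_zero
        ENNReal.one_ne_top (by simpa [lintegral_count] using (φ b).2)))
    refine (luxNorm_mono Ψ h1).trans (luxNorm_le _ one_ne_zero ENNReal.one_ne_top ?_)
    simpa [lintegral_count] using hγ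

end Core

/-! ### Gelfand–Shilov seminorms: products, translations, modulations -/

section Bounds

theorem sqrt_factorial_two_mul_le (k : ℕ) :
    Real.sqrt ((2 * k).factorial) ≤ 2 ^ k * k.factorial := by
  rw [Real.sqrt_le_left (by positivity)]
  have h1 : (2 * k).factorial = (2 * k).choose k * k.factorial * k.factorial := by
    have := Nat.choose_mul_factorial_mul_factorial (show k ≤ 2 * k by omega)
    rw [show 2 * k - k = k by omega] at this
    exact this.symm
  have h2 : ((2 * k).choose k : ℝ) ≤ 2 ^ (2 * k) := by exact_mod_cast Nat.choose_le_two_pow _ _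
  rw [h1]
  push_cast
  calc ((2 * k).choose k : ℝ) * k.factorial * k.factorial
      ≤ 2 ^ (2 * k) * k.factorial * k.factorial := by gcongr
    _ = _ := by ring

theorem hasSum_exp_real (t : ℝ) : HasSum (fun n : ℕ => t ^ n / n.factorial) (Real.exp t) := by
  rw [Real.exp_eq_exp_ℝ]
  exact NormedSpace.expSeries_div_hasSum_exp t

/-- Factorial bounds on all moments give Gaussian decay. -/
theorem mul_exp_le_of_pow_mul_le {r a B K : ℝ} (hK : 0 < K)
    (h : ∀ n : ℕ, r ^ n * a ≤ B * (K ^ n * Real.sqrt n.factorial)) (hB : 0 ≤ B) :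
    a * Real.exp (r ^ 2 / (4 * K ^ 2)) ≤ 2 * B := by
  have h1 := (hasSum_exp_real (r ^ 2 / (4 * K ^ 2))).mul_left a
  have h2 : HasSum (fun n : ℕ => B * (1 / 2 : ℝ) ^ n) (B * 2) := hasSum_geometric_two.mul_left B
  rw [mul_comm 2 B]
  refine hasSum_le (fun n => ?_) h1 h2
  -- The moment of order 2n is compared with the n-th term of the exponential series; √(2n)! ≤ 2^n
  -- n! and the factor 4K² leave a geometric series of ratio 1/2.
  have h3 := h (2 * n)
  have hf : (0 : ℝ) < n.factorial := by exact_mod_cast n.factorial_pos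
  rw [div_pow, mul_div_assoc', mul_div_assoc', div_le_iff₀ hf, div_le_iff₀ (by positivity)]
  calc a * (r ^ 2) ^ n = r ^ (2 * n) * a := by rw [pow_mul]; ring
    _ ≤ B * (K ^ (2 * n) * Real.sqrt (2 * n).factorial) := h3
    _ ≤ B * (K ^ (2 * n) * (2 ^ n * n.factorial)) := by
        gcongr
        exact sqrt_factorial_two_mul_le n
    _ = B * (1 / 2) ^ n * n.factorial * (4 * K ^ 2) ^ n := by
        rw [pow_mul, mul_pow, show (4 : ℝ) = 2 * 2 by norm_num, mul_pow, div_pow, one_pow]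
        field_simp

theorem sqrt_factorial_mul_le {n j : ℕ} (hj : j ≤ n) :
    Real.sqrt j.factorial * Real.sqrt (n - j).factorial ≤ Real.sqrt n.factorial := by
  rw [← Real.sqrt_mul (by positivity)]
  refine Real.sqrt_le_sqrt ?_
  exact_mod_cast Nat.le_of_dvd n.factorial_pos (Nat.factorial_mul_factorial_dvd_factorial hj)

/-- Leibniz sums preserve bounds of the type h^n √n!, because √(j! (n-j)!) ≤ √n! reduces them to the
binomial theorem. -/
theorem sum_choose_mul_sqrt_le (n : ℕ) {α β : ℝ} (hα : 0 ≤ α) (hβ : 0 ≤ β) :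
    ∑ j ∈ Finset.range (n + 1), (n.choose j : ℝ) * (α ^ j * Real.sqrt j.factorial) *
      (β ^ (n - j) * Real.sqrt (n - j).factorial) ≤ (α + β) ^ n * Real.sqrt n.factorial := by
  rw [add_pow, Finset.sum_mul]
  refine Finset.sum_le_sum fun j hj => ?_
  have := sqrt_factorial_mul_le (Finset.mem_range_succ_iff.mp hj)
  calc (n.choose j : ℝ) * (α ^ j * Real.sqrt j.factorial) *
        (β ^ (n - j) * Real.sqrt (n - j).factorial)
      = α ^ j * β ^ (n - j) * n.choose j *
        (Real.sqrt j.factorial * Real.sqrt (n - j).factorial) := by ring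
    _ ≤ _ := by gcongr

/-- `r ^ j ≤ s ^ j √(j!) e ^ (r² / (2 s²))`. -/
theorem pow_le_exp_mul_sqrt_factorial {r s : ℝ} (hs : 0 < s) (j : ℕ) :
    r ^ j ≤ Real.exp (r ^ 2 / (2 * s ^ 2)) * (s ^ j * Real.sqrt j.factorial) := by
  refine le_of_abs_le (abs_le_of_sq_le_sq ?_ (by positivity))
  have h1 := Real.pow_div_factorial_le_exp (r ^ 2 / s ^ 2) (by positivity) j
  have hf : (0 : ℝ) < j.factorial := by exact_mod_cast j.factorial_pos
  rw [div_le_iff₀ hf, div_pow, div_le_iff₀ (by positivity)] at h1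
  calc (r ^ j) ^ 2 = (r ^ 2) ^ j := by ring
    _ ≤ _ := h1
    _ = Real.exp (r ^ 2 / (2 * s ^ 2)) ^ 2 * ((s ^ j) ^ 2 * (Real.sqrt j.factorial) ^ 2) := by
        rw [Real.sq_sqrt hf.le, ← Real.exp_nat_mul]
        have : ((2 : ℕ) : ℝ) * (r ^ 2 / (2 * s ^ 2)) = r ^ 2 / s ^ 2 := by
          push_cast
          field_simp
        rw [this]
        ring
    _ = _ := by ring

variable {ι : Type} [Fintype ι]

/-- Smoothness of a complex valued function on `ℝ^ι`. -/
abbrev IsSmooth (f : Euc ι → ℂ) : Prop := ContDiff ℝ ((⊤ : ℕ∞) : WithTop ℕ∞) f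

theorem nat_le_smooth (n : ℕ) : ((n : ℕ∞) : WithTop ℕ∞) ≤ ((⊤ : ℕ∞) : WithTop ℕ∞) := by
  exact_mod_cast le_top

theorem GSBound.nonneg {h M : ℝ} {f : Euc ι → ℂ} (hf : GSBound h M f) : 0 ≤ M :=
  (norm_nonneg _).trans (hf.norm_le 0)

theorem GSBound.mono {h M M' : ℝ} {f : Euc ι → ℂ} (hf : GSBound h M f) (h0 : 0 < h) (hM : M ≤ M') :
    GSBound h M' f := fun k n x => (hf k n x).trans (by gcongr)

theorem GSBound.add {h M N : ℝ} {f g : Euc ι → ℂ} (hf : GSBound h M f) (hg : GSBound h N g)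
    (sf : IsSmooth f) (sg : IsSmooth g) : GSBound h (M + N) (fun t => f t + g t) := by
  intro k n x
  have : iteratedFDeriv ℝ n (fun t => f t + g t) x =
      iteratedFDeriv ℝ n f x + iteratedFDeriv ℝ n g x :=
    iteratedFDeriv_add_apply ((sf.of_le (nat_le_smooth n)).contDiffAt)
      ((sg.of_le (nat_le_smooth n)).contDiffAt)
  rw [this]
  calc ‖x‖ ^ k * ‖iteratedFDeriv ℝ n f x + iteratedFDeriv ℝ n g x‖
      ≤ ‖x‖ ^ k * (‖iteratedFDeriv ℝ n f x‖ + ‖iteratedFDeriv ℝ n g x‖) := by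
        gcongr
        exact norm_add_le _ _
    _ ≤ _ := by
        rw [mul_add, add_mul]
        exact add_le_add (hf k n x) (hg k n x)

theorem GSBound.const_mul {h M : ℝ} {f : Euc ι → ℂ} (hf : GSBound h M f) (sf : IsSmooth f) (c : ℂ) :
    GSBound h (‖c‖ * M) (fun t => c * f t) := by
  intro k n x
  have : iteratedFDeriv ℝ n (c • f) x = c • iteratedFDeriv ℝ n f x :=
    iteratedFDeriv_const_smul_apply ((sf.of_le (nat_le_smooth n)).contDiffAt)
  change ‖x‖ ^ k * ‖iteratedFDeriv ℝ n (c • f) x‖ ≤ _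
  rw [this, norm_smul, mul_left_comm, mul_assoc]
  exact mul_le_mul_of_nonneg_left (hf k n x) (norm_nonneg c)

theorem GSBound.norm_iteratedFDeriv_le {h M : ℝ} {f : Euc ι → ℂ} (hf : GSBound h M f) (h0 : 0 < h)
    (n : ℕ) (x : Euc ι) : ‖iteratedFDeriv ℝ n f x‖ ≤
      2 * (M * (h ^ n * Real.sqrt n.factorial)) * Real.exp (-(‖x‖ ^ 2 / (4 * h ^ 2))) := by
  have h1 := mul_exp_le_of_pow_mul_le (r := ‖x‖) (a := ‖iteratedFDeriv ℝ n f x‖)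
    (B := M * (h ^ n * Real.sqrt n.factorial)) h0 (fun k => by
      refine (hf k n x).trans_eq ?_
      rw [Real.sqrt_mul (by positivity), pow_add]
      ring) (mul_nonneg hf.nonneg (by positivity))
  rw [Real.exp_neg, ← div_eq_mul_inv, le_div_iff₀ (Real.exp_pos _)]
  exact h1

/-- Leibniz' rule for factorial bounds at a point. -/
theorem norm_iteratedFDeriv_mul_le_of_le {f g : Euc ι → ℂ} (sf : IsSmooth f) (sg : IsSmooth g)
    {A B α β : ℝ} (hα : 0 ≤ α) (hβ : 0 ≤ β) (hB : 0 ≤ B) {x : Euc ι}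
    (hf : ∀ j, ‖iteratedFDeriv ℝ j f x‖ ≤ A * (α ^ j * Real.sqrt j.factorial))
    (hg : ∀ j, ‖iteratedFDeriv ℝ j g x‖ ≤ B * (β ^ j * Real.sqrt j.factorial)) (n : ℕ) :
    ‖iteratedFDeriv ℝ n (fun t => f t * g t) x‖ ≤
      A * B * ((α + β) ^ n * Real.sqrt n.factorial) := by
  have hA : 0 ≤ A := by simpa using (norm_nonneg _).trans (hf 0)
  refine (norm_iteratedFDeriv_mul_le sf sg x (nat_le_smooth n)).trans ?_
  calc ∑ j ∈ Finset.range (n + 1), (n.choose j : ℝ) * ‖iteratedFDeriv ℝ j f x‖ *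
        ‖iteratedFDeriv ℝ (n - j) g x‖
      ≤ ∑ j ∈ Finset.range (n + 1), A * B * ((n.choose j : ℝ) * (α ^ j * Real.sqrt j.factorial) *
        (β ^ (n - j) * Real.sqrt (n - j).factorial)) := by
        refine Finset.sum_le_sum fun j _ => ?_
        calc _ ≤ (n.choose j : ℝ) * (A * (α ^ j * Real.sqrt j.factorial)) *
              (B * (β ^ (n - j) * Real.sqrt (n - j).factorial)) := by
              gcongr
              · exact hf j
              · exact hg (n - j)
          _ = _ := by ring
    _ ≤ _ := by
        rw [← Finset.mul_sum]
        exact mul_le_mul_of_nonneg_left (sum_choose_mul_sqrt_le n hα hβ) (by positivity)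

theorem GSBound.mul_left {h M s A : ℝ} {a f : Euc ι → ℂ} (hf : GSBound h M f) (h0 : 0 < h)
    (hs : 0 ≤ s) (sf : IsSmooth f) (sa : IsSmooth a)
    (ha : ∀ j x, ‖iteratedFDeriv ℝ j a x‖ ≤ A * (s ^ j * Real.sqrt j.factorial)) :
    GSBound (h + s) (A * M) (fun t => a t * f t) := by
  intro k n x
  have hM := hf.nonneg
  have hA : 0 ≤ A := by simpa using (norm_nonneg _).trans (ha 0 x)
  rcases (pow_nonneg (norm_nonneg x) k).eq_or_lt with h1 | h1
  · rw [← h1, zero_mul]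
    positivity
  have := norm_iteratedFDeriv_mul_le_of_le (x := x) sa sf hs h0.le
    (B := M * (h ^ k * Real.sqrt k.factorial) / ‖x‖ ^ k) (by positivity) (fun j => ha j x)
    (fun j => by
      rw [div_mul_eq_mul_div, le_div_iff₀ h1, mul_comm]
      refine (hf k j x).trans_eq ?_
      rw [Real.sqrt_mul (by positivity), pow_add]
      ring) n
  calc ‖x‖ ^ k * ‖iteratedFDeriv ℝ n (fun t => a t * f t) x‖
      ≤ ‖x‖ ^ k * (A * (M * (h ^ k * Real.sqrt k.factorial) / ‖x‖ ^ k) *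
        ((s + h) ^ n * Real.sqrt n.factorial)) := by gcongr
    _ = A * M * (h ^ k * (h + s) ^ n * (Real.sqrt k.factorial * Real.sqrt n.factorial)) := by
        field_simp
        ring
    _ ≤ A * M * ((h + s) ^ k * (h + s) ^ n * (Real.sqrt k.factorial * Real.sqrt n.factorial)) := by
        gcongr
        linarith
    _ = _ := by rw [Real.sqrt_mul (by positivity), pow_add]

/-- The binomial theorem, with b^j ≤ e^{b²/(2s²)} s^j √j!. A translation by b thus costs a Gaussian
factor in b, whose rate is as small as desired when s is large. -/
theorem pow_norm_add_le {h s a b : ℝ} (ha : 0 ≤ a) (_hb : 0 ≤ b) (h0 : 0 < h) (hs : 0 < s)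
    {N D : ℝ} (hN : 0 ≤ N) (hD : 0 ≤ D)
    (hf : ∀ k : ℕ, a ^ k * N ≤ D * (h ^ k * Real.sqrt k.factorial)) (k : ℕ) :
    (a + b) ^ k * N ≤ Real.exp (b ^ 2 / (2 * s ^ 2)) * D * ((h + s) ^ k * Real.sqrt k.factorial) := by
  rw [add_comm a b, add_pow, Finset.sum_mul]
  have := sum_choose_mul_sqrt_le k hs.le h0.le
  calc ∑ j ∈ Finset.range (k + 1), b ^ j * a ^ (k - j) * (k.choose j) * N
      ≤ ∑ j ∈ Finset.range (k + 1), Real.exp (b ^ 2 / (2 * s ^ 2)) * D *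
        ((k.choose j : ℝ) * (s ^ j * Real.sqrt j.factorial) *
        (h ^ (k - j) * Real.sqrt (k - j).factorial)) := by
        refine Finset.sum_le_sum fun j _ => ?_
        calc b ^ j * a ^ (k - j) * (k.choose j) * N = (k.choose j) * b ^ j * (a ^ (k - j) * N) := by
              ring
          _ ≤ (k.choose j) * (Real.exp (b ^ 2 / (2 * s ^ 2)) * (s ^ j * Real.sqrt j.factorial)) *
              (D * (h ^ (k - j) * Real.sqrt (k - j).factorial)) := by
              refine mul_le_mul (mul_le_mul_of_nonneg_left (pow_le_exp_mul_sqrt_factorial hs j)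
                (by positivity)) (hf (k - j)) (by positivity) (by positivity)
          _ = _ := by ring
    _ ≤ _ := by
        rw [← Finset.mul_sum, add_comm h s]
        exact mul_le_mul_of_nonneg_left this (by positivity)

theorem GSBound.translate {h M s : ℝ} {f : Euc ι → ℂ} (hf : GSBound h M f) (h0 : 0 < h)
    (hs : 0 < s) (x : Euc ι) :
    GSBound (h + s) (Real.exp (‖x‖ ^ 2 / (2 * s ^ 2)) * M) (fun t => f (t - x)) := by
  intro k n t
  have hM := hf.nonneg
  rw [iteratedFDeriv_comp_sub]
  have h1 := pow_norm_add_le (a := ‖t - x‖) (b := ‖x‖) (norm_nonneg _) (norm_nonneg _) h0 hs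
    (N := ‖iteratedFDeriv ℝ n f (t - x)‖) (D := M * (h ^ n * Real.sqrt n.factorial))
    (norm_nonneg _) (by positivity) (fun k => by
      refine (hf k n (t - x)).trans_eq ?_
      rw [Real.sqrt_mul (by positivity), pow_add]
      ring) k
  have h2 : ‖t‖ ≤ ‖t - x‖ + ‖x‖ := by simpa using norm_add_le (t - x) x
  calc ‖t‖ ^ k * ‖iteratedFDeriv ℝ n f (t - x)‖
      ≤ (‖t - x‖ + ‖x‖) ^ k * ‖iteratedFDeriv ℝ n f (t - x)‖ := by gcongr
    _ ≤ _ := h1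
    _ ≤ Real.exp (‖x‖ ^ 2 / (2 * s ^ 2)) * (M * ((h + s) ^ n * Real.sqrt n.factorial)) *
        ((h + s) ^ k * Real.sqrt k.factorial) := by
        gcongr
        linarith
    _ = _ := by
        rw [Real.sqrt_mul (by positivity), pow_add]
        ring

/-- The modulation factor `e ^ (-i⟨t,ξ⟩)`. -/
def modul (ξ t : Euc ι) : ℂ := Complex.exp (-Complex.I * (inner ℝ t ξ : ℝ))

/-- The linear form `t ↦ -i⟨t,ξ⟩`. -/
def modulCLM (ξ : Euc ι) : Euc ι →L[ℝ] ℂ := (-Complex.I) • Complex.ofRealCLM.comp (innerSL ℝ ξ)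

theorem modul_eq (ξ t : Euc ι) : modul ξ t = Complex.exp (modulCLM ξ t) := by
  simp [modul, modulCLM, real_inner_comm]

theorem norm_modul (ξ t : Euc ι) : ‖modul ξ t‖ = 1 := by
  rw [modul, Complex.norm_exp]
  simp

theorem modul_add (ξ η t : Euc ι) : modul (ξ + η) t = modul ξ t * modul η t := by
  rw [modul_eq, modul_eq, modul_eq, ← Complex.exp_add]
  simp [modulCLM]

theorem norm_modulCLM_le (ξ : Euc ι) : ‖modulCLM ξ‖ ≤ ‖ξ‖ := by
  refine ContinuousLinearMap.opNorm_le_bound _ (norm_nonneg _) fun t => ?_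
  simp only [modulCLM, smul_apply, ContinuousLinearMap.comp_apply, norm_smul,
    norm_neg, Complex.norm_I, one_mul, Complex.ofRealCLM_apply, Complex.norm_real]
  exact norm_inner_le_norm ξ t

theorem isSmooth_modul (ξ : Euc ι) : IsSmooth (modul ξ) := by
  have : modul ξ = fun t => Complex.exp (modulCLM ξ t) := funext (modul_eq ξ)
  rw [this]
  exact (modulCLM ξ).contDiff.cexp

theorem norm_iteratedFDeriv_modul_le (ξ : Euc ι) (j : ℕ) (t : Euc ι) :
    ‖iteratedFDeriv ℝ j (modul ξ) t‖ ≤ ‖ξ‖ ^ j := by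
  induction j with
  | zero => simp [norm_modul]
  | succ j ih =>
    set Λ : ℂ →L[ℝ] (Euc ι →L[ℝ] ℂ) := (ContinuousLinearMap.lsmul ℝ ℂ).flip (modulCLM ξ) with hΛ
    have hder : fderiv ℝ (modul ξ) = Λ ∘ modul ξ := by
      ext1 t
      have h1 : HasFDerivAt (fun t => Complex.exp (modulCLM ξ t))
          (Complex.exp (modulCLM ξ t) • modulCLM ξ) t := (modulCLM ξ).hasFDerivAt.cexp
      have h2 : modul ξ = fun t => Complex.exp (modulCLM ξ t) := funext (modul_eq ξ)
      rw [h2, h1.fderiv]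
      rfl
    have hn : ‖Λ‖ ≤ ‖ξ‖ := by
      refine ContinuousLinearMap.opNorm_le_bound _ (norm_nonneg _) fun c => ?_
      have : Λ c = c • modulCLM ξ := rfl
      rw [this, norm_smul, mul_comm]
      gcongr
      exact norm_modulCLM_le ξ
    rw [← norm_iteratedFDeriv_fderiv, hder, pow_succ']
    refine (Λ.norm_iteratedFDeriv_comp_left
      ((isSmooth_modul ξ).of_le (nat_le_smooth j)).contDiffAt le_rfl).trans ?_
    gcongr

theorem GSBound.modulate {h M s : ℝ} {f : Euc ι → ℂ} (hf : GSBound h M f) (h0 : 0 < h)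
    (hs : 0 < s) (sf : IsSmooth f) (ξ : Euc ι) :
    GSBound (h + s) (Real.exp (‖ξ‖ ^ 2 / (2 * s ^ 2)) * M) (fun t => modul ξ t * f t) :=
  hf.mul_left h0 hs.le sf (isSmooth_modul ξ) fun j t =>
    (norm_iteratedFDeriv_modul_le ξ j t).trans (pow_le_exp_mul_sqrt_factorial hs j)

/-- The time-frequency shift `f(t - x) e ^ (-i⟨t,ξ⟩)`. -/
def tfShift (f : Euc ι → ℂ) (z : Euc ι × Euc ι) (t : Euc ι) : ℂ := modul z.2 t * f (t - z.1)

theorem IsSmooth.translate {f : Euc ι → ℂ} (sf : IsSmooth f) (x : Euc ι) :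
    IsSmooth (fun t => f (t - x)) := sf.comp (contDiff_id.sub contDiff_const)

theorem IsSmooth.tfShift {f : Euc ι → ℂ} (sf : IsSmooth f) (z : Euc ι × Euc ι) :
    IsSmooth (tfShift f z) := (isSmooth_modul z.2).mul (sf.translate z.1)

theorem GSBound.tfShift {h M s : ℝ} {f : Euc ι → ℂ} (hf : GSBound h M f) (h0 : 0 < h)
    (hs : 0 < s) (sf : IsSmooth f) (z : Euc ι × Euc ι) :
    GSBound (h + 2 * s) (Real.exp ((‖z.1‖ ^ 2 + ‖z.2‖ ^ 2) / (2 * s ^ 2)) * M) (tfShift f z) := by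
  have := (hf.translate h0 hs z.1).modulate (s := s) (by positivity) hs (sf.translate z.1) z.2
  have e : h + s + s = h + 2 * s := by ring
  rw [e] at this
  have e2 : Real.exp (‖z.2‖ ^ 2 / (2 * s ^ 2)) * (Real.exp (‖z.1‖ ^ 2 / (2 * s ^ 2)) * M) =
      Real.exp ((‖z.1‖ ^ 2 + ‖z.2‖ ^ 2) / (2 * s ^ 2)) * M := by
    rw [← mul_assoc, ← Real.exp_add]
    congr 2
    ring
  rw [e2] at this
  exact this

theorem sqrt_factorial_succ_le (n : ℕ) :
    Real.sqrt (n + 1).factorial ≤ 2 ^ n * Real.sqrt n.factorial := by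
  rw [Nat.factorial_succ, Nat.cast_mul, Real.sqrt_mul (by positivity)]
  gcongr
  rw [Real.sqrt_le_left (by positivity)]
  have : n + 1 ≤ 2 ^ n := Nat.lt_two_pow_self
  calc ((n + 1 : ℕ) : ℝ) ≤ (2 : ℝ) ^ n := by exact_mod_cast this
    _ ≤ ((2 : ℝ) ^ n) ^ 2 := by
        rw [sq]
        exact le_mul_of_one_le_left (by positivity) (one_le_pow₀ (by norm_num))

/-- The mean value inequality on the segment from t - y to t, applied to the n-th derivative. The
loss of one derivative, √(n+1)! ≤ 2^n √n!, is absorbed by doubling the parameter. -/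
theorem GSBound.translate_sub {h M : ℝ} {f : Euc ι → ℂ} (hf : GSBound h M f) (h0 : 0 < h)
    (sf : IsSmooth f) {y : Euc ι} (hy : ‖y‖ ≤ 1) :
    GSBound (2 * (h + 1)) (‖y‖ * (Real.exp 1 * M * (h + 1))) (fun t => f (t - y) - f t) := by
  intro k n t
  have hM := hf.nonneg
  set D := fun t => iteratedFDeriv ℝ n f t with hD
  have e : iteratedFDeriv ℝ n (fun t => f (t - y) - f t) t = D (t - y) - D t := by
    have := iteratedFDeriv_sub_apply (x := t) (f := fun t => f (t - y)) (g := f)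
      ((sf.translate y).of_le (nat_le_smooth n)).contDiffAt
      (sf.of_le (nat_le_smooth n)).contDiffAt
    rw [show (fun t => f (t - y) - f t) = (fun t => f (t - y)) - f from rfl, this,
      iteratedFDeriv_comp_sub]
  have hdiff : ∀ w, DifferentiableAt ℝ D w := fun w =>
    (sf.differentiable_iteratedFDeriv (m := n) (by exact_mod_cast ENat.natCast_lt_top n)) w
  set S : ℝ := (h + 1) ^ (k + (n + 1)) * Real.sqrt (k.factorial * (n + 1).factorial)
  have hbound : ∀ w ∈ segment ℝ (t - y) t, ‖t‖ ^ k * ‖fderiv ℝ D w‖ ≤ Real.exp 1 * M * S := by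
    intro w hw
    rw [segment_symm, segment_eq_image'] at hw
    obtain ⟨θ, hθ, rfl⟩ := hw
    have hfd : ‖fderiv ℝ D (t + θ • (t - y - t))‖ =
        ‖iteratedFDeriv ℝ (n + 1) f (t - θ • y)‖ := by
      rw [hD, norm_fderiv_iteratedFDeriv]
      congr 2
      simp [sub_eq_add_neg]
    rw [hfd]
    have h1 := hf.translate h0 one_pos (θ • y) k (n + 1) t
    rw [iteratedFDeriv_comp_sub] at h1
    refine h1.trans ?_
    gcongr
    have : ‖θ • y‖ ≤ 1 := by
      rw [norm_smul, Real.norm_of_nonneg hθ.1]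
      exact mul_le_one₀ hθ.2 (norm_nonneg _) hy
    have h3 : ‖θ • y‖ ^ 2 ≤ 1 := pow_le_one₀ (norm_nonneg _) this
    linarith
  have hmv : ‖t‖ ^ k * ‖D (t - y) - D t‖ ≤ Real.exp 1 * M * S * ‖y‖ := by
    rcases (pow_nonneg (norm_nonneg t) k).eq_or_lt with h1 | h1
    · rw [← h1, zero_mul]
      positivity
    have := (convex_segment (t - y) t).norm_image_sub_le_of_norm_fderiv_le (𝕜 := ℝ)
      (f := D) (C := Real.exp 1 * M * S / ‖t‖ ^ k) (fun w _ => hdiff w)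
      (fun w hw => by
        rw [le_div_iff₀ h1, mul_comm]
        exact hbound w hw) (right_mem_segment ℝ (t - y) t) (left_mem_segment ℝ (t - y) t)
    rw [sub_sub_cancel_left, norm_neg, div_mul_eq_mul_div, le_div_iff₀ h1, mul_comm] at this
    exact this
  rw [e]
  refine hmv.trans ?_
  have hS : S ≤ (h + 1) * ((2 * (h + 1)) ^ (k + n) * Real.sqrt (k.factorial * n.factorial)) := by
    have h2k : (1 : ℝ) ≤ 2 ^ k := one_le_pow₀ (by norm_num)
    calc S = (h + 1) ^ (k + n) * (h + 1) * (Real.sqrt k.factorial * Real.sqrt (n + 1).factorial) := by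
          simp only [S]
          rw [Real.sqrt_mul (by positivity), ← add_assoc, pow_succ]
      _ ≤ (h + 1) ^ (k + n) * (h + 1) *
          (Real.sqrt k.factorial * (2 ^ n * Real.sqrt n.factorial)) := by
          gcongr
          exact sqrt_factorial_succ_le n
      _ = 1 * ((h + 1) * ((h + 1) ^ (k + n) * 2 ^ n *
          (Real.sqrt k.factorial * Real.sqrt n.factorial))) := by ring
      _ ≤ 2 ^ k * ((h + 1) * ((h + 1) ^ (k + n) * 2 ^ n *
          (Real.sqrt k.factorial * Real.sqrt n.factorial))) := by gcongr
      _ = _ := by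
          rw [Real.sqrt_mul (by positivity), mul_pow, pow_add 2]
          ring
  calc Real.exp 1 * M * S * ‖y‖ ≤ Real.exp 1 * M * ((h + 1) *
        ((2 * (h + 1)) ^ (k + n) * Real.sqrt (k.factorial * n.factorial))) * ‖y‖ := by gcongr
    _ = _ := by ring

theorem norm_iteratedFDeriv_modul_sub_one_le {ξ : Euc ι} (hξ : ‖ξ‖ ≤ 1) (j : ℕ) (t : Euc ι) :
    ‖iteratedFDeriv ℝ j (fun t => modul ξ t - 1) t‖ ≤ ‖ξ‖ * (1 + ‖t‖) := by
  rcases j with _ | j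
  · rw [norm_iteratedFDeriv_zero]
    have : ‖modul ξ t - 1‖ ≤ ‖inner ℝ t ξ‖ := by
      rw [modul, show -Complex.I * ((inner ℝ t ξ : ℝ) : ℂ) = Complex.I * ((-inner ℝ t ξ : ℝ) : ℂ) by
        push_cast; ring]
      exact (Real.norm_exp_I_mul_ofReal_sub_one_le).trans_eq (norm_neg _)
    calc _ ≤ _ := this
      _ ≤ ‖t‖ * ‖ξ‖ := norm_inner_le_norm _ _
      _ ≤ _ := by nlinarith [norm_nonneg ξ]
  · have : iteratedFDeriv ℝ (j + 1) (fun t => modul ξ t - 1) t =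
        iteratedFDeriv ℝ (j + 1) (modul ξ) t := by
      have := iteratedFDeriv_sub_apply (x := t) (f := modul ξ) (g := fun _ => (1 : ℂ))
        ((isSmooth_modul ξ).of_le (nat_le_smooth (j + 1))).contDiffAt contDiffAt_const
      rw [show (fun t => modul ξ t - 1) = modul ξ - fun _ => (1 : ℂ) from rfl, this,
        iteratedFDeriv_const_of_ne (by omega)]
      simp
    rw [this]
    refine (norm_iteratedFDeriv_modul_le ξ _ t).trans ?_
    rw [pow_succ']
    have h1 : ‖ξ‖ ^ j ≤ 1 := pow_le_one₀ (norm_nonneg _) hξ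
    gcongr
    linarith [norm_nonneg t]

/-- For ‖ξ‖ ≤ 1, the factor e^{-i⟨t,ξ⟩} - 1 and all its derivatives are at most ‖ξ‖(1 + ‖t‖). The
additional power of ‖t‖ raises k by one, which doubling the parameter absorbs. -/
theorem GSBound.modul_sub_one {h M : ℝ} {f : Euc ι → ℂ} (hf : GSBound h M f) (h0 : 0 < h)
    (sf : IsSmooth f) {ξ : Euc ι} (hξ : ‖ξ‖ ≤ 1) :
    GSBound (2 * (h + 1)) (‖ξ‖ * (M * (h + 1))) (fun t => (modul ξ t - 1) * f t) := by
  intro k n t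
  have hM := hf.nonneg
  refine le_trans (mul_le_mul_of_nonneg_left (norm_iteratedFDeriv_mul_le (N := n)
    (((isSmooth_modul ξ).of_le (nat_le_smooth n)).sub contDiff_const)
    (sf.of_le (nat_le_smooth n)) t le_rfl) (by positivity)) ?_
  have hterm : ∀ j ∈ Finset.range (n + 1), ‖t‖ ^ k * ((n.choose j : ℝ) *
      ‖iteratedFDeriv ℝ j (fun t => modul ξ t - 1) t‖ * ‖iteratedFDeriv ℝ (n - j) f t‖) ≤
      ‖ξ‖ * (M * (h + 1)) * (2 * (h + 1)) ^ k * Real.sqrt k.factorial * (((n.choose j : ℝ) *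
        (1 ^ j * Real.sqrt j.factorial) * (h ^ (n - j) * Real.sqrt (n - j).factorial))) := by
    intro j _
    have e1 := hf k (n - j) t
    have e2 := hf (k + 1) (n - j) t
    rw [Real.sqrt_mul (by positivity), pow_add h] at e1 e2
    have hj : (1 : ℝ) ≤ Real.sqrt j.factorial := by
      rw [Real.one_le_sqrt]
      exact_mod_cast j.factorial_pos
    have h2k : h ^ k ≤ (2 * (h + 1)) ^ k := by
      gcongr
      linarith
    have h2k' : h ^ k * 2 ^ k ≤ (2 * (h + 1)) ^ k := by
      rw [← mul_pow]
      exact pow_le_pow_left₀ (by positivity) (by linarith) _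
    calc _ ≤ ‖t‖ ^ k * ((n.choose j : ℝ) * (‖ξ‖ * (1 + ‖t‖)) * ‖iteratedFDeriv ℝ (n - j) f t‖) := by
          gcongr
          exact norm_iteratedFDeriv_modul_sub_one_le hξ j t
      _ = (n.choose j : ℝ) * ‖ξ‖ * (‖t‖ ^ k * ‖iteratedFDeriv ℝ (n - j) f t‖ +
          ‖t‖ ^ (k + 1) * ‖iteratedFDeriv ℝ (n - j) f t‖) := by ring
      _ ≤ (n.choose j : ℝ) * ‖ξ‖ * (M * (h ^ k * h ^ (n - j) *
            (Real.sqrt k.factorial * Real.sqrt (n - j).factorial)) +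
          M * (h ^ (k + 1) * h ^ (n - j) *
            ((2 ^ k * Real.sqrt k.factorial) * Real.sqrt (n - j).factorial))) := by
          refine mul_le_mul_of_nonneg_left (add_le_add e1 (e2.trans ?_)) (by positivity)
          gcongr
          exact sqrt_factorial_succ_le k
      _ = (n.choose j : ℝ) * ‖ξ‖ * M * h ^ (n - j) * Real.sqrt k.factorial *
          Real.sqrt (n - j).factorial * (h ^ k + h ^ k * 2 ^ k * h) * 1 := by ring
      _ ≤ (n.choose j : ℝ) * ‖ξ‖ * M * h ^ (n - j) * Real.sqrt k.factorial *
          Real.sqrt (n - j).factorial * ((2 * (h + 1)) ^ k + (2 * (h + 1)) ^ k * h) *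
          Real.sqrt j.factorial := by gcongr
      _ = _ := by
          rw [one_pow]
          ring
  rw [Finset.mul_sum]
  refine (Finset.sum_le_sum hterm).trans ?_
  rw [← Finset.mul_sum]
  have h1 := sum_choose_mul_sqrt_le n zero_le_one h0.le
  calc _ ≤ ‖ξ‖ * (M * (h + 1)) * (2 * (h + 1)) ^ k * Real.sqrt k.factorial *
        ((1 + h) ^ n * Real.sqrt n.factorial) := by gcongr
    _ ≤ ‖ξ‖ * (M * (h + 1)) * (2 * (h + 1)) ^ k * Real.sqrt k.factorial *
        ((2 * (h + 1)) ^ n * Real.sqrt n.factorial) := by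
        gcongr
        linarith
    _ = _ := by
        rw [Real.sqrt_mul (by positivity), pow_add]
        ring

end Bounds

/-! ### The Gaussian window belongs to S_{1/2} -/

section Gauss
variable {ι : Type} [Fintype ι]

/-- The real-linear map `t ↦ ⟨t, ·⟩` into complex valued linear forms. -/
def innerCLM (ι : Type) [Fintype ι] : Euc ι →L[ℝ] (Euc ι →L[ℝ] ℂ) :=
  (ContinuousLinearMap.compL ℝ (Euc ι) ℝ ℂ Complex.ofRealCLM).comp (innerSL ℝ)

theorem innerCLM_apply (t v : Euc ι) : innerCLM ι t v = ((inner ℝ t v : ℝ) : ℂ) := rfl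

theorem norm_innerCLM_apply_le (t : Euc ι) : ‖innerCLM ι t‖ ≤ ‖t‖ := by
  refine ContinuousLinearMap.opNorm_le_bound _ (norm_nonneg _) fun v => ?_
  rw [innerCLM_apply, Complex.norm_real]
  exact norm_inner_le_norm t v

theorem norm_innerCLM_le : ‖innerCLM ι‖ ≤ 1 :=
  ContinuousLinearMap.opNorm_le_bound _ zero_le_one fun t => by
    rw [one_mul]
    exact norm_innerCLM_apply_le t

theorem gaussWindow_eq (t : Euc ι) : gaussWindow t =
    ((Real.pi ^ (-(Fintype.card ι : ℝ) / 4) : ℝ) : ℂ) *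
      Complex.exp (-((‖t‖ ^ 2 : ℝ) : ℂ) / 2) := by
  simp [gaussWindow]

theorem gaussWindow_nonneg_real (t : Euc ι) : ‖(gaussWindow t : ℂ)‖ =
    Real.pi ^ (-(Fintype.card ι : ℝ) / 4) * Real.exp (-‖t‖ ^ 2 / 2) := by
  rw [gaussWindow, Complex.norm_real, Real.norm_of_nonneg (by positivity)]

theorem isSmooth_gaussWindow : IsSmooth (gaussWindow : Euc ι → ℂ) := by
  refine Complex.ofRealCLM.contDiff.comp (contDiff_const.mul ?_)
  exact ((contDiff_norm_sq ℝ).neg.div_const 2).exp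

theorem hasFDerivAt_gaussWindow (t : Euc ι) :
    HasFDerivAt (gaussWindow : Euc ι → ℂ) (gaussWindow t • (-(innerCLM ι t))) t := by
  have h1 : HasFDerivAt (fun t : Euc ι => -‖t‖ ^ 2 / 2) (-(innerSL ℝ t)) t := by
    have := ((hasStrictFDerivAt_norm_sq t).hasFDerivAt.const_mul (-1 / 2 : ℝ))
    have e : (fun t : Euc ι => -‖t‖ ^ 2 / 2) = fun t => -1 / 2 * ‖t‖ ^ 2 := by
      ext t
      ring
    rw [e]
    refine this.congr_fderiv ?_
    ext x
    simp
    ring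
  have h2 := Complex.ofRealCLM.hasFDerivAt.comp t
    (h1.exp.const_mul (Real.pi ^ (-(Fintype.card ι : ℝ) / 4)))
  refine h2.congr_fderiv ?_
  ext v
  simp [gaussWindow, innerCLM_apply, mul_assoc]

theorem norm_iteratedFDeriv_clm_of_two_le {E F : Type} [NormedAddCommGroup E] [NormedSpace ℝ E]
    [NormedAddCommGroup F] [NormedSpace ℝ F] (L : E →L[ℝ] F) {n : ℕ} (hn : 2 ≤ n) (x : E) :
    ‖iteratedFDeriv ℝ n L x‖ = 0 := by
  obtain ⟨n, rfl⟩ := Nat.exists_eq_add_of_le hn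
  rw [show 2 + n = (n + 1) + 1 by ring, ← norm_iteratedFDeriv_fderiv]
  have : fderiv ℝ L = fun _ => L := funext fun x => L.fderiv
  rw [this, iteratedFDeriv_const_of_ne (by omega)]
  simp

/-- The derivative of φ is -φ(t)⟨t, ·⟩, and the second factor is linear in t, so only two terms of
Leibniz' rule survive. For n = 0 the truncated n - 1 is harmless because of its coefficient n. -/
theorem norm_iteratedFDeriv_gaussWindow_succ_le (n : ℕ) (t : Euc ι) :
    ‖iteratedFDeriv ℝ (n + 1) (gaussWindow : Euc ι → ℂ) t‖ ≤
      ‖t‖ * ‖iteratedFDeriv ℝ n (gaussWindow : Euc ι → ℂ) t‖ +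
      n * ‖iteratedFDeriv ℝ (n - 1) (gaussWindow : Euc ι → ℂ) t‖ := by
  have hf : fderiv ℝ (gaussWindow : Euc ι → ℂ) = fun t => gaussWindow t • (-innerCLM ι) t :=
    funext fun t => (hasFDerivAt_gaussWindow t).fderiv
  rw [← norm_iteratedFDeriv_fderiv, hf]
  refine (norm_iteratedFDeriv_smul_le isSmooth_gaussWindow (-innerCLM ι).contDiff t
    (nat_le_smooth n)).trans ?_
  have h0 : ‖iteratedFDeriv ℝ 0 (-innerCLM ι) t‖ ≤ ‖t‖ := by
    rw [norm_iteratedFDeriv_zero]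
    exact (norm_neg _).trans_le (norm_innerCLM_apply_le t)
  have h1 : ‖iteratedFDeriv ℝ 1 (-innerCLM ι) t‖ ≤ 1 := by
    rw [← zero_add 1, ← norm_iteratedFDeriv_fderiv, norm_iteratedFDeriv_zero,
      ContinuousLinearMap.fderiv, norm_neg]
    exact norm_innerCLM_le
  rcases n with _ | n
  · rw [Finset.sum_range_one]
    simp only [Nat.choose_self, Nat.cast_one, one_mul, Nat.sub_zero, Nat.cast_zero, zero_mul,
      add_zero]
    rw [mul_comm]
    exact mul_le_mul_of_nonneg_right h0 (norm_nonneg _)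
  · rw [Finset.sum_range_succ, Finset.sum_range_succ, Finset.sum_eq_zero]
    · rw [show n + 1 - (n + 1) = 0 by omega, show n + 1 - n = 1 by omega,
        show n + 1 - 1 = n by omega, zero_add]
      simp only [Nat.choose_self, Nat.choose_succ_self_right, Nat.cast_one, one_mul]
      rw [add_comm, mul_comm ‖t‖]
      exact add_le_add (mul_le_mul_of_nonneg_left h0 (norm_nonneg _))
        (mul_le_of_le_one_right (by positivity) h1)
    · intro j hj
      rw [norm_iteratedFDeriv_clm_of_two_le _ (by have := Finset.mem_range.mp hj; omega), mul_zero]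

/-- The two-term recursion closes with s = √(n+1), since r(r + s) + s² ≤ (r + s)². -/
theorem norm_iteratedFDeriv_gaussWindow_le (n : ℕ) (t : Euc ι) :
    ‖iteratedFDeriv ℝ n (gaussWindow : Euc ι → ℂ) t‖ ≤
      ‖(gaussWindow t : ℂ)‖ * (‖t‖ + Real.sqrt n) ^ n := by
  induction n using Nat.strong_induction_on with
  | _ n ih =>
    rcases n with _ | n
    · simp
    refine (norm_iteratedFDeriv_gaussWindow_succ_le n t).trans ?_
    have h1 := ih n (by omega)
    set r := ‖t‖
    have hr : 0 ≤ r := norm_nonneg t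
    set P := ‖(gaussWindow t : ℂ)‖
    have hP : 0 ≤ P := norm_nonneg _
    have hs : Real.sqrt n ≤ Real.sqrt (n + 1 : ℕ) := by
      apply Real.sqrt_le_sqrt
      push_cast
      linarith
    rcases n with _ | n
    · have h0 : ‖iteratedFDeriv ℝ 0 (gaussWindow : Euc ι → ℂ) t‖ = P := norm_iteratedFDeriv_zero
      rw [h0]
      simp
      nlinarith
    · have h2 := ih n (by omega)
      have hs2 : Real.sqrt n ≤ Real.sqrt (n + 1 : ℕ) := by
        apply Real.sqrt_le_sqrt
        push_cast
        linarith
      rw [Nat.add_sub_cancel]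
      set s := Real.sqrt (n + 1 : ℕ)
      have hs0 : 0 ≤ s := Real.sqrt_nonneg _
      have hss : ((n + 1 : ℕ) : ℝ) = s * s := (Real.mul_self_sqrt (by positivity)).symm
      rw [hss]
      calc r * ‖iteratedFDeriv ℝ (n + 1) (gaussWindow : Euc ι → ℂ) t‖ +
            s * s * ‖iteratedFDeriv ℝ n (gaussWindow : Euc ι → ℂ) t‖
          ≤ r * (P * (r + s) ^ (n + 1)) + s * s * (P * (r + Real.sqrt n) ^ n) := by gcongr
        _ ≤ r * (P * (r + s) ^ (n + 1)) + s * s * (P * (r + s) ^ n) := by gcongr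
        _ = P * (r + s) ^ n * (r * (r + s) + s * s) := by ring
        _ ≤ P * (r + s) ^ n * ((r + s) ^ 2) := by
            gcongr
            nlinarith [mul_nonneg hr hs0]
        _ = P * (r + s) ^ (n + 1 + 1) := by ring
        _ ≤ _ := by gcongr

theorem sqrt_pow_le (n : ℕ) : Real.sqrt n ^ n ≤ 2 ^ n * Real.sqrt n.factorial := by
  have h1 := Real.pow_div_factorial_le_exp (n : ℝ) (by positivity) n
  have hf : (0 : ℝ) < n.factorial := by exact_mod_cast n.factorial_pos
  rw [div_le_iff₀ hf] at h1
  refine le_of_abs_le (abs_le_of_sq_le_sq ?_ (by positivity))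
  calc (Real.sqrt n ^ n) ^ 2 = (n : ℝ) ^ n := by
        rw [← pow_mul, mul_comm, pow_mul, Real.sq_sqrt (by positivity)]
    _ ≤ _ := h1
    _ ≤ 4 ^ n * n.factorial := by
        gcongr
        have : Real.exp (n : ℝ) = Real.exp 1 ^ n := by rw [← Real.exp_nat_mul, mul_one]
        rw [this]
        gcongr
        linarith [Real.exp_one_lt_d9]
    _ = _ := by
        rw [mul_pow, Real.sq_sqrt hf.le, ← pow_mul, mul_comm n 2, pow_mul]
        norm_num

/-- The decay e^{-r²/2} pays for two factors e^{r²/8}: one dominates r^k, the other the powers of r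
+ √n coming from the derivatives. Where √n is the larger, √n^n ≤ 2^n √n! is used instead. -/
theorem gsBound_gaussWindow :
    GSBound 4 (Real.pi ^ (-(Fintype.card ι : ℝ) / 4)) (gaussWindow : Euc ι → ℂ) := by
  intro k n t
  set c : ℝ := Real.pi ^ (-(Fintype.card ι : ℝ) / 4) with hc
  have hc0 : 0 ≤ c := by positivity
  set r := ‖t‖ with hr
  have hr0 : 0 ≤ r := norm_nonneg t
  have h1 := norm_iteratedFDeriv_gaussWindow_le n t
  rw [gaussWindow_nonneg_real] at h1
  have e8 : ∀ j : ℕ, r ^ j ≤ Real.exp (r ^ 2 / 8) * (2 ^ j * Real.sqrt j.factorial) := by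
    intro j
    have := pow_le_exp_mul_sqrt_factorial (r := r) (s := 2) two_pos j
    norm_num at this
    exact this
  have h2 : (r + Real.sqrt n) ^ n ≤ Real.exp (r ^ 2 / 8) * (4 ^ n * Real.sqrt n.factorial) := by
    rcases le_total r (Real.sqrt n) with h | h
    · calc (r + Real.sqrt n) ^ n ≤ (2 * Real.sqrt n) ^ n := by gcongr; linarith
        _ = 2 ^ n * Real.sqrt n ^ n := mul_pow _ _ _
        _ ≤ 2 ^ n * (2 ^ n * Real.sqrt n.factorial) := by gcongr; exact sqrt_pow_le n
        _ = 1 * (4 ^ n * Real.sqrt n.factorial) := by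
            rw [← mul_assoc, ← mul_pow]
            norm_num
        _ ≤ _ := by
            gcongr
            exact Real.one_le_exp (by positivity)
    · calc (r + Real.sqrt n) ^ n ≤ (2 * r) ^ n := by gcongr; linarith
        _ = 2 ^ n * r ^ n := mul_pow _ _ _
        _ ≤ 2 ^ n * (Real.exp (r ^ 2 / 8) * (2 ^ n * Real.sqrt n.factorial)) := by
            gcongr
            exact e8 n
        _ = Real.exp (r ^ 2 / 8) * ((2 * 2) ^ n * Real.sqrt n.factorial) := by
            rw [mul_pow]
            ring
        _ = _ := by norm_num
  calc r ^ k * ‖iteratedFDeriv ℝ n (gaussWindow : Euc ι → ℂ) t‖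
      ≤ (Real.exp (r ^ 2 / 8) * (2 ^ k * Real.sqrt k.factorial)) *
        (c * Real.exp (-r ^ 2 / 2) *
          (Real.exp (r ^ 2 / 8) * (4 ^ n * Real.sqrt n.factorial))) := by
        gcongr
        · exact e8 k
        · refine h1.trans ?_
          gcongr
    _ = (Real.exp (r ^ 2 / 8) * Real.exp (-r ^ 2 / 2) * Real.exp (r ^ 2 / 8)) * c * (2 ^ k * 4 ^ n *
        (Real.sqrt k.factorial * Real.sqrt n.factorial)) := by ring
    _ ≤ 1 * c * (4 ^ k * 4 ^ n * (Real.sqrt k.factorial * Real.sqrt n.factorial)) := by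
        gcongr
        · rw [← Real.exp_add, ← Real.exp_add]
          exact Real.exp_le_one_iff.mpr (by nlinarith [sq_nonneg r])
        · norm_num
    _ = _ := by
        rw [Real.sqrt_mul (by positivity), pow_add, one_mul]

/-- The Gaussian window as an element of `S_{1/2}`. -/
def gaussGS (ι : Type) [Fintype ι] : GS ι :=
  ⟨gaussWindow, isSmooth_gaussWindow, 4, by norm_num, _, gsBound_gaussWindow⟩

end Gauss

/-! ### Superpositions of test functions and distributions under the integral sign -/

section Synthesis
variable {ι : Type} [Fintype ι] {Ω : Type}

theorem iteratedFDeriv_integral_eq [MeasurableSpace Ω] {μ : Measure Ω} {H : Ω → Euc ι → ℂ} {b : ℕ → Ω → ℝ}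
    (hs : ∀ w, IsSmooth (H w)) (hb : ∀ n, Integrable (b n) μ)
    (hm : ∀ n t, AEStronglyMeasurable (fun w => iteratedFDeriv ℝ n (H w) t) μ)
    (hle : ∀ n w t, ‖iteratedFDeriv ℝ n (H w) t‖ ≤ b n w) (n : ℕ) :
    (iteratedFDeriv ℝ n (fun t => ∫ w, H w t ∂μ) =
      fun t => ∫ w, iteratedFDeriv ℝ n (H w) t ∂μ) ∧
    Differentiable ℝ (fun t => ∫ w, iteratedFDeriv ℝ n (H w) t ∂μ) := by
  have hd : ∀ n t, HasFDerivAt (fun t => ∫ w, iteratedFDeriv ℝ n (H w) t ∂μ)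
      (continuousMultilinearCurryLeftEquiv ℝ (fun _ : Fin (n + 1) => Euc ι) ℂ
        (∫ w, iteratedFDeriv ℝ (n + 1) (H w) t ∂μ)) t := by
    intro n t
    set L := (continuousMultilinearCurryLeftEquiv ℝ (fun _ : Fin (n + 1) => Euc ι) ℂ) with hL
    have hi : Integrable (fun w => iteratedFDeriv ℝ (n + 1) (H w) t) μ :=
      (hb (n + 1)).mono' (hm (n + 1) t) (Eventually.of_forall fun w => hle (n + 1) w t)
    have e1 : L (∫ w, iteratedFDeriv ℝ (n + 1) (H w) t ∂μ) =
        ∫ w, L (iteratedFDeriv ℝ (n + 1) (H w) t) ∂μ := by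
      have := ContinuousLinearMap.integral_comp_comm (𝕜 := ℝ)
        (E := ContinuousMultilinearMap ℝ (fun _ : Fin (n + 1) => Euc ι) ℂ)
        (Fₗ := Euc ι →L[ℝ] ContinuousMultilinearMap ℝ (fun _ : Fin n => Euc ι) ℂ)
        (L.toContinuousLinearEquiv.toContinuousLinearMap) hi
      exact this.symm
    rw [e1]
    refine hasFDerivAt_integral_of_dominated_of_fderiv_le (s := Set.univ) (bound := b (n + 1))
      (F' := fun t w => L (iteratedFDeriv ℝ (n + 1) (H w) t))
      univ_mem (Eventually.of_forall fun t => hm n t) ((hb n).mono' (hm n t)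
        (Eventually.of_forall fun w => hle n w t))
      (L.continuous.comp_aestronglyMeasurable (hm (n + 1) t))
      (Eventually.of_forall fun w t _ => by
        rw [L.norm_map]
        exact hle (n + 1) w t) (hb (n + 1)) (Eventually.of_forall fun w t _ => ?_)
    have h2 := ((hs w).differentiable_iteratedFDeriv (m := n)
      (by exact_mod_cast ENat.natCast_lt_top n)) t
    have h3 := h2.hasFDerivAt
    rwa [fderiv_iteratedFDeriv] at h3
  induction n with
  | zero =>
    refine ⟨?_, fun t => (hd 0 t).differentiableAt⟩
    ext1 t
    have hi : Integrable (fun w => iteratedFDeriv ℝ 0 (H w) t) μ :=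
      (hb 0).mono' (hm 0 t) (Eventually.of_forall fun w => hle 0 w t)
    ext v
    rw [ContinuousMultilinearMap.integral_apply hi]
    simp
  | succ n ih =>
    refine ⟨?_, fun t => (hd (n + 1) t).differentiableAt⟩
    rw [iteratedFDeriv_succ_eq_comp_left, ih.1]
    ext1 t
    rw [Function.comp_apply, (hd n t).fderiv, LinearIsometryEquiv.symm_apply_apply]

theorem isSmooth_integral [MeasurableSpace Ω] {μ : Measure Ω} {H : Ω → Euc ι → ℂ} {b : ℕ → Ω → ℝ}
    (hs : ∀ w, IsSmooth (H w)) (hb : ∀ n, Integrable (b n) μ)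
    (hm : ∀ n t, AEStronglyMeasurable (fun w => iteratedFDeriv ℝ n (H w) t) μ)
    (hle : ∀ n w t, ‖iteratedFDeriv ℝ n (H w) t‖ ≤ b n w) :
    IsSmooth (fun t => ∫ w, H w t ∂μ) := by
  refine contDiff_of_differentiable_iteratedFDeriv fun n _ => ?_
  have := iteratedFDeriv_integral_eq hs hb hm hle n
  rw [this.1]
  exact this.2

/-- The normalized derivatives whose supremum is the `S_{1/2,h}`-seminorm. -/
def gsCoeff (h : ℝ) (k n : ℕ) (x : Euc ι) : ℝ :=
  ‖x‖ ^ k / (h ^ (k + n) * Real.sqrt (k.factorial * n.factorial))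

theorem gsCoeff_nonneg {h : ℝ} (h0 : 0 < h) (k n : ℕ) (x : Euc ι) : 0 ≤ gsCoeff h k n x := by
  unfold gsCoeff
  positivity

/-- The coordinate functionals of the `S_{1/2,h}`-seminorm. -/
def gsCoord (h : ℝ) (i : ℕ × (Σ n : ℕ, Fin n → Euc ι) × Euc ι) (f : Euc ι → ℂ) : ℂ :=
  ((gsCoeff h i.1 i.2.1.1 i.2.2 * (∏ j, ‖i.2.1.2 j‖)⁻¹ : ℝ) : ℂ) *
    iteratedFDeriv ℝ i.2.1.1 f i.2.2 i.2.1.2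

/-- The operator norm of each derivative is written as a supremum of scalars, which identifies the
seminorm with a sup norm. This is what embeds S_{1/2,h} into an ℓ^∞ space. -/
theorem gsBound_iff {h M : ℝ} (h0 : 0 < h) (hM : 0 ≤ M) {f : Euc ι → ℂ} : GSBound h M f ↔
    ∀ i, ‖gsCoord h i f‖ ≤ M := by
  have key : GSBound h M f ↔ ∀ (k n : ℕ) (x : Euc ι),
      gsCoeff h k n x * ‖iteratedFDeriv ℝ n f x‖ ≤ M := by
    refine forall_congr' fun k => forall_congr' fun n => forall_congr' fun x => ?_
    rw [gsCoeff, div_mul_eq_mul_div, div_le_iff₀ (by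
      have := k.factorial_pos
      have := n.factorial_pos
      positivity)]
  rw [key]
  constructor
  · rintro H ⟨k, ⟨n, v⟩, x⟩
    refine le_trans ?_ (H k n x)
    have hv : 0 ≤ ∏ j, ‖v j‖ := Finset.prod_nonneg fun _ _ => norm_nonneg _
    have hc := gsCoeff_nonneg h0 k n x
    rw [gsCoord, norm_mul, Complex.norm_real, Real.norm_of_nonneg (by positivity), mul_assoc]
    refine mul_le_mul_of_nonneg_left ?_ hc
    calc (∏ j, ‖v j‖)⁻¹ * ‖iteratedFDeriv ℝ n f x v‖
        ≤ (∏ j, ‖v j‖)⁻¹ * (‖iteratedFDeriv ℝ n f x‖ * ∏ j, ‖v j‖) := by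
          gcongr
          exact (iteratedFDeriv ℝ n f x).le_opNorm v
      _ = ‖iteratedFDeriv ℝ n f x‖ * ((∏ j, ‖v j‖)⁻¹ * ∏ j, ‖v j‖) := by ring
      _ ≤ _ := mul_le_of_le_one_right (norm_nonneg _) inv_mul_le_one
  · intro H k n x
    have hc := gsCoeff_nonneg h0 k n x
    rw [← Real.norm_of_nonneg hc, ← norm_smul]
    refine ContinuousMultilinearMap.opNorm_le_bound hM fun v => ?_
    rcases (Finset.prod_nonneg fun j _ => norm_nonneg (v j) :
      0 ≤ ∏ j, ‖v j‖).eq_or_lt with hv | hv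
    · obtain ⟨j, -, hj⟩ := Finset.prod_eq_zero_iff.mp hv.symm
      rw [smul_apply, (iteratedFDeriv ℝ n f x).map_coord_zero j (norm_eq_zero.mp hj)]
      simp [hv.symm]
    · have := H (k, ⟨n, v⟩, x)
      rw [gsCoord, norm_mul, Complex.norm_real, Real.norm_of_nonneg (by positivity)] at this
      rw [smul_apply, norm_smul, Real.norm_of_nonneg hc, ← div_le_iff₀ hv]
      refine le_of_eq_of_le ?_ this
      simp only [div_eq_mul_inv]
      ring

theorem gsCoord_add {h : ℝ} (i : ℕ × (Σ n : ℕ, Fin n → Euc ι) × Euc ι) (f g : GS ι) :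
    gsCoord h i ((f + g : GS ι) : Euc ι → ℂ) = gsCoord h i f + gsCoord h i g := by
  have : iteratedFDeriv ℝ i.2.1.1 ((f : Euc ι → ℂ) + (g : Euc ι → ℂ)) i.2.2 = _ :=
    iteratedFDeriv_add_apply ((f.2.1.of_le (nat_le_smooth _)).contDiffAt)
      ((g.2.1.of_le (nat_le_smooth _)).contDiffAt)
  rw [gsCoord, Submodule.coe_add, this, add_apply, mul_add]
  rfl

theorem gsCoord_smul {h : ℝ} (i : ℕ × (Σ n : ℕ, Fin n → Euc ι) × Euc ι) (c : ℂ) (f : GS ι) :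
    gsCoord h i ((c • f : GS ι) : Euc ι → ℂ) = c * gsCoord h i f := by
  have : iteratedFDeriv ℝ i.2.1.1 (c • (f : Euc ι → ℂ)) i.2.2 = _ :=
    iteratedFDeriv_const_smul_apply ((f.2.1.of_le (nat_le_smooth _)).contDiffAt)
  rw [gsCoord, Submodule.coe_smul, this, smul_apply, smul_eq_mul,
    mul_left_comm]
  rfl

/-- The ambient Banach space for `S_{1/2,h}`. -/
abbrev GSAmbient (ι : Type) [Fintype ι] : Type :=
  lp (fun _ : ℕ × (Σ n : ℕ, Fin n → Euc ι) × Euc ι => ℂ) ∞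

/-- The subspace `S_{1/2,h}` of `S_{1/2}`. -/
def gsBanach (ι : Type) [Fintype ι] {h : ℝ} (_h0 : 0 < h) : Submodule ℂ (GS ι) where
  carrier := {f | ∃ M, GSBound h M (f : Euc ι → ℂ)}
  zero_mem' := ⟨0, fun k n x => by simp⟩
  add_mem' := by
    rintro f g ⟨M, hM⟩ ⟨N, hN⟩
    exact ⟨M + N, hM.add hN f.2.1 g.2.1⟩
  smul_mem' := by
    rintro c f ⟨M, hM⟩
    exact ⟨‖c‖ * M, hM.const_mul f.2.1 c⟩

/-- The embedding of `S_{1/2,h}` into its ambient Banach space. -/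
def gsEmbed {h : ℝ} (h0 : 0 < h) : gsBanach ι h0 →ₗ[ℂ] GSAmbient ι where
  toFun f := ⟨fun i => gsCoord h i ((f : GS ι) : Euc ι → ℂ), memℓp_infty (by
        obtain ⟨M, hM⟩ := f.2
        refine ⟨M, ?_⟩
        rintro _ ⟨i, rfl⟩
        exact (gsBound_iff h0 hM.nonneg).mp hM _)⟩
  map_add' f g := by
    ext i
    exact gsCoord_add i f g
  map_smul' c f := by
    ext i
    exact gsCoord_smul i c f

theorem gsEmbed_apply {h : ℝ} (h0 : 0 < h) (f : gsBanach ι h0) (i) :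
    gsEmbed h0 f i = gsCoord h i ((f : GS ι) : Euc ι → ℂ) := rfl

theorem gsEmbed_sub {h : ℝ} (h0 : 0 < h) (f g : gsBanach ι h0) :
    gsEmbed h0 (f - g) = gsEmbed h0 f - gsEmbed h0 g := by
  exact map_sub (gsEmbed h0) f g

theorem norm_gsEmbed_le {h M : ℝ} (h0 : 0 < h) {f : gsBanach ι h0}
    (hf : GSBound h M ((f : GS ι) : Euc ι → ℂ)) : ‖gsEmbed h0 f‖ ≤ M :=
  lp.norm_le_of_forall_le hf.nonneg fun _ => (gsBound_iff h0 hf.nonneg).mp hf _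

theorem gsBound_norm_gsEmbed {h : ℝ} (h0 : 0 < h) (f : gsBanach ι h0) :
    GSBound h ‖gsEmbed h0 f‖ ((f : GS ι) : Euc ι → ℂ) :=
  (gsBound_iff h0 (norm_nonneg _)).mpr fun i => lp.norm_apply_le_norm (by simp) (gsEmbed h0 f) i

theorem gsEmbed_injective {h : ℝ} (h0 : 0 < h) :
    Function.Injective (gsEmbed h0 : gsBanach ι h0 → GSAmbient ι) := by
  intro f g hfg
  have hf : gsEmbed h0 (f - g) = 0 := by rw [gsEmbed_sub, hfg, sub_self]
  rw [← sub_eq_zero]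
  ext x
  have := gsBound_norm_gsEmbed h0 (f - g) 0 0 x
  rw [hf] at this
  simpa using this

/-- Each element of the dual is, on `S_{1/2,h}`, a bounded functional of the ambient space. -/
theorem exists_ambient_functional {h : ℝ} (h0 : 0 < h) (u : GSDual ι) :
    ∃ l : GSAmbient ι →L[ℂ] ℂ, ∀ f : gsBanach ι h0,
      l (gsEmbed h0 f) = (u : GS ι →ₗ[ℂ] ℂ) (f : GS ι) := by
  obtain ⟨C, hC⟩ := u.2 h h0
  let e := LinearEquiv.ofInjective (gsEmbed (ι := ι) h0) (gsEmbed_injective h0)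
  have he : ∀ y, gsEmbed h0 (e.symm y) = y := fun y => congrArg Subtype.val (e.apply_symm_apply y)
  have he' : ∀ f, ((e f : LinearMap.range (gsEmbed (ι := ι) h0)) : GSAmbient ι) = gsEmbed h0 f :=
    fun f => rfl
  let l₀ : LinearMap.range (gsEmbed (ι := ι) h0) →ₗ[ℂ] ℂ :=
    ((u : GS ι →ₗ[ℂ] ℂ).comp (gsBanach ι h0).subtype).comp e.symm.toLinearMap
  have hl₀ : ∀ y, l₀ y = (u : GS ι →ₗ[ℂ] ℂ) (e.symm y : gsBanach ι h0) := fun y => rfl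
  clear_value e l₀
  -- Hahn–Banach. Once the functional lives on the ambient ℓ^∞ space, Bochner integrals can be taken
  -- there, and completeness of S_{1/2,h} is not needed.
  obtain ⟨l, hl, -⟩ := exists_extension_norm_eq (LinearMap.range (gsEmbed (ι := ι) h0))
    (l₀.mkContinuous C fun y => by
      have h2 := hC _ _ (gsBound_norm_gsEmbed h0 (e.symm y))
      rw [he] at h2
      rw [hl₀]
      exact h2)
  refine ⟨l, fun f => ?_⟩
  have h1 := hl (e f)
  rw [he'] at h1
  refine h1.trans ?_
  change l₀ (e f) = _
  rw [hl₀, LinearEquiv.symm_apply_apply]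

/-- Continuity of a family of functions for the `S_{1/2,h}`-seminorm. -/
def GSContinuous [TopologicalSpace Ω] (h : ℝ) (G : Ω → GS ι) : Prop :=
  ∀ w₀, ∀ ε > 0, ∀ᶠ w in 𝓝 w₀,
    GSBound h ε (fun t => (G w : Euc ι → ℂ) t - (G w₀ : Euc ι → ℂ) t)

theorem GSContinuous.continuous_apply [TopologicalSpace Ω] {h : ℝ} (h0 : 0 < h) {G : Ω → GS ι}
    (hG : GSContinuous h G) (u : GSDual ι) :
    Continuous fun w => (u : GS ι →ₗ[ℂ] ℂ) (G w) := by
  obtain ⟨C, hC⟩ := u.2 h h0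
  rw [continuous_iff_continuousAt]
  intro w₀
  rw [ContinuousAt, Metric.tendsto_nhds]
  intro ε hε
  filter_upwards [hG w₀ (ε / (|C| + 1)) (by positivity)] with w hw
  rw [dist_eq_norm, ← map_sub]
  refine (hC (G w - G w₀) _ hw).trans_lt ?_
  rw [mul_div_assoc', div_lt_iff₀ (by positivity), mul_comm]
  gcongr
  linarith [le_abs_self C]

/-- Synthesis: superpositions of a continuous family in `S_{1/2,h}` belong to `S_{1/2}`, and
distributions may be applied under the integral sign. -/
theorem synthesis [MeasurableSpace Ω] {μ : Measure Ω} [TopologicalSpace Ω] [SecondCountableTopology Ω] [OpensMeasurableSpace Ω]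
    {h : ℝ} (h0 : 0 < h) {G : Ω → GS ι} (hG : GSContinuous h G) {M : Ω → ℝ}
    (hM : ∀ w, GSBound h (M w) (G w : Euc ι → ℂ)) {c : Ω → ℂ} (hc : AEStronglyMeasurable c μ)
    (hi : Integrable (fun w => ‖c w‖ * M w) μ) :
    ∃ f : GS ι, (∀ t, (f : Euc ι → ℂ) t = ∫ w, c w * (G w : Euc ι → ℂ) t ∂μ) ∧
      GSBound h (∫ w, ‖c w‖ * M w ∂μ) (f : Euc ι → ℂ) ∧
      ∀ u : GSDual ι, Integrable (fun w => c w * (u : GS ι →ₗ[ℂ] ℂ) (G w)) μ ∧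
        (u : GS ι →ₗ[ℂ] ℂ) f = ∫ w, c w * (u : GS ι →ₗ[ℂ] ℂ) (G w) ∂μ := by
  obtain ⟨J, hJ, hJc⟩ : ∃ J : Ω → gsBanach ι h0, (∀ w, ((J w : GS ι)) = G w) ∧
      Continuous fun w => gsEmbed h0 (J w) := by
    choose J hJ using fun w => (⟨⟨G w, M w, hM w⟩, rfl⟩ : ∃ g : gsBanach ι h0, (g : GS ι) = G w)
    refine ⟨J, hJ, ?_⟩
    rw [continuous_iff_continuousAt]
    intro w₀
    rw [ContinuousAt, Metric.tendsto_nhds]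
    intro ε hε
    filter_upwards [hG w₀ (ε / 2) (by positivity)] with w hw
    rw [dist_eq_norm, ← gsEmbed_sub]
    have hw' : GSBound h (ε / 2) (((J w - J w₀ : gsBanach ι h0) : GS ι) : Euc ι → ℂ) := by
      rw [Submodule.coe_sub, hJ, hJ]
      exact hw
    exact (norm_gsEmbed_le h0 hw').trans_lt (half_lt_self hε)
  have hJle : ∀ w, ‖gsEmbed h0 (J w)‖ ≤ M w := fun w => norm_gsEmbed_le h0 (by
    rw [hJ]
    exact hM w)
  have hJi : Integrable (fun w => c w • gsEmbed h0 (J w)) μ := by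
    refine hi.mono' (hc.smul hJc.aestronglyMeasurable) (Eventually.of_forall fun w => ?_)
    rw [norm_smul]
    exact mul_le_mul_of_nonneg_left (hJle w) (norm_nonneg _)
  have hsm : ∀ w, IsSmooth (fun t => c w * (G w : Euc ι → ℂ) t) := fun w => (c w • G w).2.1
  have hD : ∀ n w t, iteratedFDeriv ℝ n (fun t => c w * (G w : Euc ι → ℂ) t) t =
      c w • iteratedFDeriv ℝ n (G w : Euc ι → ℂ) t := by
    intro n w t
    change iteratedFDeriv ℝ n (c w • (G w : Euc ι → ℂ)) t = _
    exact iteratedFDeriv_const_smul_apply (((G w).2.1.of_le (nat_le_smooth n)).contDiffAt)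
  have hle : ∀ n w t, ‖iteratedFDeriv ℝ n (fun t => c w * (G w : Euc ι → ℂ) t) t‖ ≤
      ‖c w‖ * M w * (h ^ n * Real.sqrt n.factorial) := by
    intro n w t
    rw [hD, norm_smul, mul_assoc]
    gcongr
    simpa using hM w 0 n t
  have hcont : ∀ n t, Continuous fun w => iteratedFDeriv ℝ n (G w : Euc ι → ℂ) t := by
    intro n t
    rw [continuous_iff_continuousAt]
    intro w₀
    rw [ContinuousAt, Metric.tendsto_nhds]
    intro ε hε
    have hn : 0 < h ^ n * Real.sqrt n.factorial := by
      have := n.factorial_pos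
      positivity
    filter_upwards [hG w₀ (ε / 2 / (h ^ n * Real.sqrt n.factorial)) (by positivity)] with w hw
    have h1 := hw 0 n t
    have h2 : iteratedFDeriv ℝ n (fun t => (G w : Euc ι → ℂ) t - (G w₀ : Euc ι → ℂ) t) t =
        iteratedFDeriv ℝ n (G w : Euc ι → ℂ) t - iteratedFDeriv ℝ n (G w₀ : Euc ι → ℂ) t :=
      iteratedFDeriv_sub_apply (((G w).2.1.of_le (nat_le_smooth n)).contDiffAt)
        (((G w₀).2.1.of_le (nat_le_smooth n)).contDiffAt)
    rw [h2] at h1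
    rw [dist_eq_norm]
    simp only [pow_zero, one_mul, zero_add, Nat.factorial_zero, Nat.cast_one] at h1
    rw [div_mul_cancel₀ _ hn.ne'] at h1
    exact h1.trans_lt (half_lt_self hε)
  have hm : ∀ n t, AEStronglyMeasurable
      (fun w => iteratedFDeriv ℝ n (fun t => c w * (G w : Euc ι → ℂ) t) t) μ := by
    intro n t
    simp_rw [hD]
    exact hc.smul (hcont n t).aestronglyMeasurable
  have hb : ∀ n : ℕ, Integrable (fun w => ‖c w‖ * M w * (h ^ n * Real.sqrt n.factorial)) μ :=
    fun n => hi.mul_const _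
  have hS := isSmooth_integral hsm hb hm hle
  have hform := fun n => (iteratedFDeriv_integral_eq hsm hb hm hle n).1
  have hform' : ∀ n t, iteratedFDeriv ℝ n (fun t => ∫ w, c w * (G w : Euc ι → ℂ) t ∂μ) t =
      ∫ w, c w • iteratedFDeriv ℝ n (G w : Euc ι → ℂ) t ∂μ := by
    intro n t
    rw [hform n]
    exact integral_congr_ae (Eventually.of_forall fun w => hD n w t)
  have hbd : GSBound h (∫ w, ‖c w‖ * M w ∂μ) (fun t => ∫ w, c w * (G w : Euc ι → ℂ) t ∂μ) := by
    intro k n t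
    rw [hform', ← Real.norm_of_nonneg (pow_nonneg (norm_nonneg t) k), ← norm_smul,
      ← integral_smul, ← integral_mul_const]
    refine norm_integral_le_of_norm_le (hi.mul_const _) (Eventually.of_forall fun w => ?_)
    rw [norm_smul, Real.norm_of_nonneg (pow_nonneg (norm_nonneg t) k), norm_smul,
      mul_left_comm, mul_assoc]
    exact mul_le_mul_of_nonneg_left (hM w k n t) (norm_nonneg _)
  obtain ⟨f, hf⟩ : ∃ f : GS ι, (f : Euc ι → ℂ) = fun t => ∫ w, c w * (G w : Euc ι → ℂ) t ∂μ :=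
    ⟨⟨_, hS, h, h0, _, hbd⟩, rfl⟩
  rw [← hf] at hbd hform'
  refine ⟨f, fun t => congrFun hf t, hbd, fun u => ?_⟩
  obtain ⟨l, hl⟩ := exists_ambient_functional h0 u
  have e1 : ∀ w, c w * (u : GS ι →ₗ[ℂ] ℂ) (G w) = l (c w • gsEmbed h0 (J w)) := by
    intro w
    rw [map_smul, hl, smul_eq_mul, hJ]
  simp_rw [e1]
  refine ⟨l.integrable_comp hJi, ?_⟩
  -- It remains to see that the Bochner integral in the ambient space is the image of f; this is
  -- checked coordinate by coordinate, by differentiating under the integral.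
  rw [l.integral_comp_comm hJi, ← hl ⟨f, _, hbd⟩]
  congr 1
  ext i
  have e2 : (∫ w, c w • gsEmbed h0 (J w) ∂μ : GSAmbient ι) i =
      ∫ w, c w * gsCoord h i (G w : Euc ι → ℂ) ∂μ := by
    rw [show (∫ w, c w • gsEmbed h0 (J w) ∂μ : GSAmbient ι) i =
      lp.evalCLM ℂ (fun _ => ℂ) ∞ i (∫ w, c w • gsEmbed h0 (J w) ∂μ) from rfl,
      ← ContinuousLinearMap.integral_comp_comm _ hJi]
    refine integral_congr_ae (Eventually.of_forall fun w => ?_)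
    change c w * gsCoord h i ((J w : GS ι) : Euc ι → ℂ) = _
    rw [hJ]
  rw [e2, gsEmbed_apply]
  obtain ⟨k, ⟨n, v⟩, x⟩ := i
  simp only [gsCoord]
  have hI : Integrable (fun w => c w • iteratedFDeriv ℝ n (G w : Euc ι → ℂ) x) μ := by
    refine (hb n).mono' ((hm n x).congr (Eventually.of_forall fun w => hD n w x))
      (Eventually.of_forall fun w => ?_)
    have := hle n w x
    rwa [hD] at this
  rw [hform', ContinuousMultilinearMap.integral_apply hI, ← integral_const_mul]
  refine integral_congr_ae (Eventually.of_forall fun w => ?_)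
  simp only [smul_apply, smul_eq_mul]
  ring

end Synthesis

/-! ### Gabor analysis: continuity of shifts, decay of coefficients, inversion -/

section TimeFrequency
variable {ι : Type} [Fintype ι]

/-- Time-frequency shifts act on `S_{1/2}`. -/
def tfGS (g : GS ι) (z : Euc ι × Euc ι) : GS ι :=
  ⟨tfShift g z, IsSmooth.tfShift g.2.1 z, by
    obtain ⟨-, h, h0, M, hM⟩ := g.2
    exact ⟨h + 2 * 1, by positivity, _, hM.tfShift h0 one_pos g.2.1 z⟩⟩

theorem coe_tfGS (g : GS ι) (z : Euc ι × Euc ι) : (tfGS g z : Euc ι → ℂ) = tfShift g z := rfl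

/-- The time-frequency shifts of the Gaussian window. -/
def gsPi (z : Euc ι × Euc ι) : GS ι := tfGS (gaussGS ι) z

theorem gsPi_apply (z : Euc ι × Euc ι) (t : Euc ι) :
    (gsPi z : Euc ι → ℂ) t = modul z.2 t * gaussWindow (t - z.1) := rfl

theorem stft_eq (u : GSDual ι) (z : Euc ι × Euc ι) :
    stft u z = fourierConst ι * (u : GS ι →ₗ[ℂ] ℂ) (gsPi z) := by
  have : (fun y => starRingEnd ℂ (gaussWindow (y - z.1)) *
      Complex.exp (-Complex.I * (inner ℝ y z.2 : ℝ))) = (gsPi z : Euc ι → ℂ) := by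
    ext t
    rw [gsPi_apply, mul_comm, modul, gaussWindow, Complex.conj_ofReal]
  rw [stft, this, GSDual.eval, dif_pos (gsPi z).2]

theorem GSContinuous.weaken {Ω : Type} [TopologicalSpace Ω] {h h' : ℝ} (h0 : 0 < h) (hh : h ≤ h')
    {G : Ω → GS ι} (hG : GSContinuous h G) : GSContinuous h' G := fun w₀ ε hε =>
  (hG w₀ ε hε).mono fun _ hw => hw.weaken h0 hh

theorem GSContinuous.comp {Ω Ω' : Type} [TopologicalSpace Ω] [TopologicalSpace Ω'] {h : ℝ}
    {G : Ω → GS ι} (hG : GSContinuous h G) {s : Ω' → Ω} (hs : Continuous s) :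
    GSContinuous h (fun w => G (s w)) := fun w₀ ε hε =>
  hs.continuousAt.eventually (hG (s w₀) ε hε)

/-- After removal of the modulation at z₀, the difference of two shifts is (e^{-i⟨t,w₂⟩} - 1) k₀(t -
w₁) + (k₀(t - w₁) - k₀(t)), and both parts are O(‖w₁‖ + ‖w₂‖). The parameter passes through h + 1, h
+ 2 and 2(h + 3), and one more modulation gives 2h + 7. -/
theorem gsContinuous_tfGS {h M : ℝ} (h0 : 0 < h) {g : GS ι} (hg : GSBound h M (g : Euc ι → ℂ)) :
    GSContinuous (2 * h + 7) (tfGS g) := by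
  intro z₀ ε hε
  set k₀ : Euc ι → ℂ := fun t => (g : Euc ι → ℂ) (t - z₀.1) with hk₀
  have s₀ : IsSmooth k₀ := IsSmooth.translate g.2.1 z₀.1
  have b₀ : GSBound (h + 1) (Real.exp (‖z₀.1‖ ^ 2 / (2 * 1 ^ 2)) * M) k₀ :=
    hg.translate h0 one_pos z₀.1
  set M₀ := Real.exp (‖z₀.1‖ ^ 2 / (2 * 1 ^ 2)) * M
  have hM₀ := b₀.nonneg
  set M₁ := Real.exp (1 / 2) * M₀
  set E := Real.exp (‖z₀.2‖ ^ 2 / (2 * 1 ^ 2))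
  have key : ∀ w : Euc ι × Euc ι, ‖w.1‖ ≤ 1 → ‖w.2‖ ≤ 1 →
      GSBound (2 * h + 7) (E * (‖w.2‖ * (M₁ * (h + 2 + 1)) +
        ‖w.1‖ * (Real.exp 1 * M₀ * (h + 1 + 1))))
        (fun t => tfShift g (z₀ + w) t - tfShift g z₀ t) := by
    intro w hw1 hw2
    have s₁ : IsSmooth (fun t => k₀ (t - w.1)) := s₀.translate w.1
    have b₁ : GSBound (h + 2) M₁ (fun t => k₀ (t - w.1)) := by
      have := b₀.translate (by positivity) one_pos w.1
      rw [show h + 1 + 1 = h + 2 by ring] at this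
      refine this.mono (by positivity) ?_
      simp only [M₁]
      gcongr
      · exact pow_le_one₀ (norm_nonneg _) hw1
      · norm_num
    have b₂ := (b₁.modul_sub_one (by positivity) s₁ hw2).weaken (by positivity)
      (show 2 * (h + 2 + 1) ≤ 2 * h + 6 by linarith)
    have b₃ := (b₀.translate_sub (by positivity) s₀ hw1).weaken (by positivity)
      (show 2 * (h + 1 + 1) ≤ 2 * h + 6 by linarith)
    have s₂ : IsSmooth (fun t => (modul w.2 t - 1) * k₀ (t - w.1)) :=
      ((isSmooth_modul w.2).sub contDiff_const).mul s₁
    have s₃ : IsSmooth (fun t => k₀ (t - w.1) - k₀ t) := s₁.sub s₀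
    have b₄ := (b₂.add b₃ s₂ s₃).modulate (by positivity) one_pos (s₂.add s₃) z₀.2
    rw [show 2 * h + 6 + 1 = 2 * h + 7 by ring] at b₄
    convert b₄ using 1
    ext t
    simp only [tfShift, Prod.snd_add, Prod.fst_add, modul_add, hk₀]
    rw [show t - (z₀.1 + w.1) = t - w.1 - z₀.1 by abel]
    ring
  have hlim : Tendsto (fun z : Euc ι × Euc ι => E * (‖(z - z₀).2‖ * (M₁ * (h + 2 + 1)) +
        ‖(z - z₀).1‖ * (Real.exp 1 * M₀ * (h + 1 + 1)))) (𝓝 z₀) (𝓝 0) := by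
    have : Continuous (fun z : Euc ι × Euc ι => E * (‖(z - z₀).2‖ * (M₁ * (h + 2 + 1)) +
        ‖(z - z₀).1‖ * (Real.exp 1 * M₀ * (h + 1 + 1)))) := by fun_prop
    simpa using this.tendsto z₀
  have h1 : ∀ᶠ z in 𝓝 z₀, ‖(z - z₀).1‖ ≤ 1 := by
    have : Continuous (fun z : Euc ι × Euc ι => ‖(z - z₀).1‖) := by fun_prop
    exact (this.tendsto z₀).eventually_le_const (by simp)
  have h2 : ∀ᶠ z in 𝓝 z₀, ‖(z - z₀).2‖ ≤ 1 := by
    have : Continuous (fun z : Euc ι × Euc ι => ‖(z - z₀).2‖) := by fun_prop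
    exact (this.tendsto z₀).eventually_le_const (by simp)
  filter_upwards [h1, h2, hlim.eventually_le_const hε] with z hz1 hz2 hz3
  have := (key (z - z₀) hz1 hz2).mono (by positivity) hz3
  rwa [add_sub_cancel] at this

theorem gsContinuous_gsPi : GSContinuous 15 (gsPi : Euc ι × Euc ι → GS ι) := by
  have := gsContinuous_tfGS (by norm_num) (g := gaussGS ι) gsBound_gaussWindow
  norm_num at this
  exact this

theorem continuous_apply_gsPi (u : GSDual ι) :
    Continuous fun z => (u : GS ι →ₗ[ℂ] ℂ) (gsPi z) :=
  gsContinuous_gsPi.continuous_apply (by norm_num) u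

theorem continuous_stft (u : GSDual ι) : Continuous (stft u) := by
  have : stft u = fun z => fourierConst ι * (u : GS ι →ₗ[ℂ] ℂ) (gsPi z) := funext (stft_eq u)
  rw [this]
  exact continuous_const.mul (continuous_apply_gsPi u)

/-- The Gabor coefficients `∫ g(t) φ(t - x) e ^ (i⟨t,ξ⟩) dt`. -/
def gsHat (g : GS ι) (z : Euc ι × Euc ι) : ℂ :=
  (g.toDual : GS ι →ₗ[ℂ] ℂ) (gsPi (z.1, -z.2))

theorem toDual_apply (f g : GS ι) :
    (f.toDual : GS ι →ₗ[ℂ] ℂ) g = ∫ t, (f : Euc ι → ℂ) t * (g : Euc ι → ℂ) t := rfl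

theorem gsHat_eq (g : GS ι) (z : Euc ι × Euc ι) : gsHat g z =
    ∫ t, (g : Euc ι → ℂ) t * (modul (-z.2) t * gaussWindow (t - z.1)) := rfl

theorem continuous_gsHat (g : GS ι) : Continuous (gsHat g) :=
  (continuous_apply_gsPi g.toDual).comp (by fun_prop)

theorem integrable_exp_neg_mul_sq_norm {b : ℝ} (hb : 0 < b) :
    Integrable (fun t : Euc ι => Real.exp (-b * ‖t‖ ^ 2)) := by
  have := (GaussianFourier.integrable_cexp_neg_mul_sq_norm_add (V := Euc ι) (b := b)
    (by simpa using hb) 0 0).norm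
  refine this.congr (Eventually.of_forall fun t => ?_)
  simp only [zero_mul, add_zero, Complex.norm_exp]
  congr 1
  norm_cast

/-- The windowed function whose Fourier transform gives the Gabor coefficients. -/
def windowed (g : GS ι) (x t : Euc ι) : ℂ := (g : Euc ι → ℂ) t * gaussWindow (t - x)

theorem isSmooth_windowed (g : GS ι) (x : Euc ι) : IsSmooth (windowed g x) :=
  ContDiff.mul g.2.1 (isSmooth_gaussWindow.translate x)

theorem gsHat_eq_fourier (g : GS ι) (z : Euc ι × Euc ι) :
    gsHat g z = FourierTransform.fourier (windowed g z.1) (-(2 * Real.pi)⁻¹ • z.2) := by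
  rw [gsHat_eq, Real.fourier_eq']
  refine integral_congr_ae (Eventually.of_forall fun t => ?_)
  have hpi := Real.pi_ne_zero
  simp only [windowed, modul, smul_eq_mul, inner_smul_right, inner_neg_right]
  rw [show -2 * Real.pi * (-(2 * Real.pi)⁻¹ * inner ℝ t z.2) = inner ℝ t z.2 by field_simp]
  rw [show -Complex.I * ((-inner ℝ t z.2 : ℝ) : ℂ) = ((inner ℝ t z.2 : ℝ) : ℂ) * Complex.I by
    push_cast; ring]
  ring

/-- Both factors have Gaussian decay, in t and in t - x; by ‖x‖² ≤ 2‖t‖² + 2‖t - x‖² their product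
decays in x and in t separately. -/
theorem exists_windowed_bound {h : ℝ} (h0 : 0 < h) : ∃ κ > 0, ∃ c ≥ 0, ∀ (g : GS ι) (M : ℝ),
    GSBound h M (g : Euc ι → ℂ) → ∀ (n : ℕ) (x t : Euc ι),
      ‖iteratedFDeriv ℝ n (windowed g x) t‖ ≤ c * M * ((h + 4) ^ n * Real.sqrt n.factorial) *
        Real.exp (-κ * ‖x‖ ^ 2) * Real.exp (-κ * ‖t‖ ^ 2) := by
  set κ := min (1 / (4 * h ^ 2)) (1 / 64) with hκ
  have hκ0 : 0 < κ := lt_min (by positivity) (by norm_num)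
  set c : ℝ := Real.pi ^ (-(Fintype.card ι : ℝ) / 4)
  have hc0 : 0 ≤ c := by positivity
  refine ⟨κ / 4, by positivity, 4 * c, by positivity, fun g M hg n x t => ?_⟩
  have hM := hg.nonneg
  have h1 : ∀ j, ‖iteratedFDeriv ℝ j (g : Euc ι → ℂ) t‖ ≤
      2 * M * Real.exp (-(κ * ‖t‖ ^ 2)) * (h ^ j * Real.sqrt j.factorial) := by
    intro j
    refine (hg.norm_iteratedFDeriv_le h0 j t).trans ?_
    calc _ ≤ 2 * (M * (h ^ j * Real.sqrt j.factorial)) * Real.exp (-(κ * ‖t‖ ^ 2)) := by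
          gcongr
          rw [div_eq_mul_one_div, mul_comm]
          gcongr
          exact min_le_left _ _
      _ = _ := by ring
  have h2 : ∀ j, ‖iteratedFDeriv ℝ j (fun t => (gaussWindow (t - x) : ℂ)) t‖ ≤
      2 * c * Real.exp (-(κ * ‖t - x‖ ^ 2)) * (4 ^ j * Real.sqrt j.factorial) := by
    intro j
    rw [iteratedFDeriv_comp_sub]
    refine (gsBound_gaussWindow.norm_iteratedFDeriv_le (by norm_num) j (t - x)).trans ?_
    calc _ ≤ 2 * (c * (4 ^ j * Real.sqrt j.factorial)) * Real.exp (-(κ * ‖t - x‖ ^ 2)) := by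
          gcongr
          rw [div_eq_mul_one_div, mul_comm]
          gcongr
          refine (min_le_right _ _).trans ?_
          norm_num
      _ = _ := by ring
  have h3 := norm_iteratedFDeriv_mul_le_of_le g.2.1 (isSmooth_gaussWindow.translate x) h0.le
    (by norm_num) (by positivity) h1 h2 n
  refine h3.trans ?_
  have h4 : ‖x‖ ^ 2 ≤ 2 * ‖t‖ ^ 2 + 2 * ‖t - x‖ ^ 2 := by
    have : ‖x‖ ≤ ‖t‖ + ‖t - x‖ := by
      have := norm_sub_le t (t - x)
      rwa [sub_sub_cancel] at this
    nlinarith [norm_nonneg x, norm_nonneg t, norm_nonneg (t - x), sq_nonneg (‖t‖ - ‖t - x‖)]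
  calc _ = 4 * c * M * ((h + 4) ^ n * Real.sqrt n.factorial) *
        (Real.exp (-(κ * ‖t‖ ^ 2)) * Real.exp (-(κ * ‖t - x‖ ^ 2))) := by ring
    _ ≤ 4 * c * M * ((h + 4) ^ n * Real.sqrt n.factorial) *
        (Real.exp (-(κ / 4) * ‖x‖ ^ 2) * Real.exp (-(κ / 4) * ‖t‖ ^ 2)) := by
        rw [← Real.exp_add, ← Real.exp_add]
        refine mul_le_mul_of_nonneg_left (Real.exp_le_exp.mpr ?_) (by positivity)
        nlinarith [mul_le_mul_of_nonneg_left h4 hκ0.le, mul_nonneg hκ0.le (sq_nonneg ‖t‖),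
          mul_nonneg hκ0.le (sq_nonneg ‖t - x‖)]
    _ = _ := by ring

/-- Gaussian decay of the Gabor coefficients. -/
theorem exists_norm_gsHat_le {h : ℝ} (h0 : 0 < h) : ∃ ε > 0, ∃ C ≥ 0, ∀ (g : GS ι) (M : ℝ),
    GSBound h M (g : Euc ι → ℂ) → ∀ z : Euc ι × Euc ι,
      ‖gsHat g z‖ ≤ C * M * Real.exp (-ε * (‖z.1‖ ^ 2 + ‖z.2‖ ^ 2)) := by
  obtain ⟨κ, hκ, c, hc, hb⟩ := exists_windowed_bound (ι := ι) h0
  set I : ℝ := ∫ t : Euc ι, Real.exp (-κ * ‖t‖ ^ 2) with hI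
  have hI0 : 0 ≤ I := integral_nonneg fun t => (Real.exp_pos _).le
  set K : ℝ := 4 * (h + 4) with hK
  have hK0 : 0 < K := by positivity
  set ε := min κ (1 / (16 * Real.pi ^ 2 * K ^ 2)) with hε
  have hε0 : 0 < ε := lt_min hκ (by positivity)
  refine ⟨ε, hε0, 2 * (c * I), by positivity, fun g M hg z => ?_⟩
  have hM := hg.nonneg
  set B := c * M * Real.exp (-κ * ‖z.1‖ ^ 2) * I with hB
  have hB0 : 0 ≤ B := by positivity
  have hint : ∀ n : ℕ, Integrable (fun t => ‖iteratedFDeriv ℝ n (windowed g z.1) t‖) ∧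
      ∫ t, ‖iteratedFDeriv ℝ n (windowed g z.1) t‖ ≤ B * ((h + 4) ^ n * Real.sqrt n.factorial) := by
    intro n
    have h1 := (integrable_exp_neg_mul_sq_norm (ι := ι) hκ).const_mul
      (c * M * ((h + 4) ^ n * Real.sqrt n.factorial) * Real.exp (-κ * ‖z.1‖ ^ 2))
    have h2 : ∀ t, ‖iteratedFDeriv ℝ n (windowed g z.1) t‖ ≤ _ := hb g M hg n z.1
    have h3 : Integrable (fun t => ‖iteratedFDeriv ℝ n (windowed g z.1) t‖) := by
      refine h1.mono' ?_ (Eventually.of_forall fun t => by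
        rw [norm_norm]
        exact h2 t)
      exact ((isSmooth_windowed g z.1).continuous_iteratedFDeriv
        (nat_le_smooth n)).norm.aestronglyMeasurable
    refine ⟨h3, (integral_mono h3 h1 h2).trans_eq ?_⟩
    rw [integral_const_mul, hB]
    ring
  set w : Euc ι := -(2 * Real.pi)⁻¹ • z.2 with hw
  -- Moments of a Fourier transform are bounded by L¹-norms of derivatives, and factorial bounds on
  -- all moments mean Gaussian decay in frequency. The decay in position is already contained in B;
  -- K absorbs the number n + 1 ≤ 2^n of terms.
  have hpow : ∀ n : ℕ, ‖w‖ ^ n * ‖gsHat g z‖ ≤ B * (K ^ n * Real.sqrt n.factorial) := by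
    intro n
    have h1 := Real.pow_mul_norm_iteratedFDeriv_fourier_le (K := 0) (N := ⊤)
      (isSmooth_windowed g z.1) (fun k m hk _ => by
        have : k = 0 := by simpa using hk
        subst this
        simpa using (hint m).1) (k := 0) (n := n) (by simp) le_top w
    rw [norm_iteratedFDeriv_zero, ← gsHat_eq_fourier, Finset.range_one,
      Finset.singleton_product, Finset.sum_map] at h1
    refine h1.trans ?_
    have h2 : ∀ j ∈ Finset.range (n + 1), ∫ v, ‖v‖ ^ 0 * ‖iteratedFDeriv ℝ j (windowed g z.1) v‖ ≤
        B * ((h + 4) ^ n * Real.sqrt n.factorial) := by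
      intro j hj
      simp only [pow_zero, one_mul]
      have hj' : j ≤ n := Finset.mem_range_succ_iff.mp hj
      refine (hint j).2.trans ?_
      gcongr
      linarith
    calc _ ≤ (2 * Real.pi) ^ 0 * (2 * ((0 : ℕ) : ℝ) + 2) ^ n *
          ∑ _j ∈ Finset.range (n + 1), B * ((h + 4) ^ n * Real.sqrt n.factorial) := by
          gcongr with j hj
          exact h2 j hj
      _ = B * (2 ^ n * ((n + 1 : ℕ) : ℝ) * (h + 4) ^ n * Real.sqrt n.factorial) := by
          rw [Finset.sum_const, Finset.card_range, nsmul_eq_mul]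
          simp
          ring
      _ ≤ B * (2 ^ n * 2 ^ n * (h + 4) ^ n * Real.sqrt n.factorial) := by
          gcongr
          have : n + 1 ≤ 2 ^ n := Nat.lt_two_pow_self
          exact_mod_cast this
      _ = _ := by
          rw [hK, mul_pow, ← mul_pow 2 2]
          norm_num
  have h5 := mul_exp_le_of_pow_mul_le hK0 hpow hB0
  have h6 : ‖w‖ ^ 2 / (4 * K ^ 2) = 1 / (16 * Real.pi ^ 2 * K ^ 2) * ‖z.2‖ ^ 2 := by
    rw [hw, norm_smul, norm_neg, norm_inv, Real.norm_of_nonneg (by positivity)]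
    have := Real.pi_ne_zero
    field_simp
    ring
  rw [h6, ← le_div_iff₀ (Real.exp_pos _), div_eq_mul_inv, ← Real.exp_neg] at h5
  refine h5.trans ?_
  calc 2 * B * Real.exp (-(1 / (16 * Real.pi ^ 2 * K ^ 2) * ‖z.2‖ ^ 2))
      = 2 * (c * I) * M * (Real.exp (-κ * ‖z.1‖ ^ 2) *
        Real.exp (-(1 / (16 * Real.pi ^ 2 * K ^ 2) * ‖z.2‖ ^ 2))) := by
        rw [hB]
        ring
    _ ≤ 2 * (c * I) * M * Real.exp (-ε * (‖z.1‖ ^ 2 + ‖z.2‖ ^ 2)) := by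
        rw [← Real.exp_add]
        gcongr
        have e1 : ε * ‖z.1‖ ^ 2 ≤ κ * ‖z.1‖ ^ 2 := by gcongr; exact min_le_left _ _
        have e2 : ε * ‖z.2‖ ^ 2 ≤ 1 / (16 * Real.pi ^ 2 * K ^ 2) * ‖z.2‖ ^ 2 := by
          gcongr; exact min_le_right _ _
        linarith

theorem integrable_exp_neg_mul_prod {ε : ℝ} (hε : 0 < ε) : Integrable
    (fun z : Euc ι × Euc ι => Real.exp (-ε * (‖z.1‖ ^ 2 + ‖z.2‖ ^ 2))) := by
  have := (integrable_exp_neg_mul_sq_norm (ι := ι) hε).mul_prod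
    (integrable_exp_neg_mul_sq_norm (ι := ι) hε)
  refine this.congr (Eventually.of_forall fun z => ?_)
  simp only
  rw [← Real.exp_add]
  congr 1
  ring

theorem norm_gsPi_apply (z : Euc ι × Euc ι) (t : Euc ι) :
    ‖(gsPi z : Euc ι → ℂ) t‖ = ‖(gaussWindow (t - z.1) : ℂ)‖ := by
  rw [gsPi_apply, norm_mul, norm_modul, one_mul]

theorem norm_gaussWindow_le (t : Euc ι) :
    ‖(gaussWindow t : ℂ)‖ ≤ Real.pi ^ (-(Fintype.card ι : ℝ) / 4) := gsBound_gaussWindow.norm_le t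

theorem integral_gaussWindow_sq : ∫ t : Euc ι, (gaussWindow t : ℂ) * gaussWindow t = 1 := by
  have h1 : ∀ t : Euc ι, (gaussWindow t : ℂ) * gaussWindow t =
      ((Real.pi ^ (-(Fintype.card ι : ℝ) / 2) * Real.exp (-1 * ‖t‖ ^ 2) : ℝ) : ℂ) := by
    intro t
    rw [gaussWindow, ← Complex.ofReal_mul]
    congr 1
    rw [mul_mul_mul_comm, ← Real.rpow_add Real.pi_pos, ← Real.exp_add]
    congr 2 <;> ring
  simp_rw [h1]
  rw [integral_complex_ofReal, integral_const_mul,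
    GaussianFourier.integral_rexp_neg_mul_sq_norm one_pos, div_one, finrank_euclideanSpace,
    ← Real.rpow_add Real.pi_pos]
  rw [show -(Fintype.card ι : ℝ) / 2 + (Fintype.card ι : ℝ) / 2 = 0 by ring, Real.rpow_zero,
    Complex.ofReal_one]

/-- The normalizing constant of the inversion formula. -/
def tfConst (ι : Type) [Fintype ι] : ℂ := (((2 * Real.pi) ^ Fintype.card ι : ℝ) : ℂ)⁻¹

/-- For fixed x the integral in ξ is Fourier inversion for the windowed function and gives g(t) φ(t
- x)². The integral in x is then ∫ φ² = 1. -/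
theorem gsHat_inversion (g : GS ι) (t : Euc ι) :
    (g : Euc ι → ℂ) t = ∫ z, tfConst ι * gsHat g z * (gsPi z : Euc ι → ℂ) t := by
  obtain ⟨-, h, h0, M, hM⟩ := g.2
  obtain ⟨ε, hε, C, hC, hb⟩ := exists_norm_gsHat_le (ι := ι) h0
  have hM0 := hM.nonneg
  have hle := hb g M hM
  set c : ℝ := Real.pi ^ (-(Fintype.card ι : ℝ) / 4)
  have hcont : Continuous fun z : Euc ι × Euc ι => (gsPi z : Euc ι → ℂ) t := by
    simp only [gsPi_apply, modul]
    have := isSmooth_gaussWindow (ι := ι) |>.continuous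
    fun_prop
  have hint : Integrable fun z => tfConst ι * gsHat g z * (gsPi z : Euc ι → ℂ) t := by
    refine ((integrable_exp_neg_mul_prod (ι := ι) hε).const_mul (‖tfConst ι‖ * (C * M) * c)).mono'
      ((continuous_const.mul (continuous_gsHat g)).mul hcont).aestronglyMeasurable
      (Eventually.of_forall fun z => ?_)
    rw [norm_mul, norm_mul, norm_gsPi_apply]
    calc _ ≤ ‖tfConst ι‖ * (C * M * Real.exp (-ε * (‖z.1‖ ^ 2 + ‖z.2‖ ^ 2))) * c := by
          gcongr
          · exact hle z
          · exact norm_gaussWindow_le _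
      _ = _ := by ring
  rw [Measure.volume_eq_prod] at hint ⊢
  rw [integral_prod _ hint]
  have hpi := Real.pi_pos
  have hinner : ∀ x : Euc ι, ∫ ξ, tfConst ι * gsHat g (x, ξ) * (gsPi (x, ξ) : Euc ι → ℂ) t =
      (g : Euc ι → ℂ) t * (gaussWindow (t - x) * gaussWindow (t - x)) := by
    intro x
    set k : Euc ι → ℂ := fun w => Complex.exp ((2 * Real.pi * inner ℝ w t : ℝ) * Complex.I) •
      FourierTransform.fourier (windowed g x) w
    have e1 : ∀ ξ, tfConst ι * gsHat g (x, ξ) * (gsPi (x, ξ) : Euc ι → ℂ) t =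
        tfConst ι * gaussWindow (t - x) * k (-(2 * Real.pi)⁻¹ • ξ) := by
      intro ξ
      rw [gsHat_eq_fourier, gsPi_apply, modul]
      simp only [k, smul_eq_mul, inner_smul_left, RCLike.conj_to_real]
      rw [show 2 * Real.pi * (-(2 * Real.pi)⁻¹ * inner ℝ ξ t) = -inner ℝ ξ t by field_simp,
        show -Complex.I * ((inner ℝ t ξ : ℝ) : ℂ) = ((-inner ℝ ξ t : ℝ) : ℂ) * Complex.I by
          rw [real_inner_comm]
          push_cast
          ring]
      ring
    simp_rw [e1]
    rw [integral_const_mul, Measure.integral_comp_smul volume k]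
    have e2 : ∫ w, k w = windowed g x t := by
      rw [← Real.fourierInv_eq', Continuous.fourierInv_fourier_eq]
      · exact (isSmooth_windowed g x).continuous
      · obtain ⟨κ, hκ, c', hc', hb'⟩ := exists_windowed_bound (ι := ι) h0
        refine ((integrable_exp_neg_mul_sq_norm (ι := ι) hκ).const_mul
          (c' * M * Real.exp (-κ * ‖x‖ ^ 2))).mono'
          (isSmooth_windowed g x).continuous.aestronglyMeasurable (Eventually.of_forall fun t => ?_)
        simpa using hb' g M hM 0 x t
      · have e3 : ∀ w, FourierTransform.fourier (windowed g x) w =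
            gsHat g (x, -(2 * Real.pi) • w) := by
          intro w
          rw [gsHat_eq_fourier, smul_smul]
          rw [neg_mul_neg, inv_mul_cancel₀ (by positivity), one_smul]
        have e4 : FourierTransform.fourier (windowed g x) =
            fun w => gsHat g (x, -(2 * Real.pi) • w) := funext e3
        rw [e4]
        refine ((integrable_exp_neg_mul_sq_norm (ι := ι) hε).const_mul (C * M)).mono'
          ((continuous_gsHat g).comp (by fun_prop)).aestronglyMeasurable
          (Eventually.of_forall fun w => (hle _).trans ?_)
        refine mul_le_mul_of_nonneg_left (Real.exp_le_exp.mpr ?_) (by positivity)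
        have e7 : ‖-(2 * Real.pi) • w‖ = 2 * Real.pi * ‖w‖ := by
          rw [norm_smul, norm_neg, Real.norm_of_nonneg (by positivity)]
        simp only [e7]
        have : ‖w‖ ≤ 2 * Real.pi * ‖w‖ := le_mul_of_one_le_left (norm_nonneg _)
          (by linarith [Real.pi_gt_three])
        have h5 : ‖w‖ ^ 2 ≤ (2 * Real.pi * ‖w‖) ^ 2 := pow_le_pow_left₀ (norm_nonneg _) this 2
        nlinarith [sq_nonneg ‖x‖]
    rw [e2, finrank_euclideanSpace, windowed, tfConst]
    have e5 : |((-(2 * Real.pi)⁻¹) ^ Fintype.card ι)⁻¹| = (2 * Real.pi) ^ Fintype.card ι := by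
      rw [abs_inv, abs_pow, abs_neg, abs_of_pos (by positivity), inv_pow, inv_inv]
    rw [e5, Complex.real_smul]
    have e6 : (((2 * Real.pi) ^ Fintype.card ι : ℝ) : ℂ) ≠ 0 := by
      rw [Ne, Complex.ofReal_eq_zero]
      positivity
    field_simp
  simp_rw [hinner]
  rw [integral_const_mul, integral_sub_left_eq_self
    (fun y : Euc ι => (gaussWindow y : ℂ) * gaussWindow y) volume t, integral_gaussWindow_sq,
    mul_one]

/-- The choice s² = 1/(2δ) gives the growth rate δ. At the price of a larger h', shifts grow more
slowly than any prescribed Gaussian and can be integrated against Gabor coefficients. -/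
theorem exists_gsBound_tfGS {h M : ℝ} (h0 : 0 < h) {g : GS ι} (hg : GSBound h M (g : Euc ι → ℂ))
    {δ : ℝ} (hδ : 0 < δ) : ∃ h' > 0, GSContinuous h' (tfGS g) ∧
      ∀ z : Euc ι × Euc ι, GSBound h' (Real.exp (δ * (‖z.1‖ ^ 2 + ‖z.2‖ ^ 2)) * M)
        (tfGS g z : Euc ι → ℂ) := by
  set s : ℝ := Real.sqrt (1 / (2 * δ)) with hs
  have hs0 : 0 < s := Real.sqrt_pos.mpr (by positivity)
  have hss : s ^ 2 = 1 / (2 * δ) := Real.sq_sqrt (by positivity)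
  refine ⟨2 * h + 7 + 2 * s, by positivity, (gsContinuous_tfGS h0 hg).weaken (by positivity)
    (by linarith), fun z => ?_⟩
  have := (hg.tfShift h0 hs0 g.2.1 z).weaken (by positivity)
    (show h + 2 * s ≤ 2 * h + 7 + 2 * s by linarith)
  rw [hss] at this
  have e : (‖z.1‖ ^ 2 + ‖z.2‖ ^ 2) / (2 * (1 / (2 * δ))) = δ * (‖z.1‖ ^ 2 + ‖z.2‖ ^ 2) := by
    field_simp
  rw [e] at this
  exact this

/-- The reproducing formula for distributions. -/
theorem apply_eq_integral_gsHat (u : GSDual ι) (g : GS ι) :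
    Integrable (fun z => tfConst ι * gsHat g z * (u : GS ι →ₗ[ℂ] ℂ) (gsPi z)) ∧
    (u : GS ι →ₗ[ℂ] ℂ) g = ∫ z, tfConst ι * gsHat g z * (u : GS ι →ₗ[ℂ] ℂ) (gsPi z) := by
  obtain ⟨-, h, h0, M, hM⟩ := g.2
  obtain ⟨ε, hε, C, hC, hb⟩ := exists_norm_gsHat_le (ι := ι) h0
  have hM0 := hM.nonneg
  obtain ⟨h', h'0, hcont, hbd⟩ := exists_gsBound_tfGS (by norm_num) (g := gaussGS ι)
    gsBound_gaussWindow (half_pos hε)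
  set c : ℝ := Real.pi ^ (-(Fintype.card ι : ℝ) / 4)
  have hcg : Continuous fun z => tfConst ι * gsHat g z := continuous_const.mul (continuous_gsHat g)
  obtain ⟨f, hf, -, hu⟩ := synthesis (μ := volume) h'0 hcont hbd (c := fun z => tfConst ι * gsHat g z)
    hcg.aestronglyMeasurable (by
      refine ((integrable_exp_neg_mul_prod (ι := ι) (half_pos hε)).const_mul
        (‖tfConst ι‖ * (C * M) * c)).mono' ?_ (Eventually.of_forall fun z => ?_)
      · exact (hcg.norm.mul (by fun_prop)).aestronglyMeasurable
      · rw [norm_mul, norm_norm, norm_mul, Real.norm_of_nonneg (by positivity)]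
        calc _ ≤ ‖tfConst ι‖ * (C * M * Real.exp (-ε * (‖z.1‖ ^ 2 + ‖z.2‖ ^ 2))) *
              (Real.exp (ε / 2 * (‖z.1‖ ^ 2 + ‖z.2‖ ^ 2)) * c) := by
              gcongr
              exact hb g M hM z
          _ = ‖tfConst ι‖ * (C * M) * c * (Real.exp (-ε * (‖z.1‖ ^ 2 + ‖z.2‖ ^ 2)) *
              Real.exp (ε / 2 * (‖z.1‖ ^ 2 + ‖z.2‖ ^ 2))) := by ring
          _ = _ := by
              rw [← Real.exp_add]
              congr 2
              ring)
  have : f = g := by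
    ext t
    rw [hf t]
    exact (gsHat_inversion g t).symm
  rw [this] at hu
  exact hu u

end TimeFrequency

/-! ### Coordinates on the doubled space and linear substitutions -/

section PairMaps
variable {ι : Type} [Fintype ι]

@[simp] theorem pairFst_pair (x y : Euc ι) : pairFst (pair x y) = x := rfl
@[simp] theorem pairSnd_pair (x y : Euc ι) : pairSnd (pair x y) = y := rfl

@[simp] theorem pair_fst_snd (z : Euc (ι ⊕ ι)) : pair (pairFst z) (pairSnd z) = z := by
  ext i
  rcases i with i | i <;> rfl

theorem inner_pair (x y x' y' : Euc ι) :
    inner ℝ (pair x y) (pair x' y') = inner ℝ x x' + inner ℝ y y' := by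
  simp [PiLp.inner_apply, Fintype.sum_sum_type, pair]

theorem norm_sq_pair (x y : Euc ι) : ‖pair x y‖ ^ 2 = ‖x‖ ^ 2 + ‖y‖ ^ 2 := by
  rw [← real_inner_self_eq_norm_sq, inner_pair, real_inner_self_eq_norm_sq,
    real_inner_self_eq_norm_sq]

theorem norm_sq_eq_pair (z : Euc (ι ⊕ ι)) : ‖z‖ ^ 2 = ‖pairFst z‖ ^ 2 + ‖pairSnd z‖ ^ 2 := by
  rw [← norm_sq_pair, pair_fst_snd]

theorem norm_pairSnd_le (z : Euc (ι ⊕ ι)) : ‖pairSnd z‖ ≤ ‖z‖ :=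
  le_of_sq_le_sq (by rw [norm_sq_eq_pair z]; nlinarith [sq_nonneg ‖pairFst z‖]) (norm_nonneg _)

@[fun_prop]
theorem continuous_pair : Continuous fun p : Euc ι × Euc ι => pair p.1 p.2 := by
  refine (PiLp.continuous_toLp 2 _).comp (continuous_pi fun i => ?_)
  rcases i with i | i
  · exact (PiLp.continuous_apply 2 _ i).comp continuous_fst
  · exact (PiLp.continuous_apply 2 _ i).comp continuous_snd

theorem Continuous.pair {X : Type} [TopologicalSpace X] {f g : X → Euc ι} (hf : Continuous f)
    (hg : Continuous g) : Continuous fun x => pair (f x) (g x) :=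
  continuous_pair.comp (hf.prodMk hg)

@[fun_prop]
theorem continuous_pairFst : Continuous (pairFst : Euc (ι ⊕ ι) → Euc ι) :=
  (PiLp.continuous_toLp 2 _).comp (continuous_pi fun i => PiLp.continuous_apply 2 _ (Sum.inl i))

@[fun_prop]
theorem continuous_pairSnd : Continuous (pairSnd : Euc (ι ⊕ ι) → Euc ι) :=
  (PiLp.continuous_toLp 2 _).comp (continuous_pi fun i => PiLp.continuous_apply 2 _ (Sum.inr i))

theorem pair_sub (x y x' y' : Euc ι) : pair x y - pair x' y' = pair (x - x') (y - y') := by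
  ext i
  rcases i with i | i <;> rfl

theorem pair_add (x y x' y' : Euc ι) : pair x y + pair x' y' = pair (x + x') (y + y') := by
  ext i
  rcases i with i | i <;> rfl

theorem pairFst_add (z w : Euc (ι ⊕ ι)) : pairFst (z + w) = pairFst z + pairFst w := rfl
theorem pairSnd_add (z w : Euc (ι ⊕ ι)) : pairSnd (z + w) = pairSnd z + pairSnd w := rfl
theorem pairFst_smul (c : ℝ) (z : Euc (ι ⊕ ι)) : pairFst (c • z) = c • pairFst z := rfl
theorem pairSnd_smul (c : ℝ) (z : Euc (ι ⊕ ι)) : pairSnd (c • z) = c • pairSnd z := rfl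

theorem pair_smul (c : ℝ) (x y : Euc ι) : pair (c • x) (c • y) = c • pair x y := by
  ext i
  rcases i with i | i <;> rfl

/-- Matrix multiplication as a linear map. -/
def matLin (A : Matrix ι ι ℝ) : Euc ι →ₗ[ℝ] Euc ι where
  toFun := matVec A
  map_add' x y := by
    ext i
    simp [matVec, Matrix.mulVec_add]
  map_smul' c x := by
    ext i
    simp [matVec, Matrix.mulVec_smul]

theorem matVec_add (A : Matrix ι ι ℝ) (x y : Euc ι) :
    matVec A (x + y) = matVec A x + matVec A y := (matLin A).map_add x y

theorem matVec_sub (A : Matrix ι ι ℝ) (x y : Euc ι) :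
    matVec A (x - y) = matVec A x - matVec A y := (matLin A).map_sub x y

theorem matVec_smul (A : Matrix ι ι ℝ) (c : ℝ) (x : Euc ι) :
    matVec A (c • x) = c • matVec A x := (matLin A).map_smul c x

@[fun_prop]
theorem continuous_matVec (A : Matrix ι ι ℝ) : Continuous (matVec A) :=
  (matLin A).continuous_of_finiteDimensional

theorem exists_norm_matVec_le (A : Matrix ι ι ℝ) : ∃ K ≥ 0, ∀ x, ‖matVec A x‖ ≤ K * ‖x‖ :=
  ⟨‖(matLin A).toContinuousLinearMap‖, norm_nonneg _, fun x =>
    (matLin A).toContinuousLinearMap.le_opNorm x⟩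

theorem inner_matVec (A : Matrix ι ι ℝ) (x y : Euc ι) :
    inner ℝ (matVec A x) y = inner ℝ x (matVec A.transpose y) := by
  simp only [PiLp.inner_apply, matVec, Matrix.mulVec, dotProduct, RCLike.inner_apply,
    conj_trivial, Finset.mul_sum, Finset.sum_mul, Matrix.transpose_apply]
  rw [Finset.sum_comm]
  refine Finset.sum_congr rfl fun i _ => Finset.sum_congr rfl fun j _ => ?_
  ring

theorem matVec_sub_one [DecidableEq ι] (A : Matrix ι ι ℝ) (x : Euc ι) :
    matVec (A - 1) x = matVec A x - x := by
  ext i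
  simp [matVec, Matrix.sub_mulVec]

theorem matVec_one_sub [DecidableEq ι] (A : Matrix ι ι ℝ) (x : Euc ι) :
    matVec (1 - A) x = x - matVec A x := by
  ext i
  simp [matVec, Matrix.sub_mulVec]

theorem gaussWindow_pair (x y : Euc ι) :
    (gaussWindow (pair x y) : ℂ) = gaussWindow x * gaussWindow y := by
  rw [gaussWindow, gaussWindow, gaussWindow, ← Complex.ofReal_mul, norm_sq_pair]
  congr 1
  rw [mul_mul_mul_comm, ← Real.rpow_add Real.pi_pos, ← Real.exp_add, Fintype.card_sum]
  congr 2
  · push_cast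
    ring
  · ring

theorem modul_pair (ξ η x y : Euc ι) : modul (pair ξ η) (pair x y) = modul ξ x * modul η y := by
  rw [modul, modul, modul, ← Complex.exp_add, inner_pair]
  congr 1
  push_cast
  ring

theorem GSBound.comp_clm {κ : Type} [Fintype κ] {h M K : ℝ} {f : Euc κ → ℂ} (hf : GSBound h M f)
    (sf : IsSmooth f) (L : Euc ι →L[ℝ] Euc κ) (hL : ‖L‖ ≤ K)
    (hK : ∀ x, ‖x‖ ≤ K * ‖L x‖) : GSBound (h * K) M (fun x => f (L x)) := by
  intro k n x
  have hK0 : 0 ≤ K := (norm_nonneg _).trans hL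
  have h1 : ‖iteratedFDeriv ℝ n (f ∘ L) x‖ ≤ ‖iteratedFDeriv ℝ n f (L x)‖ * ∏ _i : Fin n, ‖L‖ := by
    rw [L.iteratedFDeriv_comp_right (sf.of_le (nat_le_smooth n)) x le_rfl]
    exact ContinuousMultilinearMap.norm_compContinuousLinearMap_le _ _
  rw [Finset.prod_const, Finset.card_univ, Fintype.card_fin] at h1
  calc ‖x‖ ^ k * ‖iteratedFDeriv ℝ n (f ∘ L) x‖
      ≤ (K * ‖L x‖) ^ k * (‖iteratedFDeriv ℝ n f (L x)‖ * K ^ n) := by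
        gcongr
        · exact hK x
        · refine h1.trans ?_
          gcongr
    _ = K ^ (k + n) * (‖L x‖ ^ k * ‖iteratedFDeriv ℝ n f (L x)‖) := by
        rw [mul_pow, pow_add]
        ring
    _ ≤ K ^ (k + n) * (M * (h ^ (k + n) * Real.sqrt (k.factorial * n.factorial))) := by
        exact mul_le_mul_of_nonneg_left (hf k n (L x)) (by positivity)
    _ = _ := by
        rw [mul_pow]
        ring

theorem GS.exists_comp_linear {κ : Type} [Fintype κ] (f : GS κ) (L : Euc ι →ₗ[ℝ] Euc κ)
    (L' : Euc κ →ₗ[ℝ] Euc ι) (hL : ∀ x, L' (L x) = x) :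
    ∃ g : GS ι, ∀ x, (g : Euc ι → ℂ) x = (f : Euc κ → ℂ) (L x) := by
  obtain ⟨sf, h, h0, M, hM⟩ := f.2
  set K := ‖L.toContinuousLinearMap‖ + ‖L'.toContinuousLinearMap‖ + 1
  have hK : 0 < K := by positivity
  refine ⟨⟨fun x => (f : Euc κ → ℂ) (L x), sf.comp L.toContinuousLinearMap.contDiff, h * K,
    by positivity, M, hM.comp_clm sf L.toContinuousLinearMap (K := K) ?_ fun x => ?_⟩, fun x => rfl⟩
  · linarith [norm_nonneg L'.toContinuousLinearMap]
  · have h1 := L'.toContinuousLinearMap.le_opNorm (L x)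
    have h2 : L'.toContinuousLinearMap (L x) = x := hL x
    rw [h2] at h1
    refine h1.trans ?_
    change _ ≤ K * ‖L x‖
    gcongr
    linarith [norm_nonneg L.toContinuousLinearMap]

end PairMaps

/-! ### The partial Fourier transform on S_{1/2} -/

section PartialFourier
variable {ι : Type} [Fintype ι]

theorem integral_gaussWindow_mul_exp (x ξ : Euc ι) :
    ∫ v : Euc ι, (gaussWindow (v - x) : ℂ) * Complex.exp (Complex.I * (inner ℝ v ξ : ℝ)) =
      (((2 * Real.pi) ^ ((Fintype.card ι : ℝ) / 2) : ℝ) : ℂ) *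
        (Complex.exp (Complex.I * (inner ℝ x ξ : ℝ)) * gaussWindow ξ) := by
  have h1 : ∀ v : Euc ι, (gaussWindow (v - x) : ℂ) * Complex.exp (Complex.I * (inner ℝ v ξ : ℝ)) =
      Complex.exp (Complex.I * (inner ℝ x ξ : ℝ)) * ((gaussWindow (v - x) : ℂ) *
        Complex.exp (Complex.I * (inner ℝ (v - x) ξ : ℝ))) := by
    intro v
    rw [mul_left_comm, ← Complex.exp_add, inner_sub_left]
    congr 2
    push_cast
    ring
  simp_rw [h1]
  rw [integral_const_mul, integral_sub_right_eq_self (fun v : Euc ι => (gaussWindow v : ℂ) *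
        Complex.exp (Complex.I * (inner ℝ v ξ : ℝ))) x, mul_left_comm]
  congr 1
  have h2 : ∀ v : Euc ι, (gaussWindow v : ℂ) * Complex.exp (Complex.I * (inner ℝ v ξ : ℝ)) =
      ((Real.pi ^ (-(Fintype.card ι : ℝ) / 4) : ℝ) : ℂ) *
        Complex.exp (-((1 / 2 : ℝ) : ℂ) * ‖v‖ ^ 2 + Complex.I * (inner ℝ ξ v : ℝ)) := by
    intro v
    rw [gaussWindow_eq, mul_assoc, ← Complex.exp_add, real_inner_comm]
    congr 2
    push_cast
    ring
  simp_rw [h2]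
  rw [integral_const_mul, GaussianFourier.integral_cexp_neg_mul_sq_norm_add (by norm_num),
    finrank_euclideanSpace, gaussWindow_eq]
  have h3 : ((Real.pi : ℂ) / ((1 / 2 : ℝ) : ℂ)) ^ ((Fintype.card ι : ℂ) / 2) =
      (((2 * Real.pi) ^ ((Fintype.card ι : ℝ) / 2) : ℝ) : ℂ) := by
    rw [Complex.ofReal_cpow (by positivity)]
    push_cast
    congr 1
    ring
  rw [h3, mul_left_comm]
  congr 3
  rw [Complex.I_sq]
  push_cast
  ring

/-- Gaussian estimate for windows sliding along one variable. -/
theorem norm_gaussWindow_sub_le (v x : Euc ι) {δ : ℝ} (h0 : 0 ≤ δ) (h1 : δ ≤ 1 / 4) :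
    ‖(gaussWindow (v - x) : ℂ)‖ ≤ Real.pi ^ (-(Fintype.card ι : ℝ) / 4) *
      (Real.exp (-δ * ‖v‖ ^ 2) * Real.exp (2 * δ * ‖x‖ ^ 2)) := by
  rw [gaussWindow_nonneg_real, ← Real.exp_add]
  refine mul_le_mul_of_nonneg_left (Real.exp_le_exp.mpr ?_) (by positivity)
  have h4 : ‖v‖ ^ 2 ≤ 2 * ‖x‖ ^ 2 + 2 * ‖v - x‖ ^ 2 := by
    have : ‖v‖ ≤ ‖x‖ + ‖v - x‖ := by
      have := norm_add_le x (v - x)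
      rwa [add_sub_cancel] at this
    nlinarith [norm_nonneg x, norm_nonneg v, norm_nonneg (v - x), sq_nonneg (‖x‖ - ‖v - x‖)]
  nlinarith [mul_le_mul_of_nonneg_left h4 h0, mul_le_mul_of_nonneg_right h1 (sq_nonneg ‖v - x‖)]

/-- The partial Fourier transform in the second variable maps `S_{1/2}` to itself. -/
theorem GS.exists_partialFourier (F : GS (ι ⊕ ι)) : ∃ G : GS (ι ⊕ ι), ∀ Z,
    (G : Euc (ι ⊕ ι) → ℂ) Z = ∫ v : Euc ι, (F : Euc (ι ⊕ ι) → ℂ) (pair (pairFst Z) v) *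
      Complex.exp (Complex.I * (inner ℝ v (pairSnd Z) : ℝ)) := by
  obtain ⟨-, h, h0, M, hM⟩ := F.2
  have hM0 := hM.nonneg
  obtain ⟨ε, hε, C, hC, hb⟩ := exists_norm_gsHat_le (ι := ι ⊕ ι) h0
  obtain ⟨h', h'0, hcont, hbd⟩ := exists_gsBound_tfGS (by norm_num) (g := gaussGS (ι ⊕ ι))
    gsBound_gaussWindow (half_pos hε)
  -- The transform takes the Gaussian shift at W to a constant and a phase times the shift at s(W):
  -- in the second variable, position and frequency are rotated. As s preserves norms, the growth
  -- estimate for the shifts is unaffected.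
  let s : Euc (ι ⊕ ι) × Euc (ι ⊕ ι) → Euc (ι ⊕ ι) × Euc (ι ⊕ ι) := fun W =>
    (pair (pairFst W.1) (pairSnd W.2), pair (pairFst W.2) (-pairSnd W.1))
  have hs : Continuous s := ((continuous_pairFst.comp continuous_fst).pair
    (continuous_pairSnd.comp continuous_snd)).prodMk ((continuous_pairFst.comp continuous_snd).pair
    (continuous_pairSnd.comp continuous_fst).neg)
  have hsn : ∀ W, ‖(s W).1‖ ^ 2 + ‖(s W).2‖ ^ 2 = ‖W.1‖ ^ 2 + ‖W.2‖ ^ 2 := by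
    intro W
    simp only [s]
    rw [norm_sq_pair, norm_sq_pair, norm_sq_eq_pair W.1, norm_sq_eq_pair W.2, norm_neg]
    ring
  set K : ℂ := (((2 * Real.pi) ^ ((Fintype.card ι : ℝ) / 2) : ℝ) : ℂ) with hK
  let c : Euc (ι ⊕ ι) × Euc (ι ⊕ ι) → ℂ := fun W => tfConst (ι ⊕ ι) * gsHat F W *
    (K * Complex.exp (-Complex.I * (inner ℝ (pairSnd W.1) (pairSnd W.2) : ℝ)))
  have hph : ∀ r : ℝ, ‖Complex.exp (-Complex.I * r)‖ = 1 := fun r => by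
    rw [Complex.norm_exp]
    simp
  have hph' : ∀ r : ℝ, ‖Complex.exp (Complex.I * r)‖ = 1 := fun r => by
    rw [Complex.norm_exp]
    simp
  have hgc := continuous_gsHat F
  have hcc : Continuous c := by
    have h1 : Continuous fun W : Euc (ι ⊕ ι) × Euc (ι ⊕ ι) =>
      (inner ℝ (pairSnd W.1) (pairSnd W.2) : ℝ) := by fun_prop
    fun_prop
  set k₀ : ℝ := Real.pi ^ (-(Fintype.card (ι ⊕ ι) : ℝ) / 4)
  obtain ⟨G, hG, -, -⟩ := synthesis (μ := volume) h'0 (hcont.comp hs) (fun W => hbd (s W)) (c := c)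
    hcc.aestronglyMeasurable (by
      refine ((integrable_exp_neg_mul_prod (ι := ι ⊕ ι) (half_pos hε)).const_mul
        (‖tfConst (ι ⊕ ι)‖ * (C * M) * ‖K‖ * k₀)).mono' ?_ (Eventually.of_forall fun W => ?_)
      · have := hs.norm
        exact (hcc.norm.mul (by fun_prop)).aestronglyMeasurable
      · rw [norm_mul, norm_norm, hsn]
        simp only [c]
        rw [norm_mul, norm_mul, norm_mul, hph, mul_one, Real.norm_of_nonneg (by positivity)]
        calc _ ≤ ‖tfConst (ι ⊕ ι)‖ * (C * M * Real.exp (-ε * (‖W.1‖ ^ 2 + ‖W.2‖ ^ 2))) * ‖K‖ *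
              (Real.exp (ε / 2 * (‖W.1‖ ^ 2 + ‖W.2‖ ^ 2)) * k₀) := by
              gcongr
              exact hb F M hM W
          _ = ‖tfConst (ι ⊕ ι)‖ * (C * M) * ‖K‖ * k₀ *
              (Real.exp (-ε * (‖W.1‖ ^ 2 + ‖W.2‖ ^ 2)) *
              Real.exp (ε / 2 * (‖W.1‖ ^ 2 + ‖W.2‖ ^ 2))) := by ring
          _ = _ := by
              rw [← Real.exp_add]
              congr 2
              ring)
  refine ⟨G, fun Z => ?_⟩
  rw [hG]
  set u := pairFst Z
  set ξ := pairSnd Z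
  have e1 : ∀ v, (F : Euc (ι ⊕ ι) → ℂ) (pair u v) * Complex.exp (Complex.I * (inner ℝ v ξ : ℝ)) =
      ∫ W, tfConst (ι ⊕ ι) * gsHat F W * (gsPi W : Euc (ι ⊕ ι) → ℂ) (pair u v) *
        Complex.exp (Complex.I * (inner ℝ v ξ : ℝ)) := by
    intro v
    rw [integral_mul_const, ← gsHat_inversion]
  simp_rw [e1]
  rw [integral_integral_swap]
  · refine integral_congr_ae (Eventually.of_forall fun W => ?_)
    have e2 : ∀ v, tfConst (ι ⊕ ι) * gsHat F W * (gsPi W : Euc (ι ⊕ ι) → ℂ) (pair u v) *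
        Complex.exp (Complex.I * (inner ℝ v ξ : ℝ)) =
        tfConst (ι ⊕ ι) * gsHat F W * (modul (pairFst W.2) u * gaussWindow (u - pairFst W.1)) *
        (gaussWindow (v - pairSnd W.1) *
          Complex.exp (Complex.I * (inner ℝ v (ξ - pairSnd W.2) : ℝ))) := by
      intro v
      rw [gsPi_apply, ← pair_fst_snd W.1, ← pair_fst_snd W.2, modul_pair, pair_sub,
        gaussWindow_pair]
      simp only [pair_fst_snd]
      rw [inner_sub_right, modul, modul]
      have : Complex.exp (Complex.I * ((inner ℝ v ξ - inner ℝ v (pairSnd W.2) : ℝ) : ℂ)) =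
          Complex.exp (Complex.I * (inner ℝ v ξ : ℝ)) *
            Complex.exp (-Complex.I * (inner ℝ v (pairSnd W.2) : ℝ)) := by
        rw [← Complex.exp_add]
        congr 1
        push_cast
        ring
      rw [this]
      ring
    simp_rw [e2]
    rw [integral_const_mul, integral_gaussWindow_mul_exp]
    simp only [c, s, coe_tfGS, tfShift]
    rw [← pair_fst_snd Z, modul_pair, pair_sub]
    change _ * (_ * (gaussWindow (pair (u - _) (ξ - _)))) = _
    rw [gaussWindow_pair]
    have : Complex.exp (Complex.I * (inner ℝ (pairSnd W.1) (ξ - pairSnd W.2) : ℝ)) =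
        Complex.exp (-Complex.I * (inner ℝ (pairSnd W.1) (pairSnd W.2) : ℝ)) *
          modul (-pairSnd W.1) ξ := by
      rw [modul, ← Complex.exp_add, inner_sub_right, inner_neg_right, real_inner_comm ξ]
      congr 1
      push_cast
      ring
    rw [this, ← hK]
    ring
  -- Fubini requires decay in v. The window provides it around the second component of W.1, and the
  -- cost of recentring is paid from the Gaussian decay in W.
  · set δ := min (ε / 4) (1 / 4) with hδ
    have hδ0 : 0 < δ := lt_min (by positivity) (by norm_num)
    have hI := (integrable_exp_neg_mul_sq_norm (ι := ι) hδ0).mul_prod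
      (integrable_exp_neg_mul_prod (ι := ι ⊕ ι) (half_pos hε))
    set k₁ : ℝ := Real.pi ^ (-(Fintype.card ι : ℝ) / 4)
    refine (hI.const_mul (‖tfConst (ι ⊕ ι)‖ * (C * M) * (k₁ * k₁))).mono' ?_
      (Eventually.of_forall fun p => ?_)
    · refine Continuous.aestronglyMeasurable ?_
      have h1 : Continuous fun p : Euc ι × (Euc (ι ⊕ ι) × Euc (ι ⊕ ι)) =>
          (gsPi p.2 : Euc (ι ⊕ ι) → ℂ) (pair u p.1) := by
        simp only [gsPi_apply, modul]
        have h2 := isSmooth_gaussWindow (ι := ι ⊕ ι) |>.continuous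
        have h3 : Continuous fun p : Euc ι × (Euc (ι ⊕ ι) × Euc (ι ⊕ ι)) => pair u p.1 :=
          continuous_const.pair continuous_fst
        fun_prop
      have h2 : Continuous fun p : Euc ι × (Euc (ι ⊕ ι) × Euc (ι ⊕ ι)) => gsHat F p.2 :=
        hgc.comp continuous_snd
      exact ((continuous_const.mul h2).mul h1).mul (by fun_prop)
    · obtain ⟨v, W⟩ := p
      simp only [Function.uncurry]
      rw [norm_mul, norm_mul, norm_mul, hph', mul_one, norm_gsPi_apply, ← pair_fst_snd W.1, pair_sub,
        gaussWindow_pair, norm_mul, pair_fst_snd]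
      have h2 : ‖(gaussWindow (v - pairSnd W.1) : ℂ)‖ ≤
          k₁ * (Real.exp (-δ * ‖v‖ ^ 2) * Real.exp (ε / 2 * (‖W.1‖ ^ 2 + ‖W.2‖ ^ 2))) := by
        refine (norm_gaussWindow_sub_le _ _ hδ0.le (min_le_right _ _)).trans ?_
        refine mul_le_mul_of_nonneg_left (mul_le_mul_of_nonneg_left (Real.exp_le_exp.mpr ?_)
          (by positivity)) (by positivity)
        have h3 : ‖pairSnd W.1‖ ^ 2 ≤ ‖W.1‖ ^ 2 :=
          pow_le_pow_left₀ (norm_nonneg _) (norm_pairSnd_le _) 2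
        have h4 : δ ≤ ε / 4 := min_le_left _ _
        nlinarith [sq_nonneg ‖pairSnd W.1‖, sq_nonneg ‖W.2‖,
          mul_le_mul_of_nonneg_right h4 (sq_nonneg ‖pairSnd W.1‖)]
      calc _ ≤ ‖tfConst (ι ⊕ ι)‖ * (C * M * Real.exp (-ε * (‖W.1‖ ^ 2 + ‖W.2‖ ^ 2))) *
            (k₁ * (k₁ * (Real.exp (-δ * ‖v‖ ^ 2) *
              Real.exp (ε / 2 * (‖W.1‖ ^ 2 + ‖W.2‖ ^ 2))))) := by
            gcongr
            · exact hb F M hM W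
            · exact norm_gaussWindow_le _
        _ = ‖tfConst (ι ⊕ ι)‖ * (C * M) * (k₁ * k₁) * (Real.exp (-δ * ‖v‖ ^ 2) *
            (Real.exp (-ε * (‖W.1‖ ^ 2 + ‖W.2‖ ^ 2)) *
              Real.exp (ε / 2 * (‖W.1‖ ^ 2 + ‖W.2‖ ^ 2)))) := by ring
        _ = _ := by
            rw [← Real.exp_add (-ε * _)]
            congr 3
            ring

end PartialFourier

/-! ### The matrix of Op_A(a) in the Gabor system -/

section Kernel
variable {ι : Type} [Fintype ι] [DecidableEq ι]

/-- `kernelTranspose A` of the Gaussian belongs to `S_{1/2}`. -/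
theorem exists_kernelTheta (A : Matrix ι ι ℝ) : ∃ Θ : GS (ι ⊕ ι), (Θ : Euc (ι ⊕ ι) → ℂ) =
    kernelTranspose A fun Z => gaussWindow (pairFst Z) * gaussWindow (pairSnd Z) := by
  let L : Euc (ι ⊕ ι) →ₗ[ℝ] Euc (ι ⊕ ι) :=
    { toFun := fun Z => pair (pairFst Z + matVec A (pairSnd Z))
        (pairFst Z + matVec (A - 1) (pairSnd Z))
      map_add' := fun Z W => by
        simp only [pairFst_add, pairSnd_add, matVec_add, pair_add]
        congr 1 <;> abel
      map_smul' := fun c Z => by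
        simp only [pairFst_smul, pairSnd_smul, matVec_smul, ← smul_add, pair_smul, RingHom.id_apply] }
  -- A left inverse of L: v is the difference of the two components, and u is the first component
  -- minus Av. It makes composition with L preserve S_{1/2}, so that Θ_A is the partial Fourier
  -- transform of a Gaussian composed with L.
  let L' : Euc (ι ⊕ ι) →ₗ[ℝ] Euc (ι ⊕ ι) :=
    { toFun := fun Z => pair (pairFst Z - matVec A (pairFst Z - pairSnd Z)) (pairFst Z - pairSnd Z)
      map_add' := fun Z W => by
        simp only [pairFst_add, pairSnd_add, matVec_add, pair_add, matVec_sub]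
        congr 1 <;> abel
      map_smul' := fun c Z => by
        simp only [pairFst_smul, pairSnd_smul, ← smul_sub, matVec_smul, pair_smul,
          RingHom.id_apply] }
  have hL : ∀ Z, L' (L Z) = Z := by
    intro Z
    change pair _ _ = Z
    simp only [L, LinearMap.coe_mk, AddHom.coe_mk, pairFst_pair, pairSnd_pair, matVec_sub_one]
    conv_rhs => rw [← pair_fst_snd Z]
    have : pairFst Z + matVec A (pairSnd Z) - (pairFst Z + (matVec A (pairSnd Z) - pairSnd Z)) =
      pairSnd Z := by abel
    rw [this, add_sub_cancel_right]
  obtain ⟨F, hF⟩ := (gaussGS (ι ⊕ ι)).exists_comp_linear L L' hL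
  obtain ⟨G, hG⟩ := F.exists_partialFourier
  refine ⟨fourierConst ι • G, ?_⟩
  ext Z
  change fourierConst ι * (G : Euc (ι ⊕ ι) → ℂ) Z = _
  rw [hG, kernelTranspose]
  congr 1
  refine integral_congr_ae (Eventually.of_forall fun v => ?_)
  simp only [hF]
  congr 1
  exact gaussWindow_pair _ _

/-- `kernelTranspose A` of the Gaussian. -/
def kernelTheta (A : Matrix ι ι ℝ) : GS (ι ⊕ ι) := (exists_kernelTheta A).choose

theorem kernelTheta_apply (A : Matrix ι ι ℝ) (Z : Euc (ι ⊕ ι)) :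
    (kernelTheta A : Euc (ι ⊕ ι) → ℂ) Z = fourierConst ι * ∫ v : Euc ι,
      (gaussWindow (pairFst Z + matVec A v) * gaussWindow (pairFst Z + matVec (A - 1) v)) *
        Complex.exp (Complex.I * (inner ℝ v (pairSnd Z) : ℝ)) :=
  congrFun (exists_kernelTheta A).choose_spec Z

/-- The phase space point at which the symbol acts between the phase space points `w` and `z`. -/
def kernelPoint (A : Matrix ι ι ℝ) (z w : Euc ι × Euc ι) : Euc (ι ⊕ ι) × Euc (ι ⊕ ι) :=
  (pair (z.1 - matVec A (z.1 - w.1)) (matVec A.transpose z.2 + matVec (1 - A.transpose) w.2),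
    pair (z.2 - w.2) (w.1 - z.1))

/-- The phase produced by moving the kernel to `kernelPoint A z w`. -/
def kernelPhase (A : Matrix ι ι ℝ) (z w : Euc ι × Euc ι) : ℝ :=
  -inner ℝ z.1 z.2 + inner ℝ w.1 w.2 + inner ℝ (z.1 - matVec A (z.1 - w.1)) (z.2 - w.2)

/-- The substitution v → v + (x - y) centres both Gaussians at the same point, and collecting the
exponentials turns the two shifts into one shift of Θ_A and a constant phase. The frequency of the
second factor has its sign changed because the pairing is bilinear. -/
theorem kernelTranspose_gsPi (A : Matrix ι ι ℝ) (z w : Euc ι × Euc ι) (Z : Euc (ι ⊕ ι)) :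
    kernelTranspose A (fun Z => (gsPi z : Euc ι → ℂ) (pairFst Z) *
      (gsPi (w.1, -w.2) : Euc ι → ℂ) (pairSnd Z)) Z =
    Complex.exp (Complex.I * kernelPhase A z w) *
      (tfGS (kernelTheta A) (kernelPoint A z w) : Euc (ι ⊕ ι) → ℂ) Z := by
  obtain ⟨x, ξ⟩ := z
  obtain ⟨y, η⟩ := w
  rw [coe_tfGS, tfShift, kernelTheta_apply, kernelTranspose]
  simp only [pairFst_pair, pairSnd_pair]
  set u := pairFst Z
  set ζ := pairSnd Z
  set u₀ := x - matVec A (x - y) with hu₀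
  set ζ₀ := matVec A.transpose ξ + matVec (1 - A.transpose) η with hζ₀
  have hZ1 : pairFst (Z - (kernelPoint A (x, ξ) (y, η)).1) = u - u₀ := rfl
  have hZ2 : pairSnd (Z - (kernelPoint A (x, ξ) (y, η)).1) = ζ - ζ₀ := rfl
  rw [hZ1, hZ2]
  have hmod : modul (kernelPoint A (x, ξ) (y, η)).2 Z = modul (ξ - η) u * modul (y - x) ζ := by
    rw [← pair_fst_snd Z]
    exact modul_pair _ _ _ _
  rw [hmod, mul_left_comm _ (fourierConst ι), mul_left_comm _ (fourierConst ι),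
    ← integral_add_right_eq_self _ (x - y)]
  congr 1
  rw [← integral_const_mul, ← integral_const_mul]
  refine integral_congr_ae (Eventually.of_forall fun v => ?_)
  simp only [gsPi_apply]
  have e1 : u + matVec A (v + (x - y)) - x = u - u₀ + matVec A v := by
    rw [hu₀, matVec_add]
    abel
  have e2 : u + matVec (A - 1) (v + (x - y)) - y = u - u₀ + matVec (A - 1) v := by
    rw [hu₀, matVec_add, matVec_sub_one, matVec_sub_one]
    abel
  rw [e1, e2]
  have key : modul ξ (u + matVec A (v + (x - y))) * modul (-η) (u + matVec (A - 1) (v + (x - y))) *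
      Complex.exp (Complex.I * (inner ℝ (v + (x - y)) ζ : ℝ)) =
      Complex.exp (Complex.I * kernelPhase A (x, ξ) (y, η)) * (modul (ξ - η) u * modul (y - x) ζ *
        Complex.exp (Complex.I * (inner ℝ v (ζ - ζ₀) : ℝ))) := by
    simp only [modul, ← Complex.exp_add]
    congr 1
    rw [show -Complex.I = Complex.I * ((-1 : ℝ) : ℂ) by push_cast; ring]
    simp only [mul_assoc, ← mul_add, ← Complex.ofReal_mul, ← Complex.ofReal_add]
    congr 2
    rw [hζ₀]
    simp only [kernelPhase, inner_add_left, inner_sub_left, inner_sub_right, inner_neg_right,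
      inner_add_right, matVec_sub_one, matVec_one_sub, matVec_add, matVec_sub, ← inner_matVec,
      real_inner_comm ζ]
    ring
  linear_combination (gaussWindow (u - u₀ + matVec A v) *
    gaussWindow (u - u₀ + matVec (A - 1) v)) * key

theorem exp_phase_norm (r : ℝ) : ‖Complex.exp (Complex.I * r)‖ = 1 := by
  rw [Complex.norm_exp]
  simp

-- With the frequency reflected, the coefficients are the values of f, regarded as a distribution,
-- on the shifts of the Gaussian. These keep their meaning for arbitrary distributions.
omit [DecidableEq ι] in
theorem gsHat_inversion_conj (f : GS ι) (t : Euc ι) : (f : Euc ι → ℂ) t =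
    ∫ w, tfConst ι * (f.toDual : GS ι →ₗ[ℂ] ℂ) (gsPi w) *
      (gsPi (w.1, -w.2) : Euc ι → ℂ) t := by
  have hmp : MeasurePreserving (fun w : Euc ι × Euc ι => (w.1, -w.2)) :=
    (MeasurePreserving.id volume).prod (Measure.measurePreserving_neg volume)
  have hme : MeasurableEmbedding (fun w : Euc ι × Euc ι => (w.1, -w.2)) :=
    ((MeasurableEquiv.refl (Euc ι)).prodCongr (MeasurableEquiv.neg (Euc ι))).measurableEmbedding
  rw [gsHat_inversion, ← hmp.integral_comp hme]
  simp only [gsHat, neg_neg]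

/-- The matrix coefficients of `Op_A(a)` in the Gabor system. -/
def kernelCoef (A : Matrix ι ι ℝ) (a : GSDual (ι ⊕ ι)) (z w : Euc ι × Euc ι) : ℂ :=
  Complex.exp (Complex.I * kernelPhase A z w) *
    (a : GS (ι ⊕ ι) →ₗ[ℂ] ℂ) (tfGS (kernelTheta A) (kernelPoint A z w))

theorem continuous_kernelPoint (A : Matrix ι ι ℝ) :
    Continuous fun p : (Euc ι × Euc ι) × (Euc ι × Euc ι) => kernelPoint A p.1 p.2 := by
  unfold kernelPoint
  refine (Continuous.pair ?_ ?_).prodMk (Continuous.pair ?_ ?_) <;> fun_prop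

omit [DecidableEq ι] in
theorem continuous_kernelPhase (A : Matrix ι ι ℝ) :
    Continuous fun p : (Euc ι × Euc ι) × (Euc ι × Euc ι) => kernelPhase A p.1 p.2 := by
  unfold kernelPhase
  fun_prop

theorem exists_kernelPoint_le (A : Matrix ι ι ℝ) : ∃ K > 0, ∀ z w : Euc ι × Euc ι,
    ‖(kernelPoint A z w).1‖ ^ 2 + ‖(kernelPoint A z w).2‖ ^ 2 ≤
      K * ((‖z.1‖ ^ 2 + ‖z.2‖ ^ 2) + (‖w.1‖ ^ 2 + ‖w.2‖ ^ 2)) := by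
  obtain ⟨a, ha, hA⟩ := exists_norm_matVec_le A
  obtain ⟨b, hb, hB⟩ := exists_norm_matVec_le A.transpose
  refine ⟨4 * (1 + a + b) ^ 2 + 4, by positivity, fun z w => ?_⟩
  obtain ⟨x, ξ⟩ := z
  obtain ⟨y, η⟩ := w
  simp only [kernelPoint, norm_sq_pair]
  set c := 1 + a + b
  have h1 : ‖x - matVec A (x - y)‖ ≤ c * (‖x‖ + ‖y‖) := by
    have e1 := norm_sub_le x (matVec A (x - y))
    have e2 := (hA (x - y)).trans (mul_le_mul_of_nonneg_left (norm_sub_le x y) ha)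
    simp only [c]
    nlinarith [norm_nonneg x, norm_nonneg y, mul_nonneg hb (norm_nonneg x),
      mul_nonneg hb (norm_nonneg y)]
  have h2 : ‖matVec A.transpose ξ + matVec (1 - A.transpose) η‖ ≤ c * (‖ξ‖ + ‖η‖) := by
    rw [matVec_one_sub, show matVec A.transpose ξ + (η - matVec A.transpose η) =
      η + matVec A.transpose (ξ - η) by rw [matVec_sub]; abel]
    have e1 := norm_add_le η (matVec A.transpose (ξ - η))
    have e2 := (hB (ξ - η)).trans (mul_le_mul_of_nonneg_left (norm_sub_le ξ η) hb)
    simp only [c]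
    nlinarith [norm_nonneg ξ, norm_nonneg η, mul_nonneg ha (norm_nonneg ξ),
      mul_nonneg ha (norm_nonneg η)]
  have hc : 0 ≤ c := by positivity
  have s1 := pow_le_pow_left₀ (norm_nonneg _) h1 2
  have s2 := pow_le_pow_left₀ (norm_nonneg _) h2 2
  have s3 := pow_le_pow_left₀ (norm_nonneg _) (norm_sub_le ξ η) 2
  have s4 := pow_le_pow_left₀ (norm_nonneg _) (norm_sub_le y x) 2
  rw [mul_pow] at s1 s2
  have t1 : (‖x‖ + ‖y‖) ^ 2 ≤ 2 * (‖x‖ ^ 2 + ‖y‖ ^ 2) := by nlinarith [sq_nonneg (‖x‖ - ‖y‖)]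
  have t2 : (‖ξ‖ + ‖η‖) ^ 2 ≤ 2 * (‖ξ‖ ^ 2 + ‖η‖ ^ 2) := by nlinarith [sq_nonneg (‖ξ‖ - ‖η‖)]
  have t4 : (‖y‖ + ‖x‖) ^ 2 ≤ 2 * (‖x‖ ^ 2 + ‖y‖ ^ 2) := by nlinarith [sq_nonneg (‖x‖ - ‖y‖)]
  have c2 : 0 ≤ c ^ 2 := by positivity
  have p1 := mul_le_mul_of_nonneg_left t1 c2
  have p2 := mul_le_mul_of_nonneg_left t2 c2
  have q : 0 ≤ c ^ 2 * (‖x‖ ^ 2 + ‖y‖ ^ 2 + ‖ξ‖ ^ 2 + ‖η‖ ^ 2) := by positivity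
  have q2 : 0 ≤ (‖x‖ ^ 2 + ‖y‖ ^ 2 + ‖ξ‖ ^ 2 + ‖η‖ ^ 2) := by positivity
  nlinarith

omit [DecidableEq ι] in
theorem norm_toDual_gsPi (f : GS ι) (w : Euc ι × Euc ι) :
    ‖(f.toDual : GS ι →ₗ[ℂ] ℂ) (gsPi w)‖ = ‖gsHat f (w.1, -w.2)‖ := by
  rw [gsHat, neg_neg]

/-- The kernel pairing in terms of the matrix coefficients. -/
theorem kernelPairing_eq (A : Matrix ι ι ℝ) (a : GSDual (ι ⊕ ι)) (g f : GS ι) :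
    Integrable (fun p : (Euc ι × Euc ι) × (Euc ι × Euc ι) => (tfConst ι * gsHat g p.1) *
      (tfConst ι * (f.toDual : GS ι →ₗ[ℂ] ℂ) (gsPi p.2)) * kernelCoef A a p.1 p.2) ∧
    kernelPairing A a (fun Z => (g : Euc ι → ℂ) (pairFst Z) * (f : Euc ι → ℂ) (pairSnd Z)) =
      fourierConst ι * ∫ p : (Euc ι × Euc ι) × (Euc ι × Euc ι), (tfConst ι * gsHat g p.1) *
      (tfConst ι * (f.toDual : GS ι →ₗ[ℂ] ℂ) (gsPi p.2)) * kernelCoef A a p.1 p.2 := by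
  obtain ⟨-, h₁, h₁0, M₁, hM₁⟩ := g.2
  obtain ⟨-, h₂, h₂0, M₂, hM₂⟩ := f.2
  have hM₁0 := hM₁.nonneg
  have hM₂0 := hM₂.nonneg
  obtain ⟨ε₁, hε₁, C₁, hC₁, hb₁⟩ := exists_norm_gsHat_le (ι := ι) h₁0
  obtain ⟨ε₂, hε₂, C₂, hC₂, hb₂⟩ := exists_norm_gsHat_le (ι := ι) h₂0
  set ε := min ε₁ ε₂ with hεd
  have hε : 0 < ε := lt_min hε₁ hε₂
  obtain ⟨-, h₀, h₀0, M₀, hM₀⟩ := (kernelTheta A).2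
  have hM₀0 := hM₀.nonneg
  obtain ⟨K, hK, hKb⟩ := exists_kernelPoint_le A
  obtain ⟨h', h'0, hcont, hbd⟩ := exists_gsBound_tfGS h₀0 hM₀ (δ := ε / (2 * K)) (by positivity)
  let N : Euc ι × Euc ι → ℝ := fun z => ‖z.1‖ ^ 2 + ‖z.2‖ ^ 2
  have hN : ∀ z, 0 ≤ N z := fun z => by positivity
  have hg : ∀ z, ‖tfConst ι * gsHat g z‖ ≤ ‖tfConst ι‖ * (C₁ * M₁) * Real.exp (-ε * N z) := by
    intro z
    rw [norm_mul, mul_assoc]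
    refine mul_le_mul_of_nonneg_left ((hb₁ g M₁ hM₁ z).trans ?_) (norm_nonneg _)
    refine mul_le_mul_of_nonneg_left (Real.exp_le_exp.mpr ?_) (by positivity)
    nlinarith [mul_le_mul_of_nonneg_right (min_le_left ε₁ ε₂) (hN z)]
  have hf : ∀ w, ‖tfConst ι * (f.toDual : GS ι →ₗ[ℂ] ℂ) (gsPi w)‖ ≤
      ‖tfConst ι‖ * (C₂ * M₂) * Real.exp (-ε * N w) := by
    intro w
    rw [norm_mul, mul_assoc, norm_toDual_gsPi]
    refine mul_le_mul_of_nonneg_left ((hb₂ f M₂ hM₂ _).trans ?_) (norm_nonneg _)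
    refine mul_le_mul_of_nonneg_left (Real.exp_le_exp.mpr ?_) (by positivity)
    rw [norm_neg]
    nlinarith [mul_le_mul_of_nonneg_right (min_le_right ε₁ ε₂) (hN w)]
  set D := ‖tfConst ι‖ * (C₁ * M₁) * (‖tfConst ι‖ * (C₂ * M₂)) with hD
  have hD0 : 0 ≤ D := by positivity
  let b : (Euc ι × Euc ι) × (Euc ι × Euc ι) → ℂ := fun p => (tfConst ι * gsHat g p.1) *
      (tfConst ι * (f.toDual : GS ι →ₗ[ℂ] ℂ) (gsPi p.2))
  have hbc : Continuous b := by
    have h1 := continuous_gsHat g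
    have h2 := continuous_apply_gsPi f.toDual
    have h3 : Continuous fun p : (Euc ι × Euc ι) × (Euc ι × Euc ι) =>
      (f.toDual : GS ι →ₗ[ℂ] ℂ) (gsPi p.2) := h2.comp continuous_snd
    fun_prop
  have hbb : ∀ p, ‖b p‖ ≤ D * (Real.exp (-ε * N p.1) * Real.exp (-ε * N p.2)) := by
    intro p
    calc ‖b p‖ = ‖tfConst ι * gsHat g p.1‖ *
          ‖tfConst ι * (f.toDual : GS ι →ₗ[ℂ] ℂ) (gsPi p.2)‖ := norm_mul _ _
      _ ≤ (‖tfConst ι‖ * (C₁ * M₁) * Real.exp (-ε * N p.1)) *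
          (‖tfConst ι‖ * (C₂ * M₂) * Real.exp (-ε * N p.2)) :=
          mul_le_mul (hg _) (hf _) (norm_nonneg _) (by positivity)
      _ = _ := by
          rw [hD]
          ring
  let c : (Euc ι × Euc ι) × (Euc ι × Euc ι) → ℂ := fun p =>
    b p * Complex.exp (Complex.I * kernelPhase A p.1 p.2)
  have hcc : Continuous c := by
    have := continuous_kernelPhase A
    fun_prop
  have hcb : ∀ p, ‖c p‖ ≤ D * (Real.exp (-ε * N p.1) * Real.exp (-ε * N p.2)) := by
    intro p
    simp only [c]
    rw [norm_mul, exp_phase_norm, mul_one]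
    exact hbb p
  obtain ⟨G, hG, -, hu⟩ := synthesis (μ := volume) h'0 (hcont.comp (continuous_kernelPoint A))
    (fun p => hbd _) (c := c) hcc.aestronglyMeasurable (by
      refine (((integrable_exp_neg_mul_prod (ι := ι) (half_pos hε)).mul_prod
        (integrable_exp_neg_mul_prod (ι := ι) (half_pos hε))).const_mul (D * M₀)).mono' ?_
        (Eventually.of_forall fun p => ?_)
      · have h1 := continuous_kernelPoint A
        exact (hcc.norm.mul (by fun_prop)).aestronglyMeasurable
      · rw [norm_mul, norm_norm, Real.norm_of_nonneg (by positivity)]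
        calc _ ≤ D * (Real.exp (-ε * N p.1) * Real.exp (-ε * N p.2)) *
              (Real.exp (ε / (2 * K) * (K * (N p.1 + N p.2))) * M₀) := by
              gcongr
              · exact hcb p
              · exact hKb _ _
          _ = D * M₀ * (Real.exp (-ε * N p.1) * Real.exp (-ε * N p.2) *
              Real.exp (ε / 2 * N p.1 + ε / 2 * N p.2)) := by
              rw [show ε / (2 * K) * (K * (N p.1 + N p.2)) = ε / 2 * N p.1 + ε / 2 * N p.2 by
                field_simp]
              ring
          _ = D * M₀ * (Real.exp (-(ε / 2) * N p.1) * Real.exp (-(ε / 2) * N p.2)) := by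
              rw [← Real.exp_add, ← Real.exp_add, ← Real.exp_add]
              congr 2
              ring)
  -- Expanding both test functions in the Gabor system and exchanging integrals reduces the
  -- transposed kernel of g ⊗ f to that of pairs of shifted Gaussians, where covariance applies.
  have hGk : (G : Euc (ι ⊕ ι) → ℂ) = kernelTranspose A
      (fun Z => (g : Euc ι → ℂ) (pairFst Z) * (f : Euc ι → ℂ) (pairSnd Z)) := by
    ext Z
    rw [hG, kernelTranspose]
    set u := pairFst Z
    have e1 : ∀ v, (g : Euc ι → ℂ) (u + matVec A v) * (f : Euc ι → ℂ) (u + matVec (A - 1) v) *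
        Complex.exp (Complex.I * (inner ℝ v (pairSnd Z) : ℝ)) =
        ∫ p, b p * ((gsPi p.1 : Euc ι → ℂ) (u + matVec A v) *
          (gsPi (p.2.1, -p.2.2) : Euc ι → ℂ) (u + matVec (A - 1) v) *
            Complex.exp (Complex.I * (inner ℝ v (pairSnd Z) : ℝ))) := by
      intro v
      rw [gsHat_inversion g, gsHat_inversion_conj f, ← integral_prod_mul, ← integral_mul_const]
      refine integral_congr_ae (Eventually.of_forall fun p => ?_)
      simp only [b]
      ring
    simp only [pairFst_pair, pairSnd_pair]
    simp_rw [e1]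
    rw [integral_integral_swap]
    · rw [← integral_const_mul]
      refine integral_congr_ae (Eventually.of_forall fun p => ?_)
      simp only
      rw [integral_const_mul, mul_left_comm]
      have := kernelTranspose_gsPi A p.1 p.2 Z
      rw [kernelTranspose] at this
      simp only [pairFst_pair, pairSnd_pair] at this
      rw [this]
      simp only [c]
      ring
    · set δ := min (ε / 8) (1 / 8) with hδ
      have hδ0 : 0 < δ := lt_min (by positivity) (by norm_num)
      set k₁ : ℝ := Real.pi ^ (-(Fintype.card ι : ℝ) / 4)
      have hI := (integrable_exp_neg_mul_sq_norm (ι := ι) hδ0).mul_prod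
        ((integrable_exp_neg_mul_prod (ι := ι) (half_pos hε)).mul_prod
        (integrable_exp_neg_mul_prod (ι := ι) (half_pos hε)))
      refine (hI.const_mul (D * (k₁ * k₁))).mono' ?_ (Eventually.of_forall fun q => ?_)
      · refine Continuous.aestronglyMeasurable ?_
        have h2 := isSmooth_gaussWindow (ι := ι) |>.continuous
        simp only [gsPi_apply, modul]
        fun_prop
      · obtain ⟨v, p⟩ := q
        simp only [Function.uncurry]
        clear_value b
        rw [norm_mul (b p), norm_mul (_ * _) (Complex.exp _), exp_phase_norm, mul_one, norm_mul,
          norm_gsPi_apply, norm_gsPi_apply,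
          gaussWindow_nonneg_real, gaussWindow_nonneg_real]
        set α := u + matVec A v with hα
        set β := u + matVec (A - 1) v with hβ
        -- v is the difference of the two window arguments, so the decay of both windows and of the
        -- coefficients together controls ‖v‖.
        have hv : ‖v‖ ≤ ‖α - p.1.1‖ + ‖β - p.2.1‖ + ‖p.1.1‖ + ‖p.2.1‖ := by
          have e2 : v = (α - p.1.1) - (β - p.2.1) + p.1.1 - p.2.1 := by
            rw [hα, hβ, matVec_sub_one]
            abel
          calc ‖v‖ = ‖(α - p.1.1) - (β - p.2.1) + p.1.1 - p.2.1‖ := congrArg _ e2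
            _ ≤ ‖(α - p.1.1) - (β - p.2.1) + p.1.1‖ + ‖p.2.1‖ := norm_sub_le _ _
            _ ≤ _ := by
                gcongr
                refine (norm_add_le _ _).trans ?_
                gcongr
                exact norm_sub_le _ _
        set s := ‖α - p.1.1‖
        set t := ‖β - p.2.1‖
        have hv2 : ‖v‖ ^ 2 ≤ 4 * (s ^ 2 + t ^ 2 + ‖p.1.1‖ ^ 2 + ‖p.2.1‖ ^ 2) := by
          refine (pow_le_pow_left₀ (norm_nonneg _) hv 2).trans ?_
          nlinarith [sq_nonneg (s - t), sq_nonneg (s - ‖p.1.1‖), sq_nonneg (s - ‖p.2.1‖),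
            sq_nonneg (t - ‖p.1.1‖), sq_nonneg (t - ‖p.2.1‖), sq_nonneg (‖p.1.1‖ - ‖p.2.1‖)]
        have hδ1 : δ ≤ ε / 8 := min_le_left _ _
        have hδ2 : δ ≤ 1 / 8 := min_le_right _ _
        calc ‖b p‖ * (k₁ * Real.exp (-s ^ 2 / 2) * (k₁ * Real.exp (-t ^ 2 / 2)))
            ≤ D * (Real.exp (-ε * N p.1) * Real.exp (-ε * N p.2)) *
              (k₁ * Real.exp (-s ^ 2 / 2) * (k₁ * Real.exp (-t ^ 2 / 2))) := by
              gcongr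
              exact hbb p
          _ = D * (k₁ * k₁) * Real.exp (-ε * N p.1 + -ε * N p.2 + -s ^ 2 / 2 + -t ^ 2 / 2) := by
              rw [Real.exp_add, Real.exp_add, Real.exp_add]
              ring
          _ ≤ D * (k₁ * k₁) * Real.exp (-δ * ‖v‖ ^ 2 + (-(ε / 2) * N p.1 + -(ε / 2) * N p.2)) := by
              refine mul_le_mul_of_nonneg_left (Real.exp_le_exp.mpr ?_) (by positivity)
              have n1 := mul_le_mul_of_nonneg_left hv2 hδ0.le
              have n2 := mul_le_mul_of_nonneg_right hδ2 (by positivity : 0 ≤ s ^ 2 + t ^ 2)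
              have n3 := mul_le_mul_of_nonneg_right hδ1
                (by positivity : 0 ≤ ‖p.1.1‖ ^ 2 + ‖p.2.1‖ ^ 2)
              have n4 : 0 ≤ ε * (‖p.1.2‖ ^ 2 + ‖p.2.2‖ ^ 2) := by positivity
              simp only [N]
              nlinarith
          _ = _ := by
              rw [Real.exp_add, Real.exp_add]
  obtain ⟨hu1, hu2⟩ := hu a
  have hcoef : ∀ p, c p * (a : GS (ι ⊕ ι) →ₗ[ℂ] ℂ) (tfGS (kernelTheta A) (kernelPoint A p.1 p.2)) =
      b p * kernelCoef A a p.1 p.2 := by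
    intro p
    simp only [c, kernelCoef]
    ring
  simp_rw [hcoef] at hu1 hu2
  refine ⟨hu1, ?_⟩
  rw [kernelPairing, GSDual.eval, ← hGk, dif_pos G.2]
  congr 1

end Kernel

/-! ### Gabor coefficients of shifted functions -/

section Covariance
variable {ι : Type} [Fintype ι]

theorem tfGS_zero (g : GS ι) : tfGS g 0 = g := by
  ext t
  simp [coe_tfGS, tfShift, modul]

theorem norm_gsHat_tfGS (g : GS ι) (z w : Euc ι × Euc ι) :
    ‖gsHat (tfGS g z) w‖ = ‖gsHat g (w - z)‖ := by
  have : gsHat (tfGS g z) w = modul (z.2 - w.2) z.1 * gsHat g (w - z) := by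
    rw [gsHat_eq, gsHat_eq, ← integral_const_mul, ← integral_add_right_eq_self _ z.1]
    refine integral_congr_ae (Eventually.of_forall fun t => ?_)
    simp only [coe_tfGS, tfShift, add_sub_cancel_right, Prod.fst_sub, Prod.snd_sub]
    rw [show t + z.1 - w.1 = t - (w.1 - z.1) by abel]
    have h : modul z.2 (t + z.1) * modul (-w.2) (t + z.1) =
        modul (z.2 - w.2) z.1 * modul (-(w.2 - z.2)) t := by
      simp only [modul, ← Complex.exp_add]
      congr 1
      simp only [inner_add_left, inner_sub_right, inner_neg_right]
      push_cast
      ring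
    linear_combination (g : Euc ι → ℂ) t * gaussWindow (t - (w.1 - z.1)) * h
  rw [this, norm_mul, norm_modul, one_mul]

end Covariance

/-! ### Exponential bounds for moderate weights -/

section WeightGrowth

/-- The additive norm on phase space. -/
def phaseNorm {E F : Type*} [Norm E] [Norm F] (z : E × F) : ℝ := ‖z.1‖ + ‖z.2‖

section
variable {E F : Type*} [SeminormedAddCommGroup E] [SeminormedAddCommGroup F]

theorem phaseNorm_nonneg (z : E × F) : 0 ≤ phaseNorm z := by
  unfold phaseNorm
  positivity

theorem phaseNorm_add_le (z w : E × F) : phaseNorm (z + w) ≤ phaseNorm z + phaseNorm w := by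
  unfold phaseNorm
  have h1 := norm_add_le z.1 w.1
  have h2 := norm_add_le z.2 w.2
  simp only [Prod.fst_add, Prod.snd_add]
  linarith

theorem phaseNorm_neg (z : E × F) : phaseNorm (-z) = phaseNorm z := by
  simp [phaseNorm]

theorem phaseNorm_sub_comm (z w : E × F) : phaseNorm (z - w) = phaseNorm (w - z) := by
  rw [← phaseNorm_neg, neg_sub]

theorem norm_le_phaseNorm (z : E × F) : ‖z‖ ≤ phaseNorm z := by
  rw [Prod.norm_def, phaseNorm]
  exact max_le (by linarith [norm_nonneg z.2]) (by linarith [norm_nonneg z.1])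

theorem continuous_phaseNorm : Continuous (phaseNorm : E × F → ℝ) := by
  unfold phaseNorm
  fun_prop

end

variable {G : Type*} [NormedAddCommGroup G] [NormedSpace ℝ G] [ProperSpace G] [MeasureSpace G]
  [BorelSpace G] [(volume : Measure G).IsAddHaarMeasure]

/-- Moderate weights grow and decay at most exponentially. -/
theorem ModerateWeight.exists_le_exp (ω : ModerateWeight G) : ∃ C > 0, ∃ c ≥ 0, ∀ x y : G,
    ω (x + y) ≤ C * Real.exp (c * ‖y‖) * ω x := by
  obtain ⟨v, hv, C₀, hC₀⟩ := ω.moderate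
  have hω := ω.isWeight.pos
  obtain ⟨C₁, hC₁⟩ := hv.locBdd (Metric.closedBall 0 2) (isCompact_closedBall 0 2)
  rw [ae_restrict_iff' Metric.isClosed_closedBall.measurableSet] at hC₁
  have hC₀0 : 0 ≤ C₀ := by
    by_contra! h
    have h1 := hC₀ 0 0
    have h2 := mul_neg_of_neg_of_pos h (mul_pos (hω 0) (hv.pos 0))
    rw [add_zero] at h1
    linarith [hω 0]
  -- The weight v is bounded on compact sets only up to null sets, so v(y) itself is not controlled.
  -- Writing y = t + (y - t), almost every t in the unit ball has both v(t) and v(y - t) at most C₁.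
  have hunit : ∀ x y : G, ‖y‖ ≤ 1 → ω (x + y) ≤ (1 + C₀ * C₁ * (C₀ * C₁)) * ω x := by
    intro x y hy
    have h2 : ∀ᵐ t : G, y - t ∈ Metric.closedBall (0 : G) 2 → v (y - t) ≤ C₁ :=
      (Measure.measurePreserving_sub_left (volume : Measure G) y).quasiMeasurePreserving.ae hC₁
    have hpos : volume (Metric.ball (0 : G) 1) ≠ 0 :=
      (Metric.measure_ball_pos _ _ one_pos).ne'
    have : ∃ᵐ t : G, t ∈ Metric.ball (0 : G) 1 := frequently_ae_mem_iff.mpr hpos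
    obtain ⟨t, ht, ht1, ht2⟩ := (this.and_eventually (hC₁.and h2)).exists
    rw [mem_ball_zero_iff] at ht
    have e1 := ht1 (by rw [mem_closedBall_zero_iff]; linarith)
    have e2 := ht2 (by
      rw [mem_closedBall_zero_iff]
      linarith [norm_sub_le y t])
    have hC₁0 : 0 ≤ C₁ := (hv.pos t).le.trans e1
    calc ω (x + y) = ω (x + t + (y - t)) := by congr 1; abel
      _ ≤ C₀ * (ω (x + t) * v (y - t)) := hC₀ _ _
      _ ≤ C₀ * ((C₀ * (ω x * C₁)) * C₁) := by
          refine mul_le_mul_of_nonneg_left ?_ hC₀0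
          refine mul_le_mul ((hC₀ _ _).trans (mul_le_mul_of_nonneg_left
              (mul_le_mul_of_nonneg_left e1 (hω x).le) hC₀0)) e2 (hv.pos _).le ?_
          have := (hω x).le
          positivity
      _ ≤ _ := by nlinarith [hω x]
  have hB : 1 ≤ 1 + C₀ * C₁ * (C₀ * C₁) := by nlinarith [mul_self_nonneg (C₀ * C₁)]
  set B := 1 + C₀ * C₁ * (C₀ * C₁)
  have hB0 : 0 < B := by linarith
  have hiter : ∀ n : ℕ, ∀ x y : G, ‖y‖ ≤ n → ω (x + y) ≤ B ^ n * ω x := by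
    intro n
    induction n with
    | zero =>
      intro x y hy
      have : y = 0 := by simpa using hy
      simp [this]
    | succ n ih =>
      intro x y hy
      have hn : (0 : ℝ) < n + 1 := by positivity
      push_cast at hy
      have e1 : ‖((n : ℝ) / (n + 1)) • y‖ ≤ n := by
        rw [norm_smul, Real.norm_of_nonneg (by positivity), div_mul_eq_mul_div, div_le_iff₀ hn]
        gcongr
      have e2 : ‖((1 : ℝ) / (n + 1)) • y‖ ≤ 1 := by
        rw [norm_smul, Real.norm_of_nonneg (by positivity), div_mul_eq_mul_div, div_le_iff₀ hn]
        linarith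
      have e3 : x + y = x + ((n : ℝ) / (n + 1)) • y + ((1 : ℝ) / (n + 1)) • y := by
        rw [add_assoc, ← add_smul, ← add_div, div_self hn.ne', one_smul]
      rw [e3]
      calc _ ≤ B * ω (x + ((n : ℝ) / (n + 1)) • y) := hunit _ _ e2
        _ ≤ B * (B ^ n * ω x) := by
            gcongr
            exact ih _ _ e1
        _ = _ := by ring
  refine ⟨B, hB0, Real.log B, Real.log_nonneg hB, fun x y => ?_⟩
  refine (hiter ⌈‖y‖⌉₊ x y (Nat.le_ceil _)).trans ?_
  refine mul_le_mul_of_nonneg_right ?_ (hω x).le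
  rw [← Real.rpow_natCast, ← Real.rpow_def_of_pos hB0]
  nth_rewrite 2 [← Real.rpow_one B]
  rw [← Real.rpow_add hB0]
  exact Real.rpow_le_rpow_of_exponent_le hB (by linarith [Nat.ceil_lt_add_one (norm_nonneg y)])

end WeightGrowth

/-! ### Smearing by exponentials -/

section Smear
variable {ι : Type} [Fintype ι]

instance : (volume : Measure (Euc ι × Euc ι)).IsAddHaarMeasure := by
  rw [Measure.volume_eq_prod]
  infer_instance

theorem ModerateWeight.exists_le_expPhase (ω : ModerateWeight (Euc ι × Euc ι)) :
    ∃ C > 0, ∃ c ≥ 0, ∀ x y, ω (x + y) ≤ C * Real.exp (c * phaseNorm y) * ω x := by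
  obtain ⟨C, hC, c, hc, h⟩ := ω.exists_le_exp
  refine ⟨C, hC, c, hc, fun x y => (h x y).trans ?_⟩
  have := (ω.isWeight.pos x).le
  gcongr
  exact norm_le_phaseNorm y

/-- Convolution with the exponential `exp (-m |·|)`. -/
def smear (m : ℝ) (H : Euc ι × Euc ι → ℝ≥0∞) (z : Euc ι × Euc ι) : ℝ≥0∞ :=
  ∫⁻ w, ENNReal.ofReal (Real.exp (-m * phaseNorm (z - w))) * H w

theorem smear_mono (m : ℝ) {H H' : Euc ι × Euc ι → ℝ≥0∞} (h : ∀ᵐ w, H w ≤ H' w)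
    (z : Euc ι × Euc ι) : smear m H z ≤ smear m H' z :=
  lintegral_mono_ae (h.mono fun _ hw => by gcongr)

theorem smear_const_mul (m : ℝ) (H : Euc ι × Euc ι → ℝ≥0∞) {c : ℝ≥0∞} (hc : c ≠ ∞)
    (z : Euc ι × Euc ι) : smear m (fun w => c * H w) z = c * smear m H z := by
  rw [smear, smear, ← lintegral_const_mul' _ _ hc]
  exact lintegral_congr fun w => by ring

/-- The triangle inequality in the exponent. Smeared functions vary at most exponentially, which
later allows them to be replaced by their lattice samples. -/
theorem smear_add_le {m : ℝ} (hm : 0 ≤ m) (H : Euc ι × Euc ι → ℝ≥0∞) (z y : Euc ι × Euc ι) :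
    smear m H (z + y) ≤ ENNReal.ofReal (Real.exp (m * phaseNorm y)) * smear m H z := by
  rw [smear, smear, ← lintegral_const_mul' _ _ ENNReal.ofReal_ne_top]
  refine lintegral_mono fun w => ?_
  rw [← mul_assoc, ← ENNReal.ofReal_mul (Real.exp_nonneg _), ← Real.exp_add]
  gcongr
  have := phaseNorm_add_le (z + y - w) (-y)
  rw [phaseNorm_neg, show z + y - w + -y = z - w by abel] at this
  nlinarith

theorem measurable_smear (m : ℝ) {H : Euc ι × Euc ι → ℝ≥0∞} (hH : AEMeasurable H) :
    Measurable (smear m H) := by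
  have : smear m H = smear m (hH.mk H) := by
    ext z
    exact lintegral_congr_ae (hH.ae_eq_mk.mono fun w hw => by simp only [hw])
  rw [this]
  refine Measurable.lintegral_prod_right'
    (f := fun p : (Euc ι × Euc ι) × (Euc ι × Euc ι) =>
      ENNReal.ofReal (Real.exp (-m * phaseNorm (p.1 - p.2))) * hH.mk H p.2) ?_
  have h1 : Continuous fun p : (Euc ι × Euc ι) × (Euc ι × Euc ι) =>
      Real.exp (-m * phaseNorm (p.1 - p.2)) := by
    have := continuous_phaseNorm (E := Euc ι) (F := Euc ι)
    fun_prop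
  exact h1.measurable.ennreal_ofReal.mul (hH.measurable_mk.comp measurable_snd)

theorem integrable_exp_neg_phaseNorm {m : ℝ} (hm : 0 < m) :
    Integrable fun z : Euc ι × Euc ι => Real.exp (-m * phaseNorm z) := by
  have h1 : Integrable fun x : Euc ι => Real.exp (-m * ‖x‖) := by
    obtain ⟨n, hn⟩ := exists_nat_gt ((Module.finrank ℝ (Euc ι) : ℝ) + 1)
    have h3 := integrable_one_add_norm (E := Euc ι) (μ := volume) (r := n) (by linarith)
    refine ((h3.const_mul ((n.factorial : ℝ) / m ^ n * Real.exp m))).mono'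
      (by fun_prop) (Eventually.of_forall fun x => ?_)
    rw [Real.norm_of_nonneg (by positivity), Real.rpow_neg (by positivity), Real.rpow_natCast,
      ← div_eq_mul_inv, le_div_iff₀ (by positivity)]
    have := Real.pow_div_factorial_le_exp (x := m * (1 + ‖x‖)) (by positivity) n
    rw [div_le_iff₀ (by positivity), mul_pow] at this
    rw [div_mul_eq_mul_div, le_div_iff₀ (by positivity)]
    calc Real.exp (-m * ‖x‖) * (1 + ‖x‖) ^ n * m ^ n
        = Real.exp (-m * ‖x‖) * (m ^ n * (1 + ‖x‖) ^ n) := by ring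
      _ ≤ Real.exp (-m * ‖x‖) * (Real.exp (m * (1 + ‖x‖)) * n.factorial) := by gcongr
      _ = n.factorial * (Real.exp (-m * ‖x‖) * Real.exp (m * (1 + ‖x‖))) := by ring
      _ = n.factorial * Real.exp m := by
          rw [← Real.exp_add]
          ring_nf
  refine (h1.mul_prod h1).congr (Eventually.of_forall fun z => ?_)
  simp only [phaseNorm]
  rw [← Real.exp_add]
  ring_nf

theorem lintegral_exp_neg_phaseNorm_lt_top {m : ℝ} (hm : 0 < m) :
    ∫⁻ z : Euc ι × Euc ι, ENNReal.ofReal (Real.exp (-m * phaseNorm z)) < ∞ := by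
  have := (integrable_exp_neg_phaseNorm (ι := ι) hm).hasFiniteIntegral
  refine lt_of_le_of_lt (lintegral_mono fun z => ?_) this
  rw [Real.enorm_of_nonneg (Real.exp_nonneg _)]

/-- Smearing is bounded on mixed Orlicz spaces. -/
theorem mixedLuxNorm_smear_le {m : ℝ} (hm : 0 < m) : ∃ C : ℝ≥0, ∀ (Φ Ψ : YoungFunction)
    (H : Euc ι × Euc ι → ℝ≥0∞), AEMeasurable H →
      mixedLuxNorm Φ Ψ (smear m H) ≤ C * mixedLuxNorm Φ Ψ H := by
  have hfin := lintegral_exp_neg_phaseNorm_lt_top (ι := ι) hm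
  refine ⟨(∫⁻ z : Euc ι × Euc ι, ENNReal.ofReal (Real.exp (-m * phaseNorm z))).toNNReal,
    fun Φ Ψ H₀ hH₀ => ?_⟩
  rw [ENNReal.coe_toNNReal hfin.ne]
  have hmeas := hH₀.measurable_mk
  have e1 : smear m H₀ = smear m (hH₀.mk H₀) := by
    ext z
    exact lintegral_congr_ae (hH₀.ae_eq_mk.mono fun w hw => by simp only [hw])
  have e2 : mixedLuxNorm Φ Ψ (hH₀.mk H₀) ≤ mixedLuxNorm Φ Ψ H₀ :=
    mixedLuxNorm_mono_ae Φ Ψ (hH₀.ae_eq_mk.mono fun _ h => h.ge)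
  rw [e1]
  refine le_trans ?_ (mul_le_mul_right e2 _)
  set H := hH₀.mk H₀
  set E : Euc ι × Euc ι → ℝ≥0∞ := fun z => ENNReal.ofReal (Real.exp (-m * phaseNorm z)) with hE
  have hEm : Measurable E := by
    have := (continuous_phaseNorm (E := Euc ι) (F := Euc ι))
    have h1 : Continuous fun z : Euc ι × Euc ι => Real.exp (-m * phaseNorm z) := by fun_prop
    exact h1.measurable.ennreal_ofReal
  -- Written as a superposition of translates of H, the smeared function is estimated by Minkowski's
  -- inequality in x and then in ξ; translation invariance of the norms leaves the integral of the
  -- exponential.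
  have hs : ∀ z, smear m H z = ∫⁻ w, E w * H (z - w) := by
    intro z
    have hmp : MeasurePreserving (fun w : Euc ι × Euc ι => z - w) :=
      (Measure.measurePreserving_sub_left volume z.1).prod
        (Measure.measurePreserving_sub_left volume z.2)
    have hm : Measurable fun w => E w * H (z - w) := hEm.mul (hmeas.comp (by fun_prop))
    rw [smear, ← hmp.lintegral_comp hm]
    refine lintegral_congr fun w => ?_
    simp [hE]
  set N : Euc ι → ℝ≥0∞ := fun ξ => luxNorm Φ volume fun x => H (x, ξ) with hN
  have hNm : Measurable N := measurable_luxNorm_left Φ hmeas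
  have inner : ∀ ξ, (luxNorm Φ volume fun x => smear m H (x, ξ)) ≤ ∫⁻ w, E w * N (ξ - w.2) := by
    intro ξ
    simp only [hs]
    refine (luxNorm_lintegral_le Φ (volume : Measure (Euc ι × Euc ι))
      (F := fun p : Euc ι × (Euc ι × Euc ι) => E p.2 * H ((p.1, ξ) - p.2)) ?_).trans ?_
    · refine (hEm.comp measurable_snd).mul (hmeas.comp ?_)
      fun_prop
    · refine lintegral_mono fun w => ?_
      simp only
      refine (luxNorm_mul_le Φ volume _ (Real.toNNReal _)).trans_eq ?_
      congr 1
      exact luxNorm_comp (measurePreserving_sub_right volume w.1)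
        (u := fun x => H (x, ξ - w.2)) (hmeas.comp measurable_prodMk_right)
  calc mixedLuxNorm Φ Ψ (smear m H) ≤ luxNorm Ψ volume fun ξ => ∫⁻ w : Euc ι × Euc ι,
        E w * N (ξ - w.2) := luxNorm_mono_ae Ψ (Eventually.of_forall inner)
    _ ≤ ∫⁻ w : Euc ι × Euc ι, luxNorm Ψ volume fun ξ => E w * N (ξ - w.2) := by
        refine luxNorm_lintegral_le Ψ (volume : Measure (Euc ι × Euc ι))
          (F := fun p : Euc ι × (Euc ι × Euc ι) => E p.2 * N (p.1 - p.2.2)) ?_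
        exact (hEm.comp measurable_snd).mul (hNm.comp (by fun_prop))
    _ ≤ ∫⁻ w : Euc ι × Euc ι, E w * luxNorm Ψ volume N := by
        refine lintegral_mono fun w => ?_
        refine (luxNorm_mul_le Ψ volume _ (Real.toNNReal _)).trans_eq ?_
        congr 1
        exact luxNorm_comp (measurePreserving_sub_right volume w.2) hNm
    _ = _ := lintegral_mul_const _ hEm

/-- A moderate weight can be moved under `smear`. -/
theorem ModerateWeight.exists_mul_smear_le (ω : ModerateWeight (Euc ι × Euc ι)) :
    ∃ C : ℝ≥0, ∃ c ≥ 0, ∀ (m : ℝ) (H : Euc ι × Euc ι → ℝ≥0∞) (z : Euc ι × Euc ι),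
      ENNReal.ofReal (ω z) * smear (m + c) H z ≤
        C * smear m (fun w => H w * ENNReal.ofReal (ω w)) z := by
  obtain ⟨C, hC, c, hc, h⟩ := ω.exists_le_expPhase
  refine ⟨C.toNNReal, c, hc, fun m H z => ?_⟩
  rw [smear, smear, ← lintegral_const_mul' _ _ ENNReal.ofReal_ne_top,
    ← lintegral_const_mul' _ _ ENNReal.coe_ne_top]
  refine lintegral_mono fun w => ?_
  have h1 := h w (z - w)
  rw [add_sub_cancel] at h1
  have h2 := (ω.isWeight.pos w).le
  calc ENNReal.ofReal (ω z) * (ENNReal.ofReal (Real.exp (-(m + c) * phaseNorm (z - w))) * H w)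
      = ENNReal.ofReal (ω z * Real.exp (-(m + c) * phaseNorm (z - w))) * H w := by
        rw [ENNReal.ofReal_mul (ω.isWeight.pos z).le, mul_assoc]
    _ ≤ ENNReal.ofReal (C * (Real.exp (-m * phaseNorm (z - w)) * ω w)) * H w := by
        refine mul_le_mul_left (ENNReal.ofReal_le_ofReal ?_) _
        calc _ ≤ C * Real.exp (c * phaseNorm (z - w)) * ω w *
              Real.exp (-(m + c) * phaseNorm (z - w)) := by gcongr
          _ = C * (Real.exp (c * phaseNorm (z - w) + -(m + c) * phaseNorm (z - w)) * ω w) := by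
              rw [Real.exp_add]
              ring
          _ = _ := by ring_nf
    _ = _ := by
        rw [ENNReal.ofReal_mul hC.le, ENNReal.ofReal_mul (Real.exp_nonneg _)]
        change ENNReal.ofReal C * _ * _ = ENNReal.ofReal C * _
        ring

/-- A Gaussian beats every exponential: completing the square in each of the two norms costs
e^{m²/(4ε)}, and K is the product of these two factors. -/
theorem exists_enorm_gsHat_le {h : ℝ} (h0 : 0 < h) (m : ℝ) : ∃ C : ℝ≥0, ∀ (g : GS ι) (M : ℝ),
    GSBound h M (g : Euc ι → ℂ) → ∀ z : Euc ι × Euc ι, ‖gsHat g z‖ₑ ≤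
      C * ENNReal.ofReal M * ENNReal.ofReal (Real.exp (-m * phaseNorm z)) := by
  obtain ⟨ε, hε, C₁, hC₁, hb⟩ := exists_norm_gsHat_le (ι := ι) h0
  set K := Real.exp (m ^ 2 / (2 * ε)) with hK
  refine ⟨(C₁ * K).toNNReal, fun g M hg z => ?_⟩
  have hM := hg.nonneg
  change _ ≤ ENNReal.ofReal (C₁ * K) * _ * _
  rw [← ENNReal.ofReal_mul (by positivity), ← ENNReal.ofReal_mul (by positivity), ← ofReal_norm]
  refine ENNReal.ofReal_le_ofReal ((hb g M hg _).trans ?_)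
  rw [phaseNorm]
  set a := ‖z.1‖
  set b := ‖z.2‖
  calc C₁ * M * Real.exp (-ε * (a ^ 2 + b ^ 2)) ≤ C₁ * M *
        Real.exp (m ^ 2 / (2 * ε) + -m * (a + b)) := by
        refine mul_le_mul_of_nonneg_left (Real.exp_le_exp.mpr ?_) (by positivity)
        have : m ^ 2 / (2 * ε) + -m * (a + b) - -ε * (a ^ 2 + b ^ 2) =
            ε * ((a - m / (2 * ε)) ^ 2 + (b - m / (2 * ε)) ^ 2) := by
          field_simp
          ring
        have h2 : 0 ≤ ε * ((a - m / (2 * ε)) ^ 2 + (b - m / (2 * ε)) ^ 2) := by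
          positivity
        linarith
    _ = _ := by
        rw [Real.exp_add, hK]
        ring

theorem enorm_fourierConst_ne_zero : ‖fourierConst ι‖ₑ ≠ 0 := by
  rw [enorm_ne_zero, fourierConst]
  exact_mod_cast (Real.rpow_pos_of_pos (by positivity) _).ne'

theorem enorm_apply_gsPi (u : GSDual ι) (z : Euc ι × Euc ι) :
    ‖(u : GS ι →ₗ[ℂ] ℂ) (gsPi z)‖ₑ = ‖fourierConst ι‖ₑ⁻¹ * ‖stft u z‖ₑ := by
  rw [stft_eq, enorm_mul, ← mul_assoc, ENNReal.inv_mul_cancel enorm_fourierConst_ne_zero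
    enorm_ne_top, one_mul]

/-- The action of a distribution on time-frequency shifts is controlled by smeared short-time
Fourier transforms. -/
theorem exists_apply_tfGS_le_of_stft_le {h : ℝ} (h0 : 0 < h) (m : ℝ)
    (ω : ModerateWeight (Euc ι × Euc ι)) :
    ∃ C : ℝ≥0, ∀ (u : GSDual ι) (G : Euc ι × Euc ι → ℝ≥0∞), (∀ᵐ z, ‖stft u z‖ₑ ≤ G z) →
      ∀ (g : GS ι) (M : ℝ), GSBound h M (g : Euc ι → ℂ) →
      ∀ z : Euc ι × Euc ι, ‖(u : GS ι →ₗ[ℂ] ℂ) (tfGS g z)‖ₑ * ENNReal.ofReal (ω z) ≤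
        C * ENNReal.ofReal M * smear m (fun w => G w * ENNReal.ofReal (ω w)) z := by
  obtain ⟨C₂, c, hc, hw⟩ := ω.exists_mul_smear_le
  obtain ⟨C₁, hb⟩ := exists_enorm_gsHat_le (ι := ι) h0 (m + c)
  set k : ℝ≥0∞ := ‖fourierConst ι‖ₑ⁻¹ with hk
  have hkt : k ≠ ∞ := ENNReal.inv_ne_top.mpr enorm_fourierConst_ne_zero
  have hcoef : ‖tfConst ι‖ₑ * C₁ * k * C₂ ≠ ∞ := by finiteness
  refine ⟨(‖tfConst ι‖ₑ * C₁ * k * C₂).toNNReal, fun u G hG g M hg z => ?_⟩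
  rw [ENNReal.coe_toNNReal hcoef]
  have e1 : ‖(u : GS ι →ₗ[ℂ] ℂ) (tfGS g z)‖ₑ ≤
      ‖tfConst ι‖ₑ * C₁ * k * ENNReal.ofReal M * smear (m + c) G z := by
    -- By the reproducing formula, and since shifting g by z only translates the moduli of its Gabor
    -- coefficients, the integrand is an exponential in z - W times the short-time Fourier transform
    -- at W.
    rw [(apply_eq_integral_gsHat u (tfGS g z)).2]
    refine (enorm_integral_le_lintegral_enorm _).trans ?_
    rw [smear, ← lintegral_const_mul' _ _ (by finiteness)]
    refine lintegral_mono_ae (hG.mono fun W hW => ?_)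
    have h2 : ‖gsHat (tfGS g z) W‖ₑ ≤ C₁ * ENNReal.ofReal M *
        ENNReal.ofReal (Real.exp (-(m + c) * phaseNorm (z - W))) := by
      rw [← ofReal_norm, norm_gsHat_tfGS, ofReal_norm, phaseNorm_sub_comm]
      exact hb g M hg _
    rw [enorm_mul, enorm_mul, enorm_apply_gsPi]
    calc _ ≤ ‖tfConst ι‖ₑ * (C₁ * ENNReal.ofReal M *
          ENNReal.ofReal (Real.exp (-(m + c) * phaseNorm (z - W)))) * (k * G W) := by
          gcongr
      _ = _ := by ring
  calc _ ≤ ‖tfConst ι‖ₑ * C₁ * k * ENNReal.ofReal M *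
        smear (m + c) G z * ENNReal.ofReal (ω z) := by gcongr
    _ = ‖tfConst ι‖ₑ * C₁ * k * ENNReal.ofReal M *
        (ENNReal.ofReal (ω z) * smear (m + c) G z) := by ring
    _ ≤ ‖tfConst ι‖ₑ * C₁ * k * ENNReal.ofReal M *
        (C₂ * smear m (fun w => G w * ENNReal.ofReal (ω w)) z) := by
        exact mul_le_mul_right (hw m _ z) _
    _ = _ := by ring

theorem exists_apply_tfGS_le {h : ℝ} (h0 : 0 < h) (m : ℝ) (ω : ModerateWeight (Euc ι × Euc ι)) :
    ∃ C : ℝ≥0, ∀ (u : GSDual ι) (g : GS ι) (M : ℝ), GSBound h M (g : Euc ι → ℂ) →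
      ∀ z : Euc ι × Euc ι, ‖(u : GS ι →ₗ[ℂ] ℂ) (tfGS g z)‖ₑ * ENNReal.ofReal (ω z) ≤
        C * ENNReal.ofReal M * smear m (wstft ω u) z := by
  obtain ⟨C, hC⟩ := exists_apply_tfGS_le_of_stft_le h0 m ω
  exact ⟨C, fun u => hC u _ (Eventually.of_forall fun _ => le_rfl)⟩

end Smear

/-! ### Integer parts as measure preserving maps -/

section Lattice
variable {ι : Type} [Fintype ι]

theorem measurePreserving_count {α Γ : Type*} [MeasurableSpace α] [MeasurableSpace Γ] [Countable Γ]
    [MeasurableSingletonClass Γ] {μ : Measure α} {f : α → Γ} (hf : Measurable f)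
    (h : ∀ g, μ (f ⁻¹' {g}) = 1) : MeasurePreserving f μ .count := by
  refine ⟨hf, Measure.ext_of_singleton fun g => ?_⟩
  rw [Measure.map_apply hf (measurableSet_singleton g), h, Measure.count_singleton]

/-- The integer part of a vector. -/
def latFloor (x : Euc ι) : ι → ℤ := fun i => ⌊x i⌋

/-- The lattice point with given integer coordinates. -/
def lat (k : ι → ℤ) : Euc ι := WithLp.toLp 2 fun i => (k i : ℝ)

theorem lat_add (k l : ι → ℤ) : lat (k + l) = lat k + lat l := by
  ext i
  simp [lat]

theorem measurable_latFloor : Measurable (latFloor : Euc ι → ι → ℤ) := by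
  refine measurable_pi_lambda _ fun i => Int.measurable_floor.comp ?_
  fun_prop

theorem volume_latFloor_fiber (k : ι → ℤ) :
    volume ((latFloor : Euc ι → ι → ℤ) ⁻¹' {k}) = 1 := by
  have : (latFloor : Euc ι → ι → ℤ) ⁻¹' {k} = WithLp.ofLp ⁻¹'
      (Set.univ.pi fun i => Set.Ico (k i : ℝ) (k i + 1)) := by
    ext x
    simp [latFloor, funext_iff, Int.floor_eq_iff]
  rw [this, (PiLp.volume_preserving_ofLp ι).measure_preimage
    (MeasurableSet.univ_pi fun i => measurableSet_Ico).nullMeasurableSet, volume_pi_pi]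
  simp

/-- The unit cells have measure one, so integrals and Luxemburg norms of step functions are those of
their sequences of values. -/
theorem measurePreserving_latFloor :
    MeasurePreserving (latFloor : Euc ι → ι → ℤ) volume .count :=
  measurePreserving_count measurable_latFloor volume_latFloor_fiber

theorem norm_sub_lat_le (x : Euc ι) : ‖x - lat (latFloor x)‖ ≤ Fintype.card ι := by
  have h : ∀ i, ‖(x - lat (latFloor x)) i‖ ≤ 1 := by
    intro i
    simp only [lat, latFloor, PiLp.sub_apply, Real.norm_eq_abs, Int.self_sub_floor]
    rw [abs_of_nonneg (Int.fract_nonneg _)]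
    exact (Int.fract_lt_one _).le
  rw [EuclideanSpace.norm_eq, Real.sqrt_le_left (by positivity)]
  calc ∑ i, ‖(x - lat (latFloor x)) i‖ ^ 2 ≤ ∑ i : ι, (1 : ℝ) :=
        Finset.sum_le_sum fun i _ => pow_le_one₀ (norm_nonneg _) (h i)
    _ = Fintype.card ι := by simp
    _ ≤ (Fintype.card ι : ℝ) ^ 2 := by
        exact_mod_cast Nat.le_self_pow two_ne_zero _

/-- The integer part in phase space. -/
def latFloor₂ (z : Euc ι × Euc ι) : (ι → ℤ) × (ι → ℤ) := (latFloor z.1, latFloor z.2)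

/-- Lattice points of phase space. -/
def lat₂ (k : (ι → ℤ) × (ι → ℤ)) : Euc ι × Euc ι := (lat k.1, lat k.2)

theorem measurePreserving_latFloor₂ :
    MeasurePreserving (latFloor₂ : Euc ι × Euc ι → _) volume .count := by
  refine measurePreserving_count ((measurable_latFloor.comp measurable_fst).prodMk
    (measurable_latFloor.comp measurable_snd)) fun g => ?_
  have : (latFloor₂ : Euc ι × Euc ι → _) ⁻¹' {g} =
      (latFloor ⁻¹' {g.1}) ×ˢ (latFloor ⁻¹' {g.2}) := by
    ext z
    simp [latFloor₂, Prod.ext_iff]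
  rw [this, Measure.volume_eq_prod, Measure.prod_prod, volume_latFloor_fiber,
    volume_latFloor_fiber, one_mul]

theorem phaseNorm_sub_lat_le (z : Euc ι × Euc ι) :
    phaseNorm (z - lat₂ (latFloor₂ z)) ≤ 2 * Fintype.card ι := by
  have h1 := norm_sub_lat_le z.1
  have h2 := norm_sub_lat_le z.2
  simp only [phaseNorm, lat₂, latFloor₂, Prod.fst_sub, Prod.snd_sub]
  linarith

/-- The integer part on the doubled space. -/
def latFloorSum (x : Euc (ι ⊕ ι)) : (ι → ℤ) × (ι → ℤ) :=
  (latFloor (pairFst x), latFloor (pairSnd x))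

/-- Lattice points of the doubled space. -/
def latSum (k : (ι → ℤ) × (ι → ℤ)) : Euc (ι ⊕ ι) := pair (lat k.1) (lat k.2)

theorem measurePreserving_latFloorSum :
    MeasurePreserving (latFloorSum : Euc (ι ⊕ ι) → _) volume .count := by
  refine measurePreserving_count ((measurable_latFloor.comp continuous_pairFst.measurable).prodMk
    (measurable_latFloor.comp continuous_pairSnd.measurable)) fun g => ?_
  have : (latFloorSum : Euc (ι ⊕ ι) → _) ⁻¹' {g} = latFloor ⁻¹' {Sum.elim g.1 g.2} := by
    ext z
    simp [latFloorSum, latFloor, Prod.ext_iff, funext_iff, pairFst, pairSnd]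
  rw [this, volume_latFloor_fiber]

theorem norm_sub_latSum_le (x : Euc (ι ⊕ ι)) :
    ‖x - latSum (latFloorSum x)‖ ≤ 2 * Fintype.card ι := by
  have : latSum (latFloorSum x) = lat (latFloor x) := by
    ext i
    rcases i with i | i <;> simp [latSum, latFloorSum, lat, latFloor, pair, pairFst, pairSnd]
  rw [this]
  refine (norm_sub_lat_le x).trans_eq ?_
  simp
  ring

end Lattice

/-! ### Sampling slowly varying functions -/

section SlowlyVarying

/-- Functions that vary at most exponentially with rate `m`. -/
def SlowlyVarying {E F : Type*} [NormedAddCommGroup E] [NormedAddCommGroup F] (m : ℝ)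
    (H : E × F → ℝ≥0∞) : Prop :=
  ∀ z y, H (z + y) ≤ ENNReal.ofReal (Real.exp (m * phaseNorm y)) * H z

theorem SlowlyVarying.le {E F : Type*} [NormedAddCommGroup E] [NormedAddCommGroup F] {m D : ℝ}
    {H : E × F → ℝ≥0∞} (hH : SlowlyVarying m H) (hm : 0 ≤ m) {z y : E × F}
    (h : phaseNorm (z - y) ≤ D) : H z ≤ ENNReal.ofReal (Real.exp (m * D)) * H y := by
  have := hH y (z - y)
  rw [add_sub_cancel] at this
  exact this.trans (by gcongr)

variable {ι : Type} [Fintype ι]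

theorem slowlyVarying_smear {m : ℝ} (hm : 0 ≤ m) (H : Euc ι × Euc ι → ℝ≥0∞) :
    SlowlyVarying m (smear m H) := smear_add_le hm H

theorem mixedLuxNorm_mono (Φ Ψ : YoungFunction) {F G : Euc ι × Euc ι → ℝ≥0∞}
    (h : ∀ z, F z ≤ G z) : mixedLuxNorm Φ Ψ F ≤ mixedLuxNorm Φ Ψ G :=
  mixedLuxNorm_mono_ae Φ Ψ (Eventually.of_forall h)

theorem mixedLuxNorm_latFloor (Φ Ψ : YoungFunction) (V : (ι → ℤ) → (ι → ℤ) → ℝ≥0∞) :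
    mixedLuxNorm Φ Ψ (fun z : Euc ι × Euc ι => V (latFloor z.1) (latFloor z.2)) =
      mixLux Φ Ψ V := by
  rw [mixedLuxNorm, mixLux, ← luxNorm_comp measurePreserving_latFloor .of_discrete]
  congr 1
  ext ξ
  exact luxNorm_comp measurePreserving_latFloor (u := fun a => V a (latFloor ξ)) .of_discrete

theorem mixLux_lat_le {m : ℝ} (hm : 0 ≤ m) : ∃ C : ℝ≥0, ∀ (Φ Ψ : YoungFunction)
    (F : Euc ι × Euc ι → ℝ≥0∞), SlowlyVarying m F →
      mixLux Φ Ψ (fun a b => F (lat a, lat b)) ≤ C * mixedLuxNorm Φ Ψ F := by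
  refine ⟨(Real.exp (m * (2 * Fintype.card ι))).toNNReal, fun Φ Ψ F hF => ?_⟩
  rw [← mixedLuxNorm_latFloor]
  refine le_trans (mixedLuxNorm_mono Φ Ψ fun z => ?_) (mixedLuxNorm_mul_le Φ Ψ F _)
  refine hF.le hm ?_
  rw [phaseNorm_sub_comm]
  exact phaseNorm_sub_lat_le z

/-- Orlicz sequence spaces embed into ℓ^∞, so the lattice samples are bounded by the norm, and slow
variation fills the cells. -/
theorem SlowlyVarying.exists_le_mixedLuxNorm {m : ℝ} (hm : 0 ≤ m) (Φ Ψ : YoungFunction) :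
    ∃ C : ℝ≥0, ∀ F : Euc ι × Euc ι → ℝ≥0∞, SlowlyVarying m F → ∀ z,
      F z ≤ C * mixedLuxNorm Φ Ψ F := by
  obtain ⟨T, -, hT⟩ := exists_apply_le_mixLux Φ Ψ
  obtain ⟨C, hC⟩ := mixLux_lat_le (ι := ι) hm
  refine ⟨(Real.exp (m * (2 * Fintype.card ι))).toNNReal * (T * C), fun F hF z => ?_⟩
  calc F z ≤ (Real.exp (m * (2 * Fintype.card ι))).toNNReal * F (lat₂ (latFloor₂ z)) :=
        hF.le hm (phaseNorm_sub_lat_le z)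
    _ ≤ (Real.exp (m * (2 * Fintype.card ι))).toNNReal * (T * (C * mixedLuxNorm Φ Ψ F)) := by
        gcongr
        exact (hT (fun a b => F (lat a, lat b)) (latFloor z.1) (latFloor z.2)).trans
          (mul_le_mul_right (hC Φ Ψ F hF) _)
    _ = _ := by
        push_cast
        ring

theorem mixedLpNorm_eq {α β : Type*} [MeasureSpace α] [MeasureSpace β]
    [SFinite (volume : Measure α)] {p q : ℝ≥0∞} (hp : 1 ≤ p) (hq : 1 ≤ q) {F : α × β → ℝ≥0∞}
    (hF : Measurable F) :
    mixedLpNorm p q F = mixedLuxNorm (YoungFunction.pow p hp) (YoungFunction.pow q hq) F := by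
  rw [mixedLpNorm, mixedLuxNorm]
  have : ∀ y, eLpNorm (fun x => F (x, y)) p volume =
      luxNorm (YoungFunction.pow p hp) volume fun x => F (x, y) := fun y =>
    (luxNorm_pow hp (hF.comp measurable_prodMk_right).aemeasurable).symm
  simp only [this]
  rw [luxNorm_pow hq (measurable_luxNorm_left _ hF).aemeasurable]

/-- Sampling a slowly varying symbol along sheared lattices. -/
theorem exists_sampled_symbol_le (A : Matrix ι ι ℝ) {m : ℝ} (hm : 0 ≤ m) : ∃ C : ℝ≥0,
    ∀ (p q : ℝ≥0∞), 1 ≤ p → 1 ≤ q → ∀ h : Euc (ι ⊕ ι) × Euc (ι ⊕ ι) → ℝ≥0∞, Measurable h →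
      SlowlyVarying m h →
      eLpNorm (fun Y : (ι → ℤ) × (ι → ℤ) => eLpNorm (fun X : (ι → ℤ) × (ι → ℤ) =>
        h (latSum X + pair (matVec A (lat Y.2)) (matVec A.transpose (lat Y.1)), latSum Y))
          p .count) q .count ≤ C * mixedLpNorm p q h := by
  set D : ℝ := 2 * Fintype.card ι
  set c : ℝ≥0 := (Real.exp (m * D)).toNNReal
  refine ⟨c * c, fun p q hp hq h hh hs => ?_⟩
  rw [mixedLpNorm_eq hp hq hh, ← luxNorm_pow hq Measurable.of_discrete.aemeasurable]
  simp only [← luxNorm_pow hp Measurable.of_discrete.aemeasurable]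
  set Φ := YoungFunction.pow p hp
  set Ψ := YoungFunction.pow q hq
  set N : Euc (ι ⊕ ι) → ℝ≥0∞ := fun y => luxNorm Φ volume fun x => h (x, y) with hN
  have inner : ∀ Y : (ι → ℤ) × (ι → ℤ), (luxNorm Φ .count fun X : (ι → ℤ) × (ι → ℤ) =>
      h (latSum X + pair (matVec A (lat Y.2)) (matVec A.transpose (lat Y.1)), latSum Y)) ≤
      c * N (latSum Y) := by
    intro Y
    -- For fixed Y the shear is a translation by S in the first variable. S need not be a lattice
    -- vector, so the sum over X is first replaced by an integral, which is invariant under the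
    -- translation.
    set S := pair (matVec A (lat Y.2)) (matVec A.transpose (lat Y.1))
    rw [← luxNorm_comp measurePreserving_latFloorSum .of_discrete]
    calc _ ≤ luxNorm Φ volume fun x => c * h (x + S, latSum Y) := by
          refine luxNorm_mono Φ fun x => hs.le hm ?_
          simp only [phaseNorm, Prod.mk_sub_mk, sub_self, norm_zero, add_zero,
            add_sub_add_right_eq_sub]
          rw [norm_sub_rev]
          exact norm_sub_latSum_le x
      _ ≤ c * luxNorm Φ volume fun x => h (x + S, latSum Y) := luxNorm_mul_le _ _ _ _
      _ = _ := by
          congr 1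
          exact luxNorm_comp (measurePreserving_add_right volume S)
            (u := fun x => h (x, latSum Y)) (hh.comp measurable_prodMk_right)
  calc _ ≤ luxNorm Ψ .count fun Y => c * N (latSum Y) := luxNorm_mono Ψ inner
    _ ≤ c * luxNorm Ψ .count fun Y => N (latSum Y) := luxNorm_mul_le _ _ _ _
    _ ≤ c * (c * luxNorm Ψ volume N) := by
        gcongr
        rw [← luxNorm_comp measurePreserving_latFloorSum .of_discrete]
        refine le_trans (luxNorm_mono Ψ fun y => ?_) (luxNorm_mul_le Ψ _ _ c)
        refine le_trans (luxNorm_mono Φ fun x => hs.le hm ?_) (luxNorm_mul_le Φ _ _ c)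
        simp only [phaseNorm, Prod.mk_sub_mk, sub_self, norm_zero, zero_add]
        rw [norm_sub_rev]
        exact norm_sub_latSum_le y
    _ = _ := by
        push_cast
        rw [mul_assoc]
        rfl

end SlowlyVarying

/-! ### Twisted convolutions with a sampled symbol -/

section Bilinear

/-- The trilinear estimate for sequences on a countable group behind the mapping properties of
pseudo-differential operators. -/
def TrilinearBound (p q : ℝ≥0∞) (Φ₁ Φ₂ Ψ₁ Ψ₂ : YoungFunction) : Prop :=
  ∃ C : ℝ≥0, ∀ {Γ : Type} [MeasurableSpace Γ] [MeasurableSingletonClass Γ] [Countable Γ]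
    [AddCommGroup Γ] (F G : Γ → Γ → ℝ≥0∞) (H : Γ × Γ → Γ × Γ → ℝ≥0∞),
    ∑' Y : Γ × Γ, ∑' X : Γ × Γ, H X Y * (G X.1 (X.2 + Y.1) * F (X.1 + Y.2) X.2) ≤
      C * eLpNorm (fun Y => eLpNorm (fun X => H X Y) p .count) q .count *
        (mixLux Φ₁ Ψ₁ F * mixLux Φ₂ Ψ₂ G)

variable {ι : Type} [Fintype ι] [DecidableEq ι] {p q : ℝ≥0∞} {Φ₁ Φ₂ Ψ₁ Ψ₂ : YoungFunction}

/-- These coordinates explain the index pattern of the trilinear form: the second component of the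
kernel point is Y, and the first is X up to a shear that depends on Y only. -/
theorem kernelPoint_lat (A : Matrix ι ι ℝ) (X Y : (ι → ℤ) × (ι → ℤ)) :
    kernelPoint A (lat X.1, lat (X.2 + Y.1)) (lat (X.1 + Y.2), lat X.2) =
      (latSum X + pair (matVec A (lat Y.2)) (matVec A.transpose (lat Y.1)), latSum Y) := by
  simp only [kernelPoint, latSum, lat_add, pair_add, matVec_one_sub]
  congr 2
  · have : lat X.1 - (lat X.1 + lat Y.2) = -lat Y.2 := by abel
    rw [this, ← zero_sub, matVec_sub, ← sub_self (0 : Euc ι), matVec_sub]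
    abel
  · rw [matVec_add]
    abel
  · abel
  · abel

theorem kernelPoint_sub (A : Matrix ι ι ℝ) (z w z' w' : Euc ι × Euc ι) :
    kernelPoint A z w - kernelPoint A z' w' = kernelPoint A (z - z') (w - w') := by
  simp only [kernelPoint, Prod.mk_sub_mk, pair_sub, Prod.fst_sub, Prod.snd_sub, matVec_sub]
  congr 2 <;> abel

theorem exists_phaseNorm_kernelPoint_le (A : Matrix ι ι ℝ) (D : ℝ) : ∃ K : ℝ,
    ∀ z w : Euc ι × Euc ι, phaseNorm z ≤ D → phaseNorm w ≤ D →
      phaseNorm (kernelPoint A z w) ≤ K := by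
  obtain ⟨K, hK, h⟩ := exists_kernelPoint_le A
  refine ⟨1 + K * (D ^ 2 + D ^ 2), fun z w hz hw => ?_⟩
  have h1 := h z w
  have e : ∀ y : Euc ι × Euc ι, phaseNorm y ≤ D → ‖y.1‖ ^ 2 + ‖y.2‖ ^ 2 ≤ D ^ 2 := by
    intro y hy
    have := pow_le_pow_left₀ (phaseNorm_nonneg y) hy 2
    rw [phaseNorm] at this
    nlinarith [norm_nonneg y.1, norm_nonneg y.2, mul_nonneg (norm_nonneg y.1) (norm_nonneg y.2)]
  have h2 := mul_le_mul_of_nonneg_left (add_le_add (e z hz) (e w hw)) hK.le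
  rw [phaseNorm]
  nlinarith [sq_nonneg (‖(kernelPoint A z w).1‖ - 1 / 2), sq_nonneg (‖(kernelPoint A z w).2‖ - 1 / 2)]

omit [Fintype ι] [DecidableEq ι] in
theorem tsum_reindex (V : (ι → ℤ) → (ι → ℤ) → (ι → ℤ) × (ι → ℤ) → ℝ≥0∞) :
    ∑' n, ∑' k, ∑' w, V k n w = ∑' Y : (ι → ℤ) × (ι → ℤ), ∑' X : (ι → ℤ) × (ι → ℤ),
      V X.1 (X.2 + Y.1) (X.1 + Y.2, X.2) := by
  let e : ((ι → ℤ) × (ι → ℤ)) × ((ι → ℤ) × (ι → ℤ)) ≃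
      ((ι → ℤ) × (ι → ℤ)) × ((ι → ℤ) × (ι → ℤ)) :=
    { toFun := fun s => ((s.2.2 + s.1.1, s.2.1), (s.2.1 + s.1.2, s.2.2))
      invFun := fun t => ((t.1.1 - t.2.2, t.2.1 - t.1.2), (t.1.2, t.2.2))
      left_inv := fun s => by simp
      right_inv := fun t => by simp }
  have h1 : ∑' n, ∑' k, ∑' w, V k n w = ∑' t : ((ι → ℤ) × (ι → ℤ)) × ((ι → ℤ) × (ι → ℤ)),
      V t.1.2 t.1.1 t.2 := by
    rw [ENNReal.tsum_prod', ENNReal.tsum_prod']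
  rw [h1, ← e.tsum_eq, ENNReal.tsum_prod']
  rfl

/-- Twisted convolutions of slowly varying functions. -/
theorem TrilinearBound.exists_le (hT : TrilinearBound p q Φ₁ Φ₂ Ψ₁ Ψ₂) (hp : 1 ≤ p) (hq : 1 ≤ q)
    (A : Matrix ι ι ℝ) {m : ℝ} (hm : 0 ≤ m) : ∃ C : ℝ≥0,
    ∀ (h : Euc (ι ⊕ ι) × Euc (ι ⊕ ι) → ℝ≥0∞) (F : Euc ι × Euc ι → ℝ≥0∞), Measurable h →
      SlowlyVarying m h → SlowlyVarying m F → ∃ V : Euc ι × Euc ι → ℝ≥0∞, Measurable V ∧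
        (∀ z, ∫⁻ w, h (kernelPoint A z w) * F w ≤ V z) ∧
        mixedLuxNorm Φ₂.conj Ψ₂.conj V ≤ C * mixedLpNorm p q h * mixedLuxNorm Φ₁ Ψ₁ F ∧
        ∀ z, V z ≤ C * mixedLpNorm p q h * mixedLuxNorm Φ₁ Ψ₁ F := by
  obtain ⟨C₁, hC₁⟩ := hT
  obtain ⟨C₂, hC₂⟩ := exists_sampled_symbol_le A hm
  obtain ⟨C₃, hC₃⟩ := mixLux_lat_le (ι := ι) hm
  obtain ⟨T, -, hTp⟩ := exists_apply_le_mixLux Φ₂.conj Ψ₂.conj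
  set D : ℝ := 2 * Fintype.card ι
  obtain ⟨K, hK⟩ := exists_phaseNorm_kernelPoint_le A D
  set c : ℝ≥0 := (Real.exp (m * K)).toNNReal * (Real.exp (m * D)).toNNReal with hc
  set C := C₁ * C₂ * C₃
  -- The summand 1 serves the norm bound for V, the summand T its pointwise bound.
  refine ⟨(1 + T) * (c * C), fun h F hh hsh hsF => ?_⟩
  obtain ⟨U, hUd⟩ : ∃ U : (ι → ℤ) → (ι → ℤ) → ℝ≥0∞, ∀ k n, U k n = ∑' w : (ι → ℤ) × (ι → ℤ),
    h (kernelPoint A (lat k, lat n) (lat₂ w)) * F (lat₂ w) := ⟨_, fun _ _ => rfl⟩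
  -- Duality turns the norm of U into sums against G, and reindexing these by X and Y gives the
  -- trilinear form.
  have hU : mixLux Φ₂.conj Ψ₂.conj U ≤ C * mixedLpNorm p q h * mixedLuxNorm Φ₁ Ψ₁ F := by
    refine mixLux_conj_le Φ₂ Ψ₂ U fun G hG => ?_
    simp only [hUd, ← ENNReal.tsum_mul_right]
    rw [tsum_reindex (fun k n w => h (kernelPoint A (lat k, lat n) (lat₂ w)) * F (lat₂ w) *
      G k n)]
    have e : ∀ X Y : (ι → ℤ) × (ι → ℤ),
        h (kernelPoint A (lat X.1, lat (X.2 + Y.1)) (lat₂ (X.1 + Y.2, X.2))) *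
          F (lat₂ (X.1 + Y.2, X.2)) * G X.1 (X.2 + Y.1) =
        h (latSum X + pair (matVec A (lat Y.2)) (matVec A.transpose (lat Y.1)), latSum Y) *
          (G X.1 (X.2 + Y.1) * F (lat (X.1 + Y.2), lat X.2)) := by
      intro X Y
      rw [← kernelPoint_lat, mul_assoc, mul_comm (F _)]
      rfl
    simp only [e]
    refine (hC₁ (fun a b => F (lat a, lat b)) G _).trans ?_
    calc _ ≤ C₁ * (C₂ * mixedLpNorm p q h) * ((C₃ * mixedLuxNorm Φ₁ Ψ₁ F) * 1) := by
          gcongr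
          · exact hC₂ p q hp hq h hh hsh
          · exact hC₃ Φ₁ Ψ₁ F hsF
      _ = _ := by
          simp only [C]
          push_cast
          ring
  refine ⟨fun z => c * U (latFloor z.1) (latFloor z.2), ?_, fun z => ?_, ?_, fun z => ?_⟩
  · have h1 : Measurable fun k : (ι → ℤ) × (ι → ℤ) => (c : ℝ≥0∞) * U k.1 k.2 := .of_discrete
    have h2 := h1.comp (measurePreserving_latFloor₂ (ι := ι)).measurable
    simpa only [Function.comp_def, latFloor₂] using h2
  -- Moving z and w to the corners of their cells displaces the kernel point by a bounded amount, by
  -- linearity; slow variation of h and F then costs only the constant c.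
  · calc _ ≤ ∫⁻ w, c * (h (kernelPoint A (lat₂ (latFloor₂ z)) (lat₂ (latFloor₂ w))) *
          F (lat₂ (latFloor₂ w))) := by
          refine lintegral_mono fun w => ?_
          have h1 : h (kernelPoint A z w) ≤ ENNReal.ofReal (Real.exp (m * K)) *
              h (kernelPoint A (lat₂ (latFloor₂ z)) (lat₂ (latFloor₂ w))) := by
            refine hsh.le hm ?_
            rw [kernelPoint_sub]
            exact hK _ _ (phaseNorm_sub_lat_le z) (phaseNorm_sub_lat_le w)
          have h2 : F w ≤ ENNReal.ofReal (Real.exp (m * D)) * F (lat₂ (latFloor₂ w)) :=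
            hsF.le hm (phaseNorm_sub_lat_le w)
          refine (mul_le_mul' h1 h2).trans_eq ?_
          simp only [hc, ENNReal.ofReal]
          push_cast
          ring
      _ = c * ∫⁻ w, h (kernelPoint A (lat₂ (latFloor₂ z)) (lat₂ (latFloor₂ w))) *
          F (lat₂ (latFloor₂ w)) := lintegral_const_mul' _ _ ENNReal.coe_ne_top
      _ = _ := by
          have := measurePreserving_latFloor₂.lintegral_comp
            (f := fun w' : (ι → ℤ) × (ι → ℤ) =>
              h (kernelPoint A (lat₂ (latFloor₂ z)) (lat₂ w')) * F (lat₂ w')) .of_discrete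
          rw [this, lintegral_count]
          simp only [hUd]
          rfl
  · refine (mixedLuxNorm_mul_le _ _ _ c).trans ?_
    rw [mixedLuxNorm_latFloor]
    calc _ ≤ c * (C * mixedLpNorm p q h * mixedLuxNorm Φ₁ Ψ₁ F) := by gcongr
      _ = 1 * (c * C * mixedLpNorm p q h * mixedLuxNorm Φ₁ Ψ₁ F) := by ring
      _ ≤ (1 + T) * (c * C * mixedLpNorm p q h * mixedLuxNorm Φ₁ Ψ₁ F) := by
          gcongr
          exact le_self_add
      _ = _ := by
          push_cast
          ring
  · calc _ ≤ c * (T * (C * mixedLpNorm p q h * mixedLuxNorm Φ₁ Ψ₁ F)) := by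
          exact mul_le_mul_right ((hTp U _ _).trans (by gcongr)) _
      _ = T * (c * C * mixedLpNorm p q h * mixedLuxNorm Φ₁ Ψ₁ F) := by ring
      _ ≤ (1 + T) * (c * C * mixedLpNorm p q h * mixedLuxNorm Φ₁ Ψ₁ F) := by
          gcongr
          exact le_add_self
      _ = _ := by
          push_cast
          ring

end Bilinear

/-! ### Pairings with test functions in weighted spaces -/

section Weights
variable {ι : Type} [Fintype ι]

theorem ENNReal.le_inv_mul_of_mul_le {a b c : ℝ≥0∞} (ha : a ≠ 0) (ha' : a ≠ ∞) (h : b * a ≤ c) :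
    b ≤ a⁻¹ * c := by
  rw [mul_comm, ← div_eq_mul_inv]
  exact (ENNReal.le_div_iff_mul_le (Or.inl ha) (Or.inl ha')).mpr h

theorem ModerateWeight.ofReal_ne_zero (ω : ModerateWeight (Euc ι × Euc ι)) (z : Euc ι × Euc ι) :
    ENNReal.ofReal (ω z) ≠ 0 := by
  simpa using ω.isWeight.pos z

theorem ModerateWeight.exists_inv_le (ω : ModerateWeight (Euc ι × Euc ι)) :
    ∃ C : ℝ≥0, ∃ c ≥ 0, ∀ z, (ENNReal.ofReal (ω z))⁻¹ ≤
      C * ENNReal.ofReal (Real.exp (c * phaseNorm z)) := by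
  obtain ⟨C, hC, c, hc, h⟩ := ω.exists_le_expPhase
  refine ⟨(C * (ω 0)⁻¹).toNNReal, c, hc, fun z => ?_⟩
  have h1 := h z (-z)
  rw [add_neg_cancel, phaseNorm_neg] at h1
  have h0 := ω.isWeight.pos 0
  have hz := ω.isWeight.pos z
  change _ ≤ ENNReal.ofReal _ * _
  rw [← ENNReal.ofReal_inv_of_pos hz, ← ENNReal.ofReal_mul (by positivity)]
  refine ENNReal.ofReal_le_ofReal ?_
  rw [inv_le_iff_one_le_mul₀ hz]
  calc (1 : ℝ) = (ω 0)⁻¹ * ω 0 := (inv_mul_cancel₀ h0.ne').symm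
    _ ≤ (ω 0)⁻¹ * (C * Real.exp (c * phaseNorm z) * ω z) := by gcongr
    _ = _ := by ring

theorem exists_lintegral_gsHat_weight_le {h : ℝ} (h0 : 0 < h)
    (ω : ModerateWeight (Euc ι × Euc ι)) : ∃ C : ℝ≥0, ∀ (g : GS ι) (M : ℝ),
    GSBound h M (g : Euc ι → ℂ) →
      ∫⁻ z, ‖gsHat g z‖ₑ * (ENNReal.ofReal (ω z))⁻¹ ≤ C * ENNReal.ofReal M := by
  obtain ⟨C₁, c, hc, h₁⟩ := ω.exists_inv_le
  obtain ⟨C₂, h₂⟩ := exists_enorm_gsHat_le (ι := ι) h0 (c + 1)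
  have hfin := lintegral_exp_neg_phaseNorm_lt_top (ι := ι) one_pos
  refine ⟨C₁ * C₂ * (∫⁻ z : Euc ι × Euc ι, ENNReal.ofReal (Real.exp (-1 * phaseNorm z))).toNNReal,
    fun g M hg => ?_⟩
  push_cast
  rw [ENNReal.coe_toNNReal hfin.ne]
  calc _ ≤ ∫⁻ z : Euc ι × Euc ι, C₁ * C₂ * ENNReal.ofReal M *
        ENNReal.ofReal (Real.exp (-1 * phaseNorm z)) := by
        refine lintegral_mono fun z => ?_
        refine (mul_le_mul' (h₂ g M hg z) (h₁ z)).trans_eq ?_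
        have : Real.exp (-1 * phaseNorm z) =
            Real.exp (-(c + 1) * phaseNorm z) * Real.exp (c * phaseNorm z) := by
          rw [← Real.exp_add]
          ring_nf
        rw [this, ENNReal.ofReal_mul (Real.exp_nonneg _)]
        ring
    _ = _ := by
        rw [lintegral_const_mul' _ _ (by finiteness)]
        ring

/-- The dual pairing is bounded on the Orlicz modulation spaces. -/
theorem exists_enorm_apply_le {h : ℝ} (h0 : 0 < h) (Φ Ψ : YoungFunction)
    (ω : ModerateWeight (Euc ι × Euc ι)) : ∃ C : ℝ≥0, ∀ (f : GSDual ι), AEMeasurable (stft f) →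
      ∀ (g : GS ι) (M : ℝ), GSBound h M (g : Euc ι → ℂ) →
      ‖(f : GS ι →ₗ[ℂ] ℂ) g‖ₑ ≤ C * ENNReal.ofReal M * orliczModNorm Φ Ψ ω f := by
  obtain ⟨C₁, h₁⟩ := exists_apply_tfGS_le h0 1 ω
  obtain ⟨C₂, h₂⟩ := SlowlyVarying.exists_le_mixedLuxNorm (ι := ι) zero_le_one Φ Ψ
  obtain ⟨C₃, h₃⟩ := mixedLuxNorm_smear_le (ι := ι) one_pos
  have hfin : (ENNReal.ofReal (ω 0))⁻¹ ≠ ∞ := ENNReal.inv_ne_top.mpr (ω.ofReal_ne_zero 0)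
  refine ⟨(ENNReal.ofReal (ω 0))⁻¹.toNNReal * (C₁ * C₂ * C₃), fun f hf g M hg => ?_⟩
  push_cast
  rw [ENNReal.coe_toNNReal hfin]
  have e := h₁ f g M hg 0
  rw [tfGS_zero] at e
  refine (ENNReal.le_inv_mul_of_mul_le (ω.ofReal_ne_zero 0) ENNReal.ofReal_ne_top e).trans ?_
  calc _ ≤ (ENNReal.ofReal (ω 0))⁻¹ * (C₁ * ENNReal.ofReal M *
        (C₂ * (C₃ * orliczModNorm Φ Ψ ω f))) := by
        gcongr
        exact (h₂ _ (slowlyVarying_smear zero_le_one _) 0).trans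
          (mul_le_mul_right (h₃ Φ Ψ _ (aemeasurable_wstft ω hf)) _)
    _ = _ := by ring

theorem mixedLpNorm_eq_of_aemeasurable {p q : ℝ≥0∞} (hp : 1 ≤ p) (hq : 1 ≤ q)
    {F : Euc ι × Euc ι → ℝ≥0∞} (hF : AEMeasurable F) :
    mixedLpNorm p q F = mixedLuxNorm (YoungFunction.pow p hp) (YoungFunction.pow q hq) F := by
  have h1 : mixedLpNorm p q F = mixedLpNorm p q (hF.mk F) := by
    refine eLpNorm_congr_ae ?_
    filter_upwards [ae_ae_snd_of_ae_prod (P := fun z => F z = hF.mk F z) hF.ae_eq_mk] with y hy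
    exact eLpNorm_congr_ae hy
  rw [h1, mixedLpNorm_eq hp hq hF.measurable_mk]
  exact le_antisymm (mixedLuxNorm_mono_ae _ _ (hF.ae_eq_mk.mono fun _ h => h.ge))
    (mixedLuxNorm_mono_ae _ _ (hF.ae_eq_mk.mono fun _ h => h.le))

theorem modNorm_eq {p q : ℝ≥0∞} (hp : 1 ≤ p) (hq : 1 ≤ q) (ω : ModerateWeight (Euc ι × Euc ι))
    (u : GSDual ι) : modNorm p q ω u =
      orliczModNorm (YoungFunction.pow p hp) (YoungFunction.pow q hq) ω u :=
  mixedLpNorm_eq_of_aemeasurable hp hq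
    (aemeasurable_wstft ω (continuous_stft u).measurable.aemeasurable)

end Weights

/-! ### Majorants for the Gabor matrix -/

section Operator
variable {ι : Type} [Fintype ι] [DecidableEq ι] {p q : ℝ≥0∞} {Φ₁ Φ₂ Ψ₁ Ψ₂ : YoungFunction}

/-- The compatibility of the weights with the operator calculus `Op_A`. -/
def WeightCompat (A : Matrix ι ι ℝ) (ω₀ : ModerateWeight (Euc (ι ⊕ ι) × Euc (ι ⊕ ι)))
    (ω₁ ω₂ : ModerateWeight (Euc ι × Euc ι)) : Prop :=
  ∃ C : ℝ≥0, ∀ z w, ENNReal.ofReal (ω₂ z) ≤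
    C * (ENNReal.ofReal (ω₁ w) * ENNReal.ofReal (ω₀ (kernelPoint A z w)))

theorem continuous_kernelCoef (A : Matrix ι ι ℝ) (a : GSDual (ι ⊕ ι)) :
    Continuous fun p : (Euc ι × Euc ι) × (Euc ι × Euc ι) => kernelCoef A a p.1 p.2 := by
  obtain ⟨-, h₀, h₀0, M₀, hM₀⟩ := (kernelTheta A).2
  obtain ⟨h', h'0, hcont, -⟩ := exists_gsBound_tfGS h₀0 hM₀ (δ := 1) one_pos
  have h1 := (hcont.continuous_apply h'0 a).comp (continuous_kernelPoint A)
  have h2 := continuous_kernelPhase A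
  unfold kernelCoef
  exact (by fun_prop : Continuous fun p : (Euc ι × Euc ι) × (Euc ι × Euc ι) =>
    Complex.exp (Complex.I * kernelPhase A p.1 p.2)).mul h1

theorem enorm_kernelCoef (A : Matrix ι ι ℝ) (a : GSDual (ι ⊕ ι)) (z w : Euc ι × Euc ι) :
    ‖kernelCoef A a z w‖ₑ =
      ‖(a : GS (ι ⊕ ι) →ₗ[ℂ] ℂ) (tfGS (kernelTheta A) (kernelPoint A z w))‖ₑ := by
  rw [kernelCoef, enorm_mul, ← ofReal_norm, exp_phase_norm, ENNReal.ofReal_one, one_mul]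

variable {A : Matrix ι ι ℝ} {ω₀ : ModerateWeight (Euc (ι ⊕ ι) × Euc (ι ⊕ ι))}
  {ω₁ ω₂ : ModerateWeight (Euc ι × Euc ι)}

/-- A majorant for the action of the matrix coefficients on phase space functions. -/
theorem TrilinearBound.exists_majorant (hT : TrilinearBound p q Φ₁ Φ₂ Ψ₁ Ψ₂) (hp : 1 ≤ p)
    (hq : 1 ≤ q) (hω : WeightCompat A ω₀ ω₁ ω₂) : ∃ C : ℝ≥0, ∀ (a : GSDual (ι ⊕ ι))
    (H : Euc ι × Euc ι → ℝ≥0∞), AEMeasurable H → ∃ V : Euc ι × Euc ι → ℝ≥0∞, Measurable V ∧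
      (∀ φ : Euc ι × Euc ι → ℝ≥0∞, (∀ w, φ w * ENNReal.ofReal (ω₁ w) ≤ smear 1 H w) →
        ∀ z, (∫⁻ w, φ w * ‖kernelCoef A a z w‖ₑ) * ENNReal.ofReal (ω₂ z) ≤ V z) ∧
      mixedLuxNorm Φ₂.conj Ψ₂.conj V ≤ C * modNorm p q ω₀ a * mixedLuxNorm Φ₁ Ψ₁ H ∧
      ∀ z, V z ≤ C * modNorm p q ω₀ a * mixedLuxNorm Φ₁ Ψ₁ H := by
  obtain ⟨-, h₀, h₀0, M₀, hM₀⟩ := (kernelTheta A).2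
  obtain ⟨C₁, h₁⟩ := exists_apply_tfGS_le h₀0 1 ω₀
  obtain ⟨C₂, h₂⟩ := hT.exists_le hp hq A zero_le_one
  obtain ⟨C₃, h₃⟩ := mixedLuxNorm_smear_le (ι := ι) one_pos
  obtain ⟨C₄, h₄⟩ := mixedLuxNorm_smear_le (ι := ι ⊕ ι) one_pos
  obtain ⟨C₅, h₅⟩ := hω
  set c : ℝ≥0 := C₅ * (C₁ * M₀.toNNReal)
  refine ⟨c * (C₂ * C₄ * C₃), fun a H hH => ?_⟩
  have hwa := aemeasurable_wstft ω₀ (continuous_stft a).measurable.aemeasurable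
  obtain ⟨V, hV, hV1, hV2, hV3⟩ := h₂ (smear 1 (wstft ω₀ a)) (smear 1 H)
    (measurable_smear 1 hwa) (slowlyVarying_smear zero_le_one _) (slowlyVarying_smear zero_le_one _)
  have hK : C₂ * mixedLpNorm p q (smear 1 (wstft ω₀ a)) * mixedLuxNorm Φ₁ Ψ₁ (smear 1 H) ≤
      (C₂ * C₄ * C₃ : ℝ≥0) * modNorm p q ω₀ a * mixedLuxNorm Φ₁ Ψ₁ H := by
    rw [mixedLpNorm_eq hp hq (measurable_smear 1 hwa), modNorm_eq hp hq]
    calc _ ≤ C₂ * (C₄ * orliczModNorm (YoungFunction.pow p hp) (YoungFunction.pow q hq) ω₀ a) *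
          (C₃ * mixedLuxNorm Φ₁ Ψ₁ H) := by
          gcongr
          · exact h₄ _ _ _ hwa
          · exact h₃ _ _ _ hH
      _ = _ := by
          push_cast
          ring
  refine ⟨fun z => c * V z, hV.const_mul _, fun φ hφ z => ?_, ?_, fun z => ?_⟩
  · rw [mul_comm, ← lintegral_const_mul' _ _ ENNReal.ofReal_ne_top]
    refine le_trans ?_ (mul_le_mul_right (hV1 z) (c : ℝ≥0∞))
    rw [← lintegral_const_mul' _ _ ENNReal.coe_ne_top]
    refine lintegral_mono fun w => ?_
    -- The weight condition distributes ω₂(z) over the symbol at the kernel point and the function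
    -- at w.
    calc ENNReal.ofReal (ω₂ z) * (φ w * ‖kernelCoef A a z w‖ₑ)
        ≤ C₅ * (ENNReal.ofReal (ω₁ w) * ENNReal.ofReal (ω₀ (kernelPoint A z w))) *
          (φ w * ‖kernelCoef A a z w‖ₑ) := by
          gcongr
          exact h₅ z w
      _ = C₅ * (‖kernelCoef A a z w‖ₑ * ENNReal.ofReal (ω₀ (kernelPoint A z w))) *
          (φ w * ENNReal.ofReal (ω₁ w)) := by ring
      _ ≤ C₅ * (C₁ * ENNReal.ofReal M₀ * smear 1 (wstft ω₀ a) (kernelPoint A z w)) *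
          smear 1 H w := by
          rw [enorm_kernelCoef]
          exact mul_le_mul' (mul_le_mul_right (h₁ a _ M₀ hM₀ _) _) (hφ w)
      _ = _ := by
          simp only [c, ENNReal.ofReal]
          push_cast
          ring
  · refine (mixedLuxNorm_mul_le _ _ V c).trans ((mul_le_mul_right (hV2.trans hK) _).trans_eq ?_)
    push_cast
    ring
  · refine (mul_le_mul_right ((hV3 z).trans hK) _).trans_eq ?_
    push_cast
    ring

/-- The integrand of the weak form of `Op_A(a)` in the Gabor system. -/
def opIntegrand (A : Matrix ι ι ℝ) (a : GSDual (ι ⊕ ι)) (f : GSDual ι) (g : GS ι)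
    (p : (Euc ι × Euc ι) × (Euc ι × Euc ι)) : ℂ :=
  (tfConst ι * gsHat g p.1) * (tfConst ι * (f : GS ι →ₗ[ℂ] ℂ) (gsPi p.2)) * kernelCoef A a p.1 p.2

/-- The weak form of `Op_A(a)` in the Gabor system. -/
def opForm (A : Matrix ι ι ℝ) (a : GSDual (ι ⊕ ι)) (f : GSDual ι) (g : GS ι) : ℂ :=
  fourierConst ι * ∫ p, opIntegrand A a f g p

theorem continuous_opIntegrand (A : Matrix ι ι ℝ) (a : GSDual (ι ⊕ ι)) (f : GSDual ι) (g : GS ι) :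
    Continuous (opIntegrand A a f g) := by
  have h1 := continuous_gsHat g
  have h2 : Continuous fun p : (Euc ι × Euc ι) × (Euc ι × Euc ι) =>
    (f : GS ι →ₗ[ℂ] ℂ) (gsPi p.2) := (continuous_apply_gsPi f).comp continuous_snd
  have h3 := continuous_kernelCoef A a
  unfold opIntegrand
  fun_prop

theorem enorm_opIntegrand (A : Matrix ι ι ℝ) (a : GSDual (ι ⊕ ι)) (f : GSDual ι) (g : GS ι)
    (p : (Euc ι × Euc ι) × (Euc ι × Euc ι)) : ‖opIntegrand A a f g p‖ₑ =
      ‖tfConst ι‖ₑ ^ 2 * (‖gsHat g p.1‖ₑ *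
        (‖(f : GS ι →ₗ[ℂ] ℂ) (gsPi p.2)‖ₑ * ‖kernelCoef A a p.1 p.2‖ₑ)) := by
  simp only [opIntegrand, enorm_mul]
  ring

theorem lintegral_kernel (a : GSDual (ι ⊕ ι)) {φ : Euc ι × Euc ι → ℝ≥0∞} (hφ : Measurable φ)
    (g : GS ι) : ∫⁻ p : (Euc ι × Euc ι) × (Euc ι × Euc ι), ‖gsHat g p.1‖ₑ *
      (φ p.2 * ‖kernelCoef A a p.1 p.2‖ₑ) =
        ∫⁻ z, ‖gsHat g z‖ₑ * ∫⁻ w, φ w * ‖kernelCoef A a z w‖ₑ := by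
  rw [Measure.volume_eq_prod, lintegral_prod]
  · refine lintegral_congr fun z => ?_
    simp only
    rw [lintegral_const_mul' _ _ enorm_ne_top]
  · refine Measurable.aemeasurable ?_
    have h1 := (continuous_gsHat g).measurable
    have h2 := (continuous_kernelCoef A a).measurable
    exact (h1.comp measurable_fst).enorm.mul ((hφ.comp measurable_snd).mul h2.enorm)

/-- The pointwise bound of the majorant suffices: it makes the inner integral at most K/ω₂(z), and
the Gabor coefficients of a test function are integrable against 1/ω₂. A general φ is allowed, so
that the same estimate serves for one distribution and for the supremum of a dominated sequence. -/
theorem TrilinearBound.exists_lintegral_le (hT : TrilinearBound p q Φ₁ Φ₂ Ψ₁ Ψ₂) (hp : 1 ≤ p)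
    (hq : 1 ≤ q) (hω : WeightCompat A ω₀ ω₁ ω₂) {h : ℝ} (h0 : 0 < h) : ∃ C : ℝ≥0,
    ∀ (a : GSDual (ι ⊕ ι)) (H φ : Euc ι × Euc ι → ℝ≥0∞), AEMeasurable H → Measurable φ →
      (∀ w, φ w * ENNReal.ofReal (ω₁ w) ≤ smear 1 H w) → ∀ (g : GS ι) (M : ℝ),
      GSBound h M (g : Euc ι → ℂ) →
      ∫⁻ p : (Euc ι × Euc ι) × (Euc ι × Euc ι), ‖gsHat g p.1‖ₑ *
        (φ p.2 * ‖kernelCoef A a p.1 p.2‖ₑ) ≤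
          C * ENNReal.ofReal M * (modNorm p q ω₀ a * mixedLuxNorm Φ₁ Ψ₁ H) := by
  obtain ⟨C₁, h₁⟩ := hT.exists_majorant hp hq hω
  obtain ⟨C₂, h₂⟩ := exists_lintegral_gsHat_weight_le h0 ω₂
  refine ⟨C₂ * C₁, fun a H φ hH hφ hb g M hg => ?_⟩
  obtain ⟨V, -, hV1, -, hV⟩ := h₁ a H hH
  rw [lintegral_kernel a hφ]
  set K := C₁ * modNorm p q ω₀ a * mixedLuxNorm Φ₁ Ψ₁ H with hK
  have hm : AEMeasurable fun z => ‖gsHat g z‖ₑ * (ENNReal.ofReal (ω₂ z))⁻¹ :=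
    (continuous_gsHat g).measurable.enorm.aemeasurable.mul
      ω₂.isWeight.aemeasurable.ennreal_ofReal.inv
  calc _ ≤ ∫⁻ z, ‖gsHat g z‖ₑ * (ENNReal.ofReal (ω₂ z))⁻¹ * K := by
        refine lintegral_mono fun z => ?_
        rw [mul_assoc]
        refine mul_le_mul_right ?_ _
        exact ENNReal.le_inv_mul_of_mul_le (ω₂.ofReal_ne_zero z) ENNReal.ofReal_ne_top
          ((hV1 φ hb z).trans (hV z))
    _ = (∫⁻ z, ‖gsHat g z‖ₑ * (ENNReal.ofReal (ω₂ z))⁻¹) * K := lintegral_mul_const'' _ hm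
    _ ≤ C₂ * ENNReal.ofReal M * K := by
        gcongr
        exact h₂ g M hg
    _ = _ := by
        rw [hK]
        push_cast
        ring

end Operator

/-! ### S_{1/2} inside the Orlicz modulation spaces -/

section Embedding
variable {ι : Type} [Fintype ι]

/-- Since Φ(θt) ≤ θΦ(t) for θ ≤ 1, the modular of a bounded function is controlled linearly by its
integral once Φ(t) is finite. The level l is chosen to bring this linear bound below 1. -/
theorem luxNorm_lt_top_of_le_one {α : Type*} [MeasurableSpace α] {μ : Measure α}
    (Φ : YoungFunction) {u : α → ℝ≥0∞} (h1 : ∀ x, u x ≤ 1) (hu : ∫⁻ x, u x ∂μ ≠ ∞) :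
    luxNorm Φ μ u < ∞ := by
  obtain ⟨t, ht, hΦ⟩ := Φ.exists_finite'
  have htt : t ≠ ∞ := by
    rintro rfl
    exact hΦ Φ.map_top'
  set l : ℝ≥0∞ := t⁻¹ * (1 + Φ t * ∫⁻ x, u x ∂μ) with hl
  have hX : 1 + Φ t * ∫⁻ x, u x ∂μ ≠ ∞ := by finiteness
  have hX0 : 1 + Φ t * ∫⁻ x, u x ∂μ ≠ 0 := by simp
  have hl0 : l ≠ 0 := mul_ne_zero (ENNReal.inv_ne_zero.mpr htt) hX0
  have hlt : l ≠ ∞ := ENNReal.mul_ne_top (ENNReal.inv_ne_top.mpr ht) hX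
  refine lt_of_le_of_lt (sInf_le ⟨hl0, hlt, ?_⟩) hlt.lt_top
  set X := 1 + Φ t * ∫⁻ x, u x ∂μ
  have hpt : ∀ x, Φ (u x / l) ≤ X⁻¹ * Φ t * u x := by
    intro x
    have hx : u x ≠ ∞ := ne_top_of_le_ne_top ENNReal.one_ne_top (h1 x)
    have hux : u x * X⁻¹ ≤ 1 := by
      calc u x * X⁻¹ ≤ 1 * 1 := mul_le_mul' (h1 x) (ENNReal.inv_le_one.mpr le_self_add)
        _ = 1 := one_mul 1
    have e : u x / l = (u x * X⁻¹) * t := by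
      rw [hl, div_eq_mul_inv, ENNReal.mul_inv (Or.inr hX) (Or.inr hX0), inv_inv]
      ring
    rw [e]
    obtain ⟨θ, hθ⟩ : ∃ θ : ℝ≥0, (θ : ℝ≥0∞) = u x * X⁻¹ :=
      ⟨_, ENNReal.coe_toNNReal (ne_top_of_le_ne_top ENNReal.one_ne_top hux)⟩
    rw [← hθ] at hux ⊢
    refine (Φ.map_mul_le (by exact_mod_cast hux) t).trans_eq ?_
    rw [hθ]
    ring
  calc _ ≤ ∫⁻ x, X⁻¹ * Φ t * u x ∂μ := lintegral_mono hpt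
    _ = X⁻¹ * (Φ t * ∫⁻ x, u x ∂μ) := by
        rw [lintegral_const_mul' _ _ (by finiteness), mul_assoc]
    _ ≤ X⁻¹ * X := by
        gcongr
        exact le_add_self
    _ = 1 := ENNReal.inv_mul_cancel hX0 hX

theorem lintegral_exp_neg_norm_ne_top :
    ∫⁻ x : Euc ι, ENNReal.ofReal (Real.exp (-‖x‖)) ≠ ∞ := by
  have h := lintegral_exp_neg_phaseNorm_lt_top (ι := ι) one_pos
  intro h'
  have e : ∀ z : Euc ι × Euc ι, ENNReal.ofReal (Real.exp (-1 * phaseNorm z)) =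
      ENNReal.ofReal (Real.exp (-‖z.1‖)) * ENNReal.ofReal (Real.exp (-‖z.2‖)) := by
    intro z
    rw [← ENNReal.ofReal_mul (Real.exp_nonneg _), ← Real.exp_add, phaseNorm]
    ring_nf
  have hm : Measurable fun x : Euc ι => ENNReal.ofReal (Real.exp (-‖x‖)) := by fun_prop
  simp only [e] at h
  rw [Measure.volume_eq_prod, lintegral_prod_mul hm.aemeasurable hm.aemeasurable, h',
    ENNReal.top_mul_top] at h
  exact lt_irrefl _ h

theorem mixedLuxNorm_exp_lt_top (Φ Ψ : YoungFunction) : mixedLuxNorm Φ Ψ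
    (fun z : Euc ι × Euc ι => ENNReal.ofReal (Real.exp (-1 * phaseNorm z))) < ∞ := by
  have e : ∀ x ξ : Euc ι, ENNReal.ofReal (Real.exp (-1 * phaseNorm (x, ξ))) =
      ENNReal.ofReal (Real.exp (-‖ξ‖)) * ENNReal.ofReal (Real.exp (-‖x‖)) := by
    intro x ξ
    rw [← ENNReal.ofReal_mul (Real.exp_nonneg _), ← Real.exp_add, phaseNorm]
    ring_nf
  have h1 : ∀ x : Euc ι, ENNReal.ofReal (Real.exp (-‖x‖)) ≤ 1 := fun x => by
    rw [ENNReal.ofReal_le_one, Real.exp_le_one_iff]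
    linarith [norm_nonneg x]
  have hN : ∀ Φ : YoungFunction, luxNorm Φ volume
      (fun x : Euc ι => ENNReal.ofReal (Real.exp (-‖x‖))) < ∞ := fun Φ =>
    luxNorm_lt_top_of_le_one Φ h1 lintegral_exp_neg_norm_ne_top
  rw [mixedLuxNorm]
  simp only [e]
  refine lt_of_le_of_lt (luxNorm_mono Ψ (v := fun ξ : Euc ι => luxNorm Φ volume
    (fun x : Euc ι => ENNReal.ofReal (Real.exp (-‖x‖))) * ENNReal.ofReal (Real.exp (-‖ξ‖)))
    fun ξ => ?_) ((luxNorm_mul_le' Ψ _ (hN Φ).ne).trans_lt (ENNReal.mul_lt_top (hN Φ) (hN Ψ)))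
  rw [mul_comm]
  exact luxNorm_mul_le' Φ _ ENNReal.ofReal_ne_top

theorem stft_toDual_enorm (f : GS ι) (z : Euc ι × Euc ι) :
    ‖stft f.toDual z‖ₑ = ‖fourierConst ι‖ₑ * ‖gsHat f (z.1, -z.2)‖ₑ := by
  rw [stft_eq, enorm_mul, ← ofReal_norm, ← ofReal_norm, norm_toDual_gsPi, ofReal_norm, ofReal_norm]

theorem exists_wstft_toDual_le {h : ℝ} (h0 : 0 < h) (m : ℝ) (ω : ModerateWeight (Euc ι × Euc ι)) :
    ∃ C : ℝ≥0, ∀ (f : GS ι) (M : ℝ), GSBound h M (f : Euc ι → ℂ) → ∀ z,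
      wstft ω f.toDual z ≤ C * ENNReal.ofReal M * ENNReal.ofReal (Real.exp (-m * phaseNorm z)) := by
  obtain ⟨C₁, hC₁, c, hc, h₁⟩ := ω.exists_le_expPhase
  obtain ⟨C₂, h₂⟩ := exists_enorm_gsHat_le (ι := ι) h0 (m + c)
  refine ⟨‖fourierConst ι‖₊ * C₂ * (C₁ * ω 0).toNNReal, fun f M hf z => ?_⟩
  have h3 := h₁ 0 z
  rw [zero_add] at h3
  have h4 : ENNReal.ofReal (ω z) ≤
      ENNReal.ofReal (C₁ * ω 0) * ENNReal.ofReal (Real.exp (c * phaseNorm z)) := by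
    have := (ω.isWeight.pos 0).le
    rw [← ENNReal.ofReal_mul (by positivity)]
    refine ENNReal.ofReal_le_ofReal (h3.trans_eq ?_)
    ring
  have h5 := h₂ f M hf (z.1, -z.2)
  have h6 : phaseNorm (z.1, -z.2) = phaseNorm z := by simp [phaseNorm]
  rw [h6] at h5
  have h7 : Real.exp (-m * phaseNorm z) = Real.exp (-(m + c) * phaseNorm z) *
      Real.exp (c * phaseNorm z) := by
    rw [← Real.exp_add]
    ring_nf
  rw [wstft, stft_toDual_enorm, h7, ENNReal.ofReal_mul (Real.exp_nonneg _)]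
  refine (mul_le_mul' (mul_le_mul_right h5 _) h4).trans_eq ?_
  push_cast
  rw [enorm_eq_nnnorm]
  change _ = _ * ENNReal.ofReal (C₁ * ω 0) * _ * _
  ring

/-- `S_{1/2}` is continuously embedded in the Orlicz modulation spaces. -/
theorem exists_orliczModNorm_toDual_le {h : ℝ} (h0 : 0 < h) (Φ Ψ : YoungFunction)
    (ω : ModerateWeight (Euc ι × Euc ι)) : ∃ C : ℝ≥0, ∀ (f : GS ι) (M : ℝ),
      GSBound h M (f : Euc ι → ℂ) → orliczModNorm Φ Ψ ω f.toDual ≤ C * ENNReal.ofReal M := by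
  obtain ⟨C, hC⟩ := exists_wstft_toDual_le h0 1 ω
  have hfin := mixedLuxNorm_exp_lt_top (ι := ι) Φ Ψ
  refine ⟨C * (mixedLuxNorm Φ Ψ (fun z : Euc ι × Euc ι =>
    ENNReal.ofReal (Real.exp (-1 * phaseNorm z)))).toNNReal, fun f M hf => ?_⟩
  push_cast
  rw [ENNReal.coe_toNNReal hfin.ne]
  refine (mixedLuxNorm_mono Φ Ψ (hC f M hf)).trans ?_
  refine (mixedLuxNorm_mul_le Φ Ψ _ (C * M.toNNReal)).trans_eq ?_
  push_cast
  change _ * ENNReal.ofReal M * _ = _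
  ring

theorem GS.orliczModNorm_toDual_lt_top (f : GS ι) (Φ Ψ : YoungFunction)
    (ω : ModerateWeight (Euc ι × Euc ι)) : orliczModNorm Φ Ψ ω f.toDual < ∞ := by
  obtain ⟨-, h, h0, M, hM⟩ := f.2
  obtain ⟨C, hC⟩ := exists_orliczModNorm_toDual_le h0 Φ Ψ ω
  exact (hC f M hM).trans_lt (by finiteness)

/-- The element of an Orlicz modulation space given by a distribution of finite norm. -/
def OrliczMod.mk {Φ Ψ : YoungFunction} {ω : ModerateWeight (Euc ι × Euc ι)} (f : GSDual ι)
    (hf : orliczModNorm Φ Ψ ω f < ∞) : OrliczMod Φ Ψ ω :=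
  ⟨f, (continuous_stft f).measurable.aemeasurable, hf⟩

theorem OrliczMod.toDual_mk {Φ Ψ : YoungFunction} {ω : ModerateWeight (Euc ι × Euc ι)}
    (f : GSDual ι) (hf : orliczModNorm Φ Ψ ω f < ∞) :
    (OrliczMod.mk f hf : OrliczMod Φ Ψ ω).toDual = f := rfl

theorem OrliczMod.toDual_injective {Φ Ψ : YoungFunction} {ω : ModerateWeight (Euc ι × Euc ι)} :
    Function.Injective (OrliczMod.toDual : OrliczMod Φ Ψ ω →ₗ[ℂ] GSDual ι) :=
  Subtype.val_injective

theorem OrliczMod.ext {Φ Ψ : YoungFunction} {ω : ModerateWeight (Euc ι × Euc ι)}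
    {f g : OrliczMod Φ Ψ ω} (h : ∀ φ : GS ι, (f.toDual : GS ι →ₗ[ℂ] ℂ) φ =
      (g.toDual : GS ι →ₗ[ℂ] ℂ) φ) : f = g :=
  OrliczMod.toDual_injective (Subtype.ext (LinearMap.ext h))

theorem OrliczMod.norm_lt_top {Φ Ψ : YoungFunction} {ω : ModerateWeight (Euc ι × Euc ι)}
    (f : OrliczMod Φ Ψ ω) : orliczModNorm Φ Ψ ω f.toDual < ∞ := f.2.2

theorem OrliczMod.enorm_eq {Φ Ψ : YoungFunction} {ω : ModerateWeight (Euc ι × Euc ι)}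
    (f : OrliczMod Φ Ψ ω) : ‖f‖ₑ = orliczModNorm Φ Ψ ω f.toDual := by
  rw [← ofReal_norm, OrliczMod.norm_def, ENNReal.ofReal_toReal f.norm_lt_top.ne]

/-- The domination is assumed only almost everywhere, but the bound holds at every w because
smearing ignores null sets. The constant is placed under the smearing to match the hypothesis on φ
in the majorant estimate. -/
theorem exists_apply_gsPi_le (ω : ModerateWeight (Euc ι × Euc ι)) (m : ℝ) :
    ∃ C : ℝ≥0, ∀ (u : GSDual ι) (G : Euc ι × Euc ι → ℝ≥0∞), (∀ᵐ z, ‖stft u z‖ₑ ≤ G z) →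
      ∀ w, ‖(u : GS ι →ₗ[ℂ] ℂ) (gsPi w)‖ₑ * ENNReal.ofReal (ω w) ≤
        smear m (fun w => C * (G w * ENNReal.ofReal (ω w))) w := by
  obtain ⟨C, hC⟩ := exists_apply_tfGS_le_of_stft_le (ι := ι) (by norm_num : (0 : ℝ) < 4) m ω
  refine ⟨C * (Real.pi ^ (-(Fintype.card ι : ℝ) / 4)).toNNReal, fun u G hG w => ?_⟩
  rw [smear_const_mul _ _ ENNReal.coe_ne_top]
  push_cast
  exact hC u G hG (gaussGS ι) _ gsBound_gaussWindow w

end Embedding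

/-! ### The extension of Op_A(a): boundedness and dominated continuity -/

section Operator
variable {ι : Type} [Fintype ι] [DecidableEq ι] {p q : ℝ≥0∞} {Φ₁ Φ₂ Ψ₁ Ψ₂ : YoungFunction}
  {A : Matrix ι ι ℝ} {ω₀ : ModerateWeight (Euc (ι ⊕ ι) × Euc (ι ⊕ ι))}
  {ω₁ ω₂ : ModerateWeight (Euc ι × Euc ι)}

omit [DecidableEq ι] in
theorem gsHat_eq_toDual (g : GS ι) (z : Euc ι × Euc ι) :
    gsHat g z = ((gsPi (z.1, -z.2)).toDual : GS ι →ₗ[ℂ] ℂ) g := by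
  rw [gsHat, toDual_apply, toDual_apply]
  exact integral_congr_ae (Eventually.of_forall fun t => mul_comm _ _)

theorem opIntegrand_add_left (a : GSDual (ι ⊕ ι)) (f f' : GSDual ι) (g : GS ι) :
    opIntegrand A a (f + f') g = opIntegrand A a f g + opIntegrand A a f' g := by
  ext p
  simp only [opIntegrand, Pi.add_apply, Submodule.coe_add, LinearMap.add_apply]
  ring

theorem opIntegrand_smul_left (a : GSDual (ι ⊕ ι)) (c : ℂ) (f : GSDual ι) (g : GS ι) :
    opIntegrand A a (c • f) g = c • opIntegrand A a f g := by
  ext p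
  simp only [opIntegrand, Pi.smul_apply, Submodule.coe_smul, LinearMap.smul_apply, smul_eq_mul]
  ring

theorem opIntegrand_add_right (a : GSDual (ι ⊕ ι)) (f : GSDual ι) (g g' : GS ι) :
    opIntegrand A a f (g + g') = opIntegrand A a f g + opIntegrand A a f g' := by
  ext p
  simp only [opIntegrand, Pi.add_apply, gsHat_eq_toDual, map_add]
  ring

theorem opIntegrand_smul_right (a : GSDual (ι ⊕ ι)) (c : ℂ) (f : GSDual ι) (g : GS ι) :
    opIntegrand A a f (c • g) = c • opIntegrand A a f g := by
  ext p
  simp only [opIntegrand, Pi.smul_apply, gsHat_eq_toDual, map_smul, smul_eq_mul]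
  ring

theorem opIntegrand_sub (a b : GSDual (ι ⊕ ι)) (f : GSDual ι) (g : GS ι) :
    opIntegrand A (a - b) f g = opIntegrand A a f g - opIntegrand A b f g := by
  ext p
  simp only [opIntegrand, Pi.sub_apply, kernelCoef, Submodule.coe_sub, LinearMap.sub_apply]
  ring

theorem enorm_opForm_le (a : GSDual (ι ⊕ ι)) (f : GSDual ι) (g : GS ι) :
    ‖opForm A a f g‖ₑ ≤ ‖fourierConst ι‖ₑ * ‖tfConst ι‖ₑ ^ 2 *
      ∫⁻ p : (Euc ι × Euc ι) × (Euc ι × Euc ι), ‖gsHat g p.1‖ₑ *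
        (‖(f : GS ι →ₗ[ℂ] ℂ) (gsPi p.2)‖ₑ * ‖kernelCoef A a p.1 p.2‖ₑ) := by
  rw [opForm, enorm_mul, mul_assoc, ← lintegral_const_mul' _ _ (by finiteness)]
  gcongr
  refine (enorm_integral_le_lintegral_enorm _).trans_eq ?_
  exact lintegral_congr fun p => enorm_opIntegrand A a f g p

omit [DecidableEq ι] in
theorem measurable_enorm_apply_gsPi (f : GSDual ι) :
    Measurable fun w => ‖(f : GS ι →ₗ[ℂ] ℂ) (gsPi w)‖ₑ :=
  (continuous_apply_gsPi f).measurable.enorm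

theorem TrilinearBound.integrable_opIntegrand (hT : TrilinearBound p q Φ₁ Φ₂ Ψ₁ Ψ₂) (hp : 1 ≤ p)
    (hq : 1 ≤ q) (hω : WeightCompat A ω₀ ω₁ ω₂) {a : GSDual (ι ⊕ ι)}
    (ha : modNorm p q ω₀ a < ∞) {f : GSDual ι} (hf : orliczModNorm Φ₁ Ψ₁ ω₁ f < ∞) (g : GS ι) :
    Integrable (opIntegrand A a f g) := by
  obtain ⟨-, h, h0, M, hM⟩ := g.2
  obtain ⟨C₁, h₁⟩ := hT.exists_lintegral_le hp hq hω h0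
  obtain ⟨C₂, h₂⟩ := exists_apply_gsPi_le ω₁ 1
  refine ⟨(continuous_opIntegrand A a f g).aestronglyMeasurable, ?_⟩
  rw [HasFiniteIntegral]
  simp only [enorm_opIntegrand]
  rw [lintegral_const_mul' _ _ (by finiteness)]
  have hfm := aemeasurable_wstft ω₁ (continuous_stft f).measurable.aemeasurable
  have := h₁ a _ _ (hfm.const_mul (C₂ : ℝ≥0∞)) (measurable_enorm_apply_gsPi f)
    (h₂ f _ (Eventually.of_forall fun _ => le_rfl)) g M hM
  refine ENNReal.mul_lt_top (by finiteness) (this.trans_lt ?_)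
  have h3 : mixedLuxNorm Φ₁ Ψ₁ (fun w => C₂ * wstft ω₁ f w) < ∞ :=
    (mixedLuxNorm_mul_le Φ₁ Ψ₁ _ C₂).trans_lt (ENNReal.mul_lt_top (by finiteness) hf)
  exact ENNReal.mul_lt_top (by finiteness) (ENNReal.mul_lt_top ha h3)

/-- `Op_A(a) f` for `f` in an Orlicz modulation space. -/
theorem TrilinearBound.exists_op (hT : TrilinearBound p q Φ₁ Φ₂ Ψ₁ Ψ₂) (hp : 1 ≤ p)
    (hq : 1 ≤ q) (hω : WeightCompat A ω₀ ω₁ ω₂) : ∃ C : ℝ≥0, ∀ a : GSDual (ι ⊕ ι),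
    modNorm p q ω₀ a < ∞ → ∀ f : GSDual ι, orliczModNorm Φ₁ Ψ₁ ω₁ f < ∞ →
      ∃ u : GSDual ι, (∀ g, (u : GS ι →ₗ[ℂ] ℂ) g = opForm A a f g) ∧
        orliczModNorm Φ₂.conj Ψ₂.conj ω₂ u ≤
          C * (modNorm p q ω₀ a * orliczModNorm Φ₁ Ψ₁ ω₁ f) := by
  obtain ⟨C₁, h₁⟩ := hT.exists_majorant hp hq hω
  obtain ⟨C₂, h₂⟩ := exists_apply_gsPi_le ω₁ 1
  obtain ⟨C₃, c, hc, h₃⟩ := ω₂.exists_mul_smear_le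
  obtain ⟨C₄, h₄⟩ := exists_enorm_gsHat_le (ι := ι) (by norm_num : (0 : ℝ) < 4) (1 + c)
  obtain ⟨C₅, h₅⟩ := mixedLuxNorm_smear_le (ι := ι) one_pos
  set k : ℝ≥0 := (Real.pi ^ (-(Fintype.card ι : ℝ) / 4)).toNNReal
  set e : ℝ≥0 := ‖fourierConst ι‖₊ * (‖fourierConst ι‖₊ * ‖tfConst ι‖₊ ^ 2) * (C₄ * k) * C₃
  refine ⟨e * C₅ * C₁ * C₂, fun a ha f hf => ?_⟩
  have hfm := aemeasurable_wstft ω₁ (continuous_stft f).measurable.aemeasurable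
  have hint := fun g => hT.integrable_opIntegrand hp hq hω ha hf g
  let L : GS ι →ₗ[ℂ] ℂ :=
    { toFun := opForm A a f
      map_add' := fun g g' => by
        rw [opForm, opIntegrand_add_right, integral_add' (hint g) (hint g'), mul_add]
        rfl
      map_smul' := fun c g => by
        rw [opForm, opIntegrand_smul_right]
        simp only [Pi.smul_apply]
        rw [integral_smul, RingHom.id_apply, smul_eq_mul, smul_eq_mul, mul_left_comm]
        rfl }
  have hN2 : mixedLuxNorm Φ₁ Ψ₁ (fun w => C₂ * wstft ω₁ f w) ≤
      C₂ * orliczModNorm Φ₁ Ψ₁ ω₁ f := mixedLuxNorm_mul_le Φ₁ Ψ₁ _ C₂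
  have hfb := h₂ f _ (Eventually.of_forall fun _ => le_rfl)
  have hL : L ∈ gsDualSubmodule ι := by
    intro h h0
    obtain ⟨C, hC⟩ := hT.exists_lintegral_le hp hq hω h0
    set R : ℝ≥0∞ := modNorm p q ω₀ a * mixedLuxNorm Φ₁ Ψ₁ (fun w => C₂ * wstft ω₁ f w)
    have hR : R < ∞ := ENNReal.mul_lt_top ha (hN2.trans_lt (by finiteness))
    refine ⟨(‖fourierConst ι‖ₑ * ‖tfConst ι‖ₑ ^ 2 * (C * R)).toReal, fun g M hM => ?_⟩
    have hM0 := hM.nonneg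
    have e1 := hC a _ _ (hfm.const_mul (C₂ : ℝ≥0∞)) (measurable_enorm_apply_gsPi f) hfb g M hM
    have e2 : ‖opForm A a f g‖ₑ ≤ ‖fourierConst ι‖ₑ * ‖tfConst ι‖ₑ ^ 2 * (C * R) *
        ENNReal.ofReal M := by
      refine (enorm_opForm_le a f g).trans ((mul_le_mul_right e1 _).trans_eq ?_)
      ring
    have e3 := ENNReal.toReal_mono (by finiteness) e2
    rwa [ENNReal.toReal_mul, ENNReal.toReal_ofReal hM0, toReal_enorm] at e3
  refine ⟨⟨L, hL⟩, fun g => rfl, ?_⟩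
  obtain ⟨V, hVm, hV1, hV2, -⟩ := h₁ a _ (hfm.const_mul (C₂ : ℝ≥0∞))
  set W : Euc ι × Euc ι → ℝ≥0∞ := fun z =>
    ∫⁻ w, ‖(f : GS ι →ₗ[ℂ] ℂ) (gsPi w)‖ₑ * ‖kernelCoef A a z w‖ₑ
  have hW : ∀ z, W z * ENNReal.ofReal (ω₂ z) ≤ V z := hV1 _ hfb
  -- The short-time Fourier transform of u at z is, up to a constant, the weak form tested on the
  -- shift at z. Its Gabor coefficients are concentrated near z, so the majorant V reappears
  -- smeared.
  have hpt : ∀ z, wstft ω₂ (⟨L, hL⟩ : GSDual ι) z ≤ e * smear 1 V z := by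
    intro z
    have s1 : ‖opForm A a f (gsPi z)‖ₑ ≤ ‖fourierConst ι‖ₑ * ‖tfConst ι‖ₑ ^ 2 *
        (C₄ * k * smear (1 + c) W z) := by
      refine (enorm_opForm_le a f _).trans (mul_le_mul_right ?_ _)
      rw [lintegral_kernel a (measurable_enorm_apply_gsPi f), smear,
        ← lintegral_const_mul' _ _ (by finiteness)]
      refine lintegral_mono fun y => ?_
      have h6 : ‖gsHat (gsPi z) y‖ₑ ≤ C₄ * k *
          ENNReal.ofReal (Real.exp (-(1 + c) * phaseNorm (z - y))) := by
        rw [gsPi, ← ofReal_norm, norm_gsHat_tfGS, ofReal_norm, phaseNorm_sub_comm]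
        exact h₄ (gaussGS ι) _ gsBound_gaussWindow _
      rw [← mul_assoc]
      exact mul_le_mul_left h6 _
    have s2 : ENNReal.ofReal (ω₂ z) * smear (1 + c) W z ≤ C₃ * smear 1 V z :=
      (h₃ 1 W z).trans (mul_le_mul_right (smear_mono 1 (Eventually.of_forall hW) z) _)
    rw [wstft, stft_eq, enorm_mul]
    change ‖fourierConst ι‖ₑ * ‖opForm A a f (gsPi z)‖ₑ * _ ≤ _
    calc _ ≤ ‖fourierConst ι‖ₑ * (‖fourierConst ι‖ₑ * ‖tfConst ι‖ₑ ^ 2 *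
          (C₄ * k * smear (1 + c) W z)) * ENNReal.ofReal (ω₂ z) := by gcongr
      _ = ‖fourierConst ι‖ₑ * (‖fourierConst ι‖ₑ * ‖tfConst ι‖ₑ ^ 2 * (C₄ * k)) *
          (ENNReal.ofReal (ω₂ z) * smear (1 + c) W z) := by ring
      _ ≤ ‖fourierConst ι‖ₑ * (‖fourierConst ι‖ₑ * ‖tfConst ι‖ₑ ^ 2 * (C₄ * k)) *
          (C₃ * smear 1 V z) := by gcongr
      _ = _ := by
          simp only [e, enorm_eq_nnnorm]
          push_cast
          ring
  calc _ ≤ mixedLuxNorm Φ₂.conj Ψ₂.conj (fun z => e * smear 1 V z) := mixedLuxNorm_mono _ _ hpt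
    _ ≤ e * mixedLuxNorm Φ₂.conj Ψ₂.conj (smear 1 V) := mixedLuxNorm_mul_le _ _ _ e
    _ ≤ e * (C₅ * (C₁ * modNorm p q ω₀ a * (C₂ * orliczModNorm Φ₁ Ψ₁ ω₁ f))) := by
        refine mul_le_mul_right ((h₅ _ _ V hVm.aemeasurable).trans (mul_le_mul_right
          (hV2.trans (mul_le_mul_right hN2 _)) _)) _
    _ = _ := by
        push_cast
        ring

/-- `Op_A(a)` as a bounded operator between Orlicz modulation spaces. -/
theorem TrilinearBound.exists_opCLM (hT : TrilinearBound p q Φ₁ Φ₂ Ψ₁ Ψ₂) (hp : 1 ≤ p)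
    (hq : 1 ≤ q) (hω : WeightCompat A ω₀ ω₁ ω₂) : ∃ C : ℝ≥0, ∀ a : GSDual (ι ⊕ ι),
    modNorm p q ω₀ a < ∞ → ∃ T : OrliczMod Φ₁ Ψ₁ ω₁ →L[ℂ] OrliczMod Φ₂.conj Ψ₂.conj ω₂,
      (∀ f g, ((T f).toDual : GS ι →ₗ[ℂ] ℂ) g = opForm A a f.toDual g) ∧
        ‖T‖ ≤ C * (modNorm p q ω₀ a).toReal := by
  obtain ⟨C, hC⟩ := hT.exists_op hp hq hω
  refine ⟨C, fun a ha => ?_⟩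
  have hfin : ∀ f : OrliczMod Φ₁ Ψ₁ ω₁,
      C * (modNorm p q ω₀ a * orliczModNorm Φ₁ Ψ₁ ω₁ f.toDual) < ∞ := fun f =>
    ENNReal.mul_lt_top (by finiteness) (ENNReal.mul_lt_top ha f.norm_lt_top)
  choose u hu1 hu2 using fun f : OrliczMod Φ₁ Ψ₁ ω₁ => hC a ha f.toDual f.norm_lt_top
  have hint := fun (f : OrliczMod Φ₁ Ψ₁ ω₁) g =>
    hT.integrable_opIntegrand hp hq hω ha f.norm_lt_top g
  let T : OrliczMod Φ₁ Ψ₁ ω₁ →ₗ[ℂ] OrliczMod Φ₂.conj Ψ₂.conj ω₂ :=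
    { toFun := fun f => OrliczMod.mk (u f) ((hu2 f).trans_lt (hfin f))
      map_add' := fun f f' => OrliczMod.ext fun g => by
        change (u (f + f') : GS ι →ₗ[ℂ] ℂ) g = (u f : GS ι →ₗ[ℂ] ℂ) g + (u f' : GS ι →ₗ[ℂ] ℂ) g
        rw [hu1, hu1, hu1, opForm, map_add, opIntegrand_add_left, integral_add' (hint f g) (hint f' g), mul_add]
        rfl
      map_smul' := fun c f => OrliczMod.ext fun g => by
        change (u (c • f) : GS ι →ₗ[ℂ] ℂ) g = c * (u f : GS ι →ₗ[ℂ] ℂ) g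
        rw [hu1, hu1, opForm, map_smul, opIntegrand_smul_left]
        simp only [Pi.smul_apply]
        rw [integral_smul, smul_eq_mul, mul_left_comm]
        rfl }
  have hb : ∀ f, ‖T f‖ ≤ C * (modNorm p q ω₀ a).toReal * ‖f‖ := by
    intro f
    rw [OrliczMod.norm_def, OrliczMod.norm_def, mul_assoc, ← ENNReal.toReal_mul,
      ← ENNReal.coe_toReal, ← ENNReal.toReal_mul]
    exact ENNReal.toReal_mono (hfin f).ne (hu2 f)
  refine ⟨T.mkContinuous _ hb, fun f g => ?_, T.mkContinuous_norm_le (by positivity) hb⟩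
  exact hu1 f g

/-- Dominated convergence for the weak form of `Op_A(a)`. -/
theorem TrilinearBound.tendsto_opForm (hT : TrilinearBound p q Φ₁ Φ₂ Ψ₁ Ψ₂) (hp : 1 ≤ p)
    (hq : 1 ≤ q) (hω : WeightCompat A ω₀ ω₁ ω₂) {a : GSDual (ι ⊕ ι)}
    (ha : modNorm p q ω₀ a < ∞) {f : ℕ → GSDual ι} {f₀ : GSDual ι}
    (hf : ∀ g : GS ι, Tendsto (fun n => (f n : GS ι →ₗ[ℂ] ℂ) g) atTop
      (𝓝 ((f₀ : GS ι →ₗ[ℂ] ℂ) g))) {G : Euc ι × Euc ι → ℝ≥0∞} (hG : AEMeasurable G)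
    (hGn : mixedLuxNorm Φ₁ Ψ₁ (fun z => G z * ENNReal.ofReal (ω₁ z)) < ∞)
    (hfG : ∀ n, ∀ᵐ z, ‖stft (f n) z‖ₑ ≤ G z) (g : GS ι) :
    Tendsto (fun n => opForm A a (f n) g) atTop (𝓝 (opForm A a f₀ g)) := by
  obtain ⟨-, h, h0, M, hM⟩ := g.2
  obtain ⟨C₁, h₁⟩ := hT.exists_lintegral_le hp hq hω h0
  obtain ⟨C₂, h₂⟩ := exists_apply_gsPi_le ω₁ 1
  -- The supremum over n is the dominating function: it is measurable as a countable supremum and,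
  -- like each of its terms, bounded by the smeared common majorant. Weak convergence, tested on the
  -- shifts, gives pointwise convergence of the integrands.
  set φ : Euc ι × Euc ι → ℝ≥0∞ := fun w => ⨆ n, ‖(f n : GS ι →ₗ[ℂ] ℂ) (gsPi w)‖ₑ with hφ
  have hφm : Measurable φ := Measurable.iSup fun n => measurable_enorm_apply_gsPi (f n)
  have hφb : ∀ w, φ w * ENNReal.ofReal (ω₁ w) ≤
      smear 1 (fun w => C₂ * (G w * ENNReal.ofReal (ω₁ w))) w := by
    intro w
    rw [hφ, ENNReal.iSup_mul]
    exact iSup_le fun n => h₂ (f n) G (hfG n) w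
  have hb := h₁ a _ φ ((hG.mul ω₁.isWeight.aemeasurable.ennreal_ofReal).const_mul (C₂ : ℝ≥0∞))
    hφm hφb g M hM
  have hfin : ∫⁻ p : (Euc ι × Euc ι) × (Euc ι × Euc ι), ‖tfConst ι‖ₑ ^ 2 * (‖gsHat g p.1‖ₑ *
      (φ p.2 * ‖kernelCoef A a p.1 p.2‖ₑ)) ≠ ∞ := by
    rw [lintegral_const_mul' _ _ (by finiteness)]
    refine ENNReal.mul_ne_top (by finiteness) (hb.trans_lt ?_).ne
    exact ENNReal.mul_lt_top (by finiteness) (ENNReal.mul_lt_top ha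
      ((mixedLuxNorm_mul_le Φ₁ Ψ₁ _ C₂).trans_lt (ENNReal.mul_lt_top (by finiteness) hGn)))
  have hbm : Measurable fun p : (Euc ι × Euc ι) × (Euc ι × Euc ι) => ‖tfConst ι‖ₑ ^ 2 *
      (‖gsHat g p.1‖ₑ * (φ p.2 * ‖kernelCoef A a p.1 p.2‖ₑ)) := by
    have m1 := (continuous_gsHat g).measurable
    have m2 := (continuous_kernelCoef A a).measurable
    exact ((m1.comp measurable_fst).enorm.mul
      ((hφm.comp measurable_snd).mul m2.enorm)).const_mul _
  unfold opForm
  refine Tendsto.const_mul _ (tendsto_integral_of_dominated_convergence _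
    (fun n => (continuous_opIntegrand A a (f n) g).aestronglyMeasurable)
    (integrable_toReal_of_lintegral_ne_top hbm.aemeasurable hfin) (fun n => ?_)
    (Eventually.of_forall fun p => ?_))
  · filter_upwards [ae_lt_top hbm hfin] with p hp
    rw [← toReal_enorm]
    refine ENNReal.toReal_mono hp.ne ?_
    rw [enorm_opIntegrand]
    gcongr
    exact le_iSup (fun n => ‖(f n : GS ι →ₗ[ℂ] ℂ) (gsPi p.2)‖ₑ) n
  · exact ((hf (gsPi p.2)).const_mul _).const_mul _ |>.mul_const _

end Operator

/-! ### Tails of sequences under the local Δ₂-condition -/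

section Tail

theorem YoungFunction.map_two_pow_mul_le (Φ : YoungFunction) {r : ℝ≥0∞} {C : ℝ≥0}
    (h : ∀ t ≤ r, Φ (2 * t) ≤ C * Φ t) (j : ℕ) (t : ℝ≥0∞) (ht : 2 ^ j * t ≤ r) :
    Φ (2 ^ j * t) ≤ C ^ j * Φ t := by
  induction j with
  | zero => simp
  | succ j ih =>
    have h1 : 2 ^ j * t ≤ 2 ^ (j + 1) * t := by
      gcongr
      · exact one_le_two
      · exact Nat.le_succ j
    have h2 := h1.trans ht
    calc Φ (2 ^ (j + 1) * t) = Φ (2 * (2 ^ j * t)) := by ring_nf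
      _ ≤ C * Φ (2 ^ j * t) := h _ h2
      _ ≤ C * (C ^ j * Φ t) := by
          gcongr
          exact ih h2
      _ = _ := by ring

variable {α : Type} [MeasurableSpace α] [MeasurableSingletonClass α]

-- The sum of Φ(v/l) converges at some level l, and the level ε ≥ l/2^j is wanted. Applying Δ₂ j
-- times costs C^j, which a small enough tail of the sum compensates. As Φ vanishes only at 0, small
-- values of Φ mean small arguments, so the tail lies in the range where Δ₂ holds.
open scoped Classical in
theorem YoungFunction.exists_luxNorm_tail_le {Φ : YoungFunction} (hΔ : Φ.LocalDelta2)
    (hpos : ∀ t, t ≠ 0 → Φ t ≠ 0) {v : α → ℝ≥0∞} (hv : luxNorm Φ .count v < ∞) {ε : ℝ≥0∞}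
    (hε : ε ≠ 0) : ∃ E : Finset α, luxNorm Φ .count (fun a => if a ∈ E then 0 else v a) ≤ ε := by
  obtain ⟨r₀, hr₀, C, hC₀⟩ := hΔ
  obtain ⟨r, hr, hrt, hC⟩ : ∃ r : ℝ≥0∞, r ≠ 0 ∧ r ≠ ∞ ∧ ∀ t ≤ r, Φ (2 * t) ≤ C * Φ t :=
    ⟨min r₀ 1, by simp [hr₀], ne_top_of_le_ne_top ENNReal.one_ne_top (min_le_right _ _),
      fun t ht => hC₀ t (ht.trans (min_le_left _ _))⟩
  rcases eq_or_ne ε ∞ with rfl | hεt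
  · exact ⟨∅, le_top⟩
  set l : ℝ≥0∞ := luxNorm Φ .count v + 1
  have hl0 : l ≠ 0 := by simp [l]
  have hlt : l ≠ ∞ := by
    simp only [l]
    finiteness
  have hsum : ∑' a, Φ (v a / l) ≤ 1 := by
    rw [← lintegral_count]
    exact lintegral_le_one_of_luxNorm_lt Φ (ENNReal.lt_add_right hv.ne one_ne_zero)
  obtain ⟨j, hj⟩ : ∃ j : ℕ, l ≤ 2 ^ j * ε := by
    obtain ⟨n, hn⟩ := ENNReal.exists_nat_mul_gt hε hlt
    refine ⟨n, hn.le.trans ?_⟩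
    gcongr
    exact_mod_cast Nat.lt_two_pow_self.le
  have h2j : (2 : ℝ≥0∞) ^ j ≠ 0 := by positivity
  have h2jt : (2 : ℝ≥0∞) ^ j ≠ ∞ := by finiteness
  have hδ : Φ (r / 2 ^ j) ≠ 0 := hpos _ (by simp [ENNReal.div_eq_zero_iff, hr, h2jt])
  -- Being below Φ(r/2^j) keeps the arguments within the range of Δ₂ through j doublings; being
  -- below C^{-j} pays for them.
  obtain ⟨η, hη0, hη⟩ : ∃ η : ℝ≥0∞, 0 < η ∧ η < min (Φ (r / 2 ^ j)) ((C : ℝ≥0∞) ^ j)⁻¹ := by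
    refine exists_between (lt_min (pos_iff_ne_zero.mpr hδ) ?_)
    rw [ENNReal.inv_pos]
    finiteness
  have htail := ENNReal.tendsto_tsum_compl_atTop_zero
    (ne_top_of_le_ne_top ENNReal.one_ne_top hsum)
  obtain ⟨E, hE⟩ := (htail.eventually (gt_mem_nhds hη0)).exists
  have hE' : ∑' a, (if a ∈ E then 0 else Φ (v a / l)) ≤ η := by
    refine le_trans (le_of_eq ?_) hE.le
    rw [show (∑' b : {x // x ∉ E}, Φ (v b / l)) = ∑' b : ((E : Set α)ᶜ : Set α), Φ (v b / l)
      from rfl, tsum_subtype ((E : Set α)ᶜ) fun a => Φ (v a / l)]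
    refine tsum_congr fun a => ?_
    by_cases ha : a ∈ E <;> simp [ha]
  refine ⟨E, luxNorm_le Φ hε hεt ?_⟩
  rw [lintegral_count]
  have hpt : ∀ a, Φ ((if a ∈ E then 0 else v a) / ε) ≤
      C ^ j * (if a ∈ E then 0 else Φ (v a / l)) := by
    intro a
    split_ifs with ha
    · simp [Φ.map_zero']
    have h1 : Φ (v a / l) ≤ η := by
      have := (ENNReal.le_tsum a).trans hE'
      rwa [if_neg ha] at this
    have h2 : v a / l ≤ r / 2 ^ j := by
      by_contra! h
      exact absurd (h1.trans_lt (hη.trans_le (min_le_left _ _))) (not_lt.mpr (Φ.mono h.le))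
    have h3 : 2 ^ j * (v a / l) ≤ r := by
      calc 2 ^ j * (v a / l) ≤ 2 ^ j * (r / 2 ^ j) := by gcongr
        _ = r := ENNReal.mul_div_cancel h2j h2jt
    refine (Φ.mono ?_).trans (Φ.map_two_pow_mul_le hC j _ h3)
    rw [ENNReal.div_le_iff_le_mul (Or.inl hε) (Or.inl hεt)]
    calc v a = v a / l * l := (ENNReal.div_mul_cancel hl0 hlt).symm
      _ ≤ v a / l * (2 ^ j * ε) := by gcongr
      _ = _ := by ring
  calc _ ≤ ∑' a, (C : ℝ≥0∞) ^ j * (if a ∈ E then 0 else Φ (v a / l)) :=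
        ENNReal.tsum_le_tsum hpt
    _ ≤ (C : ℝ≥0∞) ^ j * ((C : ℝ≥0∞) ^ j)⁻¹ := by
        rw [ENNReal.tsum_mul_left]
        gcongr
        exact hE'.trans (hη.le.trans (min_le_right _ _))
    _ ≤ 1 := ENNReal.mul_inv_le_one _

-- First the columns outside a finite set B are removed, by the tail estimate for Ψ applied to the
-- column norms. In each remaining column the Φ-tail is cut down to η, which is chosen so that η
-- times the Ψ-norm of the indicator of B is at most ε/2.
open scoped Classical in
theorem exists_mixLux_tail_le [Countable α] {Φ Ψ : YoungFunction} (hΦ : Φ.LocalDelta2)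
    (hΨ : Ψ.LocalDelta2) (hpos : ∀ t, t ≠ 0 → Φ t ≠ 0 ∧ Ψ t ≠ 0) {V : α → α → ℝ≥0∞}
    (hV : mixLux Φ Ψ V < ∞) {ε : ℝ≥0∞} (hε : ε ≠ 0) :
    ∃ E : Finset (α × α), mixLux Φ Ψ (fun a b => if (a, b) ∈ E then 0 else V a b) ≤ ε := by
  rcases eq_or_ne ε ∞ with rfl | hεt
  · exact ⟨∅, le_top⟩
  set N : α → ℝ≥0∞ := fun b => luxNorm Φ .count fun a => V a b
  obtain ⟨B, hB⟩ := YoungFunction.exists_luxNorm_tail_le hΨ (fun t ht => (hpos t ht).2)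
    (v := N) hV (ε := ε / 2) (by simp [hε])
  obtain ⟨T, -, hT⟩ := Ψ.exists_apply_le
  have hN : ∀ b, N b < ∞ := fun b => (hT N b).trans_lt (ENNReal.mul_lt_top (by finiteness) hV)
  set I : ℝ≥0∞ := luxNorm Ψ .count fun b => if b ∈ B then (1 : ℝ≥0∞) else 0 with hI
  have hIt : I < ∞ := by
    refine luxNorm_lt_top_of_le_one Ψ (fun b => by split_ifs <;> simp) ?_
    rw [lintegral_count, tsum_eq_sum (s := B) (fun b hb => if_neg hb)]
    refine (ENNReal.sum_lt_top.mpr fun b _ => ?_).ne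
    split_ifs
    simp
  set η := ε / 2 / (I + 1)
  have hη : η ≠ 0 := by
    simp [η, ENNReal.div_eq_zero_iff, hε, hIt.ne]
  have hηt : η ≠ ∞ := ENNReal.div_ne_top (ENNReal.div_ne_top hεt (by simp)) (by simp)
  choose S hS using fun b => YoungFunction.exists_luxNorm_tail_le hΦ (fun t ht => (hpos t ht).1)
    (v := fun a => V a b) (hN b) hη
  refine ⟨B.biUnion fun b => S b ×ˢ {b}, ?_⟩
  have hmem : ∀ a b, (a, b) ∈ (B.biUnion fun b => S b ×ˢ {b}) ↔ b ∈ B ∧ a ∈ S b := by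
    intro a b
    simp only [Finset.mem_biUnion, Finset.mem_product, Finset.mem_singleton]
    constructor
    · rintro ⟨c, hc, ha, rfl⟩
      exact ⟨hc, ha⟩
    · rintro ⟨hb, ha⟩
      exact ⟨b, hb, ha, rfl⟩
  have hpt : ∀ b, (luxNorm Φ .count fun a => if (a, b) ∈ (B.biUnion fun b => S b ×ˢ {b}) then 0
      else V a b) ≤ η * (if b ∈ B then 1 else 0) + (if b ∈ B then 0 else N b) := by
    intro b
    simp only [hmem]
    by_cases hb : b ∈ B
    · simpa [hb] using hS b
    · simp [hb, N]
  calc _ ≤ luxNorm Ψ .count fun b => η * (if b ∈ B then 1 else 0) + (if b ∈ B then 0 else N b) :=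
        luxNorm_mono Ψ hpt
    _ ≤ η * I + ε / 2 :=
        (luxNorm_add_le Ψ Measurable.of_discrete.aemeasurable).trans
          (add_le_add (luxNorm_mul_le' Ψ _ hηt) hB)
    _ ≤ η * (I + 1) + ε / 2 := by
        gcongr
        exact le_self_add
    _ = ε := by
        rw [ENNReal.div_mul_cancel (by simp) (by finiteness), ENNReal.add_halves]

theorem exists_mixLux_le_of_eq_zero [Countable α] {Φ Ψ : YoungFunction} (hΦ : Φ.LocalDelta2)
    (hΨ : Ψ.LocalDelta2) (hpos : ∀ t, t ≠ 0 → Φ t ≠ 0 ∧ Ψ t ≠ 0) {V : α → α → ℝ≥0∞}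
    (hV : mixLux Φ Ψ V < ∞) {ε : ℝ≥0∞} (hε : ε ≠ 0) :
    ∃ E : Finset (α × α), ∀ W : α → α → ℝ≥0∞, (∀ a b, W a b ≤ V a b) →
      (∀ a b, (a, b) ∈ E → W a b = 0) → mixLux Φ Ψ W ≤ ε := by
  classical
  obtain ⟨E, hE⟩ := exists_mixLux_tail_le hΦ hΨ hpos hV hε
  refine ⟨E, fun W hW h0 => le_trans (luxNorm_mono Ψ fun b => luxNorm_mono Φ fun a => ?_) hE⟩
  beta_reduce
  split_ifs with h
  · exact (h0 a b h).le
  · exact hW a b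

end Tail
-- Truncated Gabor expansions
section Truncation
variable {ι : Type} [Fintype ι]

/-- Truncations of the Gabor expansion of a distribution are test functions. -/
theorem GSDual.exists_truncation (f : GSDual ι) (n : ℕ) : ∃ F : GS ι, ∀ g : GS ι,
    (F.toDual : GS ι →ₗ[ℂ] ℂ) g = ∫ w in Metric.closedBall (0 : Euc ι × Euc ι) n,
      tfConst ι * gsHat g w * (f : GS ι →ₗ[ℂ] ℂ) (gsPi w) := by
  obtain ⟨h', h'0, hcont, hbd⟩ := exists_gsBound_tfGS (by norm_num) (g := gaussGS ι)
    gsBound_gaussWindow one_pos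
  have hs : Continuous fun w : Euc ι × Euc ι => (w.1, -w.2) := by fun_prop
  have hc : Continuous fun w : Euc ι × Euc ι => tfConst ι * (f : GS ι →ₗ[ℂ] ℂ) (gsPi w) :=
    (continuous_apply_gsPi f).const_mul _
  obtain ⟨F, -, -, hF⟩ := synthesis (μ := volume.restrict (Metric.closedBall 0 n)) h'0
    (hcont.comp hs) (fun w => hbd _) (c := fun w => tfConst ι * (f : GS ι →ₗ[ℂ] ℂ) (gsPi w))
    hc.aestronglyMeasurable (by
      refine ContinuousOn.integrableOn_compact (isCompact_closedBall _ _) ?_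
      exact (hc.norm.mul (by fun_prop)).continuousOn)
  refine ⟨F, fun g => ?_⟩
  have h1 : (F.toDual : GS ι →ₗ[ℂ] ℂ) g = (g.toDual : GS ι →ₗ[ℂ] ℂ) F := by
    rw [toDual_apply, toDual_apply]
    exact integral_congr_ae (Eventually.of_forall fun t => mul_comm _ _)
  rw [h1, (hF g.toDual).2]
  refine integral_congr_ae (Eventually.of_forall fun w => ?_)
  simp only [gsHat, gsPi]
  ring

/-- A truncation of the Gabor expansion of a distribution. -/
def GSDual.truncation (f : GSDual ι) (n : ℕ) : GS ι := (f.exists_truncation n).choose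

theorem GSDual.truncation_apply (f : GSDual ι) (n : ℕ) (g : GS ι) :
    ((f.truncation n).toDual : GS ι →ₗ[ℂ] ℂ) g =
      ∫ w in Metric.closedBall (0 : Euc ι × Euc ι) n,
        tfConst ι * gsHat g w * (f : GS ι →ₗ[ℂ] ℂ) (gsPi w) :=
  (f.exists_truncation n).choose_spec g

theorem GSDual.tendsto_truncation (f : GSDual ι) (g : GS ι) :
    Tendsto (fun n => ((f.truncation n).toDual : GS ι →ₗ[ℂ] ℂ) g) atTop
      (𝓝 ((f : GS ι →ₗ[ℂ] ℂ) g)) := by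
  obtain ⟨h1, h2⟩ := apply_eq_integral_gsHat f g
  simp only [GSDual.truncation_apply]
  have h3 := tendsto_setIntegral_of_monotone (μ := volume)
    (s := fun n : ℕ => Metric.closedBall (0 : Euc ι × Euc ι) n)
    (f := fun w => tfConst ι * gsHat g w * (f : GS ι →ₗ[ℂ] ℂ) (gsPi w))
    (fun n => measurableSet_closedBall)
    (fun a b hab => Metric.closedBall_subset_closedBall (by exact_mod_cast hab))
    h1.integrableOn
  rwa [Metric.iUnion_closedBall_nat, setIntegral_univ, ← h2] at h3

theorem GSDual.sub_truncation_apply (f : GSDual ι) (n : ℕ) (g : GS ι) :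
    ((f - (f.truncation n).toDual : GSDual ι) : GS ι →ₗ[ℂ] ℂ) g =
      ∫ w in (Metric.closedBall (0 : Euc ι × Euc ι) n)ᶜ,
        tfConst ι * gsHat g w * (f : GS ι →ₗ[ℂ] ℂ) (gsPi w) := by
  obtain ⟨h1, h2⟩ := apply_eq_integral_gsHat f g
  rw [Submodule.coe_sub, LinearMap.sub_apply, GSDual.truncation_apply, h2, sub_eq_iff_eq_add',
    integral_add_compl measurableSet_closedBall h1]

/-- Restricted Gabor expansions are controlled by smearing. -/
theorem exists_wstft_le_of_setIntegral (ω : ModerateWeight (Euc ι × Euc ι)) : ∃ C : ℝ≥0,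
    ∀ (f u : GSDual ι) (S : Set (Euc ι × Euc ι)), MeasurableSet S → (∀ g : GS ι,
      (u : GS ι →ₗ[ℂ] ℂ) g = ∫ w in S, tfConst ι * gsHat g w * (f : GS ι →ₗ[ℂ] ℂ) (gsPi w)) →
      ∀ z, wstft ω u z ≤ C * smear 1 (S.indicator (wstft ω f)) z := by
  obtain ⟨C₁, c, hc, h₁⟩ := ω.exists_mul_smear_le
  obtain ⟨C₂, h₂⟩ := exists_enorm_gsHat_le (ι := ι) (by norm_num : (0 : ℝ) < 4) (1 + c)
  set k : ℝ≥0 := (Real.pi ^ (-(Fintype.card ι : ℝ) / 4)).toNNReal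
  have hft : ‖fourierConst ι‖ₑ⁻¹ ≠ ∞ := ENNReal.inv_ne_top.mpr enorm_fourierConst_ne_zero
  refine ⟨‖fourierConst ι‖₊ * ‖tfConst ι‖₊ * (C₂ * k) * ‖fourierConst ι‖ₑ⁻¹.toNNReal * C₁,
    fun f u S hS hu z => ?_⟩
  have s1 : ‖(u : GS ι →ₗ[ℂ] ℂ) (gsPi z)‖ₑ ≤ ‖tfConst ι‖ₑ * (C₂ * k) * ‖fourierConst ι‖ₑ⁻¹ *
      smear (1 + c) (S.indicator fun w => ‖stft f w‖ₑ) z := by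
    rw [hu]
    refine (enorm_integral_le_lintegral_enorm _).trans ?_
    rw [← lintegral_indicator hS, smear, ← lintegral_const_mul' _ _ (by finiteness)]
    refine lintegral_mono fun y => ?_
    by_cases hy : y ∈ S
    · simp only [Set.indicator_of_mem hy]
      have h6 : ‖gsHat (gsPi z) y‖ₑ ≤ C₂ * k *
          ENNReal.ofReal (Real.exp (-(1 + c) * phaseNorm (z - y))) := by
        rw [gsPi, ← ofReal_norm, norm_gsHat_tfGS, ofReal_norm, phaseNorm_sub_comm]
        exact h₂ (gaussGS ι) _ gsBound_gaussWindow _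
      rw [enorm_mul, enorm_mul, enorm_apply_gsPi]
      refine (mul_le_mul_left (mul_le_mul_right h6 _) _).trans_eq ?_
      ring
    · simp [Set.indicator_of_notMem hy]
  have s2 := h₁ 1 (S.indicator fun w => ‖stft f w‖ₑ) z
  have s3 : (fun w => S.indicator (fun w => ‖stft f w‖ₑ) w * ENNReal.ofReal (ω w)) =
      S.indicator (wstft ω f) := by
    ext w
    by_cases hw : w ∈ S <;> simp [hw, wstft]
  rw [s3] at s2
  push_cast
  rw [ENNReal.coe_toNNReal hft, ← enorm_eq_nnnorm, ← enorm_eq_nnnorm, wstft, stft_eq, enorm_mul]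
  calc _ ≤ ‖fourierConst ι‖ₑ * (‖tfConst ι‖ₑ * (C₂ * k) * ‖fourierConst ι‖ₑ⁻¹ *
      smear (1 + c) (S.indicator fun w => ‖stft f w‖ₑ) z) * ENNReal.ofReal (ω z) := by gcongr
    _ = ‖fourierConst ι‖ₑ * ‖tfConst ι‖ₑ * (C₂ * k) * ‖fourierConst ι‖ₑ⁻¹ *
      (ENNReal.ofReal (ω z) * smear (1 + c) (S.indicator fun w => ‖stft f w‖ₑ) z) := by ring
    _ ≤ ‖fourierConst ι‖ₑ * ‖tfConst ι‖ₑ * (C₂ * k) * ‖fourierConst ι‖ₑ⁻¹ *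
      (C₁ * smear 1 (S.indicator (wstft ω f)) z) := by gcongr
    _ = _ := by ring

variable {Φ Ψ : YoungFunction} {ω : ModerateWeight (Euc ι × Euc ι)}

/-- Truncation within an Orlicz modulation space. -/
def OrliczMod.trunc (f : OrliczMod Φ Ψ ω) (n : ℕ) : OrliczMod Φ Ψ ω :=
  OrliczMod.mk (f.toDual.truncation n).toDual (GS.orliczModNorm_toDual_lt_top _ Φ Ψ ω)

/-- All truncations are dominated by one function: the smeared short-time Fourier transform of f,
divided by the weight. -/
theorem OrliczMod.dominatedTendsto_trunc (f : OrliczMod Φ Ψ ω) : DominatedTendsto f.trunc f := by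
  refine ⟨f.toDual.tendsto_truncation, ?_⟩
  obtain ⟨C, hC⟩ := exists_wstft_le_of_setIntegral ω
  obtain ⟨C', hC'⟩ := mixedLuxNorm_smear_le (ι := ι) one_pos
  have hm := aemeasurable_wstft ω (continuous_stft f.toDual).measurable.aemeasurable
  have hωm := ω.isWeight.aemeasurable.ennreal_ofReal
  refine ⟨fun z => C * smear 1 (wstft ω f.toDual) z * (ENNReal.ofReal (ω z))⁻¹,
    ((measurable_smear 1 hm).aemeasurable.const_mul _).mul hωm.inv, ?_, fun n =>
      Eventually.of_forall fun z => ?_⟩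
  · have e : ∀ z, C * smear 1 (wstft ω f.toDual) z * (ENNReal.ofReal (ω z))⁻¹ *
        ENNReal.ofReal (ω z) = C * smear 1 (wstft ω f.toDual) z := fun z => by
      rw [mul_assoc, ENNReal.inv_mul_cancel (ω.ofReal_ne_zero z) ENNReal.ofReal_ne_top, mul_one]
    simp only [e]
    refine (mixedLuxNorm_mul_le Φ Ψ _ C).trans_lt (ENNReal.mul_lt_top (by finiteness) ?_)
    exact (hC' Φ Ψ _ hm).trans_lt (ENNReal.mul_lt_top (by finiteness) f.norm_lt_top)
  · refine le_trans ?_ (mul_comm _ _).le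
    refine ENNReal.le_inv_mul_of_mul_le (ω.ofReal_ne_zero z) ENNReal.ofReal_ne_top ?_
    refine (hC f.toDual _ _ measurableSet_closedBall (f.toDual.truncation_apply n) z).trans ?_
    gcongr
    exact smear_mono 1 (Eventually.of_forall fun w => Set.indicator_le_self _ _ w) z

theorem exists_wstft_le_smear (ω : ModerateWeight (Euc ι × Euc ι)) : ∃ C : ℝ≥0,
    ∀ (f : GSDual ι) z, wstft ω f z ≤ C * smear 1 (wstft ω f) z := by
  obtain ⟨C, hC⟩ := exists_wstft_le_of_setIntegral ω
  refine ⟨C, fun f z => ?_⟩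
  have := hC f f Set.univ MeasurableSet.univ (fun g => by
    rw [setIntegral_univ]
    exact (apply_eq_integral_gsHat f g).2) z
  rwa [Set.indicator_univ] at this

theorem exists_norm_le_of_latFloor_mem (E : Finset ((ι → ℤ) × (ι → ℤ))) : ∃ R : ℝ,
    ∀ z : Euc ι × Euc ι, latFloor₂ z ∈ E → ‖z‖ ≤ R := by
  obtain ⟨R, hR⟩ : ∃ R : ℝ, ∀ k ∈ E, ‖lat₂ k‖ ≤ R := by
    obtain ⟨R, hR⟩ := (E.finite_toSet.image fun k => ‖lat₂ k‖).bddAbove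
    exact ⟨R, fun k hk => hR ⟨k, hk, rfl⟩⟩
  refine ⟨2 * Fintype.card ι + R, fun z hz => ?_⟩
  have e1 := norm_le_phaseNorm (z - lat₂ (latFloor₂ z))
  have e2 := phaseNorm_sub_lat_le z
  have e3 := hR _ hz
  have e4 := norm_add_le (z - lat₂ (latFloor₂ z)) (lat₂ (latFloor₂ z))
  rw [sub_add_cancel] at e4
  linarith

/-- The weighted transform is dominated by the lattice samples of its own smearing, a sequence of
finite norm. Outside finitely many cells this sequence has small norm, and a large ball contains
those cells. -/
theorem OrliczMod.exists_tail_le (hΦ : Φ.LocalDelta2) (hΨ : Ψ.LocalDelta2)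
    (hpos : ∀ t, t ≠ 0 → Φ t ≠ 0 ∧ Ψ t ≠ 0) (f : OrliczMod Φ Ψ ω) {η : ℝ≥0∞} (hη : η ≠ 0) :
    ∃ N : ℕ, ∀ n ≥ N, mixedLuxNorm Φ Ψ
      ((Metric.closedBall (0 : Euc ι × Euc ι) n)ᶜ.indicator (wstft ω f.toDual)) ≤ η := by
  obtain ⟨C₁, h₁⟩ := exists_wstft_le_smear ω
  obtain ⟨C₂, h₂⟩ := mixedLuxNorm_smear_le (ι := ι) one_pos
  obtain ⟨C₃, h₃⟩ := mixLux_lat_le (ι := ι) zero_le_one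
  have hm := aemeasurable_wstft ω (continuous_stft f.toDual).measurable.aemeasurable
  obtain ⟨c, hc⟩ : ∃ c : ℝ≥0, ∀ z, wstft ω f.toDual z ≤
      c * smear 1 (wstft ω f.toDual) (lat (latFloor z.1), lat (latFloor z.2)) := by
    refine ⟨C₁ * (Real.exp (1 * (2 * Fintype.card ι))).toNNReal, fun z => (h₁ _ z).trans ?_⟩
    push_cast
    rw [mul_assoc]
    exact mul_le_mul_right ((slowlyVarying_smear zero_le_one _).le zero_le_one
      (phaseNorm_sub_lat_le z)) _
  set V : (ι → ℤ) → (ι → ℤ) → ℝ≥0∞ := fun a b => smear 1 (wstft ω f.toDual) (lat a, lat b) with hVd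
  have hV : mixLux Φ Ψ V < ∞ :=
    (h₃ Φ Ψ _ (slowlyVarying_smear zero_le_one _)).trans_lt (ENNReal.mul_lt_top (by finiteness)
      ((h₂ Φ Ψ _ hm).trans_lt (ENNReal.mul_lt_top (by finiteness) f.norm_lt_top)))
  have hcV : ∀ z, wstft ω f.toDual z ≤ c * V (latFloor z.1) (latFloor z.2) := hc
  clear_value V
  obtain ⟨E, hE⟩ := exists_mixLux_le_of_eq_zero hΦ hΨ hpos hV (ε := η / (c + 1))
    (by simp [ENNReal.div_eq_zero_iff, hη])
  obtain ⟨R, hR⟩ := exists_norm_le_of_latFloor_mem E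
  classical
  set W : (ι → ℤ) → (ι → ℤ) → ℝ≥0∞ := fun a b => if (a, b) ∈ E then 0 else V a b with hWd
  have hW : mixLux Φ Ψ W ≤ η / (c + 1) := by
    refine hE W (fun a b => ?_) fun a b h => if_pos h
    rw [hWd]
    beta_reduce
    split_ifs
    · exact zero_le
    · exact le_rfl
  refine ⟨⌈R⌉₊, fun n hn => ?_⟩
  have hpt : ∀ z, (Metric.closedBall (0 : Euc ι × Euc ι) n)ᶜ.indicator (wstft ω f.toDual) z ≤
      c * W (latFloor z.1) (latFloor z.2) := by
    intro z
    by_cases hz : z ∈ Metric.closedBall (0 : Euc ι × Euc ι) n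
    · rw [Set.indicator_of_notMem (by simpa using hz)]
      exact zero_le
    · have hz' : (latFloor z.1, latFloor z.2) ∉ E := by
        intro h
        refine hz (mem_closedBall_zero_iff.mpr ((hR z h).trans ((Nat.le_ceil R).trans ?_)))
        exact_mod_cast hn
      rw [Set.indicator_of_mem hz, hWd]
      simp only [if_neg hz']
      exact hcV z
  refine (mixedLuxNorm_mono Φ Ψ hpt).trans ((mixedLuxNorm_mul_le Φ Ψ _ _).trans ?_)
  rw [mixedLuxNorm_latFloor Φ Ψ W]
  calc (c : ℝ≥0∞) * mixLux Φ Ψ W ≤ (c + 1) * (η / (c + 1)) := mul_le_mul' le_self_add hW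
    _ = η := ENNReal.mul_div_cancel (by simp) (by finiteness)

/-- The remainder is a Gabor integral over the complement of a ball, so its norm is controlled by
the tail of the transform of f. -/
theorem OrliczMod.tendsto_trunc (hΦ : Φ.LocalDelta2) (hΨ : Ψ.LocalDelta2)
    (hpos : ∀ t, t ≠ 0 → Φ t ≠ 0 ∧ Ψ t ≠ 0) (f : OrliczMod Φ Ψ ω) :
    Tendsto f.trunc atTop (𝓝 f) := by
  obtain ⟨C₁, h₁⟩ := exists_wstft_le_of_setIntegral ω
  obtain ⟨C₂, h₂⟩ := mixedLuxNorm_smear_le (ι := ι) one_pos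
  have hm := aemeasurable_wstft ω (continuous_stft f.toDual).measurable.aemeasurable
  rw [EMetric.tendsto_atTop]
  intro ε hε
  obtain ⟨ε', hε'0, hε'⟩ := exists_between hε
  set K : ℝ≥0 := C₁ * C₂
  obtain ⟨N, hN⟩ := f.exists_tail_le hΦ hΨ hpos (η := ε' / (K + 1)) (by
    simp [ENNReal.div_eq_zero_iff, hε'0.ne'])
  refine ⟨N, fun n hn => lt_of_le_of_lt ?_ hε'⟩
  rw [edist_comm, edist_eq_enorm_sub, OrliczMod.enorm_eq, map_sub]
  set S : Set (Euc ι × Euc ι) := (Metric.closedBall 0 n)ᶜ with hS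
  have hSm : MeasurableSet S := measurableSet_closedBall.compl
  calc _ ≤ mixedLuxNorm Φ Ψ (fun z => C₁ * smear 1 (S.indicator (wstft ω f.toDual)) z) :=
        mixedLuxNorm_mono Φ Ψ (h₁ f.toDual _ S hSm (f.toDual.sub_truncation_apply n))
    _ ≤ C₁ * (C₂ * mixedLuxNorm Φ Ψ (S.indicator (wstft ω f.toDual))) :=
        (mixedLuxNorm_mul_le Φ Ψ _ C₁).trans
          (mul_le_mul_right (h₂ Φ Ψ _ (hm.indicator hSm)) _)
    _ ≤ C₁ * (C₂ * (ε' / (K + 1))) := mul_le_mul_right (mul_le_mul_right (hN n hn) _) _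
    _ = K * (ε' / (K + 1)) := by
        rw [← mul_assoc]
        rfl
    _ ≤ (K + 1) * (ε' / (K + 1)) := by
        gcongr
        exact le_self_add
    _ = ε' := ENNReal.mul_div_cancel (by simp) (by finiteness)

end Truncation

/-! ### Uniqueness of the extension -/

section Uniqueness
variable {ι : Type} [Fintype ι] [DecidableEq ι] {Φ₁ Φ₂ Ψ₁ Ψ₂ : YoungFunction}
  {A : Matrix ι ι ℝ} {ω₁ ω₂ : ModerateWeight (Euc ι × Euc ι)} {a : GSDual (ι ⊕ ι)}
  {T T' : OrliczMod Φ₁ Ψ₁ ω₁ →L[ℂ] OrliczMod Φ₂ Ψ₂ ω₂}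

/-- Truncations are given by test functions, where both extensions are prescribed by Op_A(a).
Passing to the limit, dominatedly or in norm, gives the two uniqueness statements. -/
theorem ExtendsOp.apply_trunc_eq (hT : ExtendsOp A a T) (hT' : ExtendsOp A a T')
    (f : OrliczMod Φ₁ Ψ₁ ω₁) (n : ℕ) : T' (f.trunc n) = T (f.trunc n) := by
  obtain ⟨f₁, h₁, e₁⟩ := hT (f.toDual.truncation n)
  obtain ⟨f₂, h₂, e₂⟩ := hT' (f.toDual.truncation n)
  obtain rfl : f₁ = f.trunc n := OrliczMod.toDual_injective h₁
  obtain rfl : f₂ = f.trunc n := OrliczMod.toDual_injective h₂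
  exact OrliczMod.ext fun g => (e₂ g).trans (e₁ g).symm

theorem ExtendsOp.eq_of_dominatedContinuous (hT : ExtendsOp A a T) (hT' : ExtendsOp A a T')
    (hd : DominatedContinuous T) (hd' : DominatedContinuous T') : T' = T := by
  ext1 f
  refine OrliczMod.ext fun g => tendsto_nhds_unique (hd' _ _ f.dominatedTendsto_trunc g) ?_
  simp only [hT.apply_trunc_eq hT' f]
  exact hd _ _ f.dominatedTendsto_trunc g

omit [DecidableEq ι] in
theorem OrliczMod.eq_zero_of_norm_eq_zero {Φ Ψ : YoungFunction}
    {ω : ModerateWeight (Euc ι × Euc ι)} {f : OrliczMod Φ Ψ ω} (hf : ‖f‖ = 0) : f = 0 := by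
  refine OrliczMod.ext fun g => ?_
  obtain ⟨-, h, h0, M, hM⟩ := g.2
  obtain ⟨C, hC⟩ := exists_enorm_apply_le h0 Φ Ψ ω
  have := hC f.toDual (continuous_stft _).measurable.aemeasurable g M hM
  have hf0 : ‖f‖ₑ = 0 := by rw [← ofReal_norm, hf, ENNReal.ofReal_zero]
  rw [← OrliczMod.enorm_eq, hf0, mul_zero, nonpos_iff_eq_zero, enorm_eq_zero] at this
  rw [this, map_zero]
  rfl

instance {Φ Ψ : YoungFunction} {ω : ModerateWeight (Euc ι × Euc ι)} :
    T2Space (OrliczMod Φ Ψ ω) := by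
  have : T0Space (OrliczMod Φ Ψ ω) := by
    refine ⟨fun f g h => ?_⟩
    rw [Metric.inseparable_iff, dist_eq_norm] at h
    exact sub_eq_zero.mp (OrliczMod.eq_zero_of_norm_eq_zero h)
  infer_instance

theorem ExtendsOp.eq_of_localDelta2 (hT : ExtendsOp A a T) (hT' : ExtendsOp A a T')
    (hΦ : Φ₁.LocalDelta2) (hΨ : Ψ₁.LocalDelta2) (hpos : ∀ t, t ≠ 0 → Φ₁ t ≠ 0 ∧ Ψ₁ t ≠ 0) :
    T' = T := by
  ext1 f
  have h := f.tendsto_trunc hΦ hΨ hpos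
  refine tendsto_nhds_unique ((T'.continuous.tendsto f).comp h) ?_
  simp only [Function.comp_def, hT.apply_trunc_eq hT' f]
  exact (T.continuous.tendsto f).comp h

end Uniqueness

/-! ### Fatou's lemma for mixed norms -/

section Fatou
variable {α β : Type*} [MeasureSpace α] [MeasureSpace β]
  [SFinite (volume : Measure α)] [SFinite (volume : Measure β)]

theorem mixedLuxNorm_le_liminf (Φ Ψ : YoungFunction) {u : α × β → ℝ≥0∞} {v : ℕ → α × β → ℝ≥0∞}
    (hv : ∀ n, AEMeasurable (v n)) (h : ∀ᵐ z, u z ≤ liminf (fun n => v n z) atTop) :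
    mixedLuxNorm Φ Ψ u ≤ liminf (fun n => mixedLuxNorm Φ Ψ (v n)) atTop := by
  have h1 : ∀ᵐ z, ∀ n, v n z = (hv n).mk _ z := ae_all_iff.mpr fun n => (hv n).ae_eq_mk
  have h2 : ∀ n, mixedLuxNorm Φ Ψ ((hv n).mk _) ≤ mixedLuxNorm Φ Ψ (v n) := fun n =>
    mixedLuxNorm_mono_ae Φ Ψ ((hv n).ae_eq_mk.mono fun z hz => hz.ge)
  refine le_trans (luxNorm_le_liminf Ψ (v := fun n y => luxNorm Φ volume fun x => (hv n).mk _ (x, y))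
    (fun n => (measurable_luxNorm_left Φ (hv n).measurable_mk).aemeasurable) ?_)
    (liminf_le_liminf (Eventually.of_forall h2))
  have h3 : ∀ᵐ z, u z ≤ liminf (fun n => (hv n).mk _ z) atTop := by
    filter_upwards [h, h1] with z hz hz1
    simpa only [hz1] using hz
  filter_upwards [ae_ae_snd_of_ae_prod h3] with y hy
  exact luxNorm_le_liminf Φ
    (fun n => ((hv n).measurable_mk.comp measurable_prodMk_right).aemeasurable) hy

end Fatou

/-! ### Evaluation functionals and the embedding as bounded maps -/

section Functionals
variable {ι : Type} [Fintype ι] {Φ Ψ : YoungFunction} {ω : ModerateWeight (Euc ι × Euc ι)}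

theorem OrliczMod.exists_norm_apply_le {h : ℝ} (h0 : 0 < h) (Φ Ψ : YoungFunction)
    (ω : ModerateWeight (Euc ι × Euc ι)) : ∃ C : ℝ≥0, ∀ (f : OrliczMod Φ Ψ ω) (g : GS ι) (M : ℝ),
      GSBound h M (g : Euc ι → ℂ) → ‖(f.toDual : GS ι →ₗ[ℂ] ℂ) g‖ ≤ C * M * ‖f‖ := by
  obtain ⟨C, hC⟩ := exists_enorm_apply_le (ι := ι) h0 Φ Ψ ω
  refine ⟨C, fun f g M hM => ?_⟩
  have h1 := ENNReal.toReal_mono (ENNReal.mul_ne_top (by finiteness) f.norm_lt_top.ne)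
    (hC f.toDual (continuous_stft _).measurable.aemeasurable g M hM)
  rwa [toReal_enorm, ENNReal.toReal_mul, ENNReal.toReal_mul, ENNReal.coe_toReal,
    ENNReal.toReal_ofReal hM.nonneg] at h1

/-- Evaluation at a test function, as a bounded functional. -/
def OrliczMod.eval (Φ Ψ : YoungFunction) (ω : ModerateWeight (Euc ι × Euc ι)) :
    GS ι →ₗ[ℂ] (OrliczMod Φ Ψ ω →L[ℂ] ℂ) where
  toFun g := LinearMap.mkContinuousOfExistsBound
    { toFun := fun f => (f.toDual : GS ι →ₗ[ℂ] ℂ) g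
      map_add' := fun f f' => by
        rw [map_add]
        rfl
      map_smul' := fun c f => by
        rw [map_smul]
        rfl } (by
      obtain ⟨-, h, h0, M, hM⟩ := g.2
      obtain ⟨C, hC⟩ := OrliczMod.exists_norm_apply_le h0 Φ Ψ ω
      exact ⟨C * M, fun f => hC f g M hM⟩)
  map_add' g g' := by
    ext f
    exact map_add (f.toDual : GS ι →ₗ[ℂ] ℂ) g g'
  map_smul' c g := by
    ext f
    exact map_smul (f.toDual : GS ι →ₗ[ℂ] ℂ) c g

theorem OrliczMod.eval_apply (g : GS ι) (f : OrliczMod Φ Ψ ω) :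
    OrliczMod.eval Φ Ψ ω g f = (f.toDual : GS ι →ₗ[ℂ] ℂ) g := rfl

theorem OrliczMod.exists_norm_eval_le {h : ℝ} (h0 : 0 < h) (Φ Ψ : YoungFunction)
    (ω : ModerateWeight (Euc ι × Euc ι)) : ∃ C : ℝ≥0, ∀ (g : GS ι) (M : ℝ),
      GSBound h M (g : Euc ι → ℂ) → ‖OrliczMod.eval Φ Ψ ω g‖ ≤ C * M := by
  obtain ⟨C, hC⟩ := OrliczMod.exists_norm_apply_le h0 Φ Ψ ω
  refine ⟨C, fun g M hM => ContinuousLinearMap.opNorm_le_bound _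
    (mul_nonneg C.2 hM.nonneg) fun f => hC f g M hM⟩

theorem GS.toDual_comm (f g : GS ι) :
    (f.toDual : GS ι →ₗ[ℂ] ℂ) g = (g.toDual : GS ι →ₗ[ℂ] ℂ) f := by
  rw [toDual_apply, toDual_apply]
  exact integral_congr_ae (Eventually.of_forall fun t => mul_comm _ _)

/-- The embedding of `S_{1/2}` into an Orlicz modulation space. -/
def GS.toOrlicz (Φ Ψ : YoungFunction) (ω : ModerateWeight (Euc ι × Euc ι)) :
    GS ι →ₗ[ℂ] OrliczMod Φ Ψ ω where
  toFun f := OrliczMod.mk f.toDual (f.orliczModNorm_toDual_lt_top Φ Ψ ω)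
  map_add' f f' := OrliczMod.ext fun g => by
    change ((f + f').toDual : GS ι →ₗ[ℂ] ℂ) g =
      (f.toDual : GS ι →ₗ[ℂ] ℂ) g + (f'.toDual : GS ι →ₗ[ℂ] ℂ) g
    rw [GS.toDual_comm, GS.toDual_comm f, GS.toDual_comm f', map_add]
  map_smul' c f := OrliczMod.ext fun g => by
    change ((c • f).toDual : GS ι →ₗ[ℂ] ℂ) g = c * (f.toDual : GS ι →ₗ[ℂ] ℂ) g
    rw [GS.toDual_comm, GS.toDual_comm f, map_smul, smul_eq_mul]

theorem GS.toDual_toOrlicz (f : GS ι) : (GS.toOrlicz Φ Ψ ω f).toDual = f.toDual := rfl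

theorem GS.exists_norm_toOrlicz_le {h : ℝ} (h0 : 0 < h) (Φ Ψ : YoungFunction)
    (ω : ModerateWeight (Euc ι × Euc ι)) : ∃ C : ℝ≥0, ∀ (f : GS ι) (M : ℝ),
      GSBound h M (f : Euc ι → ℂ) → ‖GS.toOrlicz Φ Ψ ω f‖ ≤ C * M := by
  obtain ⟨C, hC⟩ := exists_orliczModNorm_toDual_le (ι := ι) h0 Φ Ψ ω
  refine ⟨C, fun f M hM => ?_⟩
  have h1 := ENNReal.toReal_mono (by finiteness) (hC f M hM)
  rwa [ENNReal.toReal_mul, ENNReal.coe_toReal, ENNReal.toReal_ofReal hM.nonneg] at h1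

theorem GSContinuous.continuous_comp {Ω : Type} [TopologicalSpace Ω] {E : Type*}
    [SeminormedAddCommGroup E] [Module ℂ E] {h : ℝ} {G : Ω → GS ι} (hG : GSContinuous h G)
    {L : GS ι →ₗ[ℂ] E} {C : ℝ≥0}
    (hC : ∀ (g : GS ι) (M : ℝ), GSBound h M (g : Euc ι → ℂ) → ‖L g‖ ≤ C * M) :
    Continuous fun w => L (G w) := by
  rw [continuous_iff_continuousAt]
  intro w₀
  rw [ContinuousAt, Metric.tendsto_nhds]
  intro ε hε
  filter_upwards [hG w₀ (ε / (C + 1)) (by positivity)] with w hw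
  rw [dist_eq_norm, ← map_sub]
  refine (hC (G w - G w₀) _ hw).trans_lt ?_
  rw [mul_div_assoc', div_lt_iff₀ (by positivity), mul_comm]
  gcongr
  linarith

end Functionals

/-! ### Completeness of the Orlicz modulation spaces -/

section Complete
variable {ι : Type} [Fintype ι] {Φ Ψ : YoungFunction} {ω : ModerateWeight (Euc ι × Euc ι)}

instance OrliczMod.instNormedAddCommGroup : NormedAddCommGroup (OrliczMod Φ Ψ ω) :=
  NormedAddCommGroup.ofSeparation fun _ => OrliczMod.eq_zero_of_norm_eq_zero

theorem OrliczMod.exists_weak_limit {f : ℕ → OrliczMod Φ Ψ ω} (hf : CauchySeq f) :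
    ∃ u : GSDual ι, ∀ g : GS ι, Tendsto (fun n => ((f n).toDual : GS ι →ₗ[ℂ] ℂ) g) atTop
      (𝓝 ((u : GS ι →ₗ[ℂ] ℂ) g)) := by
  have hc : ∀ g : GS ι, CauchySeq fun n => ((f n).toDual : GS ι →ₗ[ℂ] ℂ) g := fun g =>
    (OrliczMod.eval Φ Ψ ω g).uniformContinuous.comp_cauchySeq hf
  choose L hL using fun g => cauchySeq_tendsto_of_complete (hc g)
  let u : GS ι →ₗ[ℂ] ℂ :=
    { toFun := L
      map_add' := fun g g' => by
        refine tendsto_nhds_unique (hL (g + g')) ?_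
        simp only [map_add]
        exact (hL g).add (hL g')
      map_smul' := fun c g => by
        refine tendsto_nhds_unique (hL (c • g)) ?_
        simp only [map_smul]
        exact (hL g).const_smul c }
  obtain ⟨R, hR⟩ := hf.norm_bddAbove
  refine ⟨⟨u, fun h h0 => ?_⟩, hL⟩
  obtain ⟨C, hC⟩ := OrliczMod.exists_norm_apply_le h0 Φ Ψ ω
  refine ⟨C * R, fun g M hM => ?_⟩
  refine le_of_tendsto (hL g).norm (Eventually.of_forall fun n => ?_)
  refine (hC (f n) g M hM).trans ?_
  have h1 : ‖f n‖ ≤ R := hR ⟨n, rfl⟩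
  have := hM.nonneg
  calc C * M * ‖f n‖ ≤ C * M * R := by gcongr
    _ = C * R * M := by ring

/-- Weak convergence tested on the shifts of the Gaussian is pointwise convergence of the short-time
Fourier transforms, to which Fatou's lemma applies. -/
theorem orliczModNorm_le_liminf {f : ℕ → GSDual ι} {u : GSDual ι}
    (h : ∀ g : GS ι, Tendsto (fun n => (f n : GS ι →ₗ[ℂ] ℂ) g) atTop (𝓝 ((u : GS ι →ₗ[ℂ] ℂ) g))) :
    orliczModNorm Φ Ψ ω u ≤ liminf (fun n => orliczModNorm Φ Ψ ω (f n)) atTop := by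
  refine mixedLuxNorm_le_liminf Φ Ψ
    (fun n => aemeasurable_wstft ω (continuous_stft (f n)).measurable.aemeasurable)
    (Eventually.of_forall fun z => ?_)
  refine (Tendsto.liminf_eq ?_).ge
  simp only [wstft, stft_eq]
  exact ENNReal.Tendsto.mul_const ((h (gsPi z)).const_mul _).enorm (Or.inr ENNReal.ofReal_ne_top)

/-- A Cauchy sequence has a weak limit in the dual, and Fatou's lemma upgrades the convergence to
the norm. Completeness is required for Bochner integrals of operators into this space. -/
instance OrliczMod.instCompleteSpace : CompleteSpace (OrliczMod Φ Ψ ω) := by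
  refine Metric.complete_of_cauchySeq_tendsto fun f hf => ?_
  obtain ⟨u, hu⟩ := OrliczMod.exists_weak_limit hf
  have key : ∀ ε > 0, ∃ N, ∀ n ≥ N,
      orliczModNorm Φ Ψ ω (u - (f n).toDual) ≤ ENNReal.ofReal ε := by
    intro ε hε
    obtain ⟨N, hN⟩ := Metric.cauchySeq_iff.mp hf ε hε
    refine ⟨N, fun n hn => ?_⟩
    refine (orliczModNorm_le_liminf (f := fun m => (f m - f n).toDual) fun g => ?_).trans ?_
    · simp only [map_sub, Submodule.coe_sub, LinearMap.sub_apply]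
      exact (hu g).sub_const _
    · refine liminf_le_of_frequently_le' (Eventually.frequently ?_)
      filter_upwards [eventually_ge_atTop N] with m hm
      rw [← OrliczMod.enorm_eq, ← ofReal_norm, ← dist_eq_norm]
      exact ENNReal.ofReal_le_ofReal (hN m hm n hn).le
  have hfin : orliczModNorm Φ Ψ ω u < ∞ := by
    obtain ⟨N, hN⟩ := key 1 one_pos
    have h1 := orliczModNorm_add_le Φ Ψ ω (g := (f N).toDual)
      (continuous_stft (u - (f N).toDual)).measurable.aemeasurable
    rw [sub_add_cancel] at h1
    exact h1.trans_lt (ENNReal.add_lt_top.mpr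
      ⟨(hN N le_rfl).trans_lt ENNReal.ofReal_lt_top, (f N).norm_lt_top⟩)
  refine ⟨OrliczMod.mk u hfin, Metric.tendsto_atTop.mpr fun ε hε => ?_⟩
  obtain ⟨N, hN⟩ := key (ε / 2) (half_pos hε)
  refine ⟨N, fun n hn => ?_⟩
  rw [dist_comm, dist_eq_norm, OrliczMod.norm_def, map_sub, OrliczMod.toDual_mk]
  refine lt_of_le_of_lt (ENNReal.toReal_mono ENNReal.ofReal_ne_top (hN n hn)) ?_
  rw [ENNReal.toReal_ofReal (half_pos hε).le]
  linarith

end Complete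

/-! ### Bochner integrals of compact operators -/

theorem isCompactOperator_smulRight {X Y : Type*} [SeminormedAddCommGroup X] [NormedSpace ℂ X]
    [NormedAddCommGroup Y] [NormedSpace ℂ Y] (l : X →L[ℂ] ℂ) (y : Y) :
    IsCompactOperator (l.smulRight y) := by
  refine ⟨(fun c : ℂ => c • y) '' Metric.closedBall 0 1,
    (isCompact_closedBall 0 1).image (by fun_prop), ?_⟩
  filter_upwards [l.continuous.continuousAt.preimage_mem_nhds (t := Metric.closedBall (l 0) 1)
    (Metric.closedBall_mem_nhds _ one_pos)] with x hx
  rw [map_zero] at hx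
  exact ⟨l x, hx, rfl⟩

/-- A closed subspace of a Banach space is complete, so the integral can be formed inside it.
Integrability is not required, since otherwise both integrals are 0. -/
theorem Submodule.integral_mem {Ω E : Type*} [MeasurableSpace Ω] {μ : Measure Ω}
    [NormedAddCommGroup E] [NormedSpace ℂ E] [CompleteSpace E] (S : Submodule ℂ E)
    (hS : IsClosed (S : Set E)) {φ : Ω → E} (h : ∀ p, φ p ∈ S) : ∫ p, φ p ∂μ ∈ S := by
  have : CompleteSpace S := hS.completeSpace_coe
  have e := S.subtypeₗᵢ.integral_comp_comm (μ := μ) fun p => (⟨φ p, h p⟩ : S)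
  have e' : ∫ p, φ p ∂μ = ((∫ p, (⟨φ p, h p⟩ : S) ∂μ : S) : E) := e
  rw [e']
  exact (∫ p, (⟨φ p, h p⟩ : S) ∂μ).2

/-- Bochner integrals of compact operators are compact. -/
theorem isCompactOperator_integral {Ω X Y : Type*} [MeasurableSpace Ω] {μ : Measure Ω}
    [NormedAddCommGroup X] [NormedSpace ℂ X] [NormedAddCommGroup Y] [NormedSpace ℂ Y]
    [CompleteSpace Y] {K : Ω → X →L[ℂ] Y} (hc : ∀ p, IsCompactOperator (K p)) :
    IsCompactOperator (∫ p, K p ∂μ : X →L[ℂ] Y) :=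
  (compactOperator (RingHom.id ℂ) X Y).integral_mem isClosed_setOfPred_isCompactOperator hc

/-! ### Gaussian decay of the Gabor matrix for symbols in S_{1/2} -/

section Decay
variable {ι : Type} [Fintype ι]

/-- The reproducing formula gives an integral of two Gaussians, one centred at the origin and one
displaced by Z up to a reflection of the frequency. A part of their decay yields a Gaussian in Z,
and the rest keeps the integral finite. -/
theorem GS.exists_norm_toDual_tfGS_le (b g : GS ι) : ∃ ε > 0, ∃ C ≥ 0, ∀ Z : Euc ι × Euc ι,
    ‖(b.toDual : GS ι →ₗ[ℂ] ℂ) (tfGS g Z)‖ ≤ C * Real.exp (-ε * (‖Z.1‖ ^ 2 + ‖Z.2‖ ^ 2)) := by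
  obtain ⟨-, h₁, h₁0, M₁, hM₁⟩ := b.2
  obtain ⟨-, h₂, h₂0, M₂, hM₂⟩ := g.2
  obtain ⟨ε₁, hε₁, C₁, hC₁, hb₁⟩ := exists_norm_gsHat_le (ι := ι) h₁0
  obtain ⟨ε₂, hε₂, C₂, hC₂, hb₂⟩ := exists_norm_gsHat_le (ι := ι) h₂0
  have n₁ := hM₁.nonneg
  have n₂ := hM₂.nonneg
  set ε := min ε₁ ε₂
  have hε : 0 < ε := lt_min hε₁ hε₂
  set B : ℝ := ∫ W : Euc ι × Euc ι, Real.exp (-(ε / 2) * (‖W.1‖ ^ 2 + ‖W.2‖ ^ 2))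
  have hB : 0 ≤ B := integral_nonneg fun W => (Real.exp_pos _).le
  have hint := integrable_exp_neg_mul_prod (ι := ι) (half_pos hε)
  refine ⟨ε / 4, by positivity, ‖tfConst ι‖ * (C₁ * M₁) * (C₂ * M₂) * B, by positivity, fun Z => ?_⟩
  rw [GS.toDual_comm, (apply_eq_integral_gsHat (tfGS g Z).toDual b).2]
  have e : ‖tfConst ι‖ * (C₁ * M₁) * (C₂ * M₂) * B *
      Real.exp (-(ε / 4) * (‖Z.1‖ ^ 2 + ‖Z.2‖ ^ 2)) = ∫ W : Euc ι × Euc ι,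
      ‖tfConst ι‖ * (C₁ * M₁) * (C₂ * M₂) * Real.exp (-(ε / 4) * (‖Z.1‖ ^ 2 + ‖Z.2‖ ^ 2)) *
        Real.exp (-(ε / 2) * (‖W.1‖ ^ 2 + ‖W.2‖ ^ 2)) := by
    rw [integral_const_mul]
    ring
  rw [e]
  refine norm_integral_le_of_norm_le (hint.const_mul _) (Eventually.of_forall fun W => ?_)
  rw [norm_mul, norm_mul, norm_toDual_gsPi, norm_gsHat_tfGS]
  have f₁ := hb₁ b M₁ hM₁ W
  have f₂ := hb₂ g M₂ hM₂ ((W.1, -W.2) - Z)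
  simp only [Prod.fst_sub, Prod.snd_sub] at f₂
  have q₁ : ‖Z.1‖ ≤ ‖W.1‖ + ‖W.1 - Z.1‖ := by
    have := norm_sub_le W.1 (W.1 - Z.1)
    rwa [sub_sub_cancel] at this
  have q₂ : ‖Z.2‖ ≤ ‖W.2‖ + ‖-W.2 - Z.2‖ := by
    have := norm_sub_le (-W.2) (-W.2 - Z.2)
    rwa [sub_sub_cancel, norm_neg] at this
  set a := ‖W.1 - Z.1‖
  set c := ‖-W.2 - Z.2‖
  have r₁ : ‖Z.1‖ ^ 2 ≤ 2 * ‖W.1‖ ^ 2 + 2 * a ^ 2 := by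
    nlinarith [sq_nonneg (‖W.1‖ - a), norm_nonneg Z.1]
  have r₂ : ‖Z.2‖ ^ 2 ≤ 2 * ‖W.2‖ ^ 2 + 2 * c ^ 2 := by
    nlinarith [sq_nonneg (‖W.2‖ - c), norm_nonneg Z.2]
  calc _ ≤ ‖tfConst ι‖ * (C₁ * M₁ * Real.exp (-ε₁ * (‖W.1‖ ^ 2 + ‖W.2‖ ^ 2))) *
        (C₂ * M₂ * Real.exp (-ε₂ * (a ^ 2 + c ^ 2))) := by gcongr
    _ = ‖tfConst ι‖ * (C₁ * M₁) * (C₂ * M₂) * (Real.exp (-ε₁ * (‖W.1‖ ^ 2 + ‖W.2‖ ^ 2)) *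
        Real.exp (-ε₂ * (a ^ 2 + c ^ 2))) := by ring
    _ ≤ ‖tfConst ι‖ * (C₁ * M₁) * (C₂ * M₂) * (Real.exp (-(ε / 4) * (‖Z.1‖ ^ 2 + ‖Z.2‖ ^ 2)) *
        Real.exp (-(ε / 2) * (‖W.1‖ ^ 2 + ‖W.2‖ ^ 2))) := by
        refine mul_le_mul_of_nonneg_left ?_ (by positivity)
        rw [← Real.exp_add, ← Real.exp_add]
        refine Real.exp_le_exp.mpr ?_
        have s₁ : ε * (‖W.1‖ ^ 2 + ‖W.2‖ ^ 2) ≤ ε₁ * (‖W.1‖ ^ 2 + ‖W.2‖ ^ 2) := by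
          gcongr
          exact min_le_left _ _
        have s₂ : ε * (a ^ 2 + c ^ 2) ≤ ε₂ * (a ^ 2 + c ^ 2) := by
          gcongr
          exact min_le_right _ _
        have s₃ : ε * (‖Z.1‖ ^ 2 + ‖Z.2‖ ^ 2) ≤
            ε * (2 * (‖W.1‖ ^ 2 + ‖W.2‖ ^ 2) + 2 * (a ^ 2 + c ^ 2)) := by
          refine mul_le_mul_of_nonneg_left ?_ hε.le
          linarith
        have s₄ : 0 ≤ ε * (a ^ 2 + c ^ 2) := by positivity
        linarith
    _ = _ := by ring

variable [DecidableEq ι]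

/-- The kernel point determines (z, w) linearly: from u = x - A(x - y) and y - x one recovers x = u
+ A(x - y), and from the frequency component v and ξ - η one recovers η = v - Aᵀ(ξ - η). -/
theorem exists_le_kernelPoint (A : Matrix ι ι ℝ) : ∃ K > 0, ∀ z w : Euc ι × Euc ι,
    (‖z.1‖ ^ 2 + ‖z.2‖ ^ 2) + (‖w.1‖ ^ 2 + ‖w.2‖ ^ 2) ≤
      K * (‖(kernelPoint A z w).1‖ ^ 2 + ‖(kernelPoint A z w).2‖ ^ 2) := by
  obtain ⟨a, ha, hA⟩ := exists_norm_matVec_le A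
  obtain ⟨b, hb, hB⟩ := exists_norm_matVec_le A.transpose
  have aux : ∀ {t u v c : ℝ}, 0 ≤ t → 0 ≤ u → 0 ≤ v → 0 ≤ c → t ≤ u + c * v →
      t ^ 2 ≤ (1 + c ^ 2) * (u ^ 2 + v ^ 2) := by
    intro t u v c ht hu hv hc h
    nlinarith [sq_nonneg (c * u - v), mul_nonneg hc hv]
  refine ⟨(1 + a ^ 2) + (1 + (1 + a) ^ 2) + (1 + b ^ 2) + (1 + (1 + b) ^ 2), by positivity,
    fun z w => ?_⟩
  obtain ⟨x, ξ⟩ := z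
  obtain ⟨y, η⟩ := w
  simp only [kernelPoint, norm_sq_pair]
  set u := x - matVec A (x - y) with hu
  set v := matVec A.transpose ξ + matVec (1 - A.transpose) η with hv
  have ex : x = u + matVec A (x - y) := by rw [hu, sub_add_cancel]
  have eη : η = v - matVec A.transpose (ξ - η) := by
    rw [hv, matVec_one_sub, matVec_sub]
    abel
  have nx : ‖x‖ ≤ ‖u‖ + a * ‖y - x‖ := by
    have h1 := norm_add_le u (matVec A (x - y))
    rw [← ex] at h1
    have h2 := hA (x - y)
    rw [norm_sub_rev x y] at h2
    linarith
  have ny : ‖y‖ ≤ ‖u‖ + (1 + a) * ‖y - x‖ := by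
    have h1 := norm_add_le x (y - x)
    rw [add_sub_cancel] at h1
    linarith
  have nη : ‖η‖ ≤ ‖v‖ + b * ‖ξ - η‖ := by
    have h1 := norm_sub_le v (matVec A.transpose (ξ - η))
    rw [← eη] at h1
    linarith [hB (ξ - η)]
  have nξ : ‖ξ‖ ≤ ‖v‖ + (1 + b) * ‖ξ - η‖ := by
    have h1 := norm_add_le η (ξ - η)
    rw [add_sub_cancel] at h1
    linarith
  have i1 := aux (norm_nonneg x) (norm_nonneg u) (norm_nonneg (y - x)) ha nx
  have i2 := aux (norm_nonneg y) (norm_nonneg u) (norm_nonneg (y - x)) (by positivity) ny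
  have i3 := aux (norm_nonneg η) (norm_nonneg v) (norm_nonneg (ξ - η)) hb nη
  have i4 := aux (norm_nonneg ξ) (norm_nonneg v) (norm_nonneg (ξ - η)) (by positivity) nξ
  have j1 : 0 ≤ ((1 + a ^ 2) + (1 + (1 + a) ^ 2)) * (‖v‖ ^ 2 + ‖ξ - η‖ ^ 2) := by positivity
  have j2 : 0 ≤ ((1 + b ^ 2) + (1 + (1 + b) ^ 2)) * (‖u‖ ^ 2 + ‖y - x‖ ^ 2) := by positivity
  linarith

theorem exists_norm_kernelCoef_le (A : Matrix ι ι ℝ) (b : GS (ι ⊕ ι)) : ∃ ε > 0, ∃ C ≥ 0,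
    ∀ z w : Euc ι × Euc ι, ‖kernelCoef A b.toDual z w‖ ≤
      C * Real.exp (-ε * ((‖z.1‖ ^ 2 + ‖z.2‖ ^ 2) + (‖w.1‖ ^ 2 + ‖w.2‖ ^ 2))) := by
  obtain ⟨ε, hε, C, hC, h⟩ := b.exists_norm_toDual_tfGS_le (kernelTheta A)
  obtain ⟨K, hK, hle⟩ := exists_le_kernelPoint A
  refine ⟨ε / K, by positivity, C, hC, fun z w => ?_⟩
  have e : ‖kernelCoef A b.toDual z w‖ =
      ‖(b.toDual : GS (ι ⊕ ι) →ₗ[ℂ] ℂ) (tfGS (kernelTheta A) (kernelPoint A z w))‖ := by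
    rw [← toReal_enorm, enorm_kernelCoef, toReal_enorm]
  rw [e]
  refine (h _).trans (mul_le_mul_of_nonneg_left (Real.exp_le_exp.mpr ?_) hC)
  have h1 := mul_le_mul_of_nonneg_left (hle z w) (div_nonneg hε.le hK.le)
  rw [← mul_assoc, div_mul_cancel₀ _ hK.ne'] at h1
  linarith

end Decay

/-! ### Compactness -/

section Compact
variable {ι : Type} [Fintype ι] [DecidableEq ι] {p q : ℝ≥0∞} {Φ₁ Φ₂ Ψ₁ Ψ₂ : YoungFunction}
  {A : Matrix ι ι ℝ} {ω₁ ω₂ : ModerateWeight (Euc ι × Euc ι)}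

/-- The rank one operators which superpose to `Op_A(a)`. -/
def rankOneKernel (A : Matrix ι ι ℝ) (a : GSDual (ι ⊕ ι)) (Φ₁ Ψ₁ Φ₂ Ψ₂ : YoungFunction)
    (ω₁ ω₂ : ModerateWeight (Euc ι × Euc ι)) (p : (Euc ι × Euc ι) × (Euc ι × Euc ι)) :
    OrliczMod Φ₁ Ψ₁ ω₁ →L[ℂ] OrliczMod Φ₂ Ψ₂ ω₂ :=
  (OrliczMod.eval Φ₁ Ψ₁ ω₁ (gsPi p.2)).smulRight
    ((fourierConst ι * (tfConst ι * tfConst ι) * kernelCoef A a p.1 p.2) •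
      GS.toOrlicz Φ₂ Ψ₂ ω₂ (gsPi (p.1.1, -p.1.2)))

theorem toDual_rankOneKernel (a : GSDual (ι ⊕ ι)) (p : (Euc ι × Euc ι) × (Euc ι × Euc ι))
    (f : OrliczMod Φ₁ Ψ₁ ω₁) (g : GS ι) :
    ((rankOneKernel A a Φ₁ Ψ₁ Φ₂ Ψ₂ ω₁ ω₂ p f).toDual : GS ι →ₗ[ℂ] ℂ) g =
      fourierConst ι * opIntegrand A a f.toDual g p := by
  rw [rankOneKernel, ContinuousLinearMap.smulRight_apply, map_smul, map_smul]
  simp only [Submodule.coe_smul, LinearMap.smul_apply, smul_eq_mul, OrliczMod.eval_apply,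
    GS.toDual_toOrlicz, opIntegrand, gsHat_eq_toDual]
  ring

omit [DecidableEq ι] in
theorem exists_continuous_norm_le {E : Type*} [SeminormedAddCommGroup E] [Module ℂ E]
    {L : GS ι →ₗ[ℂ] E} (hL : ∀ h > 0, ∃ C : ℝ≥0, ∀ (g : GS ι) (M : ℝ),
      GSBound h M (g : Euc ι → ℂ) → ‖L g‖ ≤ C * M) {δ : ℝ} (hδ : 0 < δ) :
    Continuous (fun z => L (gsPi z)) ∧ ∃ C ≥ 0, ∀ z : Euc ι × Euc ι,
      ‖L (gsPi z)‖ ≤ C * Real.exp (δ * (‖z.1‖ ^ 2 + ‖z.2‖ ^ 2)) := by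
  obtain ⟨h', h'0, hcont, hbd⟩ := exists_gsBound_tfGS (by norm_num) (g := gaussGS ι)
    gsBound_gaussWindow hδ
  obtain ⟨C, hC⟩ := hL h' h'0
  refine ⟨hcont.continuous_comp hC, C * Real.pi ^ (-(Fintype.card ι : ℝ) / 4), by positivity,
    fun z => (hC _ _ (hbd z)).trans_eq ?_⟩
  ring

/-- The matrix entries decay like a Gaussian of rate ε, while the evaluation functionals and the
embedded shifts grow with rate at most ε/2. Hence the rank one operators are integrable in operator
norm. -/
theorem integrable_rankOneKernel (A : Matrix ι ι ℝ) (b : GS (ι ⊕ ι)) (Φ₁ Ψ₁ Φ₂ Ψ₂ : YoungFunction)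
    (ω₁ ω₂ : ModerateWeight (Euc ι × Euc ι)) :
    Integrable (rankOneKernel A b.toDual Φ₁ Ψ₁ Φ₂ Ψ₂ ω₁ ω₂) := by
  obtain ⟨ε, hε, C, hC, hk⟩ := exists_norm_kernelCoef_le A b
  obtain ⟨hc₁, C₁, hC₁, h₁⟩ := exists_continuous_norm_le
    (fun h h0 => OrliczMod.exists_norm_eval_le h0 Φ₁ Ψ₁ ω₁) (half_pos hε)
  obtain ⟨hc₂, C₂, hC₂, h₂⟩ := exists_continuous_norm_le
    (fun h h0 => GS.exists_norm_toOrlicz_le h0 Φ₂ Ψ₂ ω₂) (half_pos hε)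
  have hcont : Continuous (rankOneKernel A b.toDual Φ₁ Ψ₁ Φ₂ Ψ₂ ω₁ ω₂) := by
    have k1 := hc₁.comp (continuous_snd (X := Euc ι × Euc ι))
    have k2 : Continuous fun p : (Euc ι × Euc ι) × (Euc ι × Euc ι) =>
        GS.toOrlicz Φ₂ Ψ₂ ω₂ (gsPi (p.1.1, -p.1.2)) := hc₂.comp (by fun_prop)
    have k3 := (continuous_kernelCoef A b.toDual).const_mul
      (fourierConst ι * (tfConst ι * tfConst ι))
    exact ((ContinuousLinearMap.smulRightL ℂ (OrliczMod Φ₁ Ψ₁ ω₁)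
      (OrliczMod Φ₂ Ψ₂ ω₂)).continuous.comp k1).clm_apply (k3.smul k2)
  have hint := ((integrable_exp_neg_mul_prod (ι := ι) (half_pos hε)).mul_prod
    (integrable_exp_neg_mul_prod (ι := ι) (half_pos hε))).const_mul
      (C₁ * (‖fourierConst ι * (tfConst ι * tfConst ι)‖ * C * C₂))
  refine hint.mono' hcont.aestronglyMeasurable (Eventually.of_forall fun p => ?_)
  rw [rankOneKernel, ContinuousLinearMap.norm_smulRight_apply, norm_smul, norm_mul]
  have e₁ := h₁ p.2
  have e₂ := h₂ (p.1.1, -p.1.2)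
  have e₃ := hk p.1 p.2
  simp only [norm_neg] at e₂
  set s := ‖p.1.1‖ ^ 2 + ‖p.1.2‖ ^ 2
  set t := ‖p.2.1‖ ^ 2 + ‖p.2.2‖ ^ 2
  have e : Real.exp (ε / 2 * t) * Real.exp (-ε * (s + t)) * Real.exp (ε / 2 * s) =
      Real.exp (-(ε / 2) * s) * Real.exp (-(ε / 2) * t) := by
    simp only [← Real.exp_add]
    ring_nf
  calc _ ≤ C₁ * Real.exp (ε / 2 * t) * (‖fourierConst ι * (tfConst ι * tfConst ι)‖ *
        (C * Real.exp (-ε * (s + t))) * (C₂ * Real.exp (ε / 2 * s))) := by gcongr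
    _ = C₁ * (‖fourierConst ι * (tfConst ι * tfConst ι)‖ * C * C₂) *
        (Real.exp (ε / 2 * t) * Real.exp (-ε * (s + t)) * Real.exp (ε / 2 * s)) := by ring
    _ = _ := by rw [e]

/-- Operators with test function symbols are compact. -/
theorem isCompactOperator_of_opForm_toDual {b : GS (ι ⊕ ι)}
    {T : OrliczMod Φ₁ Ψ₁ ω₁ →L[ℂ] OrliczMod Φ₂ Ψ₂ ω₂}
    (hT : ∀ f g, ((T f).toDual : GS ι →ₗ[ℂ] ℂ) g = opForm A b.toDual f.toDual g) :
    IsCompactOperator T := by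
  have hint := integrable_rankOneKernel A b Φ₁ Ψ₁ Φ₂ Ψ₂ ω₁ ω₂
  have e : T = ∫ p, rankOneKernel A b.toDual Φ₁ Ψ₁ Φ₂ Ψ₂ ω₁ ω₂ p := by
    ext1 f
    refine OrliczMod.ext fun g => ?_
    rw [hT, opForm, ContinuousLinearMap.integral_apply hint, ← OrliczMod.eval_apply (Φ := Φ₂) (Ψ := Ψ₂) (ω := ω₂),
      ← (OrliczMod.eval Φ₂ Ψ₂ ω₂ g).integral_comp_comm (hint.apply_continuousLinearMap f),
      ← integral_const_mul]
    exact integral_congr_ae (Eventually.of_forall fun p => (toDual_rankOneKernel _ p f g).symm)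
  rw [e]
  exact isCompactOperator_integral fun p => isCompactOperator_smulRight _ _

/-- The norm estimate applied to a - b bounds the distance from T to the operator with symbol b.
Symbols b in S_{1/2} give compact operators, and norm limits of compact operators are compact. -/
theorem TrilinearBound.isCompactOperator {ω₀ : ModerateWeight (Euc (ι ⊕ ι) × Euc (ι ⊕ ι))}
    (hB : TrilinearBound p q Φ₁ Φ₂ Ψ₁ Ψ₂) (hp : 1 ≤ p) (hq : 1 ≤ q)
    (hω : WeightCompat A ω₀ ω₁ ω₂) {a : GSDual (ι ⊕ ι)} (ha : modNorm p q ω₀ a < ∞)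
    {T : OrliczMod Φ₁ Ψ₁ ω₁ →L[ℂ] OrliczMod Φ₂.conj Ψ₂.conj ω₂}
    (hT : ∀ f g, ((T f).toDual : GS ι →ₗ[ℂ] ℂ) g = opForm A a f.toDual g)
    (hcl : ∀ ε : ℝ≥0∞, ε ≠ 0 → ∃ b : GS (ι ⊕ ι), modNorm p q ω₀ (a - b.toDual) < ε) :
    IsCompactOperator T := by
  obtain ⟨C, hC⟩ := hB.exists_opCLM hp hq hω
  have hb : ∀ b : GS (ι ⊕ ι), modNorm p q ω₀ b.toDual < ∞ := fun b => by
    rw [modNorm_eq hp hq]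
    exact b.orliczModNorm_toDual_lt_top _ _ _
  choose S hS _ using fun b : GS (ι ⊕ ι) => hC b.toDual (hb b)
  have hdist : ∀ b : GS (ι ⊕ ι), modNorm p q ω₀ (a - b.toDual) < ∞ →
      ‖T - S b‖ ≤ C * (modNorm p q ω₀ (a - b.toDual)).toReal := by
    intro b hab
    obtain ⟨R, hR, hRn⟩ := hC (a - b.toDual) hab
    have : T - S b = R := by
      ext1 f
      refine OrliczMod.ext fun g => ?_
      rw [sub_apply, map_sub, Submodule.coe_sub, LinearMap.sub_apply, hT, hS,
        hR, opForm, opForm, opForm, opIntegrand_sub, integral_sub'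
        (hB.integrable_opIntegrand hp hq hω ha f.norm_lt_top g)
        (hB.integrable_opIntegrand hp hq hω (hb b) f.norm_lt_top g), mul_sub]
    rw [this]
    exact hRn
  choose b hbε using fun n : ℕ => hcl (ENNReal.ofReal (1 / ((n : ℝ) + 1)))
    (by
      rw [Ne, ENNReal.ofReal_eq_zero, not_le]
      positivity)
  refine isCompactOperator_of_tendsto (F := fun n => S (b n)) (l := atTop) ?_
    (Eventually.of_forall fun n => isCompactOperator_of_opForm_toDual (hS (b n)))
  rw [tendsto_iff_norm_sub_tendsto_zero]
  refine squeeze_zero (fun n => norm_nonneg _) (fun n => ?_)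
    (g := fun n : ℕ => C * (1 / ((n : ℝ) + 1))) ?_
  · rw [norm_sub_rev]
    refine (hdist (b n) ((hbε n).trans ENNReal.ofReal_lt_top)).trans ?_
    gcongr
    exact ENNReal.toReal_le_of_le_ofReal (by positivity) (hbε n).le
  · simpa using (tendsto_one_div_add_atTop_nhds_zero_nat (𝕜 := ℝ)).const_mul (C : ℝ)

end Compact

theorem weightCompat_of_div_le {ι : Type} [Fintype ι] [DecidableEq ι] {A : Matrix ι ι ℝ}
    {ω₀ : ModerateWeight (Euc (ι ⊕ ι) × Euc (ι ⊕ ι))} {ω₁ ω₂ : ModerateWeight (Euc ι × Euc ι)}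
    (hω : ∃ C : ℝ, ∀ x ξ y η : Euc ι, ω₂ (x, ξ) / ω₁ (y, η) ≤
      C * ω₀ (pair (x - matVec A (x - y)) (matVec A.transpose ξ + matVec (1 - A.transpose) η),
        pair (ξ - η) (y - x))) : WeightCompat A ω₀ ω₁ ω₂ := by
  obtain ⟨C, hC⟩ := hω
  refine ⟨C.toNNReal, fun z w => ?_⟩
  have h := hC z.1 z.2 w.1 w.2
  have h1 := ω₁.isWeight.pos w
  have h0 := ω₀.isWeight.pos (kernelPoint A z w)
  rw [div_le_iff₀ h1] at h
  calc ENNReal.ofReal (ω₂ z) ≤ ENNReal.ofReal (C * (ω₁ w * ω₀ (kernelPoint A z w))) :=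
        ENNReal.ofReal_le_ofReal (h.trans_eq (by rw [kernelPoint]; ring))
    _ = _ := by
        rw [mul_comm C, ENNReal.ofReal_mul (by positivity), ENNReal.ofReal_mul h1.le, mul_comm]
        rfl

end

theorem mainTheorem1 (d : ℕ) (A : Matrix (Fin d) (Fin d) ℝ) (p q : ℝ≥0∞)
    (hq : 1 ≤ q) (hqp : q ≤ p) (Φ₁ Φ₂ Ψ₁ Ψ₂ : YoungFunction)
    (hp : 1 < p →
      (IsSteered (ENNReal.conjExponent p).toReal Φ₁ ∧
        IsSteered (ENNReal.conjExponent p).toReal Φ₂ ∧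
        IsSteered (ENNReal.conjExponent p).toReal Ψ₁ ∧
        IsSteered (ENNReal.conjExponent p).toReal Ψ₂) ∧
      (Φ₁.LocalDelta2 ∧ Φ₂.LocalDelta2 ∧ Ψ₁.LocalDelta2 ∧ Ψ₂.LocalDelta2) ∧
      (LeNearZero (powFun (ENNReal.conjExponent q)) Φ₁ ∧
        LeNearZero (powFun (ENNReal.conjExponent q)) Φ₂ ∧
        LeNearZero (powFun (ENNReal.conjExponent q)) Ψ₁ ∧
        LeNearZero (powFun (ENNReal.conjExponent q)) Ψ₂) ∧
      LeNearZero (fun s => Φ₁.essInv s * Φ₂.essInv s)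
        (fun s => s ^ ((ENNReal.conjExponent p)⁻¹ + (ENNReal.conjExponent q)⁻¹).toReal) ∧
      LeNearZero (fun s => Ψ₁.essInv s * Ψ₂.essInv s)
        (fun s => s ^ ((ENNReal.conjExponent p)⁻¹ + (ENNReal.conjExponent q)⁻¹).toReal))
    (ω₀ : ModerateWeight (Euc (Fin d ⊕ Fin d) × Euc (Fin d ⊕ Fin d)))
    (ω₁ ω₂ : ModerateWeight (Euc (Fin d) × Euc (Fin d)))
    (hω : ∃ C : ℝ, ∀ x ξ y η : Euc (Fin d), ω₂ (x, ξ) / ω₁ (y, η) ≤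
      C * ω₀ (pair (x - matVec A (x - y)) (matVec A.transpose ξ + matVec (1 - A.transpose) η),
        pair (ξ - η) (y - x))) :
    ∃ C : ℝ≥0, ∀ a : GSDual (Fin d ⊕ Fin d), MemMod p q ω₀ a →
      ∃ T : OrliczMod Φ₁ Ψ₁ ω₁ →L[ℂ] OrliczMod Φ₂.conj Ψ₂.conj ω₂,
        ExtendsOp A a T ∧
        DominatedContinuous T ∧
        ‖T‖ ≤ C * (modNorm p q ω₀ a).toReal ∧
        (∀ T' : OrliczMod Φ₁ Ψ₁ ω₁ →L[ℂ] OrliczMod Φ₂.conj Ψ₂.conj ω₂,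
          ExtendsOp A a T' → DominatedContinuous T' → T' = T) ∧
        (Φ₁.LocalDelta2 → Ψ₁.LocalDelta2 → (∀ t, t ≠ 0 → Φ₁ t ≠ 0 ∧ Ψ₁ t ≠ 0) →
          ∀ T' : OrliczMod Φ₁ Ψ₁ ω₁ →L[ℂ] OrliczMod Φ₂.conj Ψ₂.conj ω₂,
            ExtendsOp A a T' → T' = T) ∧
        ((∀ ε : ℝ≥0∞, ε ≠ 0 → ∃ b : GS (Fin d ⊕ Fin d), modNorm p q ω₀ (a - b.toDual) < ε) →
          IsCompactOperator T) := by
  have hB : TrilinearBound p q Φ₁ Φ₂ Ψ₁ Ψ₂ :=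
    exists_trilinear_le hq hqp fun h => ⟨(hp h).1, (hp h).2.2⟩
  have hp1 : 1 ≤ p := hq.trans hqp
  have hc := weightCompat_of_div_le hω
  obtain ⟨C, hC⟩ := hB.exists_opCLM hp1 hq hc
  refine ⟨C, fun a ha => ?_⟩
  obtain ⟨T, hT, hn⟩ := hC a ha.2
  -- On test functions the weak form agrees with the pairing against the distribution kernel,
  -- because both have the same double Gabor expansion.
  have hext : ExtendsOp A a T := fun φ =>
    ⟨GS.toOrlicz Φ₁ Ψ₁ ω₁ φ, rfl, fun g => (hT _ g).trans (kernelPairing_eq A a g φ).2.symm⟩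
  have hdom : DominatedContinuous T := by
    rintro f f₀ ⟨hf, G, hG, hGn, hfG⟩ g
    simp only [hT]
    exact hB.tendsto_opForm hp1 hq hc ha.2 hf hG hGn hfG g
  exact ⟨T, hext, hdom, hn, fun T' h h' => hext.eq_of_dominatedContinuous h hdom h',
    fun h₁ h₂ h₃ T' h => hext.eq_of_localDelta2 h h₁ h₂ h₃,
    hB.isCompactOperator hp1 hq hc ha.2 hT⟩
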